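/- Consider arrangements $\mathcal A=(L_1,\dots,L_{10})$ of ten distinct lines in $\mathbb{CP}^2$ with only double and triple points such that each line passes through at least three triple points. Let $\mathcal T_{\mathcal A}\subset((\mathbb{CP}^2)^*)^{10}$ be the set of tuples of distinct lines in which exactly those triples of lines are concurrent that are concurrent in $\mathcal A$, let $\mathcal M_{\mathcal A}=\mathcal T_{\mathcal A}/PGL(3,\mathbb C)$ be the moduli space (with the quotient of the Zariski topology), and let $\mathcal M^{\mathbb C}_{\mathcal A}$ be its quotient under complex conjugation. Call $\mathcal A$ a potential Zariski pair if $\mathcal M^{\mathbb C}_{\mathcal A}$ is not irreducible. Two arrangements are lattice isomorphic if, up to a permutation of the labels of the lines, their intersection lattices are the same. Up to lattice isomorphism there are exactly nine potential Zariski pairs among these arrangements, namely those whose triple points are given by one of the following lists (where $ijk$ stands for the triple point $L_i\cap L_j\cap L_k$, and $0$ stands for $10$): 1. $(9_3)$.ii.DFI: 123, 140, 159, 168, 247, 250, 289, 348, 357, 360, 456, 679; 2. $(9_3)$.ii.CFI: 123, 140, 159, 168, 247, 289, 348, 357, 360, 456, 580, 679; 3. $(9_3)$.iii.BDF: 123,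 147, 169, 248, 257, 290, 340, 359, 368, 456, 670, 789; 4. $(9_3)$.iii.ACG: 123, 147, 150, 169, 248, 257, 359, 368, 370, 456, 490, 789; 5. 12.B.2.iv: 124, 157, 168, 258, 269, 345, 360, 379, 467, 489, 590, 780; 6. 12.B.3.a.i: 124, 135, 160, 258, 279, 367, 389, 457, 468, 490, 569, 780; 7. 12.B.3.b.ii: 124, 135, 178, 260, 279, 367, 389, 457, 468, 490, 569, 580; 8. 12.B.3.b.iii: 124, 135, 179, 260, 278, 367, 389, 457, 468, 490, 569, 580; 9. 11.B.3.b.2.v: 124, 135, 167, 189, 236, 259, 270, 378, 390, 458, 460. All nine are realized by such arrangements, and no two of them are lattice isomorphic. In the cases 2, 3, 4 and 8 the moduli space $\mathcal M_{\mathcal A}$ consists of exactly two points, both represented by real arrangements. In the cases 1, 5, 6 and 7 it consists of exactly three points, exactly one of which is represented by a real arrangement. In each of these eight cases the points are Galois conjugate (any one is taken to any other by a field automorphism of $\mathbb C$), but they form exactly two classes under complex conjugation. In case 9, $\mathcal M_{\mathcal A}$ has dimension one and is the union of two disjoint irreducible components; each component is mapped to itself by complex conjugation and contains points represented by real arrangements,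 and the two components are Galois conjugate to each other. -/

import Mathlib

open scoped LinearAlgebra.Projectivization

noncomputable section

namespace LineArrangement

/-! ### Arrangements of lines in the complex projective plane -/

/-- Points of the complex projective plane. -/
abbrev Pt : Type := ℙ ℂ (Fin 3 → ℂ)

/-- Points of the dual plane: `[a : b : c]` is the line `a x + b y + c z = 0`. -/
abbrev Line : Type := ℙ ℂ (Fin 3 → ℂ)

/-- The point `p` lies on the line `L`. -/
def Incident (p : Pt) (L : Line) : Prop := Projectivization.orthogonal L p

/-- The number of lines of `A` through `p`. -/
def mult {n : ℕ} (A : Fin n → Line) (p : Pt) : ℕ := {i : Fin n | Incident p (A i)}.ncard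

/-- `A` is an arrangement of `n` distinct lines with only double and triple points, such that
each of the lines passes through at least three triple points. -/
structure Admissible {n : ℕ} (A : Fin n → Line) : Prop where
  injective : Function.Injective A
  mult_le_three : ∀ p : Pt, mult A p ≤ 3
  three_le_triples : ∀ i : Fin n, 3 ≤ {p : Pt | Incident p (A i) ∧ mult A p = 3}.encard

/-- The element `⋂_{i ∈ S} L_i` of the intersection lattice. -/
def flat {n : ℕ} (A : Fin n → Line) (S : Set (Fin n)) : Set Pt := {p | ∀ i ∈ S, Incident p (A i)}

/-- Lattice isomorphism: up to a permutation of the labels of the lines, the intersection lattices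
are the same. -/
def LatticeIso {n : ℕ} (A B : Fin n → Line) : Prop :=
  ∃ σ : Equiv.Perm (Fin n), ∀ S T : Set (Fin n),
    flat A S ⊆ flat A T ↔ flat (B ∘ σ) S ⊆ flat (B ∘ σ) T

/-- The intersection of the lines `A i`, `A j`, `A k` is non-empty. -/
def Concurrent {n : ℕ} (A : Fin n → Line) (i j k : Fin n) : Prop :=
  (flat A {i, j, k}).Nonempty

/-! ### Configuration tables -/

/-- A configuration table with `n` columns: column `i` is the set of (names of) triple points that
lie on the line `i`. -/
abbrev ConfigTable (n : ℕ) : Type := Fin n → Finset ℕ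

/-- `A` is an arrangement associated to the configuration table `C`: the lines are distinct, and
three of them meet in a point exactly when their columns share a point. -/
def Realizes {n : ℕ} (A : Fin n → Line) (C : ConfigTable n) : Prop :=
  Function.Injective A ∧ ∀ i j k : Fin n, i ≠ j → i ≠ k → j ≠ k →
    (Concurrent A i j k ↔ (C i ∩ C j ∩ C k).Nonempty)

/-- The nine configuration tables, in the order
`(9_3).ii.DFI`, `(9_3).ii.CFI`, `(9_3).iii.BDF`, `(9_3).iii.ACG`, `12.B.2.iv`, `12.B.3.a.i`,
`12.B.3.b.ii`, `12.B.3.b.iii`, `11.B.3.b.2.v`. The columns are those of `L_1, …, L_10`; the triple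
point `e_k` is written `k`, and in the first four tables the triple points `A, B, C, D, F, G, I` are
written `10, 11, 12, 13, 15, 16, 18`. -/
def table : Fin 9 → ConfigTable 10 := ![
  ![{1, 2, 3, 18}, {1, 4, 5, 13}, {1, 6, 7, 15}, {8, 4, 6, 18}, {8, 2, 7, 13},
    {8, 3, 9, 15}, {4, 7, 9}, {3, 5, 6}, {2, 5, 9}, {13, 15, 18}],
  ![{1, 2, 3, 18}, {1, 4, 5}, {1, 6, 7, 15}, {8, 4, 6, 18}, {8, 2, 7, 12},
    {8, 3, 9, 15}, {4, 7, 9}, {3, 5, 6, 12}, {2, 5, 9}, {12, 15, 18}],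
  ![{1, 2, 3}, {1, 4, 5, 15}, {1, 6, 7, 11}, {8, 2, 4, 11}, {8, 5, 6},
    {8, 3, 7, 13}, {9, 2, 5, 13}, {9, 4, 7}, {9, 3, 6, 15}, {11, 13, 15}],
  ![{1, 2, 3, 16}, {1, 4, 5}, {1, 6, 7, 12}, {8, 2, 4, 10}, {8, 5, 6, 16},
    {8, 3, 7}, {9, 2, 5, 12}, {9, 4, 7}, {9, 3, 6, 10}, {10, 12, 16}],
  ![{1, 2, 3}, {1, 4, 5}, {6, 7, 8}, {11, 12, 1, 7}, {2, 4, 7, 9},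
    {11, 3, 5, 6}, {11, 8, 10, 2}, {12, 3, 10, 4}, {12, 5, 8, 9}, {6, 9, 10}],
  ![{1, 2, 3}, {1, 4, 5}, {2, 6, 7}, {1, 10, 11, 9}, {2, 10, 12, 5},
    {3, 11, 12, 7}, {10, 4, 7, 8}, {11, 5, 6, 8}, {12, 4, 6, 9}, {3, 8, 9}],
  ![{1, 2, 4}, {1, 3, 5}, {2, 6, 7}, {1, 10, 11, 8}, {2, 10, 12, 9},
    {3, 11, 12, 6}, {10, 4, 5, 6}, {11, 7, 9, 4}, {12, 7, 8, 5}, {3, 8, 9}],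
  ![{1, 2, 4}, {1, 3, 5}, {2, 6, 7}, {1, 10, 11, 8}, {2, 10, 12, 9},
    {3, 11, 12, 6}, {10, 4, 5, 6}, {11, 7, 9, 5}, {12, 7, 8, 4}, {3, 8, 9}],
  ![{1, 2, 4, 5}, {1, 3, 6, 7}, {2, 3, 8, 9}, {1, 10, 11}, {2, 6, 10},
    {3, 4, 11}, {4, 7, 8}, {5, 8, 10}, {5, 6, 9}, {7, 9, 11}]]

/-! ### The Zariski topology on `((ℂℙ²)*)ⁿ` -/

/-- The Zariski topology on the affine space `ℂ^ι`: the closed sets are the common zero loci of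
sets of polynomials. -/
@[reducible] def zariskiAffine (ι : Type) : TopologicalSpace (ι → ℂ) :=
  TopologicalSpace.induced (MvPolynomial.pointToPoint (k := ℂ)) inferInstance

/-- `n`-tuples of non-zero coefficient vectors. -/
abbrev Coeffs (n : ℕ) : Type := Fin n → {v : Fin 3 → ℂ // v ≠ 0}

/-- The Zariski topology on `n`-tuples of non-zero coefficient vectors, an open subset of affine
space of dimension `3 n`. -/
@[reducible] def zariskiCoeffs (n : ℕ) : TopologicalSpace (Coeffs n) :=
  TopologicalSpace.induced (fun v (x : Fin n × Fin 3) => (v x.1).1 x.2)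
    (zariskiAffine (Fin n × Fin 3))

/-- The Zariski topology on `((ℂℙ²)*)ⁿ`: the closed sets are those cut out by polynomials in the
homogeneous coordinates of the `n` lines. -/
@[reducible] def zariskiLines (n : ℕ) : TopologicalSpace (Fin n → Line) :=
  TopologicalSpace.coinduced
    (fun (v : Coeffs n) i => (Projectivization.mk ℂ (v i).1 (v i).2 : Line)) (zariskiCoeffs n)

/-! ### Moduli spaces -/

/-- The determinant of the coefficient matrix of three lines (only its vanishing is independent of
the chosen homogeneous coordinates). -/
def det3 (P Q R : Line) : ℂ := Matrix.det !![P.rep 0, P.rep 1, P.rep 2;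
  Q.rep 0, Q.rep 1, Q.rep 2; R.rep 0, R.rep 1, R.rep 2]

/-- The total space of the arrangement `A`: labelled tuples of distinct lines in which exactly
those triples of lines are concurrent that are concurrent in `A`. -/
def TotalSpace {n : ℕ} (A : Fin n → Line) : Type :=
  {P : Fin n → Line // Function.Injective P ∧
    (∀ i j k, Concurrent A i j k → det3 (P i) (P j) (P k) = 0) ∧
    (∀ r s t, ¬ Concurrent A r s t → det3 (P r) (P s) (P t) ≠ 0)}

/-- The lines of a point of the total space. -/
def TotalSpace.lines {n : ℕ} {A : Fin n → Line} (P : TotalSpace A) : Fin n → Line := P.1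

/-- The total space carries the subspace topology of the Zariski topology. -/
instance {n : ℕ} (A : Fin n → Line) : TopologicalSpace (TotalSpace A) :=
  TopologicalSpace.induced TotalSpace.lines (zariskiLines n)

/-- Two points of the total space are equivalent when a projective automorphism (the class of some
`g ∈ GL(3, ℂ)`) of the dual plane takes one to the other. -/
def projSetoid {n : ℕ} (A : Fin n → Line) : Setoid (TotalSpace A) where
  r P Q := ∃ g : LinearMap.GeneralLinearGroup ℂ (Fin 3 → ℂ), ∀ i, Q.lines i = g • P.lines i
  iseqv :=
    { refl := fun P => ⟨1, fun i => (one_smul _ _).symm⟩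
      symm := fun ⟨g, hg⟩ => ⟨g⁻¹, fun i => by rw [hg i, inv_smul_smul]⟩
      trans := fun ⟨g, hg⟩ ⟨h, hh⟩ => ⟨h * g, fun i => by rw [hh i, hg i, mul_smul]⟩ }

/-- The moduli space of the arrangement `A`: the quotient of its total space by `PGL(3, ℂ)`. -/
def ModuliSpace {n : ℕ} (A : Fin n → Line) : Type := Quotient (projSetoid A)

/-- The class in the moduli space of a point of the total space. -/
def ModuliSpace.mk {n : ℕ} {A : Fin n → Line} (P : TotalSpace A) : ModuliSpace A :=
  Quotient.mk (projSetoid A) P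

/-- The quotient topology of the Zariski topology. -/
instance {n : ℕ} (A : Fin n → Line) : TopologicalSpace (ModuliSpace A) :=
  TopologicalSpace.coinduced ModuliSpace.mk inferInstance

/-- A field automorphism of `ℂ`, applied to the coordinates of a vector. -/
def galVec (σ : ℂ ≃+* ℂ) : (Fin 3 → ℂ) →ₛₗ[(σ : ℂ →+* ℂ)] (Fin 3 → ℂ) where
  toFun v i := σ (v i)
  map_add' v w := by ext i; simp
  map_smul' c v := by ext i; simp

lemma galVec_injective (σ : ℂ ≃+* ℂ) : Function.Injective (galVec σ) := fun v w h => by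
  ext i
  exact σ.injective (congrFun h i)

/-- A field automorphism of `ℂ`, applied to the coefficients of a line. -/
def galLine (σ : ℂ ≃+* ℂ) : Line → Line := Projectivization.map (galVec σ) (galVec_injective σ)

/-- The field automorphism `σ` of `ℂ`, applied to the coefficients of the lines, takes the point `x`
of the moduli space to `y`. -/
def GalConj {n : ℕ} {A : Fin n → Line} (σ : ℂ ≃+* ℂ) (x y : ModuliSpace A) : Prop :=
  ∃ P Q : TotalSpace A, ModuliSpace.mk P = x ∧ ModuliSpace.mk Q = y ∧
    ∀ i, Q.lines i = galLine σ (P.lines i)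

/-- Complex conjugation. -/
def conjAut : ℂ ≃+* ℂ := Complex.conjAe.toRingEquiv

/-- The quotient of the moduli space under complex conjugation. -/
def ModuliSpaceConj {n : ℕ} (A : Fin n → Line) : Type :=
  Quot (GalConj conjAut : ModuliSpace A → ModuliSpace A → Prop)

/-- The quotient topology of the Zariski topology. -/
instance {n : ℕ} (A : Fin n → Line) : TopologicalSpace (ModuliSpaceConj A) :=
  TopologicalSpace.coinduced (Quot.mk _) (inferInstanceAs (TopologicalSpace (ModuliSpace A)))

/-- The lattice of `A` is a potential Zariski pair: the moduli space of `A` modulo complex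
conjugation is reducible (that is, the moduli space is neither irreducible nor the union of two
complex conjugate irreducible components). -/
def IsPotentialZariskiPair {n : ℕ} (A : Fin n → Line) : Prop :=
  ¬ IrreducibleSpace (ModuliSpaceConj A)

/-- The points of the moduli space that are represented by an arrangement of real lines. -/
def realPoints {n : ℕ} (A : Fin n → Line) : Set (ModuliSpace A) :=
  {x | ∃ P : TotalSpace A, ModuliSpace.mk P = x ∧ ∀ i, ∃ (v : Fin 3 → ℝ)
    (hv : (fun j => (v j : ℂ)) ≠ 0), P.lines i = Projectivization.mk ℂ (fun j => (v j : ℂ)) hv}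

end LineArrangement

end

/-! The concurrent triples of an admissible arrangement form a system of triples on ten labels. Two
labels lie in at most one triple, since no four lines are concurrent. Each label is joined by
triples to at least six of the other nine, since its line carries three triple points. These two
properties leave only 65 systems up to relabelling (`TripleSystem.hasCompletePattern`). This is
proved by a case distinction along a recorded script: it branches on the third label of a chosen
pair, and a branch is closed once the known facts contain, after a recorded relabelling, a partial
system that was treated before.

For a fixed system, four lines in general position become the coordinate lines and the unit line.
The other lines are constructed one by one, either as the line through two known points or as a
member of a pencil with a new parameter (`NormalForm.exists_good_params`). The moduli space is then
described by the parameters at which the prescribed determinants vanish and no others do. All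
polynomial identities involved have integral coefficients and are verified by evaluation. For 56 of
the systems the remaining conditions are vacuous, contradictory, or a single equation that defines
an irreducible set or a pair of complex conjugate values. Hence the moduli space modulo conjugation
is irreducible or the system is not realized (`irreducibleSpace_of_check`).

For eight of the other nine systems, a ratio of two coordinates of one line is an injective function
on the moduli space. It has closed level sets, it commutes with automorphisms of `ℂ`, and its values
are all the roots of an irreducible polynomial over `ℚ` (`NormalForm.Rigid`). The polynomial is a
cubic with one real root or a quadratic with two. Cardinality, real points and the Galois action are
read off from the roots. One real root gives an open and closed subset stable under conjugation, so
the quotient is reducible. In the last system one parameter is a root of `x² - x - 1` and a second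
one is free, which gives two disjoint curves, each with the cofinite topology of a punctured line
(`TwoCurves`).

Finally, a lattice isomorphism of admissible arrangements is the same as a relabelling that respects
concurrency, so the pattern decides everything, and two numerical invariants of the patterns
separate the nine systems (`eq_of_latticeIso`). -/

open scoped Topology

namespace LineArrangement

/-! ### Integral polynomials in three variables, with a computable zero test -/

/-- Polynomial expressions with integer coefficients. -/
inductive PolyExpr : Type
  | var (i : ℕ)
  | nat (n : ℕ)
  | add (a b : PolyExpr)
  | mul (a b : PolyExpr)
  | neg (a : PolyExpr)

namespace PolyExpr

instance : Add PolyExpr := ⟨add⟩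
instance : Mul PolyExpr := ⟨mul⟩
instance : Neg PolyExpr := ⟨neg⟩
instance : Sub PolyExpr := ⟨fun a b => add a (neg b)⟩
instance (n : ℕ) : OfNat PolyExpr n := ⟨nat n⟩

/-- The value of an expression at a point with coordinates in a commutative ring. -/
def ev {R : Type*} [CommRing R] (s : ℕ → R) : PolyExpr → R
  | var i => s i
  | nat n => n
  | add a b => a.ev s + b.ev s
  | mul a b => a.ev s * b.ev s
  | neg a => -a.ev s

section ev
variable {R : Type*} [CommRing R] (s : ℕ → R)

@[simp] lemma ev_var (i : ℕ) : (var i).ev s = s i := rfl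
@[simp] lemma ev_nat (n : ℕ) : (nat n).ev s = n := rfl
@[simp] lemma ev_zero : (0 : PolyExpr).ev s = 0 := Nat.cast_zero
@[simp] lemma ev_one : (1 : PolyExpr).ev s = 1 := Nat.cast_one
@[simp] lemma ev_ofNat (n : ℕ) [n.AtLeastTwo] :
    (no_index (OfNat.ofNat n) : PolyExpr).ev s = OfNat.ofNat n := rfl
@[simp] lemma ev_add (a b : PolyExpr) : (a + b).ev s = a.ev s + b.ev s := rfl
@[simp] lemma ev_mul (a b : PolyExpr) : (a * b).ev s = a.ev s * b.ev s := rfl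
@[simp] lemma ev_neg (a : PolyExpr) : (-a).ev s = -a.ev s := rfl
@[simp] lemma ev_sub (a b : PolyExpr) : (a - b).ev s = a.ev s - b.ev s :=
  (sub_eq_add_neg _ _).symm

lemma map_ev {S : Type*} [CommRing S] (f : R →+* S) (a : PolyExpr) :
    f (a.ev s) = a.ev (fun i => f (s i)) := by
  induction a with
  | var i => rfl
  | nat n => simp
  | add a b ha hb => simp only [ev, map_add, ha, hb]
  | mul a b ha hb => simp only [ev, map_mul, ha, hb]
  | neg a ha => simp only [ev, map_neg, ha]

end ev

/-- All variables have index less than `n`. -/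
def usesBelow (n : ℕ) : PolyExpr → Bool
  | var i => Nat.blt i n
  | nat _ => true
  | add a b => a.usesBelow n && b.usesBelow n
  | mul a b => a.usesBelow n && b.usesBelow n
  | neg a => a.usesBelow n

/-- The variable of index `m` does not occur. -/
def noVar (m : ℕ) : PolyExpr → Bool
  | var i => !Nat.beq i m
  | nat _ => true
  | add a b => a.noVar m && b.noVar m
  | mul a b => a.noVar m && b.noVar m
  | neg a => a.noVar m

lemma ev_congr_of_below {R : Type*} [CommRing R] {s t : ℕ → R} {n : ℕ}
    (h : ∀ i < n, s i = t i) {a : PolyExpr} (ha : a.usesBelow n = true) : a.ev s = a.ev t := by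
  induction a with
  | var i => exact h i (by simpa [usesBelow] using ha)
  | nat n => rfl
  | add a b iha ihb =>
    simp only [usesBelow, Bool.and_eq_true] at ha
    simp only [ev, iha ha.1, ihb ha.2]
  | mul a b iha ihb =>
    simp only [usesBelow, Bool.and_eq_true] at ha
    simp only [ev, iha ha.1, ihb ha.2]
  | neg a iha => simp only [ev, iha ha]

lemma ev_congr_of_noVar {R : Type*} [CommRing R] {s t : ℕ → R} {m : ℕ}
    (h : ∀ i, i ≠ m → s i = t i) {a : PolyExpr} (ha : a.noVar m = true) : a.ev s = a.ev t := by
  induction a with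
  | var i => exact h i (by rintro rfl; simp [noVar] at ha)
  | nat n => rfl
  | add a b iha ihb =>
    simp only [noVar, Bool.and_eq_true] at ha
    simp only [ev, iha ha.1, ihb ha.2]
  | mul a b iha ihb =>
    simp only [noVar, Bool.and_eq_true] at ha
    simp only [ev, iha ha.1, ihb ha.2]
  | neg a iha => simp only [ev, iha ha]

/-- A monomial in the variables `0`, `1`, `2` with its coefficient. -/
structure Term : Type where
  e₀ : ℕ
  e₁ : ℕ
  e₂ : ℕ
  coeff : ℤ

namespace Term

/-- The value of a term. -/
def ev {R : Type*} [CommRing R] (s : ℕ → R) (t : Term) : R :=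
  t.coeff * (s 0 ^ t.e₀ * s 1 ^ t.e₁ * s 2 ^ t.e₂)

/-- The product of two terms. -/
def mul (t u : Term) : Term := ⟨t.e₀ + u.e₀, t.e₁ + u.e₁, t.e₂ + u.e₂, t.coeff * u.coeff⟩

lemma ev_mul {R : Type*} [CommRing R] (s : ℕ → R) (t u : Term) :
    (t.mul u).ev s = t.ev s * u.ev s := by
  simp only [ev, mul, Int.cast_mul, pow_add]; ring

/-- Equality of the monomials of two terms. -/
def sameMonomial (t u : Term) : Bool :=
  Nat.beq t.e₀ u.e₀ && (Nat.beq t.e₁ u.e₁ && Nat.beq t.e₂ u.e₂)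

end Term

/-- A sum of terms. -/
abbrev Sparse : Type := List Term

namespace Sparse

/-- The value of a sum of terms. -/
def ev {R : Type*} [CommRing R] (s : ℕ → R) : Sparse → R
  | [] => 0
  | t :: p => t.ev s + ev s p

/-- Add a term to a sum of terms. -/
def insert (t : Term) : Sparse → Sparse
  | [] => [t]
  | u :: p => bif t.sameMonomial u then ⟨u.e₀, u.e₁, u.e₂, t.coeff + u.coeff⟩ :: p
      else u :: insert t p

/-- The sum. -/
def add (p : Sparse) : Sparse → Sparse
  | [] => p
  | t :: q => insert t (add p q)

/-- Add the product with a term. -/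
def addMulTerm (t : Term) (r : Sparse) : Sparse → Sparse
  | [] => r
  | u :: p => insert (t.mul u) (addMulTerm t r p)

/-- The product. -/
def mul (p : Sparse) : Sparse → Sparse
  | [] => []
  | t :: q => addMulTerm t (mul p q) p

/-- The opposite. -/
def neg : Sparse → Sparse
  | [] => []
  | t :: p => ⟨t.e₀, t.e₁, t.e₂, -t.coeff⟩ :: neg p

/-- All coefficients vanish. -/
def isZero : Sparse → Bool
  | [] => true
  | t :: p => decide (t.coeff = 0) && isZero p

section
variable {R : Type*} [CommRing R] (s : ℕ → R)

lemma ev_insert (t : Term) (p : Sparse) : ev s (insert t p) = t.ev s + ev s p := by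
  induction p with
  | nil => rfl
  | cons u p ih =>
    rw [insert]
    cases h : t.sameMonomial u with
    | false => simp only [cond_false, ev, ih]; ring
    | true =>
      simp only [Term.sameMonomial, Bool.and_eq_true, Nat.beq_eq] at h
      simp only [cond_true, ev, Term.ev, h, Int.cast_add]; ring

lemma ev_add (p q : Sparse) : ev s (add p q) = ev s p + ev s q := by
  induction q with
  | nil => simp [add, ev]
  | cons t q ih => simp only [add, ev_insert, ih, ev]; ring

lemma ev_addMulTerm (t : Term) (r p : Sparse) :
    ev s (addMulTerm t r p) = ev s r + t.ev s * ev s p := by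
  induction p with
  | nil => simp [addMulTerm, ev]
  | cons u p ih => simp only [addMulTerm, ev_insert, ih, ev, Term.ev_mul]; ring

lemma ev_mul (p q : Sparse) : ev s (mul p q) = ev s p * ev s q := by
  induction q with
  | nil => simp [mul, ev]
  | cons t q ih => simp only [mul, ev_addMulTerm, ih, ev]; ring

lemma ev_neg (p : Sparse) : ev s (neg p) = -ev s p := by
  induction p with
  | nil => simp [neg, ev]
  | cons t p ih => simp only [neg, ev, ih, Term.ev, Int.cast_neg]; ring

lemma ev_of_isZero {p : Sparse} (h : isZero p = true) : ev s p = 0 := by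
  induction p with
  | nil => rfl
  | cons t p ih =>
    rw [isZero, Bool.and_eq_true, decide_eq_true_eq] at h
    simp only [ev, Term.ev, h.1, ih h.2, Int.cast_zero, zero_mul, add_zero]

end

end Sparse

/-- Expansion as a sum of terms; variables of index larger than `2` are not supported and make the
result meaningless, which `supported` excludes. -/
def expand : PolyExpr → Sparse
  | var 0 => [⟨1, 0, 0, 1⟩]
  | var 1 => [⟨0, 1, 0, 1⟩]
  | var _ => [⟨0, 0, 1, 1⟩]
  | nat n => [⟨0, 0, 0, Int.ofNat n⟩]
  | add a b => a.expand.add b.expand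
  | mul a b => a.expand.mul b.expand
  | neg a => a.expand.neg

lemma ev_expand {R : Type*} [CommRing R] (s : ℕ → R) {a : PolyExpr} (h : a.usesBelow 3 = true) :
    a.expand.ev s = a.ev s := by
  induction a with
  | var i =>
    have hi : i < 3 := by simpa [usesBelow] using h
    interval_cases i <;> simp [expand, Sparse.ev, Term.ev]
  | nat n => simp [expand, Sparse.ev, Term.ev]
  | add a b iha ihb =>
    simp only [usesBelow, Bool.and_eq_true] at h
    simp only [expand, Sparse.ev_add, ev, iha h.1, ihb h.2]
  | mul a b iha ihb =>
    simp only [usesBelow, Bool.and_eq_true] at h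
    simp only [expand, Sparse.ev_mul, ev, iha h.1, ihb h.2]
  | neg a iha => simp only [expand, Sparse.ev_neg, ev, iha h]

/-- The expression is the zero polynomial. -/
def isZero (a : PolyExpr) : Bool := a.usesBelow 3 && a.expand.isZero

lemma ev_of_isZero {R : Type*} [CommRing R] (s : ℕ → R) {a : PolyExpr} (h : a.isZero = true) :
    a.ev s = 0 := by
  rw [isZero, Bool.and_eq_true] at h
  rw [← ev_expand s h.1, Sparse.ev_of_isZero s h.2]

end PolyExpr

/-! ### Triples of vectors -/

section Vectors
variable {R : Type*} [CommRing R]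

/-- The determinant of three vectors. -/
def vdet (u v w : Fin 3 → R) : R :=
  u 0 * (v 1 * w 2 - v 2 * w 1) - u 1 * (v 0 * w 2 - v 2 * w 0) + u 2 * (v 0 * w 1 - v 1 * w 0)

/-- The cross product of two vectors. -/
def vcross (u v : Fin 3 → R) : Fin 3 → R :=
  ![u 1 * v 2 - u 2 * v 1, u 2 * v 0 - u 0 * v 2, u 0 * v 1 - u 1 * v 0]

lemma vcross_eq (u v : Fin 3 → R) : vcross u v = crossProduct u v := by
  rw [cross_apply]; rfl

lemma vdet_eq_det (u v w : Fin 3 → R) : vdet u v w = (Matrix.of ![u, v, w]).det := by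
  rw [Matrix.det_fin_three]; simp [vdet]; ring

lemma vdet_swap₁₂ (u v w : Fin 3 → R) : vdet v u w = -vdet u v w := by simp only [vdet]; ring
lemma vdet_swap₂₃ (u v w : Fin 3 → R) : vdet u w v = -vdet u v w := by simp only [vdet]; ring
lemma vdet_rotate (u v w : Fin 3 → R) : vdet v w u = vdet u v w := by simp only [vdet]; ring

lemma vdet_smul (a b c : R) (u v w : Fin 3 → R) :
    vdet (a • u) (b • v) (c • w) = a * b * c * vdet u v w := by
  simp only [vdet, Pi.smul_apply, smul_eq_mul]; ring

lemma map_vdet {S : Type*} [CommRing S] (f : R →+* S) (u v w : Fin 3 → R) :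
    f (vdet u v w) = vdet (fun i => f (u i)) (fun i => f (v i)) (fun i => f (w i)) := by
  simp only [vdet, map_add, map_sub, map_mul]

end Vectors

section VectorsField
variable {K : Type*} [Field K]

lemma vdet_ne_zero_iff {u v w : Fin 3 → K} :
    vdet u v w ≠ 0 ↔ LinearIndependent K ![u, v, w] := by
  rw [vdet_eq_det, ← isUnit_iff_ne_zero, ← Matrix.isUnit_iff_isUnit_det,
    ← Matrix.linearIndependent_rows_iff_isUnit]
  rfl

/-- Vanishing of the determinant is linear dependence, which an automorphism preserves and reflects.
-/
lemma vdet_map_eq_zero_iff (g : (Fin 3 → K) ≃ₗ[K] (Fin 3 → K)) {u v w : Fin 3 → K} :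
    vdet (g u) (g v) (g w) = 0 ↔ vdet u v w = 0 := by
  rw [← not_iff_not, ← ne_eq, ← ne_eq, vdet_ne_zero_iff, vdet_ne_zero_iff]
  have : (![g u, g v, g w] : Fin 3 → Fin 3 → K) = g ∘ ![u, v, w] := by
    ext i; fin_cases i <;> rfl
  rw [this]
  exact LinearMap.linearIndependent_iff (g : (Fin 3 → K) →ₗ[K] (Fin 3 → K)) (LinearEquiv.ker g)

lemma exists_smul_eq_of_vcross_eq_zero {p q : Fin 3 → K} (hp : p ≠ 0) (hq : q ≠ 0)
    (h : vcross p q = 0) : ∃ μ : K, μ ≠ 0 ∧ p = μ • q := by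
  rw [vcross_eq, ← Projectivization.mk_eq_mk_iff_crossProduct_eq_zero hp hq,
    Projectivization.mk_eq_mk_iff'] at h
  obtain ⟨a, rfl⟩ := h
  exact ⟨a, fun ha => hp (by rw [ha, zero_smul]), rfl⟩

/-- A line through the intersection points of two pairs of lines. -/
lemma exists_smul_eq_vcross_vcross {p a b c d : Fin 3 → K} (hp : p ≠ 0)
    (hab : vdet p a b = 0) (hcd : vdet p c d = 0) (habc : vdet a b c ≠ 0) (hc : vcross c d ≠ 0) :
    ∃ μ : K, μ ≠ 0 ∧ p = μ • vcross (vcross a b) (vcross c d) := by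
  have hq : vcross (vcross a b) (vcross c d) ≠ 0 := by
    intro h
    apply hc
    -- Taking the cross product of `(a × b) × (c × d)` with `c` leaves, up to sign, `det(a, b, c)`
    -- times `c × d`.
    have key : ∀ i, vdet a b c * vcross c d i = 0 := by
      have e0 := congrFun h 0
      have e1 := congrFun h 1
      have e2 := congrFun h 2
      simp only [vcross, Matrix.cons_val, Pi.zero_apply] at e0 e1 e2
      intro i
      fin_cases i
      · simp only [vdet, vcross, Fin.zero_eta, Matrix.cons_val]
        linear_combination c 2 * e1 - c 1 * e2
      · simp only [vdet, vcross, Fin.mk_one, Matrix.cons_val]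
        linear_combination c 0 * e2 - c 2 * e0
      · simp only [vdet, vcross, Fin.reduceFinMk, Matrix.cons_val]
        linear_combination c 1 * e0 - c 0 * e1
    ext i
    exact (mul_eq_zero.1 (key i)).resolve_left habc
  -- By the identity `p × (u × w) = (p · w) u - (p · u) w` with `u = a × b` and `w = c × d`; both
  -- scalar products are the vanishing determinants.
  refine exists_smul_eq_of_vcross_eq_zero hp hq ?_
  simp only [vdet] at hab hcd
  ext i
  fin_cases i
  · simp only [vcross, Fin.zero_eta, Matrix.cons_val, Pi.zero_apply]
    linear_combination (a 1 * b 2 - a 2 * b 1) * hcd - (c 1 * d 2 - c 2 * d 1) * hab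
  · simp only [vcross, Fin.mk_one, Matrix.cons_val, Pi.zero_apply]
    linear_combination (a 2 * b 0 - a 0 * b 2) * hcd - (c 2 * d 0 - c 0 * d 2) * hab
  · simp only [vcross, Fin.reduceFinMk, Matrix.cons_val, Pi.zero_apply]
    linear_combination (a 0 * b 1 - a 1 * b 0) * hcd - (c 0 * d 1 - c 1 * d 0) * hab

/-- A line through the intersection point of two other lines. -/
lemma exists_eq_smul_add_smul {p a b : Fin 3 → K} (hab : vcross a b ≠ 0) (hpb : vcross p b ≠ 0)
    (h : vdet p a b = 0) : ∃ μ t : K, μ ≠ 0 ∧ p = μ • (a + t • b) := by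
  obtain ⟨α, β, hαβ⟩ : ∃ α β : K, p = α • a + β • b := by
    -- Cramer's rule in a component where `a × b` does not vanish.
    obtain ⟨c, hc⟩ := Function.ne_iff.1 hab
    refine ⟨vcross p b c / vcross a b c, vcross a p c / vcross a b c, ?_⟩
    have hc' : vcross a b c ≠ 0 := hc
    have key : ∀ i, vcross a b c * p i = vcross p b c * a i + vcross a p c * b i := by
      simp only [vdet] at h
      intro i
      fin_cases c <;> fin_cases i <;>
        simp only [vcross, Fin.zero_eta, Fin.mk_one, Fin.reduceFinMk, Matrix.cons_val] <;>
        first | linear_combination h | ring1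
    ext i
    simp only [Pi.add_apply, Pi.smul_apply, smul_eq_mul]
    field_simp
    linear_combination key i
  -- The only member of the pencil not of the form `a + t b` is `b` itself, which is excluded
  -- because `p` and `b` are different lines.
  have hα : α ≠ 0 := by
    rintro rfl
    apply hpb
    rw [hαβ]
    ext i
    fin_cases i <;> simp [vcross] <;> ring
  refine ⟨α, β / α, hα, ?_⟩
  rw [hαβ, smul_add, smul_smul, mul_div_cancel₀ _ hα]

/-- Four vectors in general position are the standard frame, up to a linear automorphism and
scaling. -/
lemma exists_frame {a b c d : Fin 3 → K} (habc : vdet a b c ≠ 0) (habd : vdet a b d ≠ 0)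
    (hacd : vdet a c d ≠ 0) (hbcd : vdet b c d ≠ 0) :
    ∃ (g : (Fin 3 → K) ≃ₗ[K] (Fin 3 → K)) (x y z : K), x ≠ 0 ∧ y ≠ 0 ∧ z ≠ 0 ∧
      g a = x • ![1, 0, 0] ∧ g b = y • ![0, 1, 0] ∧ g c = z • ![0, 0, 1] ∧ g d = ![1, 1, 1] := by
  -- Cramer's rule: the coordinates of `d` in the basis `a`, `b`, `c` are the other three
  -- determinants, so none of them vanishes.
  have key : vdet a b c • d = vdet b c d • a - vdet a c d • b + vdet a b d • c := by
    ext i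
    fin_cases i <;> simp [vdet] <;> ring
  set α := vdet b c d / vdet a b c with hα
  set β := -vdet a c d / vdet a b c with hβ
  set γ := vdet a b d / vdet a b c with hγ
  have hα0 : α ≠ 0 := div_ne_zero hbcd habc
  have hβ0 : β ≠ 0 := div_ne_zero (neg_ne_zero.2 hacd) habc
  have hγ0 : γ ≠ 0 := div_ne_zero habd habc
  have hd : d = α • a + β • b + γ • c := by
    ext i
    have := congrFun key i
    simp only [Pi.add_apply, Pi.sub_apply, Pi.smul_apply, smul_eq_mul, hα, hβ, hγ] at this ⊢
    field_simp
    linear_combination this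
  have hli : LinearIndependent K ![α • a, β • b, γ • c] := by
    rw [← vdet_ne_zero_iff, vdet_smul]
    exact mul_ne_zero (mul_ne_zero (mul_ne_zero hα0 hβ0) hγ0) habc
  -- The basis is rescaled by the coordinates of `d`, so that `d` becomes the sum of the basis
  -- vectors.
  let e := basisOfLinearIndependentOfCardEqFinrank hli (by simp)
  have he : ∀ i, e i = ![α • a, β • b, γ • c] i := fun i => by simp [e]
  have h0 : e.equivFun (α • a) = ![1, 0, 0] := by
    have := he 0
    simp only [Matrix.cons_val] at this
    rw [← this]
    ext i
    rw [Module.Basis.equivFun_self]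
    fin_cases i <;> simp
  have h1 : e.equivFun (β • b) = ![0, 1, 0] := by
    have := he 1
    simp only [Matrix.cons_val] at this
    rw [← this]
    ext i
    rw [Module.Basis.equivFun_self]
    fin_cases i <;> simp
  have h2 : e.equivFun (γ • c) = ![0, 0, 1] := by
    have := he 2
    simp only [Matrix.cons_val] at this
    rw [← this]
    ext i
    rw [Module.Basis.equivFun_self]
    fin_cases i <;> simp
  refine ⟨e.equivFun, α⁻¹, β⁻¹, γ⁻¹, inv_ne_zero hα0, inv_ne_zero hβ0, inv_ne_zero hγ0,
    ?_, ?_, ?_, ?_⟩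
  · rw [← h0, map_smul, inv_smul_smul₀ hα0]
  · rw [← h1, map_smul, inv_smul_smul₀ hβ0]
  · rw [← h2, map_smul, inv_smul_smul₀ hγ0]
  · rw [hd, map_add, map_add, h0, h1, h2]
    ext i; fin_cases i <;> simp

end VectorsField

/-! ### Coordinates of lines -/

/-- The vectors `v i` are homogeneous coordinates of the lines `P i`. -/
def Represents {n : ℕ} (v : Fin n → Fin 3 → ℂ) (P : Fin n → Line) : Prop :=
  ∀ i, ∃ h : v i ≠ 0, P i = Projectivization.mk ℂ (v i) h

lemma represents_rep {n : ℕ} (P : Fin n → Line) : Represents (fun i => (P i).rep) P :=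
  fun i => ⟨(P i).rep_nonzero, ((P i).mk_rep).symm⟩

lemma Represents.comp {n m : ℕ} {v : Fin n → Fin 3 → ℂ} {P : Fin n → Line} (h : Represents v P)
    (f : Fin m → Fin n) : Represents (v ∘ f) (P ∘ f) := fun i => h (f i)

lemma Represents.smul {n : ℕ} {v : Fin n → Fin 3 → ℂ} {P : Fin n → Line} (h : Represents v P)
    (g : (Fin 3 → ℂ) ≃ₗ[ℂ] (Fin 3 → ℂ)) :
    Represents (fun i => g (v i))
      (fun i => LinearMap.GeneralLinearGroup.ofLinearEquiv g • P i) := by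
  intro i
  obtain ⟨h0, h⟩ := h i
  refine ⟨fun h' => h0 (g.map_eq_zero_iff.1 h'), ?_⟩
  beta_reduce
  rw [h]
  rfl

lemma Represents.scale {n : ℕ} {v w : Fin n → Fin 3 → ℂ} {P : Fin n → Line} (h : Represents v P)
    (hw : ∀ i, ∃ μ : ℂ, μ ≠ 0 ∧ v i = μ • w i) : Represents w P := by
  intro i
  obtain ⟨h0, h⟩ := h i
  obtain ⟨μ, hμ, hv⟩ := hw i
  have hw0 : w i ≠ 0 := fun h' => h0 (by rw [hv, h', smul_zero])
  exact ⟨hw0, by rw [h, Projectivization.mk_eq_mk_iff']; exact ⟨μ, hv.symm⟩⟩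

lemma Represents.exists_scale {n : ℕ} {v w : Fin n → Fin 3 → ℂ} {P : Fin n → Line}
    (hv : Represents v P) (hw : Represents w P) (i : Fin n) :
    ∃ μ : ℂ, μ ≠ 0 ∧ v i = μ • w i := by
  obtain ⟨h0, h⟩ := hv i
  obtain ⟨h0', h'⟩ := hw i
  rw [h, Projectivization.mk_eq_mk_iff'] at h'
  obtain ⟨a, ha⟩ := h'
  exact ⟨a, fun h => h0 (by rw [← ha, h, zero_smul]), ha.symm⟩

lemma Represents.eq {n : ℕ} {v : Fin n → Fin 3 → ℂ} {P Q : Fin n → Line}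
    (hP : Represents v P) (hQ : Represents v Q) : P = Q := by
  ext1 i
  obtain ⟨_, h⟩ := hP i
  obtain ⟨_, h'⟩ := hQ i
  rw [h, h']

/-- A vector in the kernel of the matrix with rows `u`, `v`, `w` is a common point of the three
lines. -/
lemma vdet_eq_zero_iff_exists {u v w : Fin 3 → ℂ} :
    vdet u v w = 0 ↔ ∃ p : Fin 3 → ℂ, p ≠ 0 ∧ u ⬝ᵥ p = 0 ∧ v ⬝ᵥ p = 0 ∧ w ⬝ᵥ p = 0 := by
  rw [vdet_eq_det, ← Matrix.exists_mulVec_eq_zero_iff]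
  refine exists_congr fun p => and_congr_right fun _ => ?_
  constructor
  · intro h
    exact ⟨congrFun h 0, congrFun h 1, congrFun h 2⟩
  · rintro ⟨h0, h1, h2⟩
    ext i
    fin_cases i
    exacts [h0, h1, h2]

lemma incident_mk {p v : Fin 3 → ℂ} (hp : p ≠ 0) (hv : v ≠ 0) :
    Incident (Projectivization.mk ℂ p hp) (Projectivization.mk ℂ v hv) ↔ v ⬝ᵥ p = 0 :=
  Projectivization.orthogonal_mk hv hp

/-- This turns concurrency into a polynomial condition on arbitrary homogeneous coordinates; all
later arguments go through it. -/
lemma Represents.concurrent_iff {n : ℕ} {v : Fin n → Fin 3 → ℂ} {P : Fin n → Line}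
    (h : Represents v P) (i j k : Fin n) :
    Concurrent P i j k ↔ vdet (v i) (v j) (v k) = 0 := by
  obtain ⟨hi, ei⟩ := h i
  obtain ⟨hj, ej⟩ := h j
  obtain ⟨hk, ek⟩ := h k
  rw [vdet_eq_zero_iff_exists]
  constructor
  · rintro ⟨p, hp⟩
    induction p using Projectivization.ind with | h p hp0 =>
    refine ⟨p, hp0, ?_, ?_, ?_⟩
    · rw [← incident_mk hp0 hi, ← ei]; exact hp i (by simp)
    · rw [← incident_mk hp0 hj, ← ej]; exact hp j (by simp)
    · rw [← incident_mk hp0 hk, ← ek]; exact hp k (by simp)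
  · rintro ⟨p, hp0, h1, h2, h3⟩
    refine ⟨Projectivization.mk ℂ p hp0, ?_⟩
    rintro l (rfl | rfl | rfl)
    · rw [ei, incident_mk]; exact h1
    · rw [ej, incident_mk]; exact h2
    · rw [ek, incident_mk]; exact h3

lemma det3_eq_vdet (P Q R : Line) : det3 P Q R = vdet P.rep Q.rep R.rep := by
  rw [det3, Matrix.det_fin_three]; simp [vdet]; ring

lemma concurrent_iff_det3 {n : ℕ} (P : Fin n → Line) (i j k : Fin n) :
    Concurrent P i j k ↔ det3 (P i) (P j) (P k) = 0 := by
  rw [(represents_rep P).concurrent_iff, det3_eq_vdet]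

lemma Represents.vcross_ne_zero {n : ℕ} {v : Fin n → Fin 3 → ℂ} {P : Fin n → Line}
    (h : Represents v P) {i j : Fin n} (hij : P i ≠ P j) : vcross (v i) (v j) ≠ 0 := by
  obtain ⟨hi, ei⟩ := h i
  obtain ⟨hj, ej⟩ := h j
  rwa [vcross_eq, ne_eq, ← Projectivization.mk_eq_mk_iff_crossProduct_eq_zero hi hj, ← ei, ← ej]

lemma smul_concurrent_iff {n : ℕ} (g : LinearMap.GeneralLinearGroup ℂ (Fin 3 → ℂ))
    (P : Fin n → Line) (i j k : Fin n) :
    Concurrent (fun l => g • P l) i j k ↔ Concurrent P i j k := by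
  have h := (represents_rep P).smul g.toLinearEquiv
  rw [(represents_rep P).concurrent_iff, ← vdet_map_eq_zero_iff g.toLinearEquiv]
  exact h.concurrent_iff i j k

/-! ### Vectors of polynomial expressions -/

/-- A vector of three polynomial expressions. -/
abbrev PolyVec : Type := PolyExpr × PolyExpr × PolyExpr

namespace PolyVec

/-- The value of a vector of expressions. -/
def ev {R : Type*} [CommRing R] (s : ℕ → R) (u : PolyVec) : Fin 3 → R :=
  ![u.1.ev s, u.2.1.ev s, u.2.2.ev s]

/-- The determinant. -/
def det (u v w : PolyVec) : PolyExpr :=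
  u.1 * (v.2.1 * w.2.2 - v.2.2 * w.2.1) - u.2.1 * (v.1 * w.2.2 - v.2.2 * w.1) +
    u.2.2 * (v.1 * w.2.1 - v.2.1 * w.1)

/-- The cross product. -/
def cross (u v : PolyVec) : PolyVec :=
  (u.2.1 * v.2.2 - u.2.2 * v.2.1, u.2.2 * v.1 - u.1 * v.2.2, u.1 * v.2.1 - u.2.1 * v.1)

/-- The sum `u + t v`. -/
def addMul (u : PolyVec) (t : PolyExpr) (v : PolyVec) : PolyVec :=
  (u.1 + t * v.1, u.2.1 + t * v.2.1, u.2.2 + t * v.2.2)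

/-- The vector `t v`. -/
def mul (t : PolyExpr) (v : PolyVec) : PolyVec := (t * v.1, t * v.2.1, t * v.2.2)

/-- Equality as vectors of polynomials. -/
def same (u v : PolyVec) : Bool :=
  (u.1 - v.1).isZero && ((u.2.1 - v.2.1).isZero && (u.2.2 - v.2.2).isZero)

/-- All variables have index less than `n`. -/
def usesBelow (n : ℕ) (u : PolyVec) : Bool :=
  u.1.usesBelow n && (u.2.1.usesBelow n && u.2.2.usesBelow n)

section
variable {R : Type*} [CommRing R] (s : ℕ → R)

lemma ev_det (u v w : PolyVec) : (det u v w).ev s = vdet (u.ev s) (v.ev s) (w.ev s) := by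
  simp [det, vdet, ev]

lemma ev_cross (u v : PolyVec) : (cross u v).ev s = vcross (u.ev s) (v.ev s) := by
  simp [cross, vcross, ev]

lemma ev_addMul (u : PolyVec) (t : PolyExpr) (v : PolyVec) :
    (u.addMul t v).ev s = u.ev s + t.ev s • v.ev s := by
  simp [addMul, ev]

lemma ev_mul (t : PolyExpr) (v : PolyVec) : (mul t v).ev s = t.ev s • v.ev s := by
  simp [mul, ev]

lemma ev_eq_of_same {u v : PolyVec} (h : u.same v = true) : u.ev s = v.ev s := by
  simp only [same, Bool.and_eq_true] at h
  obtain ⟨h1, h2, h3⟩ := h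
  replace h1 := PolyExpr.ev_of_isZero s h1
  replace h2 := PolyExpr.ev_of_isZero s h2
  replace h3 := PolyExpr.ev_of_isZero s h3
  rw [PolyExpr.ev_sub, sub_eq_zero] at h1 h2 h3
  simp only [ev, h1, h2, h3]

lemma ev_congr_of_usesBelow {s t : ℕ → R} {n : ℕ} (h : ∀ i < n, s i = t i) {u : PolyVec}
    (hu : u.usesBelow n = true) : u.ev s = u.ev t := by
  simp only [usesBelow, Bool.and_eq_true] at hu
  obtain ⟨h1, h2, h3⟩ := hu
  simp only [ev, PolyExpr.ev_congr_of_below h h1, PolyExpr.ev_congr_of_below h h2,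
    PolyExpr.ev_congr_of_below h h3]

lemma map_ev {S : Type*} [CommRing S] (f : R →+* S) (u : PolyVec) (j : Fin 3) :
    f (u.ev s j) = u.ev (fun i => f (s i)) j := by
  fin_cases j <;> simp [ev, PolyExpr.map_ev]

end

lemma usesBelow_mono {n m : ℕ} (h : n ≤ m) {u : PolyVec} (hu : u.usesBelow n = true) :
    u.usesBelow m = true := by
  have key : ∀ a : PolyExpr, a.usesBelow n = true → a.usesBelow m = true := by
    intro a ha
    induction a with
    | var i =>
      simp only [PolyExpr.usesBelow, Nat.blt_eq] at ha ⊢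
      omega
    | nat n => rfl
    | add a b iha ihb =>
      simp only [PolyExpr.usesBelow, Bool.and_eq_true] at ha ⊢
      exact ⟨iha ha.1, ihb ha.2⟩
    | mul a b iha ihb =>
      simp only [PolyExpr.usesBelow, Bool.and_eq_true] at ha ⊢
      exact ⟨iha ha.1, ihb ha.2⟩
    | neg a iha => exact iha ha
  simp only [usesBelow, Bool.and_eq_true] at hu ⊢
  exact ⟨key _ hu.1, key _ hu.2.1, key _ hu.2.2⟩

end PolyVec

/-! ### Patterns of concurrent triples -/

/-- The checks use `Nat.blt` and `Nat.beq`, which evaluate directly on numerals; the proofs of their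
soundness pass to `decide`. -/
lemma blt_eq_decide (a b : ℕ) : Nat.blt a b = decide (a < b) := by
  rw [Bool.eq_iff_iff, Nat.blt_eq, decide_eq_true_eq]

lemma beq_eq_decide (a b : ℕ) : Nat.beq a b = decide (a = b) := by
  rw [Bool.eq_iff_iff, Nat.beq_eq, decide_eq_true_eq]

/-- The code of a triple of lines with labels less than `10`: its three digits in increasing
order. -/
def tripleCode (a b c : ℕ) : ℕ :=
  bif Nat.blt a b then
    bif Nat.blt b c then 100 * a + 10 * b + c
    else bif Nat.blt a c then 100 * a + 10 * c + b else 100 * c + 10 * a + b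
  else
    bif Nat.blt a c then 100 * b + 10 * a + c
    else bif Nat.blt b c then 100 * b + 10 * c + a else 100 * c + 10 * b + a

/-- Membership in a list of numbers. -/
def memCode (n : ℕ) : List ℕ → Bool
  | [] => false
  | m :: l => Nat.beq n m || memCode n l

lemma memCode_eq_true {n : ℕ} {l : List ℕ} : memCode n l = true ↔ n ∈ l := by
  induction l with
  | nil => simp [memCode]
  | cons m l ih => rw [memCode, Bool.or_eq_true, ih, Nat.beq_eq, List.mem_cons]

/-- Ten lines, given by coordinate vectors, are distinct, and exactly the triples with codes in `B`
are concurrent. -/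
structure VecPattern (v : ℕ → Fin 3 → ℂ) (B : List ℕ) : Prop where
  ne_zero : ∀ i < 10, v i ≠ 0
  vcross_ne_zero : ∀ i < 10, ∀ j < 10, i ≠ j → vcross (v i) (v j) ≠ 0
  vdet_eq_zero_iff : ∀ a b c, a < b → b < c → c < 10 →
    (vdet (v a) (v b) (v c) = 0 ↔ 100 * a + 10 * b + c ∈ B)

/-- Sorting the three labels changes the determinant at most by a sign. Of the eight sign patterns
of the comparisons, two contradict transitivity. -/
lemma vdet_eq_zero_iff_tripleCode {v : ℕ → Fin 3 → ℂ} {B : List ℕ}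
    (key : ∀ a b c, a < b → b < c → c < 10 →
      (vdet (v a) (v b) (v c) = 0 ↔ 100 * a + 10 * b + c ∈ B)) {a b c : ℕ}
    (ha : a < 10) (hb : b < 10) (hc : c < 10) (hab : a ≠ b) (hac : a ≠ c) (hbc : b ≠ c) :
    vdet (v a) (v b) (v c) = 0 ↔ tripleCode a b c ∈ B := by
  rcases lt_or_gt_of_ne hab with h1 | h1 <;> rcases lt_or_gt_of_ne hac with h2 | h2 <;>
    rcases lt_or_gt_of_ne hbc with h3 | h3
  · rw [key a b c h1 h3 hc]; simp [tripleCode, blt_eq_decide, h1, h3]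
  · rw [← neg_eq_zero, ← vdet_swap₂₃, key a c b h2 h3 hb]
    simp [tripleCode, blt_eq_decide, h1, h2, not_lt.2 h3.le]
  · omega
  · rw [← vdet_rotate, ← vdet_rotate, key c a b h2 h1 hb]
    simp [tripleCode, blt_eq_decide, h1, not_lt.2 h2.le, not_lt.2 h3.le]
  · rw [← neg_eq_zero, ← vdet_swap₁₂, key b a c h1 h2 hc]
    simp [tripleCode, blt_eq_decide, not_lt.2 h1.le, h2]
  · omega
  · rw [← vdet_rotate, key b c a h3 h2 ha]
    simp [tripleCode, blt_eq_decide, not_lt.2 h1.le, not_lt.2 h2.le, h3]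
  · rw [← neg_eq_zero, ← vdet_swap₁₂, ← vdet_rotate, ← vdet_rotate, key c b a h3 h1 ha]
    simp [tripleCode, blt_eq_decide, not_lt.2 h1.le, not_lt.2 h2.le, not_lt.2 h3.le]

lemma VecPattern.vdet_iff {v : ℕ → Fin 3 → ℂ} {B : List ℕ} (h : VecPattern v B) {a b c : ℕ}
    (ha : a < 10) (hb : b < 10) (hc : c < 10) (hab : a ≠ b) (hac : a ≠ c) (hbc : b ≠ c) :
    vdet (v a) (v b) (v c) = 0 ↔ tripleCode a b c ∈ B :=
  vdet_eq_zero_iff_tripleCode h.vdet_eq_zero_iff ha hb hc hab hac hbc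

lemma VecPattern.map {v : ℕ → Fin 3 → ℂ} {B : List ℕ} (h : VecPattern v B)
    (g : (Fin 3 → ℂ) ≃ₗ[ℂ] (Fin 3 → ℂ)) : VecPattern (fun i => g (v i)) B where
  ne_zero i hi h' := h.ne_zero i hi (g.map_eq_zero_iff.1 h')
  vcross_ne_zero i hi j hj hij h' := by
    obtain ⟨μ, -, hμ⟩ := exists_smul_eq_of_vcross_eq_zero
      (fun h' => h.ne_zero i hi (g.map_eq_zero_iff.1 h'))
      (fun h' => h.ne_zero j hj (g.map_eq_zero_iff.1 h')) h'
    rw [← map_smul, g.injective.eq_iff] at hμ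
    apply h.vcross_ne_zero i hi j hj hij
    rw [hμ]
    ext l
    fin_cases l <;> simp [vcross] <;> ring
  vdet_eq_zero_iff a b c hab hbc hc := by
    rw [vdet_map_eq_zero_iff, h.vdet_eq_zero_iff a b c hab hbc hc]

lemma vcross_smul {K : Type*} [Field K] (a b : K) (u v : Fin 3 → K) :
    vcross (a • u) (b • v) = (a * b) • vcross u v := by
  ext l
  fin_cases l <;> simp [vcross] <;> ring

lemma VecPattern.scale {v w : ℕ → Fin 3 → ℂ} {B : List ℕ} (h : VecPattern v B)
    (hw : ∀ i < 10, ∃ μ : ℂ, μ ≠ 0 ∧ v i = μ • w i) : VecPattern w B where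
  ne_zero i hi h' := by
    obtain ⟨μ, -, hv⟩ := hw i hi
    exact h.ne_zero i hi (by rw [hv, h', smul_zero])
  vcross_ne_zero i hi j hj hij h' := by
    obtain ⟨μ, -, hv⟩ := hw i hi
    obtain ⟨ν, -, hv'⟩ := hw j hj
    exact h.vcross_ne_zero i hi j hj hij (by rw [hv, hv', vcross_smul, h', smul_zero])
  vdet_eq_zero_iff a b c hab hbc hc := by
    obtain ⟨μ, h1, e1⟩ := hw a (by omega)
    obtain ⟨ν, h2, e2⟩ := hw b (by omega)
    obtain ⟨ξ, h3, e3⟩ := hw c hc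
    rw [← h.vdet_eq_zero_iff a b c hab hbc hc, e1, e2, e3, vdet_smul]
    simp [h1, h2, h3]

/-! ### Normal forms -/

/-- One step in the construction of a normal form: a line through the intersection point of two
earlier lines, with a new parameter, or the line through the intersection points of two pairs of
earlier lines. -/
inductive Step : Type
  | line (i j : ℕ)
  | meet (i j k m : ℕ) (h : PolyExpr)

/-- Line `l` may be constructed in the given way, when the first `nv` parameters are in use. -/
def Step.valid (B : List ℕ) (F : ℕ → PolyVec) (l nv : ℕ) : Step → Bool
  | line i j =>
    Nat.blt i l && (Nat.blt j l && (!Nat.beq i j && (memCode (tripleCode l i j) B &&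
      ((F l).same ((F i).addMul (.var nv) (F j)) && (F l).usesBelow (nv + 1)))))
  | meet i j k m h =>
    Nat.blt i l && (Nat.blt j l && (!Nat.beq i j && (memCode (tripleCode l i j) B &&
    (Nat.blt k l && (Nat.blt m l && (!Nat.beq k m && (memCode (tripleCode l k m) B &&
    (!Nat.beq i k && (!Nat.beq j k && (!memCode (tripleCode i j k) B &&
      ((((F i).cross (F j)).cross ((F k).cross (F m))).same (PolyVec.mul h (F l)) &&
        (F l).usesBelow nv)))))))))))

/-- The number of parameters in use after a step. -/
def Step.next (nv : ℕ) : Step → ℕ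
  | line _ _ => nv + 1
  | meet _ _ _ _ _ => nv

/-- The lines from line `l` on may be constructed in the given way. -/
def validSteps (B : List ℕ) (F : ℕ → PolyVec) : ℕ → ℕ → List Step → Bool
  | l, _, [] => Nat.beq l 10
  | l, nv, st :: rest => Nat.blt l 10 && (st.valid B F l nv && validSteps B F (l + 1) (st.next nv) rest)

/-- Induction along the construction. The lines before `l` are already proportional to their
polynomial vectors, and these involve only the first `nv` parameters, so the value of the next
parameter may still be chosen. -/
lemma exists_params_of_validSteps {B : List ℕ} {F : ℕ → PolyVec} {v : ℕ → Fin 3 → ℂ}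
    (hv : VecPattern v B) (steps : List Step) : ∀ (l nv : ℕ) (s : ℕ → ℂ),
    validSteps B F l nv steps = true → (∀ i < l, (F i).usesBelow nv = true) →
    (∀ i < l, ∃ μ : ℂ, μ ≠ 0 ∧ v i = μ • (F i).ev s) →
    ∃ s : ℕ → ℂ, ∀ i < 10, ∃ μ : ℂ, μ ≠ 0 ∧ v i = μ • (F i).ev s := by
  induction steps with
  | nil =>
    intro l nv s hl _ h
    simp only [validSteps, Nat.beq_eq] at hl
    subst hl
    exact ⟨s, h⟩
  | cons st rest ih =>
    intro l nv s hst hF h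
    simp only [validSteps, Bool.and_eq_true, Nat.blt_eq] at hst
    obtain ⟨hl, hst, hrest⟩ := hst
    cases st with
    | line i j =>
      simp only [Step.valid, Bool.and_eq_true, Nat.blt_eq, Bool.not_eq_true', beq_eq_decide,
        decide_eq_false_iff_not, memCode_eq_true] at hst
      obtain ⟨hi, hj, hij, hB, hsame, hbelow⟩ := hst
      have hdet : vdet (v l) (v i) (v j) = 0 :=
        (hv.vdet_iff hl (by omega) (by omega) (by omega) (by omega) hij).2 hB
      obtain ⟨μ, t, hμ, hp⟩ := exists_eq_smul_add_smul
        (hv.vcross_ne_zero i (by omega) j (by omega) hij)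
        (hv.vcross_ne_zero l hl j (by omega) (by omega)) hdet
      obtain ⟨α, hα, eα⟩ := h i hi
      obtain ⟨β, hβ, eβ⟩ := h j hj
      -- The parameter `t` refers to the given vectors of the lines `i` and `j`. The normal form
      -- uses these vectors divided by `α` and `β`, which multiplies the parameter by `β / α`.
      let s' : ℕ → ℂ := Function.update s nv (t * β / α)
      have hs' : ∀ i < nv, s i = s' i := fun i hi => by
        simp [s', Function.update_of_ne hi.ne]
      refine ih (l + 1) (nv + 1) s' hrest (fun k hk => ?_) (fun k hk => ?_)
      · rcases Nat.lt_succ_iff_lt_or_eq.1 hk with hk | rfl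
        · exact PolyVec.usesBelow_mono (Nat.le_succ _) (hF k hk)
        · exact hbelow
      · rcases Nat.lt_succ_iff_lt_or_eq.1 hk with hk | rfl
        · obtain ⟨μ, hμ, e⟩ := h k hk
          exact ⟨μ, hμ, by rw [e, PolyVec.ev_congr_of_usesBelow hs' (hF k hk)]⟩
        · refine ⟨μ * α, mul_ne_zero hμ hα, ?_⟩
          rw [PolyVec.ev_eq_of_same s' hsame, PolyVec.ev_addMul,
            ← PolyVec.ev_congr_of_usesBelow hs' (hF i hi),
            ← PolyVec.ev_congr_of_usesBelow hs' (hF j hj), hp, eα, eβ, mul_smul, smul_add,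
            smul_smul, smul_smul]
          simp only [PolyExpr.ev_var, s', Function.update_self, smul_add, smul_smul]
          congr 2
          field_simp
    | meet i j k m c =>
      simp only [Step.valid, Bool.and_eq_true, Nat.blt_eq, Bool.not_eq_true', beq_eq_decide,
        decide_eq_false_iff_not, memCode_eq_true] at hst
      obtain ⟨hi, hj, hij, hB, hk, hm, hkm, hB', hik, hjk, hB'', hsame, hbelow⟩ := hst
      rw [← Bool.not_eq_true, memCode_eq_true] at hB''
      obtain ⟨μ, hμ, hp⟩ := exists_smul_eq_vcross_vcross (hv.ne_zero l hl)
        ((hv.vdet_iff hl (by omega) (by omega) (by omega) (by omega) hij).2 hB)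
        ((hv.vdet_iff hl (by omega) (by omega) (by omega) (by omega) hkm).2 hB')
        (mt (hv.vdet_iff (by omega) (by omega) (by omega) hij hik hjk).1 hB'')
        (hv.vcross_ne_zero k (by omega) m (by omega) hkm)
      obtain ⟨α, hα, eα⟩ := h i hi
      obtain ⟨β, hβ, eβ⟩ := h j hj
      obtain ⟨γ, hγ, eγ⟩ := h k hk
      obtain ⟨δ, hδ, eδ⟩ := h m hm
      have key : v l = (μ * (α * β * (γ * δ)) * c.ev s) • (F l).ev s := by
        rw [hp, eα, eβ, eγ, eδ, vcross_smul, vcross_smul, vcross_smul, ← PolyVec.ev_cross,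
          ← PolyVec.ev_cross, ← PolyVec.ev_cross, PolyVec.ev_eq_of_same s hsame, PolyVec.ev_mul,
          smul_smul, smul_smul, mul_assoc]
      refine ih (l + 1) nv s hrest (fun k hk => ?_) (fun k hk => ?_)
      · rcases Nat.lt_succ_iff_lt_or_eq.1 hk with hk | rfl
        · exact hF k hk
        · exact hbelow
      · rcases Nat.lt_succ_iff_lt_or_eq.1 hk with hk | rfl
        · exact h k hk
        -- The common factor `c` that the normal form cancels needs no certificate: if its value
        -- were zero, the line `l` would have the zero vector.
        · refine ⟨_, fun h0 => hv.ne_zero k hl ?_, key⟩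
          rw [key, h0, zero_smul]

/-- A normal form for ten lines with a given pattern of concurrent triples: the first four lines
are the coordinate lines and the unit line, the other six are given by vectors of polynomials. -/
structure NormalForm : Type where
  blocks : List ℕ
  vecs : List PolyVec
  steps : List Step

namespace NormalForm

/-- The coordinate vectors of the lines. -/
def vec (N : NormalForm) (i : ℕ) : PolyVec :=
  ([(1, 0, 0), (0, 1, 0), (0, 0, 1), (1, 1, 1)] ++ N.vecs).getD i (0, 0, 0)

/-- The normal form can be constructed. -/
def valid (N : NormalForm) : Bool :=
  !memCode 12 N.blocks && (!memCode 13 N.blocks && (!memCode 23 N.blocks &&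
    (!memCode 123 N.blocks && validSteps N.blocks N.vec 4 0 N.steps)))

lemma exists_params {N : NormalForm} (hN : N.valid = true) {v : ℕ → Fin 3 → ℂ}
    (hv : VecPattern v N.blocks) : ∃ (g : (Fin 3 → ℂ) ≃ₗ[ℂ] (Fin 3 → ℂ)) (s : ℕ → ℂ),
      ∀ i < 10, ∃ μ : ℂ, μ ≠ 0 ∧ g (v i) = μ • (N.vec i).ev s := by
  simp only [valid, Bool.and_eq_true, Bool.not_eq_true', ← Bool.not_eq_true (memCode _ _),
    memCode_eq_true] at hN
  obtain ⟨h1, h2, h3, h4, hN⟩ := hN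
  have key := hv.vdet_eq_zero_iff
  obtain ⟨g, x, y, z, hx, hy, hz, ha, hb, hc, hd⟩ := exists_frame
    (mt (key 0 1 2 (by omega) (by omega) (by omega)).1 h1)
    (mt (key 0 1 3 (by omega) (by omega) (by omega)).1 h2)
    (mt (key 0 2 3 (by omega) (by omega) (by omega)).1 h3)
    (mt (key 1 2 3 (by omega) (by omega) (by omega)).1 h4)
  refine ⟨g, exists_params_of_validSteps (hv.map g) N.steps 4 0 (fun _ => 0) hN ?_ ?_⟩
  · intro i hi
    interval_cases i <;> rfl
  · intro i hi
    interval_cases i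
    · exact ⟨x, hx, by rw [ha]; congr 1; ext i; fin_cases i <;> simp [vec, PolyVec.ev]⟩
    · exact ⟨y, hy, by rw [hb]; congr 1; ext i; fin_cases i <;> simp [vec, PolyVec.ev]⟩
    · exact ⟨z, hz, by rw [hc]; congr 1; ext i; fin_cases i <;> simp [vec, PolyVec.ev]⟩
    · exact ⟨1, one_ne_zero, by rw [hd, one_smul]; ext i; fin_cases i <;> simp [vec, PolyVec.ev]⟩

/-- The parameters for which the normal form has the right pattern. -/
def Good (N : NormalForm) (s : ℕ → ℂ) : Prop := VecPattern (fun i => (N.vec i).ev s) N.blocks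

lemma exists_good_params {N : NormalForm} (hN : N.valid = true) {v : ℕ → Fin 3 → ℂ}
    (hv : VecPattern v N.blocks) : ∃ (g : (Fin 3 → ℂ) ≃ₗ[ℂ] (Fin 3 → ℂ)) (s : ℕ → ℂ),
      N.Good s ∧ ∀ i < 10, ∃ μ : ℂ, μ ≠ 0 ∧ g (v i) = μ • (N.vec i).ev s := by
  obtain ⟨g, s, h⟩ := exists_params hN hv
  exact ⟨g, s, (hv.map g).scale h, h⟩

/-- The determinant of three lines of the normal form. -/
def det (N : NormalForm) (n : ℕ) : PolyExpr :=
  PolyVec.det (N.vec (n / 100)) (N.vec (n / 10 % 10)) (N.vec (n % 10))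

/-- The number is the code of a triple. -/
def isCode (n : ℕ) : Bool :=
  Nat.blt (n / 100) (n / 10 % 10) && Nat.blt (n / 10 % 10) (n % 10)

lemma Good.ev_det_eq_zero_iff {N : NormalForm} {s : ℕ → ℂ} (hs : N.Good s) {n : ℕ}
    (hn : isCode n = true) : (N.det n).ev s = 0 ↔ n ∈ N.blocks := by
  simp only [isCode, Bool.and_eq_true, Nat.blt_eq] at hn
  rw [det, PolyVec.ev_det, hs.vdet_eq_zero_iff _ _ _ hn.1 hn.2 (by omega)]
  have : 100 * (n / 100) + 10 * (n / 10 % 10) + n % 10 = n := by omega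
  rw [this]

/-- A product of determinants of triples that are not concurrent. -/
def prodDet (N : NormalForm) : List ℕ → PolyExpr
  | [] => 1
  | n :: l => N.det n * prodDet N l

/-- The polynomial `u` is shown not to vanish at good parameters: its product with `w` is a nonzero
multiple of the product of the determinants of some triples that are not concurrent. -/
def isUnit (N : NormalForm) (u : PolyExpr) (w : ℕ × PolyExpr × List ℕ) : Bool :=
  -- Writing the multiple as `w.1 + 1` makes it nonzero in `ℂ` without a further check.
  (u * w.2.1 - .nat (w.1 + 1) * N.prodDet w.2.2).isZero &&
    w.2.2.all fun n => isCode n && !memCode n N.blocks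

lemma Good.ev_ne_zero {N : NormalForm} {s : ℕ → ℂ} (hs : N.Good s) {u : PolyExpr}
    {w : ℕ × PolyExpr × List ℕ} (h : N.isUnit u w = true) : u.ev s ≠ 0 := by
  obtain ⟨c, w, l⟩ := w
  simp only [isUnit, Bool.and_eq_true, List.all_eq_true, Bool.not_eq_true',
    ← Bool.not_eq_true (memCode _ _), memCode_eq_true] at h
  obtain ⟨h, hl⟩ := h
  have hprod : (N.prodDet l).ev s ≠ 0 := by
    clear h
    induction l with
    | nil => simp [prodDet]
    | cons n l ih =>
      rw [prodDet, PolyExpr.ev_mul]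
      have hn := hl n (by simp)
      exact mul_ne_zero (mt (hs.ev_det_eq_zero_iff hn.1).1 hn.2)
        (ih fun m hm => hl m (List.mem_cons_of_mem _ hm))
  have := PolyExpr.ev_of_isZero s h
  rw [PolyExpr.ev_sub, PolyExpr.ev_mul, PolyExpr.ev_mul, PolyExpr.ev_nat, sub_eq_zero] at this
  intro h0
  rw [h0, zero_mul, eq_comm, mul_eq_zero] at this
  rcases this with h | h
  · exact Nat.cast_ne_zero.2 (Nat.succ_ne_zero c) h
  · exact hprod h

/-- All determinants of concurrent triples are polynomial multiples of `r`: the determinant of the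
triple with code `b` is `q` times `r`, the others vanish. -/
def blocksVanish (N : NormalForm) (r : PolyExpr) (b : ℕ) (q : PolyExpr) : Bool :=
  N.blocks.all fun n => isCode n &&
    bif Nat.beq n b then (N.det n - q * r).isZero else (N.det n).isZero

lemma ev_det_eq_zero_of_blocksVanish {N : NormalForm} {r : PolyExpr} {b : ℕ} {q : PolyExpr}
    (h : N.blocksVanish r b q = true) {R : Type*} [CommRing R] (s : ℕ → R) (hr : r.ev s = 0) {n : ℕ}
    (hn : n ∈ N.blocks) : (N.det n).ev s = 0 := by
  simp only [blocksVanish, List.all_eq_true, Bool.and_eq_true] at h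
  have := (h n hn).2
  cases hb : Nat.beq n b with
  | false =>
    rw [hb, cond_false] at this
    exact PolyExpr.ev_of_isZero s this
  | true =>
    rw [hb, cond_true] at this
    have := PolyExpr.ev_of_isZero s this
    rwa [PolyExpr.ev_sub, PolyExpr.ev_mul, hr, mul_zero, sub_zero] at this

/-- The residual equation `r = 0` is shown to hold at good parameters: the determinant of the
concurrent triple with code `b` is `q r`, and `q` does not vanish. -/
def residual (N : NormalForm) (r : PolyExpr) (b : ℕ) (q : PolyExpr)
    (w : ℕ × PolyExpr × List ℕ) : Bool :=
  memCode b N.blocks && (isCode b && ((N.det b - q * r).isZero && N.isUnit q w))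

lemma Good.ev_eq_zero {N : NormalForm} {s : ℕ → ℂ} (hs : N.Good s) {r : PolyExpr} {b : ℕ}
    {q : PolyExpr} {w : ℕ × PolyExpr × List ℕ} (h : N.residual r b q w = true) : r.ev s = 0 := by
  simp only [residual, Bool.and_eq_true, memCode_eq_true] at h
  obtain ⟨hb, hb', h, hu⟩ := h
  have := PolyExpr.ev_of_isZero s h
  rw [PolyExpr.ev_sub, (hs.ev_det_eq_zero_iff hb').2 hb, PolyExpr.ev_mul, zero_sub,
    neg_eq_zero] at this
  exact (mul_eq_zero.1 this).resolve_left (hs.ev_ne_zero hu)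

end NormalForm

/-! ### The Zariski topology on tuples of lines -/

/-- Basic open sets form a basis of the prime spectrum, and a point lies in the one of `q` exactly
when `q` does not vanish there. -/
lemma exists_poly_of_isOpen_zariskiAffine {ι : Type} {W : Set (ι → ℂ)}
    (hW : IsOpen[zariskiAffine ι] W) {x : ι → ℂ} (hx : x ∈ W) :
    ∃ q : MvPolynomial ι ℂ, MvPolynomial.aeval x q ≠ 0 ∧
      ∀ y : ι → ℂ, MvPolynomial.aeval y q ≠ 0 → y ∈ W := by
  rw [isOpen_induced_iff] at hW
  obtain ⟨O, hO, rfl⟩ := hW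
  obtain ⟨_, ⟨q, rfl⟩, hq, hqO⟩ :=
    PrimeSpectrum.isTopologicalBasis_basic_opens.exists_subset_of_mem_open hx hO
  have key : ∀ y : ι → ℂ, MvPolynomial.pointToPoint (k := ℂ) y ∈ PrimeSpectrum.basicOpen q ↔
      MvPolynomial.aeval y q ≠ 0 := fun y => by
    rw [PrimeSpectrum.mem_basicOpen, ne_eq, ← MvPolynomial.mem_vanishingIdeal_singleton_iff]
    rfl
  exact ⟨q, (key x).1 hq, fun y hy => hqO ((key y).2 hy)⟩

lemma isClosed_zariskiAffine {ι : Type} (q : MvPolynomial ι ℂ) :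
    IsClosed[zariskiAffine ι] {y : ι → ℂ | MvPolynomial.aeval y q = 0} := by
  rw [isClosed_induced_iff]
  refine ⟨PrimeSpectrum.zeroLocus {q}, PrimeSpectrum.isClosed_zeroLocus _, ?_⟩
  ext y
  rw [Set.mem_preimage, PrimeSpectrum.mem_zeroLocus, Set.singleton_subset_iff, SetLike.mem_coe,
    Set.mem_ofPred_eq, ← MvPolynomial.mem_vanishingIdeal_singleton_iff]
  rfl

/-- The value of a polynomial in the coordinates of `n` vectors. -/
noncomputable def evalVecs {n : ℕ} (q : MvPolynomial (Fin n × Fin 3) ℂ) (v : Fin n → Fin 3 → ℂ) : ℂ :=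
  MvPolynomial.aeval (fun x : Fin n × Fin 3 => v x.1 x.2) q

/-- The tuple of lines with given coordinates. -/
noncomputable def lineTuple {n : ℕ} (v : Coeffs n) : Fin n → Line :=
  fun i => Projectivization.mk ℂ (v i).1 (v i).2

lemma represents_iff_exists {n : ℕ} {v : Fin n → Fin 3 → ℂ} {P : Fin n → Line} :
    Represents v P ↔ ∃ c : Coeffs n, (fun i => (c i).1) = v ∧ lineTuple c = P := by
  constructor
  · intro h
    exact ⟨fun i => ⟨v i, (h i).1⟩, rfl, funext fun i => (h i).2.symm⟩
  · rintro ⟨c, rfl, rfl⟩ i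
    exact ⟨(c i).2, rfl⟩

lemma isOpen_zariskiLines {n : ℕ} {V : Set (Fin n → Line)} :
    IsOpen[zariskiLines n] V ↔ IsOpen[zariskiCoeffs n] (lineTuple ⁻¹' V) := isOpen_coinduced

/-- A basic open neighbourhood of one chosen coordinate vector. The polynomial need not be
homogeneous, because it is only evaluated at coordinate vectors and never at tuples of lines. -/
lemma exists_poly_of_isOpen_zariskiLines {n : ℕ} {V : Set (Fin n → Line)}
    (hV : IsOpen[zariskiLines n] V) {v : Fin n → Fin 3 → ℂ} {P : Fin n → Line}
    (hv : Represents v P) (hP : P ∈ V) : ∃ q, evalVecs q v ≠ 0 ∧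
      ∀ w Q, Represents w Q → evalVecs q w ≠ 0 → Q ∈ V := by
  obtain ⟨W, hW, hWV⟩ := (@isOpen_induced_iff _ _ (zariskiAffine (Fin n × Fin 3)) _ _).1
    (isOpen_zariskiLines.1 hV)
  obtain ⟨c, rfl, rfl⟩ := represents_iff_exists.1 hv
  have hc : c ∈ lineTuple ⁻¹' V := hP
  rw [← hWV] at hc
  obtain ⟨q, hq, hqW⟩ := exists_poly_of_isOpen_zariskiAffine hW hc
  refine ⟨q, hq, fun w Q hw hwq => ?_⟩
  obtain ⟨d, rfl, rfl⟩ := represents_iff_exists.1 hw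
  have hd : d ∈ lineTuple ⁻¹' V := by rw [← hWV]; exact hqW _ hwq
  exact hd

/-- A set of tuples is closed when its preimage in the space of coordinates is. Since `hZ` ranges
over all coordinates, homogeneity of `q` need not be discussed. -/
lemma isClosed_zariskiLines {n : ℕ} (q : MvPolynomial (Fin n × Fin 3) ℂ) {Z : Set (Fin n → Line)}
    (hZ : ∀ v P, Represents v P → (P ∈ Z ↔ evalVecs q v = 0)) : IsClosed[zariskiLines n] Z := by
  rw [← @isOpen_compl_iff _ _ (zariskiLines n), isOpen_zariskiLines, Set.preimage_compl,
    @isOpen_compl_iff _ _ (zariskiCoeffs n),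
    @isClosed_induced_iff _ _ (zariskiAffine (Fin n × Fin 3))]
  refine ⟨_, isClosed_zariskiAffine q, ?_⟩
  ext c
  exact (hZ _ _ (represents_iff_exists.2 ⟨c, rfl, rfl⟩)).symm

/-! ### Points of moduli spaces -/

lemma TotalSpace.concurrent_iff {n : ℕ} {A : Fin n → Line} (P : TotalSpace A) (i j k : Fin n) :
    Concurrent P.lines i j k ↔ Concurrent A i j k := by
  rw [concurrent_iff_det3]
  exact ⟨fun h => by_contra fun h' => P.2.2.2 i j k h' h, P.2.2.1 i j k⟩

/-- The point of the total space given by a tuple of distinct lines with the right pattern. -/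
def TotalSpace.ofLines {n : ℕ} {A : Fin n → Line} (P : Fin n → Line) (hP : Function.Injective P)
    (h : ∀ i j k, Concurrent P i j k ↔ Concurrent A i j k) : TotalSpace A :=
  ⟨P, hP, fun i j k h' => (concurrent_iff_det3 P i j k).1 ((h i j k).2 h'),
    fun i j k h' h'' => h' ((h i j k).1 ((concurrent_iff_det3 P i j k).2 h''))⟩

lemma TotalSpace.ext {n : ℕ} {A : Fin n → Line} {P Q : TotalSpace A} (h : P.lines = Q.lines) :
    P = Q := Subtype.ext h

lemma ModuliSpace.mk_surjective {n : ℕ} {A : Fin n → Line} :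
    Function.Surjective (ModuliSpace.mk (A := A)) := Quotient.mk_surjective

lemma ModuliSpace.mk_eq_mk {n : ℕ} {A : Fin n → Line} {P Q : TotalSpace A} :
    ModuliSpace.mk P = ModuliSpace.mk Q ↔
      ∃ g : LinearMap.GeneralLinearGroup ℂ (Fin 3 → ℂ), ∀ i, Q.lines i = g • P.lines i :=
  Quotient.eq (r := projSetoid A)

/-- The translate of a point of the total space by a projective automorphism. -/
noncomputable def TotalSpace.smul {n : ℕ} {A : Fin n → Line} (g : LinearMap.GeneralLinearGroup ℂ (Fin 3 → ℂ))
    (P : TotalSpace A) : TotalSpace A :=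
  TotalSpace.ofLines (fun i => g • P.lines i)
    (fun _ _ h => P.2.1 (MulAction.injective g h))
    (fun i j k => by rw [smul_concurrent_iff, P.concurrent_iff])

lemma ModuliSpace.mk_smul {n : ℕ} {A : Fin n → Line}
    (g : LinearMap.GeneralLinearGroup ℂ (Fin 3 → ℂ)) (P : TotalSpace A) :
    ModuliSpace.mk (P.smul g) = ModuliSpace.mk P :=
  (ModuliSpace.mk_eq_mk.2 ⟨g, fun _ => rfl⟩).symm

/-! ### Galois action -/

lemma galLine_mk (σ : ℂ ≃+* ℂ) {v : Fin 3 → ℂ} (hv : v ≠ 0) :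
    galLine σ (Projectivization.mk ℂ v hv) =
      Projectivization.mk ℂ (galVec σ v) (fun h => hv (galVec_injective σ (by rw [h, map_zero]))) :=
  rfl

lemma Represents.gal {n : ℕ} {v : Fin n → Fin 3 → ℂ} {P : Fin n → Line} (h : Represents v P)
    (σ : ℂ ≃+* ℂ) : Represents (fun i j => σ (v i j)) (fun i => galLine σ (P i)) := by
  intro i
  obtain ⟨h0, h⟩ := h i
  refine ⟨fun h' => h0 (galVec_injective σ (by rw [map_zero]; exact h')), ?_⟩
  beta_reduce
  rw [h, galLine_mk]
  rfl

lemma gal_concurrent_iff {n : ℕ} (σ : ℂ ≃+* ℂ) (P : Fin n → Line) (i j k : Fin n) :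
    Concurrent (fun l => galLine σ (P l)) i j k ↔ Concurrent P i j k := by
  rw [((represents_rep P).gal σ).concurrent_iff, (represents_rep P).concurrent_iff]
  have := map_vdet (σ : ℂ →+* ℂ) (P i).rep (P j).rep (P k).rep
  simp only [RingEquiv.coe_toRingHom] at this
  rw [← this, map_eq_zero_iff _ σ.injective]

lemma galLine_injective (σ : ℂ ≃+* ℂ) : Function.Injective (galLine σ) := fun P Q h => by
  induction P using Projectivization.ind with | h v hv =>
  induction Q using Projectivization.ind with | h w hw =>
  rw [galLine_mk, galLine_mk, Projectivization.mk_eq_mk_iff'] at h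
  rw [Projectivization.mk_eq_mk_iff']
  obtain ⟨a, ha⟩ := h
  refine ⟨σ.symm a, galVec_injective σ ?_⟩
  rw [← ha, map_smulₛₗ]
  simp

/-- The image of a point of the total space under a field automorphism. -/
noncomputable def TotalSpace.gal {n : ℕ} {A : Fin n → Line} (σ : ℂ ≃+* ℂ) (P : TotalSpace A) : TotalSpace A :=
  TotalSpace.ofLines (fun i => galLine σ (P.lines i))
    (fun _ _ h => P.2.1 (galLine_injective σ h))
    (fun i j k => by rw [gal_concurrent_iff, P.concurrent_iff])

lemma galConj_mk_gal {n : ℕ} {A : Fin n → Line} (σ : ℂ ≃+* ℂ) (P : TotalSpace A) :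
    GalConj σ (ModuliSpace.mk P) (ModuliSpace.mk (P.gal σ)) :=
  ⟨P, P.gal σ, rfl, rfl, fun _ => rfl⟩

lemma galConj_iff {n : ℕ} {A : Fin n → Line} {σ : ℂ ≃+* ℂ} {x y : ModuliSpace A} :
    GalConj σ x y ↔ ∃ P : TotalSpace A, ModuliSpace.mk P = x ∧ ModuliSpace.mk (P.gal σ) = y := by
  constructor
  · rintro ⟨P, Q, rfl, rfl, h⟩
    refine ⟨P, rfl, ?_⟩
    congr 1
    exact TotalSpace.ext (funext fun i => (h i).symm)
  · rintro ⟨P, rfl, rfl⟩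
    exact galConj_mk_gal σ P

/-! ### Irreducible families -/

/-- A set of parameters on which the product of two polynomials vanishes only if one of them does:
an irreducible set in the Zariski topology. -/
def PolyIrreducible (S : Set (ℕ → ℂ)) : Prop :=
  ∀ f g : MvPolynomial ℕ ℂ,
    (∀ s ∈ S, MvPolynomial.eval s f * MvPolynomial.eval s g = 0) →
    (∀ s ∈ S, MvPolynomial.eval s f = 0) ∨ ∀ s ∈ S, MvPolynomial.eval s g = 0

/-- The form in which irreducibility is used: two nonempty basic open subsets meet. -/
lemma PolyIrreducible.exists_ne_zero {S : Set (ℕ → ℂ)} (hS : PolyIrreducible S)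
    {f g : MvPolynomial ℕ ℂ} {s t : ℕ → ℂ} (hs : s ∈ S) (ht : t ∈ S)
    (hf : MvPolynomial.eval s f ≠ 0) (hg : MvPolynomial.eval t g ≠ 0) :
    ∃ u ∈ S, MvPolynomial.eval u f ≠ 0 ∧ MvPolynomial.eval u g ≠ 0 := by
  by_contra! h
  rcases hS f g fun u hu => by
    by_cases h0 : MvPolynomial.eval u f = 0
    · rw [h0, zero_mul]
    · rw [h u hu h0, mul_zero] with h | h
  · exact hf (h s hs)
  · exact hg (h t ht)

/-- The polynomial given by an expression. -/
noncomputable def PolyExpr.toMv (a : PolyExpr) : MvPolynomial ℕ ℂ := a.ev MvPolynomial.X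

@[simp] lemma PolyExpr.eval_toMv (a : PolyExpr) (s : ℕ → ℂ) :
    MvPolynomial.eval s a.toMv = a.ev s := by
  rw [toMv, PolyExpr.map_ev]
  simp

/-- A family of tuples of lines, given by vectors of polynomials. -/
abbrev Family (n : ℕ) : Type := Fin n → PolyVec

/-- The coordinates of the lines of a member of the family. -/
def Family.ev {n : ℕ} (F : Family n) (s : ℕ → ℂ) : Fin n → Fin 3 → ℂ := fun i => (F i).ev s

lemma Family.exists_eval_eq {n : ℕ} (F : Family n) (q : MvPolynomial (Fin n × Fin 3) ℂ) :
    ∃ p : MvPolynomial ℕ ℂ, ∀ s, MvPolynomial.eval s p = evalVecs q (F.ev s) := by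
  refine ⟨MvPolynomial.aeval (fun x : Fin n × Fin 3 => (F x.1).ev MvPolynomial.X x.2) q,
    fun s => ?_⟩
  rw [evalVecs, ← MvPolynomial.coe_aeval_eq_eval, RingHom.coe_coe, ← AlgHom.comp_apply,
    MvPolynomial.comp_aeval]
  congr 2
  ext x
  have := PolyVec.map_ev MvPolynomial.X (MvPolynomial.eval s) (F x.1) x.2
  rw [MvPolynomial.aeval_eq_eval]
  simpa [Family.ev] using this

/-- Any two lines have a third line that does not pass through their intersection. -/
def Spread {n : ℕ} (A : Fin n → Line) : Prop := ∀ i j, i ≠ j → ∃ k, ¬ Concurrent A i j k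

lemma concurrent_of_eq {n : ℕ} {P : Fin n → Line} {i j : Fin n} (h : P i = P j) (k : Fin n) :
    Concurrent P i j k := by
  rw [(represents_rep P).concurrent_iff, h]
  simp only [vdet]; ring

/-- Members of the family with the right pattern give points of the total space; the members without
superfluous concurrent triples form an open set. -/
lemma exists_poly_totalSpace {n : ℕ} [Nontrivial (Fin n)] {A : Fin n → Line} (hA : Spread A) (F : Family n)
    {S : Set (ℕ → ℂ)} (hS : ∀ s ∈ S, ∀ i j k, Concurrent A i j k →
      vdet (F.ev s i) (F.ev s j) (F.ev s k) = 0) :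
    ∃ p : MvPolynomial ℕ ℂ,
      (∀ s, ∀ P : TotalSpace A, Represents (F.ev s) P.lines → MvPolynomial.eval s p ≠ 0) ∧
      ∀ s ∈ S, MvPolynomial.eval s p ≠ 0 → ∃ P : TotalSpace A, Represents (F.ev s) P.lines := by
  classical
  -- The polynomial is the product of the determinants of all triples that must not be concurrent.
  let T : Finset (Fin n × Fin n × Fin n) :=
    Finset.univ.filter fun t => ¬ Concurrent A t.1 t.2.1 t.2.2
  have hev : ∀ s : ℕ → ℂ, MvPolynomial.eval s
      (∏ t ∈ T, ((F t.1).det (F t.2.1) (F t.2.2)).toMv) =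
        ∏ t ∈ T, vdet (F.ev s t.1) (F.ev s t.2.1) (F.ev s t.2.2) := fun s => by
    rw [map_prod]
    refine Finset.prod_congr rfl fun t _ => ?_
    rw [PolyExpr.eval_toMv, PolyVec.ev_det]
    rfl
  refine ⟨∏ t ∈ T, ((F t.1).det (F t.2.1) (F t.2.2)).toMv, fun s P hP => ?_, fun s hs h => ?_⟩
  · rw [hev, Finset.prod_ne_zero_iff]
    rintro ⟨i, j, k⟩ ht h
    simp only [T, Finset.mem_filter, Finset.mem_univ, true_and] at ht
    exact ht ((P.concurrent_iff i j k).1 ((hP.concurrent_iff i j k).2 h))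
  · rw [hev, Finset.prod_ne_zero_iff] at h
    have hiff : ∀ i j k, vdet (F.ev s i) (F.ev s j) (F.ev s k) = 0 ↔ Concurrent A i j k :=
      fun i j k => ⟨fun h0 => by_contra fun h' => h (i, j, k) (by simp [T, h']) h0, hS s hs i j k⟩
    -- Nonzero vectors and distinct lines come for free: a zero vector, or two equal lines, would
    -- make too many triples concurrent for `hA`.
    have hne : ∀ i, F.ev s i ≠ 0 := by
      intro i hi
      have hc : ∀ j k, Concurrent A i j k := fun j k => by
        rw [← hiff, hi]; simp [vdet]
      obtain ⟨j, hj⟩ := exists_ne i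
      obtain ⟨k, hk⟩ := hA i j hj.symm
      exact hk (hc j k)
    have hrep : Represents (F.ev s) (fun i => Projectivization.mk ℂ (F.ev s i) (hne i)) :=
      fun i => ⟨hne i, rfl⟩
    refine ⟨TotalSpace.ofLines _ (fun i j hij => ?_) (fun i j k => ?_), hrep⟩
    · by_contra hne'
      obtain ⟨k, hk⟩ := hA i j hne'
      exact hk ((hiff i j k).1 ((hrep.concurrent_iff i j k).1 (concurrent_of_eq hij k)))
    · exact (hrep.concurrent_iff i j k).trans (hiff i j k)

/-- If every point of the total space is, up to complex conjugation, equivalent to a member of an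
irreducible family, then the moduli space modulo complex conjugation is irreducible. -/
theorem irreducibleSpace_of_family {n : ℕ} [Nontrivial (Fin n)] {A : Fin n → Line}
    (hA : Spread A) (hinj : Function.Injective A) (F : Family n) {S : Set (ℕ → ℂ)}
    (hS : PolyIrreducible S) (hF : ∀ s ∈ S, ∀ i j k, Concurrent A i j k →
      vdet (F.ev s i) (F.ev s j) (F.ev s k) = 0)
    (h : ∀ P : TotalSpace A, ∃ s ∈ S, ∃ Q : TotalSpace A, Represents (F.ev s) Q.lines ∧
      (Quot.mk _ (ModuliSpace.mk P) : ModuliSpaceConj A) = Quot.mk _ (ModuliSpace.mk Q)) :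
    IrreducibleSpace (ModuliSpaceConj A) := by
  let π : TotalSpace A → ModuliSpaceConj A := fun P => Quot.mk _ (ModuliSpace.mk P)
  have hπ : ∀ y, ∃ P, π P = y := by
    rintro ⟨x⟩
    obtain ⟨P, rfl⟩ := ModuliSpace.mk_surjective x
    exact ⟨P, rfl⟩
  have hcont : ∀ U : Set (ModuliSpaceConj A), IsOpen U →
      ∃ V, IsOpen[zariskiLines n] V ∧ TotalSpace.lines ⁻¹' V = π ⁻¹' U := by
    intro U hU
    exact (@isOpen_induced_iff _ _ (zariskiLines n) _ _).1
      (isOpen_coinduced.1 (isOpen_coinduced.1 hU))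
  obtain ⟨p, hp, hpS⟩ := exists_poly_totalSpace hA F hF
  -- Every nonempty open set contains the classes of a nonempty basic open part of the family. The
  -- factor `p` keeps superfluous triples from being concurrent, and `q'` keeps the point inside
  -- `U`.
  have key : ∀ U : Set (ModuliSpaceConj A), IsOpen U → U.Nonempty →
      ∃ s ∈ S, ∃ f : MvPolynomial ℕ ℂ, MvPolynomial.eval s f ≠ 0 ∧
        ∀ t ∈ S, MvPolynomial.eval t f ≠ 0 → ∃ Q : TotalSpace A, Represents (F.ev t) Q.lines ∧
          π Q ∈ U := by
    rintro U hU ⟨y, hy⟩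
    obtain ⟨P, rfl⟩ := hπ y
    obtain ⟨V, hV, hVU⟩ := hcont U hU
    obtain ⟨s, hs, Q, hQ, hPQ⟩ := h P
    have hQV : Q.lines ∈ V := by
      have : Q ∈ π ⁻¹' U := by
        change π Q ∈ U
        rwa [← show π P = π Q from hPQ]
      rwa [← hVU] at this
    obtain ⟨q, hq, hqV⟩ := exists_poly_of_isOpen_zariskiLines hV hQ hQV
    obtain ⟨q', hq'⟩ := F.exists_eval_eq q
    refine ⟨s, hs, p * q', ?_, fun t ht htf => ?_⟩
    · rw [map_mul, hq']
      exact mul_ne_zero (hp s Q hQ) hq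
    · rw [map_mul, hq'] at htf
      obtain ⟨R, hR⟩ := hpS t ht (left_ne_zero_of_mul htf)
      refine ⟨R, hR, ?_⟩
      have : R ∈ TotalSpace.lines ⁻¹' V := hqV _ _ hR (right_ne_zero_of_mul htf)
      rwa [hVU] at this
  have hne : Nonempty (ModuliSpaceConj A) :=
    ⟨π (TotalSpace.ofLines A hinj fun _ _ _ => Iff.rfl)⟩
  have : PreirreducibleSpace (ModuliSpaceConj A) := by
    refine ⟨fun U V hU hV hU' hV' => ?_⟩
    rw [Set.univ_inter] at hU' hV' ⊢
    obtain ⟨s, hs, f, hf, hfU⟩ := key U hU hU'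
    obtain ⟨t, ht, g, hg, hgV⟩ := key V hV hV'
    -- A common parameter gives points of both open sets with the same coordinates, hence the same
    -- point.
    obtain ⟨u, hu, huf, hug⟩ := hS.exists_ne_zero hs ht hf hg
    obtain ⟨Q, hQ, hQU⟩ := hfU u hu huf
    obtain ⟨R, hR, hRV⟩ := hgV u hu hug
    have : Q = R := TotalSpace.ext (hQ.eq hR)
    exact ⟨π Q, hQU, this ▸ hRV⟩
  exact { toNonempty := hne }

/-! ### Irreducible sets of parameters -/

section
variable {m : ℕ}

/-- The value of the polynomial does not depend on the parameter of index `m`. -/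
def FreeOf (m : ℕ) (f : MvPolynomial ℕ ℂ) : Prop :=
  ∀ s t : ℕ → ℂ, (∀ i, i ≠ m → s i = t i) → MvPolynomial.eval s f = MvPolynomial.eval t f

lemma freeOf_C (c : ℂ) : FreeOf m (.C c) := fun s t _ => by simp
lemma FreeOf.add {f g : MvPolynomial ℕ ℂ} (hf : FreeOf m f) (hg : FreeOf m g) :
    FreeOf m (f + g) := fun s t h => by rw [map_add, map_add, hf s t h, hg s t h]
lemma FreeOf.mul {f g : MvPolynomial ℕ ℂ} (hf : FreeOf m f) (hg : FreeOf m g) :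
    FreeOf m (f * g) := fun s t h => by rw [map_mul, map_mul, hf s t h, hg s t h]
lemma FreeOf.pow {f : MvPolynomial ℕ ℂ} (hf : FreeOf m f) (n : ℕ) :
    FreeOf m (f ^ n) := fun s t h => by rw [map_pow, map_pow, hf s t h]
lemma FreeOf.neg {f : MvPolynomial ℕ ℂ} (hf : FreeOf m f) : FreeOf m (-f) :=
  fun s t h => by rw [map_neg, map_neg, hf s t h]
lemma freeOf_X {i : ℕ} (hi : i ≠ m) : FreeOf m (.X i) := fun s t h => by simp [h i hi]
lemma PolyExpr.freeOf_toMv {a : PolyExpr} (ha : a.noVar m = true) : FreeOf m a.toMv :=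
  fun s t h => by
    rw [eval_toMv, eval_toMv, ev_congr_of_noVar h ha]

lemma eq_zero_of_eval {f : MvPolynomial ℕ ℂ} (h : ∀ s, MvPolynomial.eval s f = 0) : f = 0 :=
  MvPolynomial.funext fun s => by rw [h, map_zero]

lemma polyIrreducible_univ : PolyIrreducible Set.univ := by
  intro f g h
  have : f * g = 0 := eq_zero_of_eval fun s => by rw [map_mul]; exact h s trivial
  rcases mul_eq_zero.1 this with rfl | rfl
  · exact Or.inl fun s _ => map_zero _
  · exact Or.inr fun s _ => map_zero _

/-- The solutions of the quadratic equation `a x² + b x + c = 0`, `a ≠ 0`. -/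
def quadraticSet (m : ℕ) (a b c : MvPolynomial ℕ ℂ) : Set (ℕ → ℂ) :=
  {s | MvPolynomial.eval s a ≠ 0 ∧ MvPolynomial.eval s a * s m ^ 2 + MvPolynomial.eval s b * s m +
    MvPolynomial.eval s c = 0}

/-- The solutions of the linear equation `a x + b = 0`, `a ≠ 0`. -/
def linearSet (m : ℕ) (a b : MvPolynomial ℕ ℂ) : Set (ℕ → ℂ) :=
  {s | MvPolynomial.eval s a ≠ 0 ∧ MvPolynomial.eval s a * s m + MvPolynomial.eval s b = 0}

/-- Pseudo-division: each occurrence of the variable `m` is replaced by `-b` at the cost of one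
factor `a`. -/
lemma exists_freeOf_linear {a b : MvPolynomial ℕ ℂ} (ha : FreeOf m a) (hb : FreeOf m b)
    (f : MvPolynomial ℕ ℂ) : ∃ (N : ℕ) (g : MvPolynomial ℕ ℂ), FreeOf m g ∧
      ∀ s ∈ linearSet m a b, MvPolynomial.eval s a ^ N * MvPolynomial.eval s f =
        MvPolynomial.eval s g := by
  induction f using MvPolynomial.induction_on with
  | C c => exact ⟨0, .C c, freeOf_C c, fun s _ => by simp⟩
  | add p q hp hq =>
    obtain ⟨N, g, hg, h⟩ := hp
    obtain ⟨M, k, hk, h'⟩ := hq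
    refine ⟨N + M, a ^ M * g + a ^ N * k, ((ha.pow M).mul hg).add ((ha.pow N).mul hk),
      fun s hs => ?_⟩
    simp only [map_add, map_mul, map_pow, ← h s hs, ← h' s hs]
    ring
  | mul_X p i hp =>
    obtain ⟨N, g, hg, h⟩ := hp
    rcases eq_or_ne i m with rfl | hi
    · refine ⟨N + 1, g * -b, hg.mul hb.neg, fun s hs => ?_⟩
      simp only [map_mul, map_neg, ← h s hs, MvPolynomial.eval_X]
      linear_combination (MvPolynomial.eval s a ^ N * MvPolynomial.eval s p) * hs.2
    · refine ⟨N, g * .X i, hg.mul (freeOf_X hi), fun s hs => ?_⟩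
      simp only [map_mul, ← h s hs, MvPolynomial.eval_X]
      ring

/-- The set is the graph of `-b / a` over the open set `a ≠ 0` of an affine space. After elimination
of the variable `m`, the product `a f' g'` vanishes at all points, so it is the zero polynomial and
one factor is zero. -/
lemma polyIrreducible_linearSet {a b : MvPolynomial ℕ ℂ} (ha : FreeOf m a) (hb : FreeOf m b) :
    PolyIrreducible (linearSet m a b) := by
  intro f g h
  by_cases ha0 : a = 0
  · exact Or.inl fun s hs => absurd (by rw [ha0, map_zero]) hs.1
  obtain ⟨N, f', hf', hf⟩ := exists_freeOf_linear ha hb f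
  obtain ⟨M, g', hg', hg⟩ := exists_freeOf_linear ha hb g
  have key : a * (f' * g') = 0 := by
    refine eq_zero_of_eval fun s => ?_
    simp only [map_mul]
    by_cases hs : MvPolynomial.eval s a = 0
    · rw [hs, zero_mul]
    · let t := Function.update s m (-MvPolynomial.eval s b / MvPolynomial.eval s a)
      have hst : ∀ i, i ≠ m → s i = t i := fun i hi => by
        simp [t, Function.update_of_ne hi]
      have ht : t ∈ linearSet m a b := by
        refine ⟨by rwa [← ha s t hst], ?_⟩
        rw [← ha s t hst, ← hb s t hst]
        simp only [t, Function.update_self]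
        field_simp
        ring
      rw [hf' s t hst, hg' s t hst, ← hf t ht, ← hg t ht]
      linear_combination (MvPolynomial.eval s a * MvPolynomial.eval t a ^ N *
        MvPolynomial.eval t a ^ M) * h t ht
  rcases mul_eq_zero.1 ((mul_eq_zero.1 key).resolve_left ha0) with rfl | rfl
  · refine Or.inl fun s hs => ?_
    have := hf s hs
    rw [map_zero] at this
    exact (mul_eq_zero.1 this).resolve_left (pow_ne_zero _ hs.1)
  · refine Or.inr fun s hs => ?_
    have := hg s hs
    rw [map_zero] at this
    exact (mul_eq_zero.1 this).resolve_left (pow_ne_zero _ hs.1)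

/-- Pseudo-division by the quadratic, which leaves a remainder of degree at most one in the variable
`m`. -/
lemma exists_freeOf_quadratic {a b c : MvPolynomial ℕ ℂ} (ha : FreeOf m a) (hb : FreeOf m b)
    (hc : FreeOf m c) (f : MvPolynomial ℕ ℂ) :
    ∃ (N : ℕ) (g k : MvPolynomial ℕ ℂ), FreeOf m g ∧ FreeOf m k ∧
      ∀ s ∈ quadraticSet m a b c, MvPolynomial.eval s a ^ N * MvPolynomial.eval s f =
        MvPolynomial.eval s g * s m + MvPolynomial.eval s k := by
  induction f using MvPolynomial.induction_on with
  | C z => exact ⟨0, 0, .C z, fun s t _ => by simp, freeOf_C z, fun s _ => by simp⟩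
  | add p q hp hq =>
    obtain ⟨N, g, k, hg, hk, h⟩ := hp
    obtain ⟨M, g', k', hg', hk', h'⟩ := hq
    refine ⟨N + M, a ^ M * g + a ^ N * g', a ^ M * k + a ^ N * k',
      ((ha.pow M).mul hg).add ((ha.pow N).mul hg'), ((ha.pow M).mul hk).add ((ha.pow N).mul hk'),
      fun s hs => ?_⟩
    simp only [map_add, map_mul, map_pow]
    linear_combination MvPolynomial.eval s a ^ M * h s hs + MvPolynomial.eval s a ^ N * h' s hs
  | mul_X p i hp =>
    obtain ⟨N, g, k, hg, hk, h⟩ := hp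
    rcases eq_or_ne i m with rfl | hi
    · refine ⟨N + 1, a * k + -(b * g), -(c * g), (ha.mul hk).add (hb.mul hg).neg, (hc.mul hg).neg,
        fun s hs => ?_⟩
      simp only [map_add, map_mul, map_neg, MvPolynomial.eval_X]
      linear_combination MvPolynomial.eval s a * s i * h s hs + MvPolynomial.eval s g * hs.2
    · refine ⟨N, g * .X i, k * .X i, hg.mul (freeOf_X hi), hk.mul (freeOf_X hi),
        fun s hs => ?_⟩
      simp only [map_mul, MvPolynomial.eval_X]
      linear_combination s i * h s hs

/-- The norm of the remainder `α x + β` is `a β² - b α β + c α²`, which is `a` times the product of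
its values at the two roots. If `f g` vanishes on the set, the product of the norms of the two
remainders vanishes wherever `a ≠ 0`, so one norm is zero. Completing the square gives `(2 a β - b
α)² = (b² - 4 a c) α²`, and as the discriminant is not a square, that remainder is zero. -/
lemma polyIrreducible_quadraticSet {a b c : MvPolynomial ℕ ℂ} (ha : FreeOf m a) (hb : FreeOf m b)
    (hc : FreeOf m c) (hD : ∀ p q : MvPolynomial ℕ ℂ, p ^ 2 = (b ^ 2 - 4 * a * c) * q ^ 2 → q = 0) :
    PolyIrreducible (quadraticSet m a b c) := by
  intro f g h
  by_cases ha0 : a = 0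
  · exact Or.inl fun s hs => absurd (by rw [ha0, map_zero]) hs.1
  obtain ⟨N, α, β, hα, hβ, hf⟩ := exists_freeOf_quadratic ha hb hc f
  obtain ⟨M, γ, δ, hγ, hδ, hg⟩ := exists_freeOf_quadratic ha hb hc g
  let norm : MvPolynomial ℕ ℂ → MvPolynomial ℕ ℂ → MvPolynomial ℕ ℂ :=
    fun α β => a * β ^ 2 - b * α * β + c * α ^ 2
  have hnorm : ∀ α β, norm α β = 0 → α = 0 ∧ β = 0 := by
    intro α β h
    have hα : α = 0 := hD (2 * a * β - b * α) α (by
      simp only [norm] at h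
      linear_combination 4 * a * h)
    subst hα
    refine ⟨rfl, ?_⟩
    simpa [norm, ha0] using h
  have key : a * (norm α β * norm γ δ) = 0 := by
    refine eq_zero_of_eval fun s => ?_
    by_cases hs : MvPolynomial.eval s a = 0
    · rw [map_mul, hs, zero_mul]
    · obtain ⟨x, hx⟩ : ∃ x : ℂ, MvPolynomial.eval s a * x ^ 2 + MvPolynomial.eval s b * x +
          MvPolynomial.eval s c = 0 := by
        obtain ⟨r, hr⟩ := IsAlgClosed.exists_pow_nat_eq (MvPolynomial.eval s b ^ 2 -
          4 * MvPolynomial.eval s a * MvPolynomial.eval s c) (n := 2) (by norm_num)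
        refine ⟨(r - MvPolynomial.eval s b) / (2 * MvPolynomial.eval s a), ?_⟩
        field_simp
        linear_combination hr
      let t := Function.update s m x
      have hst : ∀ i, i ≠ m → s i = t i := fun i hi => by
        simp [t, Function.update_of_ne hi]
      have htm : t m = x := by simp [t]
      have ht : t ∈ quadraticSet m a b c := by
        refine ⟨by rwa [← ha s t hst], ?_⟩
        rw [← ha s t hst, ← hb s t hst, ← hc s t hst, htm, hx]
      have e1 := hf t ht
      have e2 := hg t ht
      have e3 := h t ht
      simp only [map_mul, map_add, map_sub, map_pow, norm]
      rw [hα s t hst, hβ s t hst, hγ s t hst, hδ s t hst, ha s t hst, hb s t hst, hc s t hst]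
      have h2 := ht.2
      rcases mul_eq_zero.1 e3 with h0 | h0
      · rw [h0, mul_zero] at e1
        have : MvPolynomial.eval t a * MvPolynomial.eval t β ^ 2 -
          MvPolynomial.eval t b * MvPolynomial.eval t α * MvPolynomial.eval t β +
          MvPolynomial.eval t c * MvPolynomial.eval t α ^ 2 = 0 := by
          linear_combination (MvPolynomial.eval t α ^ 2) * h2 - (MvPolynomial.eval t a *
            MvPolynomial.eval t β - MvPolynomial.eval t b * MvPolynomial.eval t α -
            MvPolynomial.eval t a * MvPolynomial.eval t α * t m) * e1
        rw [this]; ring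
      · rw [h0, mul_zero] at e2
        have : MvPolynomial.eval t a * MvPolynomial.eval t δ ^ 2 -
          MvPolynomial.eval t b * MvPolynomial.eval t γ * MvPolynomial.eval t δ +
          MvPolynomial.eval t c * MvPolynomial.eval t γ ^ 2 = 0 := by
          linear_combination (MvPolynomial.eval t γ ^ 2) * h2 - (MvPolynomial.eval t a *
            MvPolynomial.eval t δ - MvPolynomial.eval t b * MvPolynomial.eval t γ -
            MvPolynomial.eval t a * MvPolynomial.eval t γ * t m) * e2
        rw [this]; ring
  rcases mul_eq_zero.1 ((mul_eq_zero.1 key).resolve_left ha0) with h0 | h0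
  · obtain ⟨rfl, rfl⟩ := hnorm _ _ h0
    refine Or.inl fun s hs => ?_
    have := hf s hs
    rw [map_zero, zero_mul, add_zero] at this
    exact (mul_eq_zero.1 this).resolve_left (pow_ne_zero _ hs.1)
  · obtain ⟨rfl, rfl⟩ := hnorm _ _ h0
    refine Or.inr fun s hs => ?_
    have := hg s hs
    rw [map_zero, zero_mul, add_zero] at this
    exact (mul_eq_zero.1 this).resolve_left (pow_ne_zero _ hs.1)

end

/-- A polynomial with a simple zero is not a square, even of a fraction. -/
lemma eq_zero_of_sq_eq_mul_sq {D : MvPolynomial ℕ ℂ} (s : ℕ → DualNumber ℂ)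
    (h0 : (MvPolynomial.aeval s D).fst = 0) (h1 : (MvPolynomial.aeval s D).snd ≠ 0)
    (p q : MvPolynomial ℕ ℂ) (h : p ^ 2 = D * q ^ 2) : q = 0 := by
  by_contra hq
  -- From `q² ∣ p²` follows `q ∣ p` by unique factorization, so `D` itself would be a square.
  have hdvd : q ∣ p := by
    rw [← UniqueFactorizationMonoid.pow_dvd_pow_iff_dvd two_ne_zero, h]
    exact dvd_mul_left _ _
  obtain ⟨e, rfl⟩ := hdvd
  have hD : D = e ^ 2 := by
    have : q ^ 2 * (D - e ^ 2) = 0 := by linear_combination -h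
    have := (mul_eq_zero.1 this).resolve_left (pow_ne_zero _ hq)
    linear_combination this
  -- Where `e²` vanishes, so does `e`, and then the derivative `2 e e'` vanishes as well.
  rw [hD, map_pow, sq] at h0 h1
  simp only [TrivSqZeroExt.fst_mul, mul_self_eq_zero] at h0
  simp [TrivSqZeroExt.snd_mul, h0] at h1

/-! ### Arrangements of ten lines with a given pattern -/

/-- The arrangement consists of distinct lines, and exactly the triples with codes in `B` are
concurrent. -/
def HasPattern (A : Fin 10 → Line) (B : List ℕ) : Prop :=
  Function.Injective A ∧ ∀ a b c : Fin 10, a < b → b < c →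
    (Concurrent A a b c ↔ 100 * a.val + 10 * b.val + c.val ∈ B)

lemma HasPattern.vecPattern {A : Fin 10 → Line} {B : List ℕ} (h : HasPattern A B)
    {v : Fin 10 → Fin 3 → ℂ} (hv : Represents v A) : VecPattern (fun n => v (Fin.ofNat 10 n)) B where
  ne_zero i _ := (hv _).1
  vcross_ne_zero i hi j hj hij := hv.vcross_ne_zero fun h' => hij (by
    have := congrArg Fin.val (h.1 h')
    simpa [Nat.mod_eq_of_lt hi, Nat.mod_eq_of_lt hj] using this)
  vdet_eq_zero_iff a b c hab hbc hc := by
    have ha : a < 10 := by omega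
    have hb : b < 10 := by omega
    rw [← hv.concurrent_iff, h.2]
    · simp [Nat.mod_eq_of_lt ha, Nat.mod_eq_of_lt hb, Nat.mod_eq_of_lt hc]
    · simpa [Fin.lt_def, Nat.mod_eq_of_lt ha, Nat.mod_eq_of_lt hb] using hab
    · simpa [Fin.lt_def, Nat.mod_eq_of_lt hb, Nat.mod_eq_of_lt hc] using hbc

lemma VecPattern.exists_hasPattern {v : ℕ → Fin 3 → ℂ} {B : List ℕ} (h : VecPattern v B) :
    ∃ A : Fin 10 → Line, Represents (fun i : Fin 10 => v i) A ∧ HasPattern A B := by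
  have hrep : Represents (fun i : Fin 10 => v i)
      (fun i : Fin 10 => Projectivization.mk ℂ (v i) (h.ne_zero i i.2)) :=
    fun i => ⟨h.ne_zero i i.2, rfl⟩
  refine ⟨_, hrep, fun i j hij => ?_, fun a b c hab hbc => ?_⟩
  · by_contra hne
    have := h.vcross_ne_zero i i.2 j j.2 (fun h' => hne (Fin.ext h'))
    rw [vcross_eq, ne_eq, ← Projectivization.mk_eq_mk_iff_crossProduct_eq_zero
      (h.ne_zero i i.2) (h.ne_zero j j.2)] at this
    exact this hij
  · rw [hrep.concurrent_iff, h.vdet_eq_zero_iff _ _ _ hab hbc c.2]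

lemma HasPattern.concurrent_iff {A : Fin 10 → Line} {B : List ℕ} (h : HasPattern A B)
    (i j k : Fin 10) :
    Concurrent A i j k ↔ i = j ∨ i = k ∨ j = k ∨ tripleCode i j k ∈ B := by
  have hv := h.vecPattern (represents_rep A)
  have key := hv.vdet_iff i.2 j.2 k.2
  have e : ∀ l : Fin 10, Fin.ofNat 10 l.val = l := fun l => by ext; simp
  simp only [e] at key
  rw [(represents_rep A).concurrent_iff]
  by_cases hij : i = j
  · subst hij; simp [vdet]; ring
  by_cases hik : i = k
  · subst hik; simp [vdet]; ring
  by_cases hjk : j = k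
  · subst hjk; simp [vdet]; ring
  rw [key (by omega) (by omega) (by omega)]
  simp [hij, hik, hjk]

lemma HasPattern.of_concurrent_iff {A A' : Fin 10 → Line} {B : List ℕ} (h : HasPattern A B)
    (hA' : Function.Injective A')
    (h' : ∀ i j k, Concurrent A' i j k ↔ Concurrent A i j k) : HasPattern A' B :=
  ⟨hA', fun a b c hab hbc => by rw [h', h.2 a b c hab hbc]⟩

lemma concurrent_comp {n m : ℕ} (P : Fin n → Line) (f : Fin m → Fin n) (i j k : Fin m) :
    Concurrent (P ∘ f) i j k ↔ Concurrent P (f i) (f j) (f k) := by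
  rw [((represents_rep P).comp f).concurrent_iff, (represents_rep P).concurrent_iff]
  rfl

lemma TotalSpace.hasPattern {A : Fin 10 → Line} (P : TotalSpace A) {σ : Equiv.Perm (Fin 10)}
    {B : List ℕ} (h : HasPattern (A ∘ σ) B) : HasPattern (P.lines ∘ σ) B :=
  h.of_concurrent_iff (P.2.1.comp σ.injective) fun i j k => by
    rw [concurrent_comp, concurrent_comp, P.concurrent_iff]

/-- Only one implication, but for a single triple and without any assumption on the others; thus it
also applies where superfluous triples may be concurrent. -/
lemma vdet_eq_zero_of_tripleCode {R : Type*} [CommRing R] (w : ℕ → Fin 3 → R) {a b c : ℕ}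
    (ha : a < 10) (hb : b < 10) (hc : c < 10) (hab : a ≠ b) (hac : a ≠ c) (hbc : b ≠ c)
    (h : vdet (w (tripleCode a b c / 100)) (w (tripleCode a b c / 10 % 10))
      (w (tripleCode a b c % 10)) = 0) : vdet (w a) (w b) (w c) = 0 := by
  have digits : ∀ x y z : ℕ, x < 10 → y < 10 → z < 10 →
      (100 * x + 10 * y + z) / 100 = x ∧ (100 * x + 10 * y + z) / 10 % 10 = y ∧
        (100 * x + 10 * y + z) % 10 = z := by
    intros; omega
  have key : ∀ x y z : ℕ, x < 10 → y < 10 → z < 10 → tripleCode a b c = 100 * x + 10 * y + z →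
      vdet (w x) (w y) (w z) = 0 := by
    intro x y z hx hy hz e
    obtain ⟨e1, e2, e3⟩ := digits x y z hx hy hz
    rwa [e, e1, e2, e3] at h
  rcases lt_or_gt_of_ne hab with h1 | h1 <;> rcases lt_or_gt_of_ne hac with h2 | h2 <;>
    rcases lt_or_gt_of_ne hbc with h3 | h3
  · exact key a b c ha hb hc (by simp [tripleCode, blt_eq_decide, h1, h3])
  · rw [← neg_eq_zero, ← vdet_swap₂₃]
    exact key a c b ha hc hb (by simp [tripleCode, blt_eq_decide, h1, h2, not_lt.2 h3.le])
  · omega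
  · rw [← vdet_rotate, ← vdet_rotate]
    exact key c a b hc ha hb
      (by simp [tripleCode, blt_eq_decide, h1, not_lt.2 h2.le, not_lt.2 h3.le])
  · rw [← neg_eq_zero, ← vdet_swap₁₂]
    exact key b a c hb ha hc (by simp [tripleCode, blt_eq_decide, not_lt.2 h1.le, h2])
  · omega
  · rw [← vdet_rotate]
    exact key b c a hb hc ha
      (by simp [tripleCode, blt_eq_decide, not_lt.2 h1.le, not_lt.2 h2.le, h3])
  · rw [← neg_eq_zero, ← vdet_swap₁₂, ← vdet_rotate, ← vdet_rotate]
    exact key c b a hc hb ha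
      (by simp [tripleCode, blt_eq_decide, not_lt.2 h1.le, not_lt.2 h2.le, not_lt.2 h3.le])

namespace NormalForm

/-- The family of arrangements in normal form, with the labels permuted. -/
def family (N : NormalForm) (σ : Equiv.Perm (Fin 10)) : Family 10 := fun i => N.vec (σ.symm i)

variable {N : NormalForm} {A : Fin 10 → Line} {σ : Equiv.Perm (Fin 10)}

lemma exists_represents (hN : N.valid = true) (hA : HasPattern (A ∘ σ) N.blocks)
    (P : TotalSpace A) : ∃ s, N.Good s ∧ ∃ Q : TotalSpace A,
      Represents ((N.family σ).ev s) Q.lines ∧ ModuliSpace.mk Q = ModuliSpace.mk P := by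
  have hrep := represents_rep (P.lines ∘ σ)
  obtain ⟨g, s, hs, h⟩ := exists_good_params hN ((P.hasPattern hA).vecPattern hrep)
  refine ⟨s, hs, P.smul (LinearMap.GeneralLinearGroup.ofLinearEquiv g), ?_,
    ModuliSpace.mk_smul _ _⟩
  refine (((represents_rep P.lines).smul g).scale fun i => ?_)
  obtain ⟨μ, hμ, h⟩ := h (σ.symm i) (σ.symm i).2
  refine ⟨μ, hμ, ?_⟩
  have e : Fin.ofNat 10 (σ.symm i).val = σ.symm i := by ext; simp
  simp only [e, Function.comp_apply, Equiv.apply_symm_apply] at h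
  exact h

lemma Good.exists_totalSpace {s : ℕ → ℂ} (hs : N.Good s) (hA : HasPattern (A ∘ σ) N.blocks) :
    ∃ Q : TotalSpace A, Represents ((N.family σ).ev s) Q.lines := by
  obtain ⟨A', hrep, hA'⟩ := VecPattern.exists_hasPattern hs
  refine ⟨TotalSpace.ofLines (A' ∘ σ.symm) (hA'.1.comp σ.symm.injective) fun i j k => ?_, ?_⟩
  · have h1 := hA'.concurrent_iff (σ.symm i) (σ.symm j) (σ.symm k)
    have h2 := hA.concurrent_iff (σ.symm i) (σ.symm j) (σ.symm k)
    rw [concurrent_comp] at h2 ⊢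
    rw [h1, ← h2]
    simp
  · exact hrep.comp σ.symm

/-- Only the equations of the pattern are assumed, not its inequalities: irreducibility is shown for
the full solution set of the equations. -/
lemma vdet_family_eq_zero (hA : HasPattern (A ∘ σ) N.blocks) {s : ℕ → ℂ}
    (hs : ∀ n ∈ N.blocks, (N.det n).ev s = 0) {i j k : Fin 10} (h : Concurrent A i j k) :
    vdet ((N.family σ).ev s i) ((N.family σ).ev s j) ((N.family σ).ev s k) = 0 := by
  have h2 := hA.concurrent_iff (σ.symm i) (σ.symm j) (σ.symm k)
  rw [concurrent_comp] at h2
  simp only [Equiv.apply_symm_apply, EmbeddingLike.apply_eq_iff_eq] at h2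
  rw [h2] at h
  by_cases hij : i = j
  · subst hij; simp [vdet]; ring
  by_cases hik : i = k
  · subst hik; simp [vdet]; ring
  by_cases hjk : j = k
  · subst hjk; simp [vdet]; ring
  simp only [hij, hik, hjk, false_or] at h
  have hne : ∀ {a b : Fin 10}, a ≠ b → (σ.symm a).val ≠ (σ.symm b).val := fun h h' =>
    h (σ.symm.injective (Fin.ext h'))
  refine vdet_eq_zero_of_tripleCode (fun n => (N.vec n).ev s) (σ.symm i).2 (σ.symm j).2
    (σ.symm k).2 (hne hij) (hne hik) (hne hjk) ?_
  have := hs _ h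
  rwa [det, PolyVec.ev_det] at this

end NormalForm

/-! ### Certificates of irreducibility -/

/-- Values and derivatives of expressions along a line in parameter space. -/
def PolyExpr.jet (s : ℕ → ℤ × ℤ) : PolyExpr → ℤ × ℤ
  | var i => s i
  | nat n => (n, 0)
  | add a b => ((a.jet s).1 + (b.jet s).1, (a.jet s).2 + (b.jet s).2)
  | mul a b => ((a.jet s).1 * (b.jet s).1, (a.jet s).1 * (b.jet s).2 + (a.jet s).2 * (b.jet s).1)
  | neg a => (-(a.jet s).1, -(a.jet s).2)

open TrivSqZeroExt in
lemma PolyExpr.ev_jet (s : ℕ → ℤ × ℤ) (a : PolyExpr) :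
    a.ev (fun i => inl ((s i).1 : ℂ) + inr ((s i).2 : ℂ) : ℕ → DualNumber ℂ) =
      inl ((a.jet s).1 : ℂ) + inr ((a.jet s).2 : ℂ) := by
  induction a with
  | var i => rfl
  | nat n => ext <;> simp [jet, ev]
  | add a b ha hb => rw [ev, ha, hb]; ext <;> simp [jet]
  | mul a b ha hb => rw [ev, ha, hb]; ext <;> simp [jet]
  | neg a ha => rw [ev, ha]; ext <;> simp [jet]

/-- How the equations of a normal form define an irreducible set, up to complex conjugation:
there are none, or they have no solution, or there is one, which is linear in the parameter of index
`m` or quadratic with a discriminant that is not a square, or quadratic with constant coefficients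
and complex conjugate solutions. -/
inductive Kind : Type
  | free
  | empty (l : List (ℕ × PolyExpr)) (w : ℕ × PolyExpr × List ℕ)
  | linear (m : ℕ) (a b : PolyExpr) (wa : ℕ × PolyExpr × List ℕ) (n : ℕ) (q : PolyExpr)
      (w : ℕ × PolyExpr × List ℕ)
  | quadratic (m : ℕ) (a b c : PolyExpr) (wa : ℕ × PolyExpr × List ℕ) (n : ℕ) (q : PolyExpr)
      (w : ℕ × PolyExpr × List ℕ) (zero : List (ℤ × ℤ))
  | conic (n : ℕ) (q : PolyExpr) (w : ℕ × PolyExpr × List ℕ)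
  | conj (m a b c : ℕ) (n : ℕ) (q : PolyExpr) (w : ℕ × PolyExpr × List ℕ)

/-- A linear combination of determinants of concurrent triples. -/
def NormalForm.combination (N : NormalForm) : List (ℕ × PolyExpr) → PolyExpr
  | [] => 0
  | (n, p) :: l => p * N.det n + N.combination l

/-- The check of the description of the set of parameters. -/
def Kind.check (N : NormalForm) : Kind → Bool
  -- The number 0 is not the code of a triple, so here all determinants of concurrent triples have
  -- to be identically zero.
  | free => N.blocksVanish 0 0 0
  | empty l w => N.isUnit (N.combination l) w && l.all fun x => isCode x.1 && memCode x.1 N.blocks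
  | linear m a b wa n q w =>
    let r := a * .var m + b
    a.noVar m && (b.noVar m && (N.isUnit a wa && (N.blocksVanish r n q && N.residual r n q w)))
  | quadratic m a b c wa n q w zero =>
    let r := a * (.var m * .var m) + b * .var m + c
    -- The list `zero` describes a point together with a tangent direction. The discriminant
    -- vanishes there and its derivative does not, so it has a simple zero and is not a square.
    let d := (b * b - 4 * a * c).jet fun i => zero.getD i (0, 0)
    a.noVar m && (b.noVar m && (c.noVar m && (decide (d.1 = 0) && (decide (d.2 ≠ 0) &&
      (N.isUnit a wa && (N.blocksVanish r n q && N.residual r n q w))))))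
  | conic n q w =>
    let r := .var 0 * .var 0 + .var 0 * .var 1 + .var 1 * .var 1 - 1
    N.blocksVanish r n q && N.residual r n q w
  | conj m a b c n q w =>
    let r := .nat a * (.var m * .var m) - .nat b * .var m + .nat c
    decide (b * b < 4 * a * c) && (N.blocksVanish r n q && N.residual r n q w)
where
  isCode := NormalForm.isCode

/-! ### From checked certificates to irreducibility of the moduli space modulo conjugation. -/

section
variable {N : NormalForm} {A : Fin 10 → Line} {σ : Equiv.Perm (Fin 10)}

/-- The second alternative serves the patterns whose equation has two complex conjugate solutions:
modulo conjugation it suffices to keep one of them. -/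
lemma irreducibleSpace_of_set (hN : N.valid = true) (hA : HasPattern (A ∘ σ) N.blocks)
    (hspread : Spread A) (hinj : Function.Injective A) {S : Set (ℕ → ℂ)} (hS : PolyIrreducible S)
    (hB : ∀ s ∈ S, ∀ n ∈ N.blocks, (N.det n).ev s = 0)
    (h : ∀ s, N.Good s → s ∈ S ∨ (fun i => conjAut (s i)) ∈ S) :
    IrreducibleSpace (ModuliSpaceConj A) := by
  refine irreducibleSpace_of_family hspread hinj (N.family σ) hS
    (fun s hs i j k hc => N.vdet_family_eq_zero hA (hB s hs) hc) fun P => ?_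
  obtain ⟨s, hs, Q, hQ, hQP⟩ := N.exists_represents hN hA P
  rcases h s hs with h | h
  · exact ⟨s, h, Q, hQ, by rw [hQP]⟩
  · refine ⟨_, h, Q.gal conjAut, ?_, ?_⟩
    · have := hQ.gal conjAut
      have e : (N.family σ).ev (fun i => conjAut (s i)) =
          fun i j => conjAut ((N.family σ).ev s i j) := by
        ext i j
        exact (PolyVec.map_ev s (conjAut : ℂ →+* ℂ) (N.family σ i) j).symm
      rw [e]
      exact this
    · rw [← hQP]
      exact Quot.sound (galConj_mk_gal conjAut Q)

/-- The discriminant is `4 - 3 y²`. Its zeros `±2/√3` are irrational, so the integral tangent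
vectors of the general quadratic certificate do not reach them; the zero `2/√3` is simple. -/
lemma not_isSquare_conic {a b c : MvPolynomial ℕ ℂ} (ha : a = 1) (hb : b = .X 1)
    (hc : c = .X 1 ^ 2 - 1) (p q : MvPolynomial ℕ ℂ) (h : p ^ 2 = (b ^ 2 - 4 * a * c) * q ^ 2) :
    q = 0 := by
  subst ha hb hc
  have hr : ((Real.sqrt 3 : ℝ) : ℂ) ^ 2 = 3 := by
    rw [← Complex.ofReal_pow, Real.sq_sqrt (by norm_num)]; norm_num
  have hr0 : ((Real.sqrt 3 : ℝ) : ℂ) ≠ 0 := fun h0 => by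
    rw [h0] at hr; norm_num at hr
  have h4 : (4 : DualNumber ℂ) = TrivSqZeroExt.inl 4 := rfl
  refine eq_zero_of_sq_eq_mul_sq
    (fun _ => TrivSqZeroExt.inl (2 / ((Real.sqrt 3 : ℝ) : ℂ)) + TrivSqZeroExt.inr 1) ?_ ?_ p q h
  · simp [sq, TrivSqZeroExt.fst_mul, h4]
    field_simp
    rw [hr]; norm_num
  · simp [sq, TrivSqZeroExt.fst_mul, TrivSqZeroExt.snd_mul, h4]
    field_simp
    norm_num

/-- The roots are `(b ± i d) / (2 a)` with a real square root `d` of `4 a c - b²`. -/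
lemma exists_conj_roots {a b c : ℕ} (hD : b * b < 4 * a * c) :
    ∃ ω : ℂ, a * (ω * ω) - b * ω + c = 0 ∧
      ∀ x : ℂ, a * (x * x) - b * x + c = 0 → x = ω ∨ x = conjAut ω := by
  have ha : (a : ℂ) ≠ 0 := by
    rintro h
    rw [Nat.cast_eq_zero] at h
    simp [h] at hD
  obtain ⟨d, hd⟩ : ∃ d : ℝ, d ^ 2 = 4 * a * c - b * b := by
    refine ⟨Real.sqrt (4 * a * c - b * b), Real.sq_sqrt ?_⟩
    rw [sub_nonneg]
    exact_mod_cast hD.le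
  have hd' : (d : ℂ) ^ 2 = 4 * a * c - b * b := by exact_mod_cast congrArg (Complex.ofReal) hd
  obtain ⟨e, he⟩ : ∃ e : ℂ, e = Complex.I * d := ⟨_, rfl⟩
  have he2 : e ^ 2 = -(4 * a * c - b * b) := by rw [he, mul_pow, Complex.I_sq, hd']; ring
  have hconj : conjAut ((b + e) / (2 * a)) = (b - e) / (2 * a) := by
    change (starRingEnd ℂ) _ = _
    simp [he, sub_eq_add_neg, Complex.conj_ofNat]
  refine ⟨(b + e) / (2 * a), ?_, fun x hx => ?_⟩
  · field_simp
    linear_combination he2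
  · rw [hconj]
    have hfac : (2 * a * x - (b + e)) * (2 * a * x - (b - e)) = 0 := by
      linear_combination 4 * (a : ℂ) * hx - he2
    rcases mul_eq_zero.1 hfac with h | h
    · left; field_simp; linear_combination h
    · right; field_simp; linear_combination h

open NormalForm in
/-- The moduli space of an arrangement with a checked pattern is irreducible up to complex
conjugation. -/
theorem irreducibleSpace_of_check {κ : Kind} (hN : N.valid = true) (hκ : κ.check N = true)
    (hA : HasPattern (A ∘ σ) N.blocks) (hspread : Spread A) (hinj : Function.Injective A) :
    IrreducibleSpace (ModuliSpaceConj A) := by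
  cases κ with
  | free =>
    exact irreducibleSpace_of_set hN hA hspread hinj polyIrreducible_univ
      (fun s _ n hn => N.ev_det_eq_zero_of_blocksVanish hκ s (by simp) hn)
      fun s _ => Or.inl trivial
  | empty l w =>
    exfalso
    simp only [Kind.check, Bool.and_eq_true, List.all_eq_true, memCode_eq_true] at hκ
    obtain ⟨s, hs, -⟩ := N.exists_represents hN hA (TotalSpace.ofLines A hinj fun _ _ _ => Iff.rfl)
    -- The combination vanishes at good parameters, yet the certificate shows that it does not. If
    -- the combination is empty, the certificate says that the product of some determinants that
    -- must not vanish is identically zero.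
    apply hs.ev_ne_zero hκ.1
    have hl := hκ.2
    clear hκ
    induction l with
    | nil => simp [combination]
    | cons x l ih =>
      have hx := hl x (by simp)
      rw [combination, PolyExpr.ev_add, PolyExpr.ev_mul, (hs.ev_det_eq_zero_iff hx.1).2 hx.2,
        ih fun y hy => hl y (List.mem_cons_of_mem _ hy)]
      simp
  | linear m a b wa n q w =>
    simp only [Kind.check, Bool.and_eq_true] at hκ
    obtain ⟨ha, hb, hwa, hB, hr⟩ := hκ
    refine irreducibleSpace_of_set hN hA hspread hinj
      (polyIrreducible_linearSet (PolyExpr.freeOf_toMv ha) (PolyExpr.freeOf_toMv hb))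
      (fun s hs n hn => N.ev_det_eq_zero_of_blocksVanish hB s ?_ hn) fun s hs => Or.inl ?_
    · simpa using hs.2
    · have := hs.ev_eq_zero hr
      exact ⟨by simpa using hs.ev_ne_zero hwa, by simpa using this⟩
  | quadratic m a b c wa n q w zero =>
    simp only [Kind.check, Bool.and_eq_true, decide_eq_true_eq] at hκ
    obtain ⟨ha, hb, hc, h0, h1, hwa, hB, hr⟩ := hκ
    have hD : ∀ p q : MvPolynomial ℕ ℂ,
        p ^ 2 = (b.toMv ^ 2 - 4 * a.toMv * c.toMv) * q ^ 2 → q = 0 := by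
      have e : MvPolynomial.aeval (fun i => TrivSqZeroExt.inl (((zero.getD i (0, 0)).1 : ℤ) : ℂ) +
          TrivSqZeroExt.inr (((zero.getD i (0, 0)).2 : ℤ) : ℂ) : ℕ → DualNumber ℂ)
          (b.toMv ^ 2 - 4 * a.toMv * c.toMv) =
          (b * b - 4 * a * c).ev (fun i => TrivSqZeroExt.inl (((zero.getD i (0, 0)).1 : ℤ) : ℂ) +
          TrivSqZeroExt.inr (((zero.getD i (0, 0)).2 : ℤ) : ℂ) : ℕ → DualNumber ℂ) := by
        have : b.toMv ^ 2 - 4 * a.toMv * c.toMv = (b * b - 4 * a * c).toMv := by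
          simp [PolyExpr.toMv, sq]
        rw [this, PolyExpr.toMv, ← RingHom.coe_coe, PolyExpr.map_ev]
        simp
      refine eq_zero_of_sq_eq_mul_sq (fun i => TrivSqZeroExt.inl (((zero.getD i (0, 0)).1 : ℤ) : ℂ) +
          TrivSqZeroExt.inr (((zero.getD i (0, 0)).2 : ℤ) : ℂ) : ℕ → DualNumber ℂ) ?_ ?_
      · rw [e, PolyExpr.ev_jet]
        simpa using h0
      · rw [e, PolyExpr.ev_jet]
        simpa using h1
    refine irreducibleSpace_of_set hN hA hspread hinj
      (polyIrreducible_quadraticSet (PolyExpr.freeOf_toMv ha) (PolyExpr.freeOf_toMv hb)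
        (PolyExpr.freeOf_toMv hc) hD)
      (fun s hs n hn => N.ev_det_eq_zero_of_blocksVanish hB s ?_ hn) fun s hs => Or.inl ?_
    · have := hs.2
      simp only [PolyExpr.eval_toMv] at this
      simpa [sq] using this
    · have := hs.ev_eq_zero hr
      exact ⟨by simpa using hs.ev_ne_zero hwa, by simpa [sq] using this⟩
  | conic n q w =>
    simp only [Kind.check, Bool.and_eq_true] at hκ
    obtain ⟨hB, hr⟩ := hκ
    have h1 : FreeOf 0 (MvPolynomial.X 1) := freeOf_X (by norm_num)
    have h2 : FreeOf 0 (1 : MvPolynomial ℕ ℂ) := freeOf_C 1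
    refine irreducibleSpace_of_set hN hA hspread hinj
      (polyIrreducible_quadraticSet (m := 0) (a := 1) (b := .X 1) (c := .X 1 ^ 2 - 1)
        h2 h1 (by rw [sub_eq_add_neg]; exact (h1.pow 2).add h2.neg)
        (not_isSquare_conic rfl rfl rfl))
      (fun s hs n hn => N.ev_det_eq_zero_of_blocksVanish hB s ?_ hn) fun s hs => Or.inl ?_
    · have := hs.2
      simp only [map_one, map_sub, map_pow, MvPolynomial.eval_X] at this
      simp only [PolyExpr.ev_sub, PolyExpr.ev_add, PolyExpr.ev_mul, PolyExpr.ev_var,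
        PolyExpr.ev_one]
      linear_combination this
    · have := hs.ev_eq_zero hr
      simp only [PolyExpr.ev_sub, PolyExpr.ev_add, PolyExpr.ev_mul, PolyExpr.ev_var,
        PolyExpr.ev_one] at this
      refine ⟨by simp, ?_⟩
      simp only [map_one, map_sub, map_pow, MvPolynomial.eval_X]
      linear_combination this
  | conj m a b c n q w =>
    simp only [Kind.check, Bool.and_eq_true, decide_eq_true_eq] at hκ
    obtain ⟨hD, hB, hr⟩ := hκ
    obtain ⟨ω, hω, hfac⟩ := exists_conj_roots hD
    have hc1 : FreeOf m (1 : MvPolynomial ℕ ℂ) := freeOf_C 1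
    -- Fixing one coordinate to be `ω` is a linear condition, with leading coefficient one.
    have hmem : ∀ s : ℕ → ℂ, s ∈ linearSet m 1 (.C (-ω)) ↔ s m = ω := fun s => by
      simp [linearSet, ← sub_eq_add_neg, sub_eq_zero]
    refine irreducibleSpace_of_set hN hA hspread hinj
      (polyIrreducible_linearSet hc1 (freeOf_C (-ω)))
      (fun s hs n hn => N.ev_det_eq_zero_of_blocksVanish hB s ?_ hn) fun s hs => ?_
    · rw [hmem] at hs
      simpa [hs] using hω
    · have := hs.ev_eq_zero hr
      simp only [PolyExpr.ev_sub, PolyExpr.ev_add, PolyExpr.ev_mul, PolyExpr.ev_var,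
        PolyExpr.ev_nat] at this
      rw [hmem, hmem]
      rcases hfac (s m) this with h | h
      · exact Or.inl h
      · right
        rw [h]
        change (starRingEnd ℂ) ((starRingEnd ℂ) ω) = ω
        exact Complex.conj_conj ω

end

/-! ### The patterns with an irreducible moduli space -/

namespace PolyExpr

/-- The first parameter. -/
abbrev x : PolyExpr := var 0
/-- The second parameter. -/
abbrev y : PolyExpr := var 1
/-- The third parameter. -/
abbrev z : PolyExpr := var 2

end PolyExpr

open PolyExpr in
/-- Normal forms with a description of the set of good parameters. -/
def irreducibleCases₁ : List (NormalForm × Kind) := [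
  ⟨⟨[14, 25, 39, 127, 138, 246, 356, 479, 578, 689],
    [(1, x, 0), (1, 0, y), (-1, -x, x*y - x - y), (0, 1, z), (-z, y - 1, -z), (z - 1, x*z, x*z)],
    [.line 0 1, .line 0 2, .meet 2 4 3 5 (1), .line 1 2, .meet 1 3 5 7 (1), .meet 0 3 4 7 (1)]⟩,
    .quadratic 0 (y*z*z) (y*y*z - y*y - y*z*z - y*z + 2*y + z - 1) (-y*y*z + y*y + y*z - y) (0,
     1, [15, 17, 17]) 689 (-1) (0, -1, []) [(0, 0), (-12, 0), (1, 1)]⟩,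
  ⟨⟨[15, 34, 79, 127, 136, 238, 259, 456, 489, 678],
    [(x + 1, x, x), (1, y, 0), (x, x - y, x), (0, 1, z), (x, x, x + y*z), (-1, -y, -y*z)],
    [.line 0 3, .line 0 1, .meet 1 3 4 5 (1), .line 1 2, .meet 2 3 6 7 (1), .meet 0 7 2 5 (1)]⟩,
    .linear 1 (x*z + z) (-2*x*z + x) (0, 1, [124, 17]) 489 (y) (0, -z, [19])⟩,
  ⟨⟨[15, 24, 38, 136, 178, 239, 257, 456, 489, 679],
    [(1, 0, x), (1, y, 0), (x, x*y - y, x), (z, y*z, 1), (z, 1, 1), (1, 1, -x*z + x + 1)],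
    [.line 0 2, .line 0 1, .meet 1 3 4 5 (1), .line 2 5, .meet 0 3 1 7 (1), .meet 2 3 4 8 (1)]⟩,
    .linear 2 (x*y) (x*y - x - y) (0, -1, [14, 25]) 679 (-z + 1) (0, x, [39])⟩,
  ⟨⟨[16, 34, 79, 128, 135, 237, 269, 456, 489, 578],
    [(x + 1, x, x), (y, y + 1, y), (y, -x, 0), (z, z, z + 1), (0, z, -y), (-y*z, x*z, x*z + x)],
    [.line 0 3, .line 1 3, .meet 0 1 4 5 (1), .line 2 3, .meet 1 2 5 7 (1), .meet 0 7 2 6 (1)]⟩,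
    .linear 0 (y + z + 1) (y*y + y*z + y + z + 1) (0, 1, [57]) 489 (x*z) (0, -1, [14, 27])⟩,
  ⟨⟨[14, 59, 78, 138, 169, 235, 247, 289, 346, 567],
    [(1, x, 0), (y, y, y + 1), (z + 1, x*z + 1, 1), (y*z, x*y*z, -1), (-1, x*y*z, -1), (1,
     -x*y*z, -x*y*z - x*z)],
    [.line 0 1, .line 2 3, .line 3 4, .meet 2 4 5 6 (x - 1), .meet 0 7 1 3 (1), .meet 0 5 2 8
     (y)]⟩,
    .linear 0 (y*z*z + y*z + z*z + z) (1) (0, -x*y, [15, 126, 27]) 169 (1) (0, 1, [])⟩,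
  ⟨⟨[14, 27, 36, 139, 156, 238, 245, 478, 579, 689],
    [(1, x, 0), (y, x*y, 1), (y, 1, 1), (1, 0, z), (-x, -x, -x*z + z), (-y*z + 1, -x*y*z + x*y,
     -y*z + 1)],
    [.line 0 1, .line 2 4, .meet 0 3 1 5 (1), .line 0 2, .meet 2 3 4 7 (1), .meet 1 3 5 7 (1)]⟩,
    .quadratic 2 (x*x*y*y - x*y*y - x*y + y) (-x*x*y*y - x*x*y + 2*x*y + x - 1) (x*x*y + x*y -
     2*x) (0, -x*z, [18, 35, 25]) 689 (-1) (0, -1, []) [(-1, 1), (-1, 0), (0, 0)]⟩,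
  ⟨⟨[14, 25, 78, 127, 159, 236, 348, 379, 456, 689],
    [(1, x, 0), (1, 0, y), (-x, -x, -x*y + y), (0, 1, z), (-x*z + z - 1, -x, -x*z), (-z, -y - z +
     1, -y*z)],
    [.line 0 1, .line 0 2, .meet 2 3 4 5 (1), .line 1 2, .meet 0 7 3 4 (1), .meet 1 5 3 7 (1)]⟩,
    .quadratic 0 (y*y*z - 2*y*z + z) (-2*y*y*z + y*y - y*z*z + 3*y*z - y) (y*y*z - y*y + y*z*z -
     2*y*z + y) (0, 1, [135, 135, 17]) 689 (-1) (0, -1, []) [(0, 0), (0, 1), (-12, 0)]⟩,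
  ⟨⟨[14, 27, 56, 136, 158, 239, 245, 378, 479, 689],
    [(1, x, 0), (y, x*y, 1), (1, x*y, 1), (1, 0, z), (-y*z + y, -y*z + 1, -z + 1), (-x, -x, -x*z
     + z)],
    [.line 0 1, .line 2 4, .meet 0 5 1 3 (1), .line 0 2, .meet 1 5 3 7 (1), .meet 2 3 4 7 (1)]⟩,
    .quadratic 0 (y*y*z*z - y*y*z - y*z + y) (-y*y*z*z + y*y*z - y*z*z + y + 2*z - 2) (y*z*z - z)
     (0, x, [178, 25]) 689 (-1) (0, -1, []) [(0, 0), (-12, 0), (1, 1)]⟩,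
  ⟨⟨[14, 39, 56, 125, 138, 236, 278, 457, 489, 679],
    [(1, x, 0), (0, 1, y), (-1, -1, -y), (1, x + z, y*z), (1, x + z, 1), (-z + 1, x, x)],
    [.line 0 1, .line 1 2, .meet 0 5 2 3 (1), .line 4 5, .meet 1 3 2 7 (1), .meet 0 3 4 8 (1)]⟩,
    -- The determinant that should vanish equals a product of two determinants that must not.
    .empty [(679, 1)] (0, 1, [38, 19])⟩,
  ⟨⟨[17, 28, 39, 125, 134, 236, 456, 479, 578, 689],
    [(x, x + 1, x), (0, 1, y), (x, x, x - y), (1, z, 0), (1, 0, -y*z), (-x*z + 1, -x*z, -x*z)],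
    [.line 1 3, .line 1 2, .meet 2 3 4 5 (1), .line 0 1, .meet 0 2 5 7 (1), .meet 0 3 4 7 (1)]⟩,
    .free⟩,
  ⟨⟨[14, 25, 37, 126, 135, 234, 278, 369, 468, 479, 589],
    [(-1, -1, 0), (1, 0, 1), (0, 1, x), (y + 1, y, y), (-y - 1, -y, x), (-x - y, -x - y + 1, -y)],
    [.meet 0 1 2 3 (1), .meet 0 2 1 3 (1), .line 1 2, .line 0 3, .meet 2 7 4 6 (1), .meet 3 6 4 7
     (1)]⟩,
    .conic 589 (1) (0, 1, [])⟩,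
  ⟨⟨[15, 34, 78, 124, 138, 167, 237, 256, 289, 369, 459],
    [(0, 1, 1), (1, x, 0), (y, x*y, 1), (y, y, 1), (1, y, 1), (-1, -y, x - y)],
    [.meet 0 3 1 2 (1), .line 0 1, .line 2 5, .meet 1 6 2 3 (1), .meet 0 7 1 3 (1), .meet 2 8 4 5
     (1)]⟩,
    .quadratic 1 (-x) (x*x + 1) (-1) (0, 1, [25]) 369 (1) (0, 1, []) [(1, 1), (0, 0), (-12, 0)]⟩,
  ⟨⟨[14, 39, 78, 125, 138, 236, 247, 289, 345, 469, 567],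
    [(1, x, 0), (0, -x + 1, 1), (y, y, y + 1), (y, x*y, 1), (1, x*y, 1), (-1, -x*y, -x*y)],
    [.line 0 1, .meet 1 2 3 4 (1), .line 2 3, .meet 2 4 5 6 (x - 1), .meet 0 7 1 3 (1), .meet 0 3
     2 8 (1)]⟩,
    .empty [(469, 1)] (0, -y, [179, 19])⟩,
  ⟨⟨[25, 34, 89, 124, 136, 158, 239, 357, 456, 479, 678],
    [(0, 1, 1), (1, 0, x), (1, -x + 1, 1), (y + 1, 1, x*y + 1), (-y, -x, -x*y), (1, 1, y)],
    [.meet 0 3 1 2 (1), .line 0 2, .meet 1 3 4 5 (1), .line 3 5, .meet 1 5 6 7 (x - 1), .meet 0 8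
     2 3 (x)]⟩,
    .linear 0 (y) (-y*y + 1) (0, -x, [18]) 479 (1) (0, 1, [])⟩]

open PolyExpr in
/-- Normal forms with a description of the set of good parameters. -/
def irreducibleCases₂ : List (NormalForm × Kind) := [
  ⟨⟨[17, 25, 34, 124, 156, 268, 358, 369, 467, 489, 579],
    [(0, 1, 1), (1, 0, x), (y, 1, x*y), (-y, x*y - 1, 0), (-y, -1, -x*y + x - 1), (y, -x*x*y + x,
     -x*x*y + x*y)],
    [.meet 0 3 1 2 (1), .line 0 2, .line 1 5, .meet 0 1 4 6 (1), .meet 2 6 3 5 (1), .meet 4 8 5 7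
     (1)]⟩,
    .linear 1 (x*x*x) (-2*x*x + 2*x - 1) (0, 1, [15, 15, 15]) 369 (y) (0, x, [16])⟩,
  ⟨⟨[15, 24, 37, 126, 134, 239, 368, 458, 467, 569, 789],
    [(1, 0, 1), (1, x, 0), (0, 1, y), (y - 1, -1, -1), (-x*y - 1, -x*y, -x*y + y - 1), (1, 1,
     -x*y + y)],
    [.meet 0 2 1 3 (1), .line 0 1, .line 1 2, .meet 0 3 4 6 (1), .meet 3 6 4 5 (1), .meet 2 3 5 6
     (1)]⟩,
    .linear 0 (y*y) (-y*y + 1) (0, 1, [16, 16]) 789 (x*y + 1) (0, -1, [128])⟩,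
  ⟨⟨[26, 45, 79, 124, 138, 157, 237, 289, 349, 356, 678],
    [(0, 1, x), (1, y, x*y), (-y + 1, 0, x*y - y), (1, 1, x*y), (y, 1, y), (-y, -1, -x*y)],
    [.line 1 2, .line 0 4, .meet 0 2 3 5 (1), .meet 1 5 2 3 (1), .meet 1 3 6 7 (x*y - 1), .meet 0
     7 2 8 (1)]⟩,
    .empty [(349, 1)] (0, y, [169])⟩,
  ⟨⟨[24, 37, 68, 126, 139, 145, 235, 289, 346, 478, 579],
    [(1, 0, x), (1, 1, x), (0, 1, -x + 1), (y + 1, y, y), (-1, -y, x*y - y), (-1, -y, -1)],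
    [.line 0 2, .meet 1 4 2 3 (1), .meet 1 2 3 4 (1), .line 0 3, .meet 0 6 4 7 (x), .meet 1 3 2 8
     (1)]⟩,
    .linear 0 (y*y) (-y*y + y - 1) (0, 1, [17, 17]) 579 (-1) (0, -1, [])⟩,
  ⟨⟨[14, 25, 67, 126, 135, 234, 289, 368, 379, 478, 569],
    [(-1, -1, 0), (1, 0, 1), (0, 1, x), (1, y, x*y), (-x, -x - y + 1, -x*y), (-x, -x - y + 1,
     -x*x - x*y)],
    [.meet 0 1 2 3 (1), .meet 0 2 1 3 (1), .line 1 2, .line 0 6, .meet 3 6 4 7 (1), .meet 2 8 5 6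
     (1)]⟩,
    .conj 0 1 1 1 379 (-y + 1) (0, -x, [138])⟩,
  ⟨⟨[14, 25, 89, 129, 136, 234, 267, 358, 379, 456, 478],
    [(-1, -1, 0), (1, 0, x), (x, x - 1, x), (x*y, x*y - y, x*y + 1), (y + 1, 1, x*y + 1), (0, y,
     -1)],
    [.meet 0 1 2 3 (1), .line 0 2, .meet 1 3 4 5 (1), .line 2 6, .meet 3 5 4 7 (1), .meet 1 2 3 7
     (1)]⟩,
    .linear 0 (y*y) (y + 1) (0, 1, [29, 29]) 89 (-1) (0, -1, [])⟩,
  ⟨⟨[15, 34, 78, 124, 138, 169, 236, 257, 289, 379, 456],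
    [(0, 1, 1), (1, x, 0), (-1, -1, x - 1), (y, x*y, 1), (1, x*y, 1), (-1, -x*y, x - 1)],
    [.meet 0 3 1 2 (1), .line 0 1, .meet 2 3 4 5 (1), .line 2 5, .meet 0 7 1 3 (1), .meet 1 6 2 8
     (1)]⟩,
    .quadratic 1 (-x) (x*x + 1) (-1) (0, 1, [25]) 379 (1) (0, 1, []) [(1, 1), (0, 0), (-12, 0)]⟩,
  ⟨⟨[15, 26, 34, 124, 138, 235, 278, 379, 459, 467, 689],
    [(0, 1, 1), (-1, -1, 0), (1, 0, x), (y, 1, x*y + 1), (y, 1, y), (-x*y, -x*y - y + 1, -y + 1)],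
    [.meet 0 3 1 2 (1), .meet 0 1 2 3 (1), .line 0 2, .line 4 6, .meet 1 3 2 7 (1), .meet 3 7 4 5
     (1)]⟩,
    .quadratic 0 (y*y - y) (-y) (-y*y + 2*y - 1) (0, -1, [19, 18]) 689 (-1) (0, -1, []) [(0, 0),
     (0, 1), (-12, 0)]⟩,
  ⟨⟨[24, 36, 57, 125, 138, 146, 269, 278, 345, 379, 489],
    [(1, 0, x), (0, 1, -x + 1), (1, x, x), (1, y, -x*y + y), (1, y, 1), (y, x*y, -x*x + x*y + x)],
    [.line 0 2, .meet 1 2 3 4 (1), .meet 0 3 1 4 (1), .line 0 5, .meet 1 3 2 7 (1), .meet 2 6 4 8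
     (1)]⟩,
    .conj 1 1 1 1 379 (x*x - x) (0, -1, [15, 14])⟩,
  ⟨⟨[19, 24, 37, 125, 134, 178, 238, 267, 369, 456, 589],
    [(1, 0, 1), (0, 1, x), (1, y, x*y + 1), (-1, -y, -y), (-1, -1, -y), (x, x - y, 0)],
    [.meet 0 2 1 3 (1), .line 1 2, .line 4 5, .meet 0 3 2 6 (1), .meet 1 7 2 3 (1), .meet 0 1 5 8
     (1)]⟩,
    .conj 1 1 1 1 369 (x) (0, 1, [15])⟩,
  ⟨⟨[14, 26, 79, 138, 157, 237, 245, 289, 349, 356, 678],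
    [(1, x, 0), (y, x*y, 1), (-x*y + y, 0, -x*y + 1), (y, y, 1), (-x, -1, -x), (x*y, y, 1)],
    [.line 0 1, .line 2 4, .meet 0 2 3 5 (1), .meet 1 5 2 3 (1), .meet 1 3 6 7 (y*y - y), .meet 0
     7 2 8 (1)]⟩,
    .linear 0 (y) (y - 1) (0, -x, [25]) 349 (-x + 1) (0, 1, [38])⟩,
  ⟨⟨[14, 25, 78, 156, 189, 234, 268, 357, 369, 459, 467],
    [(-1, -1, 0), (1, 0, x), (y, 1, x*y), (x + y - 1, x, x*y), (-y, -1, -y), (1, 1, 1)],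
    [.meet 0 1 2 3 (1), .line 0 2, .line 1 5, .meet 3 5 4 6 (1), .meet 0 7 2 6 (x), .meet 1 8 3 6
     (x*y*y - y*y)]⟩,
    .empty [] (0, 0, [39])⟩,
  ⟨⟨[14, 39, 56, 125, 138, 234, 268, 279, 367, 457, 489],
    [(-1, -1, 0), (0, 1, x), (1, y, x*y), (x - 1, x - y, -x*y + x), (1, y, 1), (y - 2, -1, -1)],
    [.meet 0 1 2 3 (1), .line 1 2, .line 0 5, .meet 3 6 4 5 (1), .meet 1 3 2 6 (1), .meet 0 3 4 8
     (1)]⟩,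
    .linear 0 (1) (-y + 1) (0, 1, []) 279 (-y + 1) (0, x, [17])⟩,
  ⟨⟨[24, 39, 68, 125, 137, 146, 189, 238, 279, 345, 567],
    [(1, 0, x), (0, 1, -x + 1), (y, 1, x*y), (-y, -y - 1, -y), (-1, -1, -x*y), (-1, -x*y, -x*y)],
    [.line 0 2, .meet 1 2 3 4 (1), .line 1 4, .meet 1 3 5 6 (x - 1), .meet 0 6 2 3 (1), .meet 0 3
     1 8 (1)]⟩,
    .linear 0 (y*y) (-y - 1) (0, x*x, [16, 16]) 279 (1) (0, 1, [])⟩]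

open PolyExpr in
/-- Normal forms with a description of the set of good parameters. -/
def irreducibleCases₃ : List (NormalForm × Kind) := [
  ⟨⟨[19, 27, 34, 124, 136, 235, 268, 378, 456, 489, 579],
    [(0, 1, 1), (x, x, x + 1), (x, x - 1, x), (1, 0, y), (-x, -x + 1, -x - y + 1), (x, -y, 0)],
    [.meet 0 3 1 2 (1), .line 2 3, .meet 1 3 4 5 (1), .line 0 2, .meet 2 6 3 7 (1), .meet 0 1 4 8
     (1)]⟩,
    .linear 1 (x) (x*x - x - 1) (0, 1, [16]) 579 (y) (0, 1, [17])⟩,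
  ⟨⟨[24, 35, 78, 125, 137, 146, 189, 238, 267, 349, 569],
    [(1, 0, x), (0, 1, 1), (y, 1, x*y), (y, 1, y), (-1, -1, -y), (-y, x*y - y*y - 1, -y*y)],
    [.line 0 2, .meet 0 3 1 2 (1), .line 1 4, .meet 1 3 2 6 (1), .meet 0 7 2 3 (1), .meet 1 8 5 6
     (1)]⟩,
    .quadratic 0 (y) (-y*y - 1) (1) (0, x, [16]) 349 (-1) (0, -1, []) [(0, 0), (1, 1), (-12, 0)]⟩,
  ⟨⟨[19, 24, 67, 126, 134, 235, 368, 379, 456, 478, 589],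
    [(1, 0, 1), (x, x, x + 1), (0, -x, -1), (1, -x*y, -y), (x, -x*y, x - y - 1), (-y - 1, x*y -
     y, 0)],
    [.meet 0 2 1 3 (1), .line 2 3, .meet 1 2 4 5 (1), .line 0 6, .meet 3 6 4 7 (1), .meet 0 1 3 7
     (1)]⟩,
    .linear 0 (1) (y*y + y - 1) (0, 1, []) 589 (-x) (0, 1, [25])⟩,
  ⟨⟨[24, 56, 79, 125, 134, 167, 237, 289, 358, 369, 468],
    [(1, 0, 1), (0, 1, x), (1, y, x*y), (1, 1, x*y), (-1, -x*y, -x*x*y + x - 1), (1, x*y,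
     x*x*y*y)],
    [.meet 0 2 1 3 (1), .line 1 2, .line 0 5, .meet 1 6 2 3 (1), .meet 3 5 4 6 (1), .meet 0 7 2 8
     (1)]⟩,
    .linear 1 (x) (-2*x + 1) (0, 1, [15]) 369 (x*y*y - y) (0, x, [37, 16])⟩,
  ⟨⟨[15, 26, 34, 124, 138, 169, 239, 278, 367, 457, 589],
    [(0, 1, 1), (1, x, 0), (1, 0, y), (y, x + y, -x*y + x + y), (y, x + y, y), (1, 1, y)],
    [.meet 0 3 1 2 (1), .line 0 1, .line 0 2, .meet 3 6 4 5 (1), .meet 1 3 2 7 (1), .meet 1 6 2 3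
     (1)]⟩,
    .linear 1 (x - 1) (-2*x + 1) (0, 1, [235]) 589 (-y) (0, -1, [16])⟩,
  ⟨⟨[14, 37, 56, 125, 136, 234, 268, 279, 389, 459, 478],
    [(-1, -1, 0), (0, 1, x), (x, 1, x), (y + 1, y, y), (x, 1, x*y - y), (-y - 1, -y, x)],
    [.meet 0 1 2 3 (1), .line 1 2, .meet 0 5 1 3 (1), .line 0 3, .meet 2 6 4 7 (1), .meet 2 7 4 5
     (1)]⟩,
    .linear 1 (2*x - 2) (x*x - x - 1) (1, y, [18]) 389 (-1) (0, -1, [])⟩,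
  ⟨⟨[25, 36, 47, 124, 138, 156, 179, 237, 268, 359, 489],
    [(0, 1, x), (1, 0, y), (1, y, y), (-1, -1, -x), (1, y, 1), (-x, -x*y - x + 1, -x*x)],
    [.line 1 2, .line 0 2, .meet 0 3 1 5 (1), .meet 0 4 2 3 (1), .meet 1 3 2 6 (1), .meet 1 7 4 8
     (1)]⟩,
    .quadratic 1 (x) (-x - 1) (x*x - x + 1) (0, 1, [14]) 359 (1) (0, 1, []) [(1, 1), (0, 0),
     (-12, 0)]⟩,
  ⟨⟨[15, 26, 37, 124, 169, 279, 345, 368, 467, 489, 578],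
    [(0, 1, x), (x, x - 1, 0), (1, 0, y), (-x + 1, y, y), (-x*y + x - 1, -x*y, -y), (-x + 1, y,
     -x*y + y)],
    [.line 1 2, .meet 0 1 3 4 (1), .line 0 2, .meet 0 3 4 6 (1), .meet 3 6 5 7 (x + y - 1), .meet
     1 6 2 7 (1)]⟩,
    .linear 1 (2*x - 1) (x*x - 3*x + 2) (0, -y, [49]) 489 (-x*y) (0, -1, [14, 16])⟩,
  ⟨⟨[15, 24, 37, 126, 134, 178, 235, 279, 389, 468, 569],
    [(1, 0, 1), (-1, -1, 0), (0, 1, x), (y + 1, y, y), (-x*y - x, 1, -x*y), (-y - 1, -y, x)],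
    [.meet 0 2 1 3 (1), .meet 0 1 2 3 (1), .line 1 2, .line 0 3, .meet 1 7 4 6 (1), .meet 2 7 5 6
     (1)]⟩,
    .linear 1 (x) (x*x + x + 1) (0, 1, [16]) 389 (y + 1) (0, -x, [68])⟩,
  ⟨⟨[17, 38, 45, 124, 135, 189, 239, 256, 278, 346, 679],
    [(0, 1, x), (x, 1, x), (x, 1, -x*x + 2*x), (1, y, 0), (-1, -y, -y), (-1, -1, -y)],
    [.line 1 2, .meet 0 4 1 3 (1), .meet 2 5 3 4 (1), .line 0 1, .meet 0 3 2 7 (1), .meet 1 8 2 3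
     (1)]⟩,
    .quadratic 1 (x) (x*x - 2*x - 1) (-x*x + 2*x) (0, 1, [14]) 679 (-1) (0, -1, []) [(1, 1), (0,
     0), (-12, 0)]⟩,
  ⟨⟨[24, 37, 89, 126, 134, 158, 235, 279, 369, 456, 478],
    [(1, 0, 1), (x, x, x + 1), (0, -x, -1), (y + 1, y, y), (x, -y, x + 1), (y + 1, y, -x - 1)],
    [.meet 0 2 1 3 (1), .line 2 3, .meet 1 2 4 5 (1), .line 0 3, .meet 1 5 4 7 (1), .meet 0 8 2 7
     (y)]⟩,
    .linear 1 (x) (x*x + 2*x - 1) (0, -1, [25]) 369 (1) (0, 1, [])⟩,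
  ⟨⟨[15, 26, 37, 124, 168, 238, 345, 369, 467, 489, 579],
    [(0, 1, x), (x, x - 1, 0), (1, 0, y), (-x + 1, y, y), (1, 1, y), (-x*y + x - 1, -x*y, -y)],
    [.line 1 2, .meet 0 1 3 4 (1), .line 0 2, .meet 0 3 4 6 (1), .meet 1 6 2 3 (1), .meet 3 6 5 7
     (x + y - 1)]⟩,
    .linear 0 (1) (y*y - y - 1) (0, 1, []) 489 (-x) (0, -1, [14])⟩,
  ⟨⟨[15, 24, 38, 126, 134, 178, 235, 289, 379, 469, 567],
    [(1, 0, 1), (-1, -1, 0), (0, 1, x), (-1, y - 1, x*y), (-1, x*y, x*y), (-1, x*y, x*x*y - 1)],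
    [.meet 0 2 1 3 (1), .meet 0 1 2 3 (1), .line 1 2, .line 5 6, .meet 0 3 1 7 (1), .meet 2 8 4 6
     (1)]⟩,
    .empty [(379, 1)] (0, 1, [458])⟩,
  ⟨⟨[24, 38, 67, 126, 137, 145, 189, 235, 278, 349, 569],
    [(1, 0, x), (1, 1, x), (0, 1, y), (y, 1, y), (-y, -1, -1), (y*y, -x*y + y*y + 1, y)],
    [.line 0 2, .meet 1 4 2 3 (1), .line 1 2, .meet 0 6 1 3 (1), .meet 0 3 2 7 (1), .meet 1 8 5 6
     (1)]⟩,
    .quadratic 0 (y) (-y - 1) (y*y - y + 1) (0, 1, [16]) 349 (1) (0, 1, []) [(0, 0), (1, 1),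
     (-12, 0)]⟩]

open PolyExpr in
/-- Normal forms with a description of the set of good parameters. -/
def irreducibleCases₄ : List (NormalForm × Kind) := [
  ⟨⟨[18, 27, 45, 134, 179, 235, 246, 369, 378, 489, 567],
    [(x, x + 1, x), (-x - 1, -x - 1, -x), (x*y, x*y + y, x*y + 1), (y, 0, -1), (-y - 1, -1, 0),
     (-y, y*y, 1)],
    [.line 1 3, .meet 0 4 2 3 (1), .line 2 4, .meet 0 2 5 6 (x + 1), .meet 0 1 3 7 (1), .meet 1 7
     3 6 (1)]⟩,
    .linear 0 (y*y) (-1) (0, -1, [29]) 489 (-y - 1) (0, 1, [128])⟩,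
  ⟨⟨[14, 26, 57, 125, 138, 179, 234, 278, 359, 367, 456, 689],
    [(-1, -1, 0), (0, 1, x), (1, 0, -x), (-1, -x, -x*x), (-1, -x, -1), (-1, -x*x, -x*x)],
    [.meet 0 1 2 3 (1), .line 1 2, .meet 0 2 4 5 (1), .meet 0 5 3 6 (1), .meet 1 3 2 7 (1), .meet
     1 7 6 8 (x + 1)]⟩,
    .empty [] (0, 0, [39])⟩,
  ⟨⟨[26, 34, 79, 124, 135, 167, 189, 237, 258, 369, 456, 478],
    [(0, 1, 1), (x, x + 1, x), (x, 0, -1), (x, x, -1), (-x, -x - 1, 0), (1, 0, 0)],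
    [.meet 0 3 1 2 (1), .line 1 3, .meet 0 2 4 5 (1), .meet 1 6 2 3 (1), .meet 2 5 4 7 (x), .meet
     0 7 1 8 (x)]⟩,
    .empty [] (0, 0, [18])⟩,
  ⟨⟨[15, 24, 38, 79, 126, 134, 178, 239, 257, 367, 456, 689],
    [(1, 0, 1), (1, x, 0), (0, -x, 1), (-x, -x*x, -1), (-x, -1, -1), (x*x, x*x, 1)],
    [.meet 0 2 1 3 (1), .line 0 1, .meet 1 2 4 5 (1), .meet 2 5 3 6 (1), .meet 0 3 1 7 (1), .meet
     0 7 2 3 (1)]⟩,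
    .free⟩,
  ⟨⟨[14, 26, 89, 125, 139, 167, 234, 279, 357, 368, 456, 478],
    [(-1, -1, 0), (0, 1, x), (1, 0, -x), (-x, 1, x*x), (-2*x - 1, -x, x*x), (x, -1, x)],
    [.meet 0 1 2 3 (1), .line 1 2, .meet 0 2 4 5 (1), .meet 1 6 3 5 (1), .meet 3 6 4 7 (1), .meet
     0 8 1 3 (x)]⟩,
    .free⟩,
  ⟨⟨[24, 56, 89, 127, 136, 145, 235, 269, 348, 379, 467, 578],
    [(1, 0, x), (1, 1, x), (x, 1, x), (0, -1, x*x - x), (-x + 1, -x, 0), (x, 1, 0)],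
    [.line 0 2, .meet 1 4 2 3 (1), .meet 0 5 1 3 (1), .meet 1 2 4 6 (1), .meet 3 4 5 7 (x - 1),
     .meet 0 8 2 6 (x)]⟩,
    .empty [] (0, 0, [18])⟩,
  ⟨⟨[15, 27, 36, 126, 134, 189, 235, 248, 379, 467, 569, 578],
    [(x, x + 1, x), (-1, -1, 0), (0, 1, 1), (-x, 0, 1), (-x*x, -x*x - x, -1), (x*x, x, 1)],
    [.line 1 3, .meet 0 1 2 3 (1), .meet 0 3 1 2 (1), .meet 0 2 4 6 (1), .meet 2 4 5 7 (1), .meet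
     1 8 3 7 (x + 1)]⟩,
    -- The equation is `x² - x + 1 = 0`, with two complex conjugate solutions.
    .conj 0 1 1 1 569 (-1) (0, -1, [])⟩,
  ⟨⟨[16, 25, 34, 78, 124, 135, 179, 238, 267, 369, 456, 489],
    [(0, 1, 1), (1, 0, 1), (-1, 1, 0), (-x, x, 1), (-x, -x, -1), (x, -x - 2, -1)],
    [.meet 0 3 1 2 (1), .meet 0 2 1 3 (1), .meet 0 1 4 5 (1), .line 2 6, .meet 0 7 2 3 (1), .meet
     1 7 3 6 (1)]⟩,
    -- The determinant of 489 is twice the square of the determinant of 0, 2, 7, so it cannot vanish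
    -- in characteristic zero.
    .empty [(489, 1)] (1, 1, [27, 27])⟩,
  ⟨⟨[24, 37, 56, 128, 136, 145, 179, 235, 267, 349, 478, 689],
    [(1, 0, x), (1, 1, x), (x, 1, x), (-x, -1, -1), (0, 1, -x*x + 1), (x, x + 1, 1)],
    [.line 0 2, .meet 1 4 2 3 (1), .meet 0 5 1 3 (1), .meet 0 3 2 6 (1), .meet 1 2 4 7 (1), .meet
     1 7 3 4 (x - 1)]⟩,
    .empty [] (0, 0, [589])⟩,
  ⟨⟨[17, 24, 35, 125, 134, 189, 236, 279, 378, 458, 467, 569],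
    [(1, 0, 1), (0, 1, 1), (x, x, x + 1), (1, -x, 0), (-x, 1, -x + 1), (-x, x*x, -x + 1)],
    [.meet 0 2 1 3 (1), .meet 0 3 1 2 (1), .line 2 3, .meet 0 1 4 6 (1), .meet 3 7 4 5 (1), .meet
     1 8 2 7 (1)]⟩,
    .linear 0 (1) (2) (0, 1, []) 569 (x*x - x) (0, 1, [18, 26])⟩,
  ⟨⟨[18, 25, 34, 79, 124, 139, 156, 236, 278, 357, 467, 689],
    [(0, 1, 1), (1, 0, x), (1, 1, x), (x, 1, x*x - x + 1), (-x, -1, 0), (-x*x, -2*x + 1, -x*x)],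
    [.meet 0 3 1 2 (1), .line 0 2, .meet 1 5 2 3 (1), .meet 3 5 4 6 (1), .meet 0 1 2 7 (1), .meet
     1 3 6 8 (1)]⟩,
    .conj 0 2 2 1 79 (x - 1) (0, 1, [36])⟩,
  ⟨⟨[16, 25, 34, 78, 124, 135, 189, 238, 267, 369, 456, 479],
    [(0, 1, 1), (1, 0, 1), (-1, 1, 0), (-x, x, 1), (-x, -x, -1), (x, -x + 2, 1)],
    [.meet 0 3 1 2 (1), .meet 0 2 1 3 (1), .meet 0 1 4 5 (1), .line 2 6, .meet 0 7 2 3 (1), .meet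
     1 8 3 6 (1)]⟩,
    .free⟩,
  ⟨⟨[15, 24, 68, 79, 126, 134, 189, 239, 257, 358, 367, 456, 478],
    [(1, 0, 1), (1, x, 0), (0, -x, 1), (-x, -x*x, -1), (1, x*x, -x), (-1, x*x*x, x)],
    [.meet 0 2 1 3 (1), .line 0 1, .meet 1 2 4 5 (1), .meet 2 5 3 6 (1), .meet 0 6 3 5 (1), .meet
     0 7 1 8 (1)]⟩,
    .empty [(478, 1)] (1, 1, [18, 18])⟩,
  ⟨⟨[15, 26, 34, 79, 124, 138, 169, 235, 278, 367, 457, 468, 589],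
    [(0, 1, 1), (-1, -1, 0), (1, 0, x), (-x, -x - 1, -1), (-x, -x - 1, -x), (-1, -2, -x)],
    [.meet 0 3 1 2 (1), .meet 0 1 2 3 (1), .line 0 2, .meet 3 6 4 5 (1), .meet 1 3 2 7 (1), .meet
     1 6 5 8 (x)]⟩,
    -- The two equations in the one parameter generate the constant 10, so they have no common
    -- solution in characteristic zero.
    .empty [(79, -x - 3), (468, -x - 4)] (9, 1, [])⟩]

/-- Normal forms of all patterns of arrangements whose moduli space is irreducible up to complex
conjugation. -/
def irreducibleCases : List (NormalForm × Kind) :=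
  irreducibleCases₁ ++ (irreducibleCases₂ ++ (irreducibleCases₃ ++ irreducibleCases₄))

lemma check_irreducibleCases₁ :
    (irreducibleCases₁.all fun c => c.1.valid && c.2.check c.1) = true := by decide +kernel

lemma check_irreducibleCases₂ :
    (irreducibleCases₂.all fun c => c.1.valid && c.2.check c.1) = true := by decide +kernel

lemma check_irreducibleCases₃ :
    (irreducibleCases₃.all fun c => c.1.valid && c.2.check c.1) = true := by decide +kernel

lemma check_irreducibleCases₄ :
    (irreducibleCases₄.all fun c => c.1.valid && c.2.check c.1) = true := by decide +kernel

lemma irreducibleSpace_of_mem_irreducibleCases {c : NormalForm × Kind} (hc : c ∈ irreducibleCases)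
    {A : Fin 10 → Line} {σ : Equiv.Perm (Fin 10)} (hA : HasPattern (A ∘ σ) c.1.blocks)
    (hspread : Spread A) (hinj : Function.Injective A) : IrreducibleSpace (ModuliSpaceConj A) := by
  have key : c.1.valid = true ∧ c.2.check c.1 = true := by
    rw [← Bool.and_eq_true]
    simp only [irreducibleCases, List.mem_append] at hc
    rcases hc with hc | hc | hc | hc
    · exact List.all_eq_true.1 check_irreducibleCases₁ c hc
    · exact List.all_eq_true.1 check_irreducibleCases₂ c hc
    · exact List.all_eq_true.1 check_irreducibleCases₃ c hc
    · exact List.all_eq_true.1 check_irreducibleCases₄ c hc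
  exact irreducibleSpace_of_check key.1 key.2 hA hspread hinj

/-! ### Systems of triples on ten points -/

/-- A system of triples of ten points, such that two points are in at most one triple and each point
is joined by triples to all but at most three of the other points. -/
structure TripleSystem (C : Fin 10 → Fin 10 → Fin 10 → Prop) : Prop where
  swap : ∀ {i j k}, C i j k → C j i k
  rotate : ∀ {i j k}, C i j k → C j k i
  ne : ∀ {i j k}, C i j k → i ≠ j
  unique : ∀ {i j k l}, C i j k → C i j l → k = l
  degree : ∀ (i : Fin 10) (s : Finset (Fin 10)), (∀ j ∈ s, j ≠ i ∧ ∀ k, ¬ C i j k) → s.card ≤ 3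

/-- The system with its points relabelled. -/
def relabel (C : Fin 10 → Fin 10 → Fin 10 → Prop) (σ : Equiv.Perm (Fin 10)) :
    Fin 10 → Fin 10 → Fin 10 → Prop := fun i j k => C (σ i) (σ j) (σ k)

lemma TripleSystem.relabel {C : Fin 10 → Fin 10 → Fin 10 → Prop} (h : TripleSystem C)
    (σ : Equiv.Perm (Fin 10)) : TripleSystem (relabel C σ) where
  swap := h.swap
  rotate := h.rotate
  ne h' := fun e => h.ne h' (by rw [e])
  unique h1 h2 := σ.injective (h.unique h1 h2)
  degree i s hs := by
    rw [← Finset.card_image_of_injective s σ.injective]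
    refine h.degree (σ i) _ fun j hj => ?_
    obtain ⟨j, hjs, rfl⟩ := Finset.mem_image.1 hj
    obtain ⟨h1, h2⟩ := hs j hjs
    refine ⟨fun h' => h1 (σ.injective h'), fun k hk => h2 (σ.symm k) ?_⟩
    simpa [LineArrangement.relabel] using hk

/-- What is known about a pair of points, as a number less than `16`: nothing if the number is `0`,
that it is in no triple if the number is `15`, and that it is in a triple with the point `r` if the
number is `r + 1`. -/
def PairFact (C : Fin 10 → Fin 10 → Fin 10 → Prop) (a b v : ℕ) : Prop :=
  (v = 15 → ∀ k, ¬ C (Fin.ofNat 10 a) (Fin.ofNat 10 b) k) ∧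
    ∀ r < 10, v = r + 1 → C (Fin.ofNat 10 a) (Fin.ofNat 10 b) (Fin.ofNat 10 r)

/-- The entry for the pair with code `i` in a table of known facts. -/
def entry (M i : ℕ) : ℕ := Nat.land (Nat.shiftRight M (4 * i)) 15

/-- The table with a new entry. -/
def withEntry (M i v : ℕ) : ℕ := Nat.lor M (Nat.shiftLeft v (4 * i))

/-- The code of an unordered pair. -/
def pairCode (p q : ℕ) : ℕ := bif Nat.blt p q then 10 * p + q else 10 * q + p

/-- The entry for an unordered pair. -/
def pairEntry (M p q : ℕ) : ℕ := entry M (pairCode p q)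

lemma entry_zero (i : ℕ) : entry 0 i = 0 := by
  change (0 >>> (4 * i)) &&& 15 = 0
  simp

/-- An entry takes four bits, and `v < 16` fits into its own place. The new value is combined with
the old one by a bitwise or, so it is recorded faithfully only where the entry was zero; this is why
all insertions test for that first. -/
lemma entry_withEntry (M i j v : ℕ) (hv : v < 16) :
    entry (withEntry M i v) j = entry M j ||| (if i = j then v else 0) := by
  change ((M ||| v <<< (4 * i)) >>> (4 * j)) &&& 15 = (M >>> (4 * j)) &&& 15 ||| _
  apply Nat.eq_of_testBit_eq
  intro k
  have h15 : Nat.testBit 15 k = decide (k < 4) := by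
    rw [show (15 : ℕ) = 2 ^ 4 - 1 by norm_num, Nat.testBit_two_pow_sub_one]
  have hvk : ∀ k, 4 ≤ k → v.testBit k = false := fun k hk => Nat.testBit_lt_two_pow
    (lt_of_lt_of_le hv (by rw [show (16 : ℕ) = 2 ^ 4 by norm_num]; exact Nat.pow_le_pow_right (by norm_num) hk))
  simp only [Nat.testBit_and, Nat.testBit_shiftRight, Nat.testBit_or, Nat.testBit_shiftLeft, h15,
    Bool.and_or_distrib_right]
  congr 1
  by_cases hk : k < 4
  · rcases lt_trichotomy i j with h | rfl | h
    · have : v.testBit (4 * j + k - 4 * i) = false := hvk _ (by omega)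
      rw [if_neg h.ne, this]
      simp
    · simp [hk]
    · rw [if_neg h.ne']
      have : ¬ 4 * j + k ≥ 4 * i := by omega
      simp [this]
  · have := hvk k (not_lt.1 hk)
    by_cases h : i = j <;> simp [hk, h, this]

/-- All entries of the table are facts about the system of triples. -/
def Extends (C : Fin 10 → Fin 10 → Fin 10 → Prop) (M : ℕ) : Prop :=
  ∀ a b, a < b → b < 10 → PairFact C a b (entry M (10 * a + b))

section
variable {C : Fin 10 → Fin 10 → Fin 10 → Prop}

lemma extends_zero : Extends C 0 := fun a b _ _ => by
  rw [entry_zero]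
  exact ⟨by omega, by omega⟩

lemma pairFact_symm (hC : TripleSystem C) {a b v : ℕ} (h : PairFact C a b v) : PairFact C b a v :=
  ⟨fun hv k hk => h.1 hv k (hC.swap hk), fun r hr hv => hC.swap (h.2 r hr hv)⟩

lemma Extends.pairFact (hC : TripleSystem C) {M p q : ℕ} (h : Extends C M) (hp : p < 10)
    (hq : q < 10) (hpq : p ≠ q) : PairFact C p q (pairEntry M p q) := by
  unfold pairEntry pairCode
  rw [blt_eq_decide]
  rcases lt_or_gt_of_ne hpq with h' | h'
  · rw [decide_eq_true h', cond_true]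
    exact h p q h' hq
  · rw [decide_eq_false h'.not_gt, cond_false]
    exact pairFact_symm hC (h q p h' hp)

lemma Extends.withEntry (hC : TripleSystem C) {M p q v : ℕ} (h : Extends C M) (hp : p < 10)
    (hq : q < 10) (hpq : p ≠ q) (h0 : pairEntry M p q = 0) (hv : v < 16) (hf : PairFact C p q v) :
    Extends C (withEntry M (pairCode p q) v) := by
  intro a b hab hb
  rw [entry_withEntry _ _ _ _ hv]
  split_ifs with hi
  · have h0' : entry M (10 * a + b) = 0 := by rw [← hi]; exact h0
    rw [h0', Nat.zero_or]
    unfold pairCode at hi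
    rw [blt_eq_decide] at hi
    rcases lt_or_gt_of_ne hpq with h' | h'
    · rw [decide_eq_true h', cond_true] at hi
      obtain ⟨rfl, rfl⟩ : p = a ∧ q = b := by omega
      exact hf
    · rw [decide_eq_false h'.not_gt, cond_false] at hi
      obtain ⟨rfl, rfl⟩ : q = a ∧ p = b := by omega
      exact pairFact_symm hC hf
  · rw [Nat.or_zero]
    exact h a b hab hb

end

/-- The function applied to a number, which is computed first. -/
def forcing {α : Type} (f : ℕ → α) : ℕ → α
  | 0 => f 0
  | n + 1 => f (n + 1)

lemma forcing_eq {α : Type} (f : ℕ → α) (n : ℕ) : forcing f n = f n := by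
  cases n <;> rfl

/-- The table with the triple `p`, `q`, `r` added, if the entries are free. -/
def addTriple {α : Type} (M p q r : ℕ) (f : ℕ → Option α) : Option α :=
  bif Nat.beq (pairEntry M p q) 0 then
    forcing (fun M => bif Nat.beq (pairEntry M p r) 0 then
      forcing (fun M => bif Nat.beq (pairEntry M q r) 0 then
        forcing f (withEntry M (pairCode q r) (p + 1)) else none)
        (withEntry M (pairCode p r) (q + 1)) else none)
      (withEntry M (pairCode p q) (r + 1))
  else none

/-- The table with the entry that there is no triple with `p`, `q`, if the entry is free. -/
def addNone {α : Type} (M p q : ℕ) (f : ℕ → Option α) : Option α :=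
  bif Nat.beq (pairEntry M p q) 0 then forcing f (withEntry M (pairCode p q) 15) else none

section
variable {C : Fin 10 → Fin 10 → Fin 10 → Prop} {α : Type}

/-- A triple contributes facts about its three pairs. If one of the entries is already in use the
result is `none`, so success guarantees that all three facts were recorded. -/
lemma exists_of_addTriple (hC : TripleSystem C) {M p q r : ℕ} {f : ℕ → Option α} {x : α}
    (hM : Extends C M) (hp : p < 10) (hq : q < 10) (hr : r < 10)
    (h : C (Fin.ofNat 10 p) (Fin.ofNat 10 q) (Fin.ofNat 10 r)) (hf : addTriple M p q r f = some x) :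
    ∃ M', Extends C M' ∧ f M' = some x := by
  have hne : ∀ {a b c : ℕ}, C (Fin.ofNat 10 a) (Fin.ofNat 10 b) (Fin.ofNat 10 c) → a ≠ b :=
    fun h e => hC.ne h (by rw [e])
  have hfact : ∀ {a b c : ℕ}, c < 10 → C (Fin.ofNat 10 a) (Fin.ofNat 10 b) (Fin.ofNat 10 c) →
      PairFact C a b (c + 1) := fun hc h => ⟨by omega, fun r _ e => by
        obtain rfl : _ = r := Nat.succ_injective e
        exact h⟩
  have h2 := hC.swap (hC.rotate (hC.rotate h))
  have h3 := hC.rotate h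
  simp only [addTriple, beq_eq_decide, forcing_eq] at hf
  by_cases c1 : pairEntry M p q = 0
  swap; · simp [c1] at hf
  rw [decide_eq_true c1, cond_true] at hf
  have hM1 := hM.withEntry hC hp hq (hne h) c1 (by omega) (hfact hr h)
  by_cases c2 : pairEntry (withEntry M (pairCode p q) (r + 1)) p r = 0
  swap; · simp [c2] at hf
  rw [decide_eq_true c2, cond_true] at hf
  have hM2 := hM1.withEntry hC hp hr (hne h2) c2 (by omega) (hfact hq h2)
  by_cases c3 : pairEntry (withEntry (withEntry M (pairCode p q) (r + 1))
      (pairCode p r) (q + 1)) q r = 0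
  swap; · simp [c3] at hf
  rw [decide_eq_true c3, cond_true] at hf
  exact ⟨_, hM2.withEntry hC hq hr (hne h3) c3 (by omega) (hfact hp h3), hf⟩

lemma exists_of_addNone (hC : TripleSystem C) {M p q : ℕ} {f : ℕ → Option α} {x : α}
    (hM : Extends C M) (hp : p < 10) (hq : q < 10) (hpq : p ≠ q)
    (h : ∀ k, ¬ C (Fin.ofNat 10 p) (Fin.ofNat 10 q) k) (hf : addNone M p q f = some x) :
    ∃ M', Extends C M' ∧ f M' = some x := by
  simp only [addNone, beq_eq_decide, forcing_eq] at hf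
  by_cases c1 : pairEntry M p q = 0
  swap; · simp [c1] at hf
  rw [decide_eq_true c1, cond_true] at hf
  exact ⟨_, hM.withEntry hC hp hq hpq c1 (by omega) ⟨fun _ => h, by omega⟩, hf⟩

end

/-- A partially known system of triples: codes of some triples, and of some pairs that are not in
any triple. -/
abbrev PartialSystem : Type := List ℕ × List ℕ

/-- The system of triples has the given triples, and no triples on the given pairs. -/
def PartialSystem.Holds (R : PartialSystem) (C : Fin 10 → Fin 10 → Fin 10 → Prop) : Prop :=
  (∀ n ∈ R.1, C (Fin.ofNat 10 (n / 100)) (Fin.ofNat 10 (n / 10 % 10)) (Fin.ofNat 10 (n % 10))) ∧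
    ∀ n ∈ R.2, ∀ k, ¬ C (Fin.ofNat 10 (n / 10)) (Fin.ofNat 10 (n % 10)) k

/-- Triples with the given codes are added to a table. -/
def addTriples {α : Type} (f : ℕ → Option α) : List ℕ → ℕ → Option α
  | [], M => f M
  | n :: B, M => addTriple M (n / 100) (n / 10 % 10) (n % 10) (addTriples f B)

/-- Pairs with the given codes that are in no triple are added to a table. -/
def addNones {α : Type} (f : ℕ → Option α) : List ℕ → ℕ → Option α
  | [], M => f M
  | n :: E, M => addNone M (n / 10) (n % 10) (addNones f E)

lemma exists_of_addTriples {C : Fin 10 → Fin 10 → Fin 10 → Prop} (hC : TripleSystem C)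
    {α : Type} {f : ℕ → Option α} {x : α} {B : List ℕ} : ∀ {M : ℕ},
      (∀ n ∈ B, C (Fin.ofNat 10 (n / 100)) (Fin.ofNat 10 (n / 10 % 10)) (Fin.ofNat 10 (n % 10))) →
      (B.all fun n => Nat.blt n 1000) = true → Extends C M → addTriples f B M = some x →
      ∃ M', Extends C M' ∧ f M' = some x := by
  induction B with
  | nil => exact fun _ _ hM h => ⟨_, hM, h⟩
  | cons n B ih =>
    intro M hR hB hM h
    rw [List.all_cons, Bool.and_eq_true, Nat.blt_eq] at hB
    rw [addTriples] at h
    obtain ⟨M', hM', h⟩ := exists_of_addTriple hC hM (by omega) (by omega) (by omega)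
      (hR n (by simp)) h
    exact ih (fun m hm => hR m (List.mem_cons_of_mem _ hm)) hB.2 hM' h

lemma exists_of_addNones {C : Fin 10 → Fin 10 → Fin 10 → Prop} (hC : TripleSystem C)
    {α : Type} {f : ℕ → Option α} {x : α} {E : List ℕ} : ∀ {M : ℕ},
      (∀ n ∈ E, ∀ k, ¬ C (Fin.ofNat 10 (n / 10)) (Fin.ofNat 10 (n % 10)) k) →
      (E.all fun n => Nat.blt n 100 && !Nat.beq (n / 10) (n % 10)) = true →
      Extends C M → addNones f E M = some x → ∃ M', Extends C M' ∧ f M' = some x := by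
  induction E with
  | nil => exact fun _ _ hM h => ⟨_, hM, h⟩
  | cons n E ih =>
    intro M hR hE hM h
    rw [List.all_cons, Bool.and_eq_true, Bool.and_eq_true, Nat.blt_eq, Bool.not_eq_true',
      beq_eq_decide, decide_eq_false_iff_not] at hE
    rw [addNones] at h
    obtain ⟨M', hM', h⟩ := exists_of_addNone hC hM (by omega) (by omega) hE.1.2 (hR n (by simp)) h
    exact ih (fun m hm => hR m (List.mem_cons_of_mem _ hm)) hE.2 hM' h

/-- The entries of the table contain the partially known system, with the points relabelled by the
decimal digits of `d`. -/
def PartialSystem.containedIn (R : PartialSystem) (M d : ℕ) : Bool :=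
  (R.1.all fun n => forcing (fun a => forcing (fun b =>
    !Nat.beq a b && Nat.beq (pairEntry M a b) (d / 10 ^ (n % 10) % 10 + 1))
      (d / 10 ^ (n / 10 % 10) % 10)) (d / 10 ^ (n / 100) % 10)) &&
  R.2.all fun n => forcing (fun a => forcing (fun b =>
    !Nat.beq a b && Nat.beq (pairEntry M a b) 15) (d / 10 ^ (n % 10) % 10)) (d / 10 ^ (n / 10) % 10)

/-- The partially known system with the given position in the list is contained in the table. -/
def refersTo (M d : ℕ) : List PartialSystem → ℕ → Bool
  | [], _ => false
  | R :: _, 0 => R.containedIn M d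
  | _ :: l, n + 1 => refersTo M d l n

lemma exists_of_refersTo {M d : ℕ} {l : List PartialSystem} :
    ∀ {n : ℕ}, refersTo M d l n = true → ∃ R ∈ l, R.containedIn M d = true := by
  induction l with
  | nil => intro n h; simp [refersTo] at h
  | cons R l ih =>
    intro n h
    cases n with
    | zero => exact ⟨R, by simp, h⟩
    | succ n =>
      obtain ⟨R', hR, h'⟩ := ih h
      exact ⟨R', List.mem_cons_of_mem _ hR, h'⟩

/-- The ten lowest decimal digits of the number are different. -/
def digitsDistinct (d : ℕ) : Bool :=
  Nat.beq (2 ^ (d % 10) ||| 2 ^ (d / 10 % 10) ||| 2 ^ (d / 100 % 10) ||| 2 ^ (d / 1000 % 10) |||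
    2 ^ (d / 10000 % 10) ||| 2 ^ (d / 100000 % 10) ||| 2 ^ (d / 1000000 % 10) |||
    2 ^ (d / 10000000 % 10) ||| 2 ^ (d / 100000000 % 10) ||| 2 ^ (d / 1000000000 % 10)) 1023

/-- All ten bits of 1023 are set, so every digit occurs; a surjective self-map of ten labels is a
permutation. -/
lemma exists_perm_of_digitsDistinct {d : ℕ} (h : digitsDistinct d = true) :
    ∃ σ : Equiv.Perm (Fin 10), ∀ i, σ i = Fin.ofNat 10 (d / 10 ^ i.val % 10) := by
  have hs : Function.Surjective fun i : Fin 10 => Fin.ofNat 10 (d / 10 ^ i.val % 10) := by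
    intro j
    rw [digitsDistinct, Nat.beq_eq] at h
    have h' := congrArg (fun n => Nat.testBit n j.val) h
    have h1023 : Nat.testBit 1023 j.val = true := by
      rw [show (1023 : ℕ) = 2 ^ 10 - 1 by norm_num, Nat.testBit_two_pow_sub_one]
      simp
    simp only [Nat.testBit_or, Nat.testBit_two_pow, h1023, Bool.or_eq_true, decide_eq_true_eq] at h'
    have key : ∃ i : Fin 10, d / 10 ^ i.val % 10 = j.val := by
      rcases h' with ((((((((h | h) | h) | h) | h) | h) | h) | h) | h) | h
      · exact ⟨0, by simpa using h⟩
      · exact ⟨1, h⟩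
      · exact ⟨2, h⟩
      · exact ⟨3, h⟩
      · exact ⟨4, h⟩
      · exact ⟨5, h⟩
      · exact ⟨6, h⟩
      · exact ⟨7, h⟩
      · exact ⟨8, h⟩
      · exact ⟨9, h⟩
    obtain ⟨i, hi⟩ := key
    refine ⟨i, ?_⟩
    ext
    simp [hi]
  exact ⟨Equiv.ofBijective _ ⟨Finite.injective_iff_surjective.2 hs, hs⟩, fun i => rfl⟩

lemma PartialSystem.holds_of_containedIn {R : PartialSystem} {M d : ℕ}
    (h : R.containedIn M d = true) {C : Fin 10 → Fin 10 → Fin 10 → Prop} (hC : TripleSystem C)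
    (hM : Extends C M) {σ : Equiv.Perm (Fin 10)}
    (hσ : ∀ i, σ i = Fin.ofNat 10 (d / 10 ^ i.val % 10)) (hR : (R.1.all fun n => Nat.blt n 1000) = true)
    (hR' : (R.2.all fun n => Nat.blt n 100) = true) :
    R.Holds (relabel C σ) := by
  simp only [containedIn, forcing_eq, Bool.and_eq_true, List.all_eq_true, Bool.not_eq_true', beq_eq_decide,
    decide_eq_false_iff_not, decide_eq_true_eq] at h
  simp only [List.all_eq_true, Nat.blt_eq] at hR hR'
  have hσ' : ∀ n, n < 10 → σ (Fin.ofNat 10 n) = Fin.ofNat 10 (d / 10 ^ n % 10) := fun n hn => by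
    rw [hσ]; simp [Nat.mod_eq_of_lt hn]
  constructor
  · intro n hn
    have hn' := hR n hn
    obtain ⟨hne, h⟩ := h.1 n hn
    have hf := hM.pairFact hC (Nat.mod_lt _ (by norm_num)) (Nat.mod_lt _ (by norm_num)) hne
    simp only [relabel]
    rw [hσ' _ (by omega), hσ' _ (by omega), hσ' _ (by omega)]
    exact hf.2 _ (Nat.mod_lt _ (by norm_num)) h
  · intro n hn k
    have hn' := hR' n hn
    obtain ⟨hne, h⟩ := h.2 n hn
    have hf := hM.pairFact hC (Nat.mod_lt _ (by norm_num)) (Nat.mod_lt _ (by norm_num)) hne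
    simp only [relabel]
    rw [hσ' _ (by omega), hσ' _ (by omega)]
    exact hf.1 h _

/-- The number of `q < n`, `q ≠ p`, for which the pair is known to be in no triple. -/
def countNone (M p : ℕ) : ℕ → ℕ
  | 0 => 0
  | n + 1 => bif !Nat.beq p n && Nat.beq (pairEntry M p n) 15 then countNone M p n + 1
    else countNone M p n

/-- The entry `v` for a pair with a point rules out that there is a triple with these points and the
point `q`. -/
def excludes (v q : ℕ) : Bool :=
  forcing (fun v => !Nat.beq v 0 && (!Nat.beq v (q + 1) && (Nat.blt v 11 || Nat.beq v 15))) v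

/-- The successive treatment of the cases that `r < n` is in a triple with `p` and `q`. -/
def searchTriples (f : ℕ → List ℕ → Option (List ℕ)) (M p q : ℕ) :
    ℕ → Option (List ℕ) → Option (List ℕ)
  | 0, s => s
  | n + 1, s => searchTriples f M p q n
    (bif Nat.beq n p || (Nat.beq n q || (excludes (pairEntry M p n) q || excludes (pairEntry M q n) p))
      then s else s.bind fun ts => addTriple M p q n fun M => f M ts)

/-- Case distinction on the triples containing a pair of points, where the pair to consider, or the
partial system already treated and the relabelling that leads to it, are given by the next number in
the list. -/
def search (proved : List PartialSystem) : ℕ → ℕ → List ℕ → Option (List ℕ)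
  | 0, _, _ => none
  | _ + 1, _, [] => none
  | n + 1, M, t :: ts =>
    -- Numbers below 100 are pairs to branch on. The others, diminished by 100, carry a relabelling
    -- in their last ten digits and the position of a treated system in the digits above.
    bif Nat.blt t 100 then
      bif Nat.beq (t / 10) (t % 10) then none else
      searchTriples (search proved n) M (t / 10) (t % 10) 10
        -- A point has at most three partners with which it is in no triple. If one of the two
        -- points already has three, the case that the pair is in no triple cannot occur and
        -- consumes nothing of the script.
        (bif Nat.blt (countNone M (t / 10) 10) 3 && Nat.blt (countNone M (t % 10) 10) 3 &&
            Nat.beq (pairEntry M (t / 10) (t % 10)) 0 then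
          addNone M (t / 10) (t % 10) fun M => search proved n M ts
        else bif Nat.beq (pairEntry M (t / 10) (t % 10)) 0 then some ts else none)
    else
      -- A branch is closed only by a treated system that is contained in the table after the
      -- recorded relabelling.
      bif digitsDistinct (t - 100) && refersTo M (t - 100) proved ((t - 100) / 10 ^ 10) then
        some ts
      else none

/-- All partial systems are treated in turn. -/
def searchAll (proved : List PartialSystem) : List (PartialSystem × List ℕ) → Bool
  | [] => true
  | (R, ts) :: rest =>
    (R.1.all fun n => Nat.blt n 1000) &&
    ((R.2.all fun n => Nat.blt n 100 && !Nat.beq (n / 10) (n % 10)) &&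
    -- The bound 46 suffices for a decision on each of the 45 pairs and the final reference.
    ((addTriples (addNones (fun M => search proved 46 M ts) R.2) R.1 0).isSome &&
      searchAll (R :: proved) rest))

/-! ### Soundness of the search. -/

section
variable {C : Fin 10 → Fin 10 → Fin 10 → Prop}

lemma countNone_eq (M p n : ℕ) : countNone M p n =
    ((Finset.range n).filter fun q => p ≠ q ∧ pairEntry M p q = 15).card := by
  induction n with
  | zero => rfl
  | succ n ih =>
    rw [countNone, Finset.range_add_one, Finset.filter_insert, ih, beq_eq_decide, beq_eq_decide]
    by_cases h : p ≠ n ∧ pairEntry M p n = 15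
    · rw [if_pos h, Finset.card_insert_of_notMem (by simp)]
      simp [h.1, h.2]
    · rw [if_neg h]
      have : (!decide (p = n) && decide (pairEntry M p n = 15)) = false := by
        rw [← Bool.not_eq_true]
        simpa using h
      rw [this, cond_false]

/-- The recorded partners of `p` together with the unrecorded `q` form a set to which the degree
condition applies, so they are at most three. -/
lemma countNone_lt (hC : TripleSystem C) {M p q : ℕ} (hM : Extends C M) (hp : p < 10) (hq : q < 10)
    (hpq : p ≠ q) (h0 : pairEntry M p q = 0)
    (h : ∀ k, ¬ C (Fin.ofNat 10 p) (Fin.ofNat 10 q) k) : countNone M p 10 < 3 := by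
  rw [countNone_eq]
  set s := (Finset.range 10).filter fun q => p ≠ q ∧ pairEntry M p q = 15 with hs
  have hqs : q ∉ s := by simp [hs, h0]
  have hlt : ∀ a ∈ insert q s, a < 10 := by
    intro a ha
    rcases Finset.mem_insert.1 ha with rfl | ha
    · exact hq
    · exact Finset.mem_range.1 (Finset.mem_filter.1 ha).1
  have hinj : Set.InjOn (Fin.ofNat 10) (insert q s : Finset ℕ) := by
    intro a ha b hb hab
    have := congrArg Fin.val hab
    simpa [Nat.mod_eq_of_lt (hlt a ha), Nat.mod_eq_of_lt (hlt b hb)] using this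
  have hval : ∀ {a b : ℕ}, a < 10 → b < 10 → a ≠ b → Fin.ofNat 10 a ≠ Fin.ofNat 10 b := by
    intro a b ha hb hab h
    have := congrArg Fin.val h
    exact hab (by simpa [Nat.mod_eq_of_lt ha, Nat.mod_eq_of_lt hb] using this)
  have := hC.degree (Fin.ofNat 10 p) ((insert q s).image (Fin.ofNat 10)) fun j hj => by
    obtain ⟨a, ha, rfl⟩ := Finset.mem_image.1 hj
    have ha' := hlt a ha
    rcases Finset.mem_insert.1 ha with rfl | ha
    · exact ⟨hval hq hp hpq.symm, h⟩
    · obtain ⟨-, hne, h15⟩ := Finset.mem_filter.1 ha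
      exact ⟨hval ha' hp hne.symm, (hM.pairFact hC hp ha' hne).1 h15⟩
  rw [Finset.card_image_of_injOn hinj, Finset.card_insert_of_notMem hqs] at this
  omega

lemma not_of_excludes (hC : TripleSystem C) {M p q r : ℕ} (hM : Extends C M) (hp : p < 10)
    (hq : q < 10) (hr : r < 10) (hpr : p ≠ r) (h : excludes (pairEntry M p r) q = true) :
    ¬ C (Fin.ofNat 10 p) (Fin.ofNat 10 r) (Fin.ofNat 10 q) := by
  intro hc
  simp only [excludes, forcing_eq, Bool.and_eq_true, Bool.or_eq_true, Bool.not_eq_true', beq_eq_decide,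
    blt_eq_decide, decide_eq_true_eq, decide_eq_false_iff_not] at h
  obtain ⟨h0, h1, h | h⟩ := h
  · have hf := (hM.pairFact hC hp hr hpr).2 (pairEntry M p r - 1) (by omega) (by omega)
    have := congrArg Fin.val (hC.unique hc hf)
    simp only [Fin.ofNat_eq_cast, Fin.val_natCast] at this
    omega
  · exact (hM.pairFact hC hp hr hpr).1 h _ hc

/-- The rest of the script is passed through all cases in turn, and failure is never repaired.
Success at the end therefore means success in each case before. -/
lemma exists_of_searchTriples_of_some {f : ℕ → List ℕ → Option (List ℕ)} {M p q n : ℕ} :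
    ∀ {s : Option (List ℕ)} {x : List ℕ}, searchTriples f M p q n s = some x →
      ∃ ts, s = some ts := by
  induction n with
  | zero => exact fun h => ⟨_, h⟩
  | succ n ih =>
    intro s x h
    rw [searchTriples] at h
    obtain ⟨ts, hts⟩ := ih h
    generalize (Nat.beq n p || (Nat.beq n q || (excludes (pairEntry M p n) q ||
      excludes (pairEntry M q n) p))) = b at hts
    cases b with
    | true => exact ⟨ts, hts⟩
    | false =>
      rw [cond_false, Option.bind_eq_some_iff] at hts
      obtain ⟨a, ha, -⟩ := hts
      exact ⟨a, ha⟩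

/-- The case of the actual third point `r` is not skipped, because the table records only facts
about `C`; hence this case was treated successfully. -/
lemma exists_of_searchTriples (hC : TripleSystem C) {f : ℕ → List ℕ → Option (List ℕ)}
    {M p q r n : ℕ} (hM : Extends C M) (hp : p < 10) (hq : q < 10) (hr : r < 10)
    (hc : C (Fin.ofNat 10 p) (Fin.ofNat 10 q) (Fin.ofNat 10 r)) :
    ∀ {s : Option (List ℕ)} {x : List ℕ}, r < n → searchTriples f M p q n s = some x →
      ∃ M' ts y, Extends C M' ∧ f M' ts = some y := by
  induction n with
  | zero => exact fun h => absurd h (Nat.not_lt_zero _)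
  | succ n ih =>
    intro s x hrn h
    rw [searchTriples] at h
    rcases Nat.lt_succ_iff_lt_or_eq.1 hrn with hrn | rfl
    · exact ih hrn h
    · have hne : ∀ {a b c : ℕ}, C (Fin.ofNat 10 a) (Fin.ofNat 10 b) (Fin.ofNat 10 c) → a ≠ b :=
        fun h e => hC.ne h (by rw [e])
      have h2 := hC.swap (hC.rotate (hC.rotate hc))
      have h3 := hC.rotate hc
      obtain ⟨ts, hts⟩ := exists_of_searchTriples_of_some h
      have hb : (Nat.beq r p || (Nat.beq r q || (excludes (pairEntry M p r) q ||
          excludes (pairEntry M q r) p))) = false := by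
        rw [← Bool.not_eq_true]
        simp only [Bool.or_eq_true, Nat.beq_eq]
        rintro (h | h | h | h)
        · exact hne h2 h.symm
        · exact hne h3 h.symm
        · exact not_of_excludes hC hM hp hq hr (hne h2) h h2
        · exact not_of_excludes hC hM hq hp hr (hne h3) h h3
      rw [hb, cond_false, Option.bind_eq_some_iff] at hts
      obtain ⟨a, -, ha⟩ := hts
      obtain ⟨M', hM', h'⟩ := exists_of_addTriple hC hM hp hq hr hc ha
      exact ⟨M', a, ts, hM', h'⟩

/-- The partially known system implies a property of systems of triples. -/
structure PartialSystem.Implies (R : PartialSystem) (G : (Fin 10 → Fin 10 → Fin 10 → Prop) → Prop) :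
    Prop where
  triple_lt : (R.1.all fun n => Nat.blt n 1000) = true
  pair_lt : (R.2.all fun n => Nat.blt n 100) = true
  implies : ∀ C, TripleSystem C → R.Holds C → G C

/-- A property of systems of triples that is invariant under relabelling holds for the systems that
extend a table, if the search succeeds. -/
lemma of_search {G : (Fin 10 → Fin 10 → Fin 10 → Prop) → Prop}
    (hG : ∀ C σ, G (relabel C σ) → G C) {proved : List PartialSystem}
    (hproved : ∀ R ∈ proved, R.Implies G) (hC : TripleSystem C) {n : ℕ} :
    ∀ {M : ℕ} {ts x : List ℕ}, Extends C M → search proved n M ts = some x → G C := by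
  induction n with
  | zero => intro M ts x _ h; simp [search] at h
  | succ n ih =>
    intro M ts x hM h
    cases ts with
    | nil => simp [search] at h
    | cons t ts =>
    rw [search] at h
    by_cases ht : t < 100
    · rw [blt_eq_decide, decide_eq_true ht, cond_true] at h
      have hp : t / 10 < 10 := by omega
      have hq : t % 10 < 10 := by omega
      by_cases hpq : t / 10 = t % 10
      · rw [beq_eq_decide, decide_eq_true hpq] at h
        simp at h
      rw [beq_eq_decide, decide_eq_false hpq, cond_false] at h
      -- Either the pair has a third point in `C`, and the case of that point succeeded, or it has
      -- none; then the degree condition shows that the corresponding case was entered.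
      by_cases hk : ∃ k, C (Fin.ofNat 10 (t / 10)) (Fin.ofNat 10 (t % 10)) k
      · obtain ⟨k, hk⟩ := hk
        have ek : Fin.ofNat 10 k.val = k := by ext; simp
        rw [← ek] at hk
        obtain ⟨M', ts', y, hM', h'⟩ := exists_of_searchTriples hC hM hp hq k.2 hk k.2 h
        exact ih hM' h'
      · push Not at hk
        obtain ⟨y, hy⟩ := exists_of_searchTriples_of_some h
        have h0 : pairEntry M (t / 10) (t % 10) = 0 := by
          by_contra h0
          rw [beq_eq_decide, decide_eq_false h0] at hy
          simp at hy
        have h0' : pairEntry M (t % 10) (t / 10) = 0 := by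
          rw [← h0]
          unfold pairEntry pairCode
          rw [blt_eq_decide, blt_eq_decide]
          congr 1
          rcases lt_or_gt_of_ne hpq with h | h <;> simp [h, h.not_gt]
        have h1 := countNone_lt hC hM hp hq hpq h0 hk
        have h2 := countNone_lt hC hM hq hp (Ne.symm hpq) h0' fun k hk' => hk k (hC.swap hk')
        rw [blt_eq_decide, blt_eq_decide, beq_eq_decide, decide_eq_true h1, decide_eq_true h2,
          decide_eq_true h0] at hy
        obtain ⟨M', hM', h'⟩ := exists_of_addNone hC hM hp hq hpq hk hy
        exact ih hM' h'
    · rw [blt_eq_decide, decide_eq_false ht, cond_false] at h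
      cases hb : (digitsDistinct (t - 100) &&
          refersTo M (t - 100) proved ((t - 100) / 10 ^ 10)) with
      | false => rw [hb] at h; simp at h
      | true =>
        rw [Bool.and_eq_true] at hb
        obtain ⟨σ, hσ⟩ := exists_perm_of_digitsDistinct hb.1
        obtain ⟨R, hR, h'⟩ := exists_of_refersTo hb.2
        have := hproved R hR
        exact hG C σ (this.implies _ (hC.relabel σ)
          (PartialSystem.holds_of_containedIn h' hC hM hσ this.triple_lt this.pair_lt))

/-- Each system, once treated, is prepended to the list to which later scripts may refer, so the
property spreads along the order of dependence. -/
lemma implies_of_searchAll {G : (Fin 10 → Fin 10 → Fin 10 → Prop) → Prop}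
    (hG : ∀ C σ, G (relabel C σ) → G C) {l : List (PartialSystem × List ℕ)} :
    ∀ {proved : List PartialSystem}, (∀ R ∈ proved, R.Implies G) → searchAll proved l = true →
      ∀ x ∈ l, x.1.Implies G := by
  induction l with
  | nil => simp
  | cons x l ih =>
    intro proved hproved h
    obtain ⟨R, ts⟩ := x
    simp only [searchAll, Bool.and_eq_true] at h
    obtain ⟨hB, hE, hs, h⟩ := h
    have hR : R.Implies G := by
      refine ⟨hB, ?_, fun C hC hR => ?_⟩
      · simp only [List.all_eq_true, Bool.and_eq_true] at hE ⊢
        exact fun n hn => (hE n hn).1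
      · obtain ⟨x, hx⟩ := Option.isSome_iff_exists.1 hs
        obtain ⟨M, hM, h1⟩ := exists_of_addTriples hC hR.1 hB extends_zero hx
        obtain ⟨M', hM', h2⟩ := exists_of_addNones hC hR.2 hE hM h1
        exact of_search hG hproved hC hM' h2
    intro y hy
    rcases List.mem_cons.1 hy with rfl | hy
    · exact hR
    · refine ih (fun R' hR' => ?_) h y hy
      rcases List.mem_cons.1 hR' with rfl | hR'
      · exact hR
      · exact hproved R' hR'

end

/-! ### The classification of the systems of triples -/

/-- The complete systems of triples, up to relabelling, with the pairs that are in no triple. -/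
def completeSystems : List PartialSystem := [
  ([14, 25, 39, 127, 138, 246, 356, 479, 578, 689], [6, 7, 8, 15, 16, 19, 23, 28, 29, 34, 37, 45,
   48, 59, 67]),
  ([15, 34, 79, 127, 136, 238, 259, 456, 489, 678], [2, 6, 8, 14, 18, 19, 24, 26, 35, 37, 39, 47,
   57, 58, 69]),
  ([15, 24, 38, 136, 178, 239, 257, 456, 489, 679], [6, 7, 9, 12, 14, 19, 26, 28, 34, 35, 37, 47,
   58, 59, 68]),
  ([16, 34, 79, 128, 135, 237, 269, 456, 489, 578], [2, 5, 8, 14, 17, 19, 24, 25, 36, 38, 39, 47,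
   59, 67, 68]),
  ([14, 59, 78, 138, 169, 235, 247, 289, 346, 567], [2, 3, 6, 12, 15, 17, 26, 37, 39, 45, 48, 49,
   58, 68, 79]),
  ([14, 27, 36, 139, 156, 238, 245, 478, 579, 689], [5, 8, 9, 12, 17, 18, 26, 29, 34, 35, 37, 46,
   49, 58, 67]),
  ([14, 25, 78, 127, 159, 236, 348, 379, 456, 689], [3, 6, 9, 13, 16, 18, 24, 28, 29, 35, 47, 49,
   57, 58, 67]),
  ([14, 27, 56, 136, 158, 239, 245, 378, 479, 689], [3, 8, 9, 12, 17, 19, 26, 28, 34, 35, 46, 48,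
   57, 59, 67]),
  ([14, 39, 56, 125, 138, 236, 278, 457, 489, 679], [2, 7, 8, 16, 17, 19, 24, 29, 34, 35, 37, 46,
   58, 59, 68]),
  ([17, 28, 39, 125, 134, 236, 456, 479, 578, 689], [4, 5, 6, 16, 18, 19, 24, 27, 29, 35, 37, 38,
   48, 59, 67]),
  ([14, 25, 37, 126, 135, 234, 278, 369, 468, 479, 589], [6, 8, 9, 17, 18, 19, 29, 38, 45, 56, 57,
   67]),
  ([15, 34, 78, 124, 138, 167, 237, 256, 289, 369, 459], [2, 6, 9, 19, 35, 46, 47, 48, 57, 58, 68,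
   79]),
  ([14, 39, 78, 125, 138, 236, 247, 289, 345, 469, 567], [2, 5, 6, 16, 17, 19, 37, 48, 58, 59, 68,
   79]),
  ([25, 34, 89, 124, 136, 158, 239, 357, 456, 479, 678], [1, 6, 7, 17, 19, 26, 27, 28, 38, 48, 59,
   69]),
  ([17, 25, 34, 124, 156, 268, 358, 369, 467, 489, 579], [6, 8, 9, 13, 18, 19, 23, 27, 29, 37, 45,
   78]),
  ([15, 24, 37, 126, 134, 239, 368, 458, 467, 569, 789], [6, 8, 9, 17, 18, 19, 25, 27, 28, 35, 49,
   57]),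
  ([26, 45, 79, 124, 138, 157, 237, 289, 349, 356, 678], [1, 3, 8, 16, 19, 25, 46, 47, 48, 58, 59,
   69]),
  ([24, 37, 68, 126, 139, 145, 235, 289, 346, 478, 579], [1, 5, 9, 17, 18, 27, 38, 49, 56, 58, 67,
   69]),
  ([14, 25, 67, 126, 135, 234, 289, 368, 379, 478, 569], [3, 8, 9, 17, 18, 19, 27, 45, 46, 49, 57,
   58]),
  ([14, 25, 89, 129, 136, 234, 267, 358, 379, 456, 478], [3, 6, 7, 15, 17, 18, 28, 49, 57, 59, 68,
   69]),
  ([15, 34, 78, 124, 138, 169, 236, 257, 289, 379, 456], [2, 6, 9, 17, 35, 47, 48, 49, 58, 59, 67,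
   68]),
  ([15, 26, 34, 124, 138, 235, 278, 379, 459, 467, 689], [7, 8, 9, 16, 17, 19, 29, 36, 48, 56, 57,
   58]),
  ([24, 36, 57, 125, 138, 146, 269, 278, 345, 379, 489], [1, 8, 9, 17, 19, 23, 47, 56, 58, 59, 67,
   68]),
  ([19, 24, 37, 125, 134, 178, 238, 267, 369, 456, 589], [5, 6, 8, 16, 29, 35, 47, 48, 49, 57, 68,
   79]),
  ([14, 26, 79, 138, 157, 237, 245, 289, 349, 356, 678], [3, 5, 8, 12, 16, 19, 46, 47, 48, 58, 59,
   69]),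
  ([14, 25, 78, 156, 189, 234, 268, 357, 369, 459, 467], [3, 6, 9, 12, 13, 17, 27, 29, 38, 48, 58,
   79]),
  ([14, 39, 56, 125, 138, 234, 268, 279, 367, 457, 489], [2, 7, 8, 16, 17, 19, 35, 46, 58, 59, 69,
   78]),
  ([24, 39, 68, 125, 137, 146, 189, 238, 279, 345, 567], [1, 5, 7, 26, 36, 47, 48, 49, 58, 59, 69,
   78]),
  ([19, 27, 34, 124, 136, 235, 268, 378, 456, 489, 579], [5, 6, 8, 15, 17, 18, 29, 39, 47, 58, 67,
   69]),
  ([24, 35, 78, 125, 137, 146, 189, 238, 267, 349, 569], [1, 6, 9, 29, 36, 45, 47, 48, 57, 58, 68,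
   79]),
  ([19, 24, 67, 126, 134, 235, 368, 379, 456, 478, 589], [3, 5, 8, 15, 17, 18, 27, 28, 29, 49, 57,
   69]),
  ([24, 56, 79, 125, 134, 167, 237, 289, 358, 369, 468], [1, 3, 8, 18, 19, 26, 45, 47, 49, 57, 59,
   78]),
  ([15, 26, 34, 124, 138, 169, 239, 278, 367, 457, 589], [7, 8, 9, 17, 25, 35, 46, 48, 49, 56, 68,
   79]),
  ([14, 37, 56, 125, 136, 234, 268, 279, 389, 459, 478], [2, 8, 9, 17, 18, 19, 35, 46, 57, 58, 67,
   69]),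
  ([25, 36, 47, 124, 138, 156, 179, 237, 268, 359, 489], [1, 8, 9, 29, 34, 45, 46, 57, 58, 67, 69,
   78]),
  ([15, 26, 37, 124, 169, 279, 345, 368, 467, 489, 578], [4, 8, 9, 13, 17, 18, 23, 25, 28, 39, 56,
   59]),
  ([15, 24, 37, 126, 134, 178, 235, 279, 389, 468, 569], [6, 8, 9, 19, 28, 36, 45, 47, 49, 57, 58,
   67]),
  ([17, 38, 45, 124, 135, 189, 239, 256, 278, 346, 679], [2, 6, 9, 16, 37, 47, 48, 49, 57, 58, 59,
   68]),
  ([24, 37, 89, 126, 134, 158, 235, 279, 369, 456, 478], [1, 5, 6, 17, 19, 28, 38, 49, 57, 59, 67,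
   68]),
  ([15, 26, 37, 124, 168, 238, 345, 369, 467, 489, 579], [4, 8, 9, 13, 17, 19, 25, 27, 29, 56, 58,
   78]),
  ([15, 24, 38, 126, 134, 178, 235, 289, 379, 469, 567], [6, 7, 9, 19, 27, 36, 45, 47, 48, 58, 59,
   68]),
  ([24, 38, 67, 126, 137, 145, 189, 235, 278, 349, 569], [1, 5, 9, 29, 36, 46, 47, 48, 57, 58, 68,
   79]),
  ([18, 27, 45, 134, 179, 235, 246, 369, 378, 489, 567], [3, 6, 9, 12, 15, 16, 28, 29, 47, 58, 59,
   68]),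
  ([14, 26, 57, 125, 138, 179, 234, 278, 359, 367, 456, 689], [3, 8, 9, 16, 29, 47, 48, 49, 58]),
  ([26, 34, 79, 124, 135, 167, 189, 237, 258, 369, 456, 478], [1, 5, 8, 29, 38, 49, 57, 59, 68]),
  ([15, 24, 38, 79, 126, 134, 178, 239, 257, 367, 456, 689], [6, 19, 28, 35, 47, 48, 49, 58, 59]),
  ([14, 26, 89, 125, 139, 167, 234, 279, 357, 368, 456, 478], [3, 5, 7, 18, 28, 49, 58, 59, 69]),
  ([24, 56, 89, 127, 136, 145, 235, 269, 348, 379, 467, 578], [1, 3, 7, 18, 19, 28, 49, 59, 68]),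
  ([15, 27, 36, 126, 134, 189, 235, 248, 379, 467, 569, 578], [4, 8, 9, 17, 29, 38, 45, 49, 68]),
  ([16, 25, 34, 78, 124, 135, 179, 238, 267, 369, 456, 489], [9, 18, 29, 37, 47, 57, 58, 59, 68]),
  ([24, 37, 56, 128, 136, 145, 179, 235, 267, 349, 478, 689], [1, 8, 9, 29, 38, 46, 57, 58, 59]),
  ([17, 24, 35, 125, 134, 189, 236, 279, 378, 458, 467, 569], [6, 8, 9, 16, 28, 39, 49, 57, 68]),
  ([18, 25, 34, 79, 124, 139, 156, 236, 278, 357, 467, 689], [6, 17, 29, 38, 45, 48, 49, 58, 59]),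
  ([16, 25, 34, 78, 124, 135, 189, 238, 267, 369, 456, 479], [9, 17, 29, 37, 48, 57, 58, 59, 68]),
  ([15, 24, 68, 79, 126, 134, 189, 239, 257, 358, 367, 456, 478], [3, 17, 28, 49, 59, 69]),
  ([15, 26, 34, 79, 124, 138, 169, 235, 278, 367, 457, 468, 589], [8, 17, 29, 39, 49, 56]),
  ([15, 24, 67, 126, 134, 235, 278, 368, 379, 469, 589], [3, 8, 9, 17, 18, 19, 29, 45, 47, 48, 56,
   57]),
  ([15, 26, 34, 89, 124, 139, 178, 238, 257, 367, 456, 479], [7, 16, 29, 35, 48, 58, 59, 68, 69]),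
  ([16, 24, 79, 125, 134, 189, 239, 267, 357, 368, 456, 478], [3, 5, 8, 17, 28, 49, 58, 59, 69]),
  ([24, 35, 69, 78, 126, 137, 145, 189, 238, 257, 346, 479], [1, 29, 39, 48, 56, 58, 59, 67, 68]),
  ([15, 24, 78, 126, 134, 238, 257, 359, 367, 456, 479, 689], [3, 6, 9, 17, 18, 19, 29, 48, 58]),
  ([16, 24, 35, 78, 125, 134, 179, 239, 267, 368, 456, 589], [9, 18, 28, 37, 47, 48, 49, 57, 69]),
  ([15, 28, 34, 124, 137, 189, 235, 267, 369, 456, 479, 578], [6, 7, 9, 16, 29, 38, 48, 59, 68]),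
  ([15, 24, 37, 89, 126, 134, 178, 238, 257, 356, 459, 679], [6, 19, 29, 39, 46, 47, 48, 58, 68]),
  ([16, 24, 57, 89, 125, 134, 179, 239, 268, 358, 367, 478], [3, 18, 27, 45, 46, 49, 56, 59, 69])]

/-- Partial systems with instructions for a search. -/
def searchData₁ : List (PartialSystem × List ℕ) := [
  (([14, 25, 39, 127, 138, 246, 356, 479, 578, 689], [6, 15]), [7, 8, 16, 19, 23, 28, 29, 34, 37,
   45, 48, 59, 67, 649876543310]),
  (([15, 34, 79, 127, 136, 238, 259, 456, 489, 678], [2, 35]), [6, 8, 14, 18, 19, 24, 26, 37, 39,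
   47, 57, 58, 69, 649876543310]),
  (([15, 24, 38, 136, 178, 239, 257, 456, 489, 679], [26, 34]), [6, 7, 9, 12, 14, 19, 28, 35, 37,
   47, 58, 59, 68, 649876543310]),
  (([16, 34, 79, 128, 135, 237, 269, 456, 489, 578], [2, 14, 36]), [5, 8, 17, 19, 24, 25, 38, 39,
   47, 59, 67, 68, 649876543310]),
  (([14, 59, 78, 138, 169, 235, 247, 289, 346, 567], [2, 37, 45]), [3, 6, 12, 15, 17, 26, 39, 48,
   49, 58, 68, 79, 649876543310]),
  (([14, 27, 36, 139, 156, 238, 245, 478, 579, 689], [5]), [8, 9, 12, 17, 18, 26, 29, 34, 35, 37,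
   46, 49, 58, 67, 649876543310]),
  (([14, 25, 78, 127, 159, 236, 348, 379, 456, 689], [24]), [3, 6, 9, 13, 16, 18, 28, 29, 35, 47,
   49, 57, 58, 67, 649876543310]),
  (([14, 27, 56, 136, 158, 239, 245, 378, 479, 689], []), [3, 8, 9, 12, 17, 19, 26, 28, 34, 35,
   46, 48, 57, 59, 67, 649876543310]),
  (([14, 39, 56, 125, 138, 236, 278, 457, 489, 679], []), [2, 7, 8, 16, 17, 19, 24, 29, 34, 35,
   37, 46, 58, 59, 68, 649876543310]),
  (([17, 28, 39, 125, 134, 236, 456, 479, 578, 689], []), [4, 5, 6, 16, 18, 19, 24, 27, 29, 35,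
   37, 38, 48, 59, 67, 649876543310]),
  (([14, 25, 37, 126, 135, 234, 278, 369, 468, 479, 589], [56]), [6, 8, 9, 17, 18, 19, 29, 38, 45,
   57, 67, 649876543310]),
  (([15, 34, 78, 124, 138, 167, 237, 256, 289, 369, 459], [46]), [2, 6, 9, 19, 35, 47, 48, 57, 58,
   68, 79, 649876543310]),
  (([14, 39, 78, 125, 138, 236, 247, 289, 345, 469, 567], [17]), [2, 5, 6, 16, 19, 37, 48, 58, 59,
   68, 79, 649876543310]),
  (([25, 34, 89, 124, 136, 158, 239, 357, 456, 479, 678], [1]), [6, 7, 17, 19, 26, 27, 28, 38, 48,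
   59, 69, 649876543310]),
  (([17, 25, 34, 124, 156, 268, 358, 369, 467, 489, 579], [23]), [6, 8, 9, 13, 18, 19, 27, 29, 37,
   45, 78, 649876543310]),
  (([15, 24, 37, 126, 134, 239, 368, 458, 467, 569, 789], [25]), [6, 8, 9, 17, 18, 19, 27, 28, 35,
   49, 57, 649876543310]),
  (([26, 45, 79, 124, 138, 157, 237, 289, 349, 356, 678], [16]), [1, 3, 8, 19, 25, 46, 47, 48, 58,
   59, 69, 649876543310]),
  (([24, 37, 68, 126, 139, 145, 235, 289, 346, 478, 579], []), [1, 5, 9, 17, 18, 27, 38, 49, 56,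
   58, 67, 69, 649876543310]),
  (([14, 25, 67, 126, 135, 234, 289, 368, 379, 478, 569], []), [3, 8, 9, 17, 18, 19, 27, 45, 46,
   49, 57, 58, 649876543310]),
  (([14, 25, 89, 129, 136, 234, 267, 358, 379, 456, 478], [15]), [3, 6, 7, 17, 18, 28, 49, 57, 59,
   68, 69, 649876543310]),
  (([15, 34, 78, 124, 138, 169, 236, 257, 289, 379, 456], []), [2, 6, 9, 17, 35, 47, 48, 49, 58,
   59, 67, 68, 649876543310]),
  (([15, 26, 34, 124, 138, 235, 278, 379, 459, 467, 689], []), [7, 8, 9, 16, 17, 19, 29, 36, 48,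
   56, 57, 58, 649876543310]),
  (([24, 36, 57, 125, 138, 146, 269, 278, 345, 379, 489], [1, 56]), [8, 9, 17, 19, 23, 47, 58, 59,
   67, 68, 649876543310]),
  (([19, 24, 37, 125, 134, 178, 238, 267, 369, 456, 589], [6, 47]), [5, 8, 16, 29, 35, 48, 49, 57,
   68, 79, 649876543310]),
  (([14, 26, 79, 138, 157, 237, 245, 289, 349, 356, 678], [5, 16]), [3, 8, 12, 19, 46, 47, 48, 58,
   59, 69, 649876543310]),
  (([14, 25, 78, 156, 189, 234, 268, 357, 369, 459, 467], [27]), [3, 6, 9, 12, 13, 17, 29, 38, 48,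
   58, 79, 649876543310]),
  (([14, 39, 56, 125, 138, 234, 268, 279, 367, 457, 489], [7, 16]), [2, 8, 17, 19, 35, 46, 58, 59,
   69, 78, 649876543310]),
  (([24, 39, 68, 125, 137, 146, 189, 238, 279, 345, 567], [47]), [1, 5, 7, 26, 36, 48, 49, 58, 59,
   69, 78, 649876543310]),
  (([19, 27, 34, 124, 136, 235, 268, 378, 456, 489, 579], [58]), [5, 6, 8, 15, 17, 18, 29, 39, 47,
   67, 69, 649876543310]),
  (([24, 35, 78, 125, 137, 146, 189, 238, 267, 349, 569], [45]), [1, 6, 9, 29, 36, 47, 48, 57, 58,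
   68, 79, 649876543310]),
  (([19, 24, 67, 126, 134, 235, 368, 379, 456, 478, 589], [15]), [3, 5, 8, 17, 18, 27, 28, 29, 49,
   57, 69, 649876543310]),
  (([24, 56, 79, 125, 134, 167, 237, 289, 358, 369, 468], [1, 45]), [3, 8, 18, 19, 26, 47, 49, 57,
   59, 78, 649876543310]),
  (([15, 26, 34, 124, 138, 169, 239, 278, 367, 457, 589], [7, 46]), [8, 9, 17, 25, 35, 48, 49, 56,
   68, 79, 649876543310]),
  (([14, 37, 56, 125, 136, 234, 268, 279, 389, 459, 478], []), [2, 8, 9, 17, 18, 19, 35, 46, 57,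
   58, 67, 69, 649876543310]),
  (([25, 36, 47, 124, 138, 156, 179, 237, 268, 359, 489], [57]), [1, 8, 9, 29, 34, 45, 46, 58, 67,
   69, 78, 649876543310]),
  (([15, 26, 37, 124, 169, 279, 345, 368, 467, 489, 578], []), [4, 8, 9, 13, 17, 18, 23, 25, 28,
   39, 56, 59, 649876543310]),
  (([15, 24, 37, 126, 134, 178, 235, 279, 389, 468, 569], [45]), [6, 8, 9, 19, 28, 36, 47, 49, 57,
   58, 67, 649876543310]),
  (([17, 38, 45, 124, 135, 189, 239, 256, 278, 346, 679], []), [2, 6, 9, 16, 37, 47, 48, 49, 57,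
   58, 59, 68, 649876543310]),
  (([24, 37, 89, 126, 134, 158, 235, 279, 369, 456, 478], []), [1, 5, 6, 17, 19, 28, 38, 49, 57,
   59, 67, 68, 649876543310]),
  (([15, 26, 37, 124, 168, 238, 345, 369, 467, 489, 579], []), [4, 8, 9, 13, 17, 19, 25, 27, 29,
   56, 58, 78, 649876543310]),
  (([15, 24, 38, 126, 134, 178, 235, 289, 379, 469, 567], [45]), [6, 7, 9, 19, 27, 36, 47, 48, 58,
   59, 68, 649876543310]),
  (([24, 38, 67, 126, 137, 145, 189, 235, 278, 349, 569], [46]), [1, 5, 9, 29, 36, 47, 48, 57, 58,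
   68, 79, 649876543310]),
  (([18, 27, 45, 134, 179, 235, 246, 369, 378, 489, 567], []), [3, 6, 9, 12, 15, 16, 28, 29, 47,
   58, 59, 68, 649876543310]),
  (([14, 26, 57, 125, 138, 179, 234, 278, 359, 367, 456, 689], []), [3, 8, 9, 16, 29, 47, 48, 49,
   58, 649876543310]),
  (([26, 34, 79, 124, 135, 167, 189, 237, 258, 369, 456, 478], []), [1, 5, 8, 29, 38, 49, 57, 59,
   68, 649876543310]),
  (([15, 24, 38, 79, 126, 134, 178, 239, 257, 367, 456, 689], []), [6, 19, 28, 35, 47, 48, 49, 58,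
   59, 649876543310]),
  (([14, 26, 89, 125, 139, 167, 234, 279, 357, 368, 456, 478], []), [3, 5, 7, 18, 28, 49, 58, 59,
   69, 649876543310]),
  (([24, 56, 89, 127, 136, 145, 235, 269, 348, 379, 467, 578], []), [1, 3, 7, 18, 19, 28, 49, 59,
   68, 649876543310]),
  (([15, 27, 36, 126, 134, 189, 235, 248, 379, 467, 569, 578], [4]), [8, 9, 17, 29, 38, 45, 49,
   68, 649876543310]),
  (([16, 25, 34, 78, 124, 135, 179, 238, 267, 369, 456, 489], []), [9, 18, 29, 37, 47, 57, 58, 59,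
   68, 649876543310]),
  (([24, 37, 56, 128, 136, 145, 179, 235, 267, 349, 478, 689], []), [1, 8, 9, 29, 38, 46, 57, 58,
   59, 649876543310]),
  (([17, 24, 35, 125, 134, 189, 236, 279, 378, 458, 467, 569], [6]), [8, 9, 16, 28, 39, 49, 57,
   68, 649876543310]),
  (([18, 25, 34, 79, 124, 139, 156, 236, 278, 357, 467, 689], [45]), [6, 17, 29, 38, 48, 49, 58,
   59, 649876543310]),
  (([16, 25, 34, 78, 124, 135, 189, 238, 267, 369, 456, 479], []), [9, 17, 29, 37, 48, 57, 58, 59,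
   68, 649876543310]),
  (([15, 24, 68, 79, 126, 134, 189, 239, 257, 358, 367, 456, 478], []), [3, 17, 28, 49, 59, 69,
   649876543310]),
  (([15, 26, 34, 79, 124, 138, 169, 235, 278, 367, 457, 468, 589], []), [8, 17, 29, 39, 49, 56,
   649876543310]),
  (([15, 24, 67, 126, 134, 235, 278, 368, 379, 469, 589], [45]), [3, 8, 9, 17, 18, 19, 29, 47, 48,
   56, 57, 649876543310]),
  (([15, 26, 34, 89, 124, 139, 178, 238, 257, 367, 456, 479], []), [7, 16, 29, 35, 48, 58, 59, 68,
   69, 649876543310]),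
  (([16, 24, 79, 125, 134, 189, 239, 267, 357, 368, 456, 478], [5]), [3, 8, 17, 28, 49, 58, 59,
   69, 649876543310]),
  (([24, 35, 69, 78, 126, 137, 145, 189, 238, 257, 346, 479], [56]), [1, 29, 39, 48, 58, 59, 67,
   68, 649876543310]),
  (([15, 24, 78, 126, 134, 238, 257, 359, 367, 456, 479, 689], []), [3, 6, 9, 17, 18, 19, 29, 48,
   58, 649876543310]),
  (([16, 24, 35, 78, 125, 134, 179, 239, 267, 368, 456, 589], []), [9, 18, 28, 37, 47, 48, 49, 57,
   69, 649876543310]),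
  (([15, 28, 34, 124, 137, 189, 235, 267, 369, 456, 479, 578], []), [6, 7, 9, 16, 29, 38, 48, 59,
   68, 649876543310]),
  (([15, 24, 37, 89, 126, 134, 178, 238, 257, 356, 459, 679], [46]), [6, 19, 29, 39, 47, 48, 58,
   68, 649876543310]),
  (([16, 24, 57, 89, 125, 134, 179, 239, 268, 358, 367, 478], [45, 69]), [3, 18, 27, 46, 49, 56,
   59, 649876543310]),
  -- From here on, all partial systems contain the three triples 012, 034, 056 through the point 0.
  (([12, 34, 56, 169, 178, 268, 589], [13, 14, 36, 38, 46, 48]), [35, 39, 45, 47, 278617436020,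
   39, 45, 24, 278617346020]),
  (([12, 34, 56, 169, 178, 268, 489], [7, 9, 13, 14, 15, 36, 38, 46, 58, 67]), [24, 45, 35, 23,
   608741952460, 37, 587841259460, 45, 23, 25, 37, 57, 47, 23, 27, 35, 57]),
  (([12, 34, 56, 169, 178, 268, 458], [7, 8, 9, 13, 14, 36, 38, 46, 67, 89]), [24, 47, 37, 23,
   617914863350, 35, 609375604912, 47, 23, 35, 57, 27, 49, 23, 35, 59, 29]),
  (([12, 34, 56, 169, 178, 268, 357, 389, 458], [7, 9, 14, 23, 25, 46, 59, 67]), [24, 27, 47, 27,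
   47, 29, 49]),
  (([12, 34, 56, 169, 178, 259, 268, 357, 389, 458], [7, 14, 46]), [24, 47, 301067359042,
   531692058843]),
  (([12, 34, 56, 169, 178, 268, 389, 458], [7, 9, 13, 14, 15, 36, 46, 67]), [35, 23, 24, 47, 57,
   25, 564056289813, 25, 57, 373457069921, 23, 25, 59, 19876543310, 9876543310, 37, 57, 27,
   589347165920]),
  (([12, 34, 56, 169, 178, 268], [7, 8, 9, 13, 14, 15, 36, 46, 67]), [38, 48, 58, 59876543310, 58,
   49876543310, 89, 39876543310, 48, 58, 49876534310, 9876543310, 48, 89, 39876534310,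
   9876534310]),
  (([12, 34, 56, 169, 178, 468, 589], [7, 9, 13, 14, 26, 28, 36, 38, 67]), [35, 39, 25, 24,
   715879136340, 27, 47, 443271864690, 39, 29, 24, 45, 651976058523, 27, 47, 411865749420]),
  (([12, 34, 56, 169, 178, 289, 468], [7, 13, 15, 26, 36, 38, 58, 67]), [23, 39, 25, 45,
   669862371154, 57, 47, 550167594338, 39, 27, 47, 674785614002, 57, 45, 523507184396]),
  (([12, 34, 56, 169, 178, 258, 468], [7, 8, 9, 13, 14, 36, 38, 67, 89]), [23, 35, 27, 47,
   692569147930, 79, 49, 451063925578, 35, 29, 49, 716850342027, 79, 47, 487192543186]),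
  (([12, 34, 56, 169, 178, 389, 468], [7, 9, 13, 14, 15, 26, 28, 36, 58, 67]), [23, 35, 25, 24,
   704756091383, 27, 698349607612, 35, 25, 45, 722573890246, 57, 681867239604, 37, 27, 47,
   687128469450, 57, 746951708334]),
  (([12, 34, 56, 169, 178, 258, 357, 389, 468], [7, 9, 14, 23, 26, 45, 59, 67]), [24, 27, 47, 27,
   47, 29, 49]),
  (([12, 34, 56, 169, 178, 237, 258, 389, 468], [7, 9, 14, 15, 24, 29, 35, 67]), [45, 47, 57, 47,
   57, 49, 59]),
  (([12, 34, 56, 169, 178, 358, 379, 468], [8, 9, 14, 23, 26, 28, 36]), [27, 24, 732965083571, 25,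
   747382596501]),
  (([12, 34, 56, 169, 178, 238, 379, 468], [8, 9, 13, 15, 26, 35, 58]), [57, 25, 747825906243, 45,
   781798362550]),
  (([12, 34, 56, 169, 178, 238, 379, 468, 589], [7, 14, 15, 26, 29, 35, 49, 67]), [24, 25, 45, 25,
   45, 27, 47]),
  (([12, 34, 56, 169, 178, 468], [7, 8, 9, 13, 14, 15, 26, 36, 67]), [38, 28, 58, 89876543310, 58,
   79876543310, 89, 69876543310, 28, 58, 59876543310, 23, 35, 45, 59, 49876543310, 24, 27,
   500469385821, 489603124687, 35, 24, 29, 39876543310, 45, 57, 553052987246, 571930652587, 28,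
   89, 23, 37, 29876543310, 37, 29026453818, 39, 29, 49, 793749521960, 59, 786491780623, 23, 39,
   49, 59, 24, 25, 45, 25, 45, 27, 47, 24, 25, 537230469051, 671065498832, 39, 24, 25, 45, 47, 57,
   47, 57, 49, 59, 47, 57, 631063958374, 627912368550, 58, 89, 35, 37, 19876543310, 37,
   19051723568, 39, 59, 29, 748731692145, 49, 773742956910, 35, 39, 29, 49, 9876543310, 25, 27,
   45, 485617029043, 520167529934, 39, 25, 45, 37893421750, 27, 47, 670169854472, 607913048356]),
  (([12, 34, 56, 169, 178, 268, 389, 459, 467], [7, 13, 15, 24, 29, 36, 58, 79]), [23, 25, 35, 25,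
   35, 27, 37]),
  (([12, 34, 56, 169, 178, 268, 358, 459, 467], [7, 9, 13, 24, 25, 36, 57, 89]), [23, 27, 37, 27,
   37, 29, 39]),
  (([12, 34, 56, 169, 178, 249, 268, 467], [13, 15, 23, 25, 36, 45]), [37, 57, 38, 58]),
  (([12, 34, 56, 169, 178, 268, 467, 489], [13, 15, 36, 38, 45, 58]), [23, 25, 35, 25, 35, 37,
   57]),
  (([12, 34, 56, 169, 178, 268, 467, 489], [7, 9, 13, 14, 15, 24, 36, 45]), [38, 58, 9876543310,
   23, 37, 27, 25, 587410259963, 550258177043, 25, 57, 570537469012, 597150386394, 25, 57,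
   601046879623, 615961738340]),
  (([12, 34, 56, 169, 178, 245, 268, 467, 489], [9, 13, 36, 38]), [23, 35, 79, 303502794781, 35,
   711876942153]),
  (([12, 34, 56, 169, 178, 245, 268, 358, 467, 489], [7, 9, 13, 36, 57, 59]), [23, 37,
   502501978743, 27, 37, 29, 39]),
  (([12, 34, 56, 169, 178, 268, 458, 467], [9, 13, 36, 38, 49, 89]), [23, 35, 59, 29, 35, 29, 37]),
  (([12, 34, 56, 169, 178, 268, 389, 458, 467], [7, 9, 13, 15, 24, 36, 49]), [23, 35, 25, 27,
   513059168824, 333478095721, 35, 25, 57, 571239048865, 631973462950, 37, 27, 29, 57,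
   553427908751, 567913462950]),
  (([12, 34, 56, 169, 178, 249, 268, 458, 467], [9, 13, 36, 38]), [23, 35, 615873906341, 37,
   561895072563]),
  (([12, 34, 56, 169, 178, 249, 268, 389, 458, 467], [7, 9, 13, 15, 36, 59, 79]), [23, 35,
   763574069021, 25, 35, 27, 37]),
  (([12, 34, 56, 169, 178, 268, 467], [7, 8, 9, 13, 14, 15, 36]), [48, 24, 45, 58, 89, 29, 79,
   109876543310, 23, 35, 543058269814, 714350769381, 89, 25, 57, 99876543310, 23, 37,
   513820497751, 633874092751, 45, 27, 23, 25, 89876543310, 37, 38, 57, 630183457027, 38, 58,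
   810185346397, 23, 37, 35, 608501342779, 25, 57, 35, 695810346379, 49, 27, 23, 29, 37, 35, 59,
   79, 37, 38, 89, 57, 637401895363, 38, 79, 58, 773405763081, 23, 37, 38, 540351872794, 29, 79,
   39, 519543816370, 24, 45, 69876543310, 38, 59876543310, 57, 59, 49876543310, 37, 23,
   323024895771, 481068357529, 24, 49, 38, 89, 39876543310, 29876543310, 38, 19876543310, 59, 79,
   9876543310, 35, 23, 290543218086, 301067598523]),
  (([12, 34, 56, 169, 178, 467], [7, 8, 9, 13, 14, 15, 36]), [68, 26, 129786543310, 9876543310]),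
  (([12, 34, 56, 169, 178, 267], [7, 8, 9, 13, 14, 15, 36]), [46, 68, 239786543310, 19786543310]),
  (([12, 34, 56, 169, 178, 279, 359, 368, 467], [8, 14, 15, 23, 26, 57]), [49, 89, 128046172639,
   24, 25, 650358496812, 568374169602]),
  (([12, 34, 56, 169, 178, 257, 359, 368, 467], [8, 9, 14, 23, 26, 79]), [45, 58, 24, 28, 48, 28,
   48, 29, 49, 24, 28, 847204368691, 718106454072]),
  (([12, 34, 56, 169, 178, 239, 368, 467], [7, 8, 9, 14, 15, 26, 35, 37]), [27, 79, 5436987301,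
   79, 24, 28, 218641093672, 45, 58, 664732158790, 668372094751]),
  (([12, 34, 56, 169, 178, 235, 368, 467], [7, 8, 9, 14, 15, 26, 37, 39]), [27, 57, 25436987301,
   57, 24, 28, 304680197632, 45, 58, 847948621630, 843584621071]),
  (([12, 34, 56, 169, 178, 235, 368, 379, 467], [9, 14, 15, 26, 27, 57]), [24, 28, 48, 45,
   607483169602, 644783169602, 45, 58, 874217864050, 89, 725081793562, 45, 58, 892054138779,
   862187643690]),
  (([12, 34, 56, 169, 178, 368, 379, 467], [8, 9, 13, 14, 15, 26]), [23, 35, 148796512530, 27, 57,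
   9876543310]),
  (([12, 34, 56, 169, 178, 237, 368, 467], [9, 15, 35, 39, 57, 79]), [25, 45, 49, 29, 45, 29, 49]),
  (([12, 34, 56, 169, 178, 237, 368, 467, 579], [8, 9, 13, 14, 15, 26, 35]), [25, 45, 24, 28,
   892034679051, 765891246830, 45, 24, 48, 740529168843, 714936517380, 58, 28, 48, 922053147789,
   888937621640]),
  (([12, 34, 56, 169, 178, 237, 368, 467], [8, 9, 13, 14, 15, 26, 35, 39]), [57, 79, 19876543310,
   9876543310]),
  (([12, 34, 56, 169, 178, 368, 467], [7, 8, 9, 13, 14, 15, 26]), [37, 23, 35, 57, 79,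
   89876543310, 79, 79876543310, 35, 69876543310, 39, 59876543310, 39876543310, 35436987301, 35,
   39, 9876543310, 79, 15436987301]),
  (([12, 34, 56, 169, 178, 368], [7, 8, 9, 13, 14, 15]), [46, 119786534310, 26, 9876543310, 67,
   125436987301]),
  (([12, 34, 56, 169, 178], [7, 8, 9, 13, 14, 15]), [36, 67, 46, 68, 359876543310, 26,
   259876543310, 68, 355436987301, 129876543310, 119876543310, 9876543310, 9786543310, 67,
   115436987301, 68, 135346978301])]

/-- Partial systems with instructions for a search. -/
def searchData₂ : List (PartialSystem × List ℕ) := [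
  (([12, 34, 56, 149, 168, 267, 458], [7, 9, 13, 17, 36, 47, 69]), [57, 78, 35, 23, 1054185790462,
   39, 29, 711064932957, 78, 38, 23, 991986542830, 39, 29, 671604392957]),
  (([12, 34, 56, 149, 168, 248, 267], [13, 15, 23, 25, 36, 45]), [35, 37, 57, 37, 57, 38, 58]),
  (([12, 34, 56, 149, 168, 239, 248, 267], [7, 15, 17, 25, 45, 47]), [35, 37, 58, 78]),
  (([12, 34, 56, 149, 168, 235, 248, 267], [7, 9, 17, 29, 47, 69]), [37, 57, 59, 39]),
  (([12, 34, 56, 149, 168, 248, 267], [7, 9, 13, 15, 17, 36, 45, 47, 69]), [23, 25, 29876543310,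
   35, 57, 38, 78, 25, 19876543310, 29, 9876543310]),
  (([12, 34, 56, 149, 168, 248, 267, 457], [9, 13, 23, 29, 36, 69]), [35, 37, 79, 59]),
  (([12, 34, 56, 149, 168, 248, 267], [7, 8, 9, 13, 15, 17, 36, 69]), [47, 45, 19876543310, 25,
   23, 29, 9876543310, 35, 37, 58, 873975624910, 37, 78, 940619782535, 23, 35, 37, 846791805523,
   29, 59, 39, 1026730185349]),
  (([12, 34, 56, 149, 168, 267], [7, 8, 9, 13, 15, 17, 36, 46, 69]), [24, 47, 45, 69876543310, 45,
   392651987404, 48, 392680358014, 9876543310, 3576849301]),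
  (([12, 34, 56, 149, 168, 237, 248, 269, 457, 789], [13, 36]), [38, 35, 768714692450,
   807924681450]),
  (([12, 34, 56, 149, 168, 237, 245, 269, 478, 579], [8, 13, 36]), [35, 38, 820517365028,
   1066190825537]),
  (([12, 34, 56, 149, 168, 269], [7, 8, 9, 13, 15, 17, 36, 67]), [24, 47, 45, 452651987404, 48,
   442680358014, 47, 27, 78, 19876543310, 45, 48, 58974365310, 23, 47986543220, 78, 37,
   787932584260, 57, 37, 89, 1050683742691, 47, 27, 57, 9876543310]),
  (([12, 34, 56, 149, 168, 369, 378], [7, 8, 13, 15, 17, 26, 67]), [23, 35, 445126987503, 27, 47,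
   24, 28, 48, 58, 901407293686, 89, 906917834350, 571603879525, 57, 28, 89, 48, 932184358006, 58,
   821046853037, 696103789552]),
  (([12, 34, 56, 149, 168, 267, 357, 369, 789], [8, 15, 23, 38, 46, 47]), [29, 59, 24, 25, 45, 25,
   45, 28, 48, 24, 45, 794810239667, 807852396240]),
  (([12, 34, 56, 149, 168, 267, 357, 369, 478], [7, 8, 9, 15, 23, 38, 79]), [24, 45, 432651987404,
   28, 58, 989813254770, 1068172469153]),
  (([12, 34, 56, 149, 168, 238, 267, 369], [7, 15, 17, 25, 35, 37]), [45, 47, 58, 78]),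
  (([12, 34, 56, 149, 168, 238, 267, 357, 369], [7, 15, 17, 24, 25, 29, 46]), [45, 47, 58,
   994950123787, 47, 78, 824501293967]),
  (([12, 34, 56, 149, 168, 269, 358, 367, 789], [7, 15, 17, 23, 46, 59]), [28, 48, 24, 25, 45, 25,
   45, 27, 47, 25, 45, 819247568410, 849716482630]),
  (([12, 34, 56, 149, 168, 238, 269, 367], [7, 15, 17, 25, 27, 35]), [45, 47, 58, 78]),
  (([12, 34, 56, 149, 168, 238, 257, 269, 367], [7, 15, 17, 24, 35, 46]), [45, 47, 58,
   939105436387, 47, 78, 1009438627610]),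
  (([12, 34, 56, 149, 168, 235, 269, 367], [7, 8, 17, 27, 28, 38]), [47, 57, 58, 48]),
  (([12, 34, 56, 149, 168, 235, 269, 367, 389], [7, 9, 17, 79]), [27, 47, 1008974506331, 57,
   1164750193368]),
  (([12, 34, 56, 149, 168, 235, 269, 367, 389, 579], [7, 8, 17, 45, 46, 58]), [24, 47,
   1085207486491, 27, 47, 28, 48]),
  (([12, 34, 56, 149, 168, 235, 269, 367, 389, 579], [7, 8, 17, 46]), [45, 58, 9876543310, 47, 27,
   681405978723, 78, 781048654027]),
  (([12, 34, 56, 149, 168, 269, 359, 367], [7, 8, 17, 38, 79, 89]), [27, 47, 48, 28, 47, 28, 48]),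
  (([12, 34, 56, 149, 168, 269, 359, 367, 789], [7, 15, 17, 23, 46]), [27, 47, 24, 25,
   1137349805721, 898267349610, 47, 24, 45, 954180329667, 967826491630, 57, 25, 28, 45,
   1095308296571, 1120418792753]),
  (([12, 34, 56, 149, 168, 238, 269, 359, 367], [7, 9, 17, 79]), [27, 47, 1044015932778, 57,
   1034781903725]),
  (([12, 34, 56, 149, 168, 238, 269, 359, 367, 789], [7, 15, 17, 46, 48, 58]), [24, 45,
   1161407237085, 25, 45, 27, 47]),
  (([12, 34, 56, 149, 168, 238, 269, 359, 367, 789], [7, 15, 17, 46]), [48, 58, 9876543310, 47,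
   27, 850416735929, 865049318367]),
  (([12, 34, 56, 149, 168, 269, 367], [7, 8, 9, 13, 15, 17, 46]), [39, 23, 35, 59, 89,
   119876543310, 89, 25, 45, 530386214859, 27, 47, 1213705469021, 1011907846623, 35, 24, 25, 27,
   109876543310, 99876543310, 25, 45, 57, 1049176082535, 27, 47, 57, 1133870926515, 38, 24, 27,
   28, 89876543310, 47, 48, 89, 57, 1074817956330, 48, 79, 58, 1221403526979, 27, 47, 78,
   931960542487, 28, 48, 78, 1213072645298, 23, 35, 317896521530, 79, 79876543310, 59876543310,
   23, 38, 79, 89, 49876543310, 39876543310, 79, 29876543310, 9876543310]),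
  (([12, 34, 56, 149, 168, 259, 278, 467], [8, 9, 13, 15, 23, 36, 45]), [57, 58, 37,
   1321659237940, 38, 1331824766030]),
  (([12, 34, 56, 149, 168, 258, 279, 467], [7, 9, 13, 15, 23, 26, 36, 45]), [57, 59, 37,
   1344731866020, 38, 1364938612850]),
  (([12, 34, 56, 149, 168, 257, 289, 467], [7, 13, 15, 23, 36, 45]), [58, 59, 37, 1344659328810,
   37, 1365860432819]),
  (([12, 34, 56, 149, 168, 238, 467], [7, 8, 9, 13, 15, 17, 24, 26, 36, 45, 48, 69]), [25, 27,
   28974365310, 27, 35, 39, 57, 1372910653947, 39, 78, 1382186505073, 29, 23576849301]),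
  (([12, 34, 56, 149, 168, 357, 458, 467], [9, 24, 25, 26, 59, 69]), [23, 27, 79, 39]),
  (([12, 34, 56, 149, 168, 235, 458, 467], [7, 9, 17, 57, 59, 69]), [27, 37, 39, 29]),
  (([12, 34, 56, 149, 168, 458, 467], [7, 9, 13, 15, 17, 24, 26, 36, 69]), [25, 35, 57,
   588794312750, 57, 23, 37, 28, 78, 59, 19876543310, 35, 57, 209874321750, 23, 27, 38,
   1186753918520, 27, 39, 78, 1266753218590, 35, 59, 177894321750, 23, 29, 37, 1167360185592, 29,
   37, 78, 1186789305521, 57, 59, 9876543310, 27, 29, 37, 1232197648630, 37, 38, 1167961058532]),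
  (([12, 34, 56, 149, 168, 269, 458, 467], [7, 8, 9, 13, 15, 17, 24, 36]), [25, 28, 23,
   207986534220, 23, 38, 35, 1283574069012, 27, 78, 37, 1262307146995, 23, 35, 37, 1141872094663,
   35, 37, 1129172806553, 37, 78, 850329785741, 27, 57, 37, 1321879204753, 38, 89, 37,
   1215038962517, 37, 57, 840351769042]),
  (([12, 34, 56, 149, 168, 248, 269, 467], [13, 15, 23, 25, 36, 45]), [35, 37, 57, 37, 57, 38,
   58]),
  (([12, 34, 56, 149, 168, 248, 257, 269, 467], [8, 9, 13, 23, 36]), [35, 37, 1173051946387, 37,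
   1209384621175]),
  (([12, 34, 56, 149, 168, 235, 248, 269, 467], [7, 9, 17, 27]), [37, 57, 89, 1065037982741, 57,
   89, 1105307982741]),
  (([12, 34, 56, 149, 168, 248, 269, 467], [7, 8, 9, 13, 15, 17, 36, 45]), [23, 25, 29876543310,
   19876543310, 25, 18974365310, 27, 9876543310]),
  (([12, 34, 56, 149, 168, 245, 269, 467], [7, 8, 13, 17, 23, 27, 28, 36, 48]), [35, 37, 57, 37,
   57, 38, 58]),
  (([12, 34, 56, 149, 168, 245, 269, 278, 467], [8, 9, 13, 15, 23, 36]), [37, 35, 1179781356340,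
   38, 1368375426209]),
  (([12, 34, 56, 149, 168, 238, 245, 269, 467], [7, 9, 13, 17, 27]), [37, 57, 1278503792561, 78,
   1321982076553]),
  (([12, 34, 56, 149, 168, 245, 269, 467], [7, 8, 9, 13, 15, 17, 36, 48]), [23, 27, 28,
   29876543310, 19876543310, 27, 9876543310, 28, 15374968301]),
  (([12, 34, 56, 149, 168, 269, 467], [7, 8, 9, 13, 15, 17, 36]), [24, 45, 48, 97981265440,
   89876543310, 45, 49876543310, 48, 9876543310]),
  (([12, 34, 56, 149, 168, 369, 458, 467], [7, 8, 9, 13, 15, 17, 24, 26]), [35, 38, 23,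
   277986521530, 23, 28, 25, 1217503214789, 37, 78, 27, 1287218469450, 23, 25, 27, 1287205464081,
   25, 27, 1287203645991, 27, 78, 1072196748630, 37, 57, 27, 1217819204753, 28, 27, 1217918206535,
   27, 57, 1062185649470]),
  (([12, 34, 56, 149, 168, 369, 467], [7, 8, 9, 13, 15, 17, 26]), [24, 45, 48, 118974365310,
   9876543310, 45, 108974365310, 48, 105374968301]),
  (([12, 34, 56, 149, 168, 246, 478], [7, 9, 13, 15, 17, 36, 45, 67, 69]), [27, 37, 23, 39, 59,
   25, 1379734158360, 25, 58, 1420537842296, 37, 23, 35, 59, 29, 1380359682517, 35, 58,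
   1409738524260, 57, 25, 35, 39, 29, 1281695732580, 35, 38, 999734518360]),
  (([12, 34, 56, 149, 168, 246], [7, 8, 9, 13, 15, 17, 36, 67, 69]), [47, 45, 9876543310, 48,
   3576849301]),
  (([12, 34, 56, 149, 168, 246, 278, 357, 458, 679], [8, 13, 36, 59]), [23, 38, 1467219356940,
   1383791862505]),
  (([12, 34, 56, 149, 168, 246, 458, 679], [7, 8, 13, 17, 36, 47]), [57, 78, 59, 9876543310, 23,
   38, 1143058169347, 78, 89, 23, 35, 1297203896551, 35, 1320158724793, 23, 35, 981042896673]),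
  (([12, 34, 56, 149, 168, 246, 257, 478, 679], [9, 13, 36, 37]), [23, 35, 89, 1350149756383, 35,
   1331803564379]),
  (([12, 34, 56, 149, 168, 246, 478, 679], [7, 8, 9, 13, 15, 17, 36, 45]), [27, 37, 23, 38, 28,
   25, 1408731029565, 1433051768592, 25, 58, 1435031749782, 89, 1440149756383, 25, 58,
   1409751028743, 1417591026583, 37, 9876543310, 57, 8974365310]),
  (([12, 34, 56, 149, 168, 246, 278, 457, 679], [8, 13, 36, 37]), [23, 35, 1359178542703, 38,
   1519871364305]),
  (([12, 34, 56, 149, 168, 246, 457, 679], [7, 8, 13, 15, 17, 36, 48]), [27, 37, 23, 35, 25, 28,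
   1257538217040, 89, 1471206855073, 35, 25, 58, 1470214396678, 1389120576583, 28, 58,
   1257983204661, 1270164829637, 37, 9876543310, 78, 5374968301]),
  (([12, 34, 56, 149, 168, 246, 679], [7, 8, 9, 13, 15, 17, 36]), [47, 45, 48, 78974365310,
   49876543310, 45, 29876543310, 48, 9876543310]),
  (([12, 34, 56, 149, 168, 246, 369], [7, 8, 9, 13, 15, 17, 67]), [47, 45, 58974365310, 48,
   55374968301]),
  (([12, 34, 56, 149, 168], [7, 8, 9, 13, 15, 17]), [46, 36, 69, 26, 509876543310, 26,
   848971243660, 67, 479876543310, 26, 67, 37, 469876543310, 23, 38, 578973412660, 27, 47, 24, 25,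
   45, 58, 1405023987561, 89, 1405683428001, 1161604789425, 78, 25, 59, 45, 1256910258447, 58,
   1251406583037, 1126103759582, 464270593916, 23, 37, 35, 47, 57, 45, 24, 25, 28, 1332147039065,
   89, 1342704985731, 1140163498627, 78, 24, 28, 25, 1424381029757, 29, 1433509284771,
   1173068519347, 35, 679876521530, 38, 47, 79, 459876543310, 79, 449876543310, 37, 35, 25,
   439876543310, 79, 47, 1407439268250, 47, 57, 1347856312509, 24, 25, 29, 429876543310, 45, 47,
   1407493265181, 47, 78, 1124105738792, 29, 47, 78, 1267582936141, 79, 59, 1179165803347, 37, 38,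
   28, 47, 57, 58, 48, 79, 47, 1354812769630, 47, 78, 1515072463289, 24, 28, 47, 48, 89, 57,
   1402196537904, 48, 79, 58, 1332047195468, 48, 45, 79, 1354502763991, 47, 57, 1164105798732, 29,
   47, 57, 89, 1530495762481, 79, 59, 1141069435927, 69, 26, 845370249961, 299876543310, 69, 67,
   473576849301, 293576849301, 36, 69, 26, 24, 45, 48, 23, 25, 27, 289876543310, 27, 279876543310,
   28, 269876543310, 25, 27, 278974365310, 27, 35, 38, 57, 1646759143920, 78, 1565327986510, 28,
   275374968301, 259876543310, 259786512440, 27, 28, 38, 39, 57, 1578761059532, 39, 57,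
   1637564193902, 28, 265374968301, 29, 263576849301, 229876543310, 45, 227891243660, 48,
   229230547916, 129876543310, 26, 109876543310, 69, 123576849301, 36, 69, 67, 89876543310,
   19876543310, 67, 9876543310, 69, 13576849301]),
  (([12, 34, 56, 149], [7, 8, 9, 13, 15]), [16, 17, 599874365310, 17, 9876543310, 18, 9786543310]),
  (([12, 34, 56, 146, 189, 247, 359, 578], [7, 8, 9, 13, 17, 25, 48, 49]), [79, 29, 67, 68, 28,
   1335794086331, 29, 37, 23, 26, 36, 1617568239240, 28, 38]),
  (([12, 34, 56, 146, 189, 247, 259], [7, 8, 9, 13, 15, 17, 45, 48, 49]), [26, 28, 23, 58, 35, 38,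
   37, 1625728639204, 57, 68, 37, 1685863709512, 58, 35, 78, 79, 39, 1464017936358, 35, 68,
   853572047081, 23, 58, 35, 38, 35, 38, 57, 78, 28, 68, 58, 57, 37, 1589875132704]),
  (([12, 34, 56, 146, 189, 249, 368, 679], [7, 15, 17, 45, 47, 59]), [35, 25, 27, 37]),
  (([12, 34, 56, 146, 189, 249, 268, 679], [7, 13, 15, 17, 36, 39, 45, 47, 59]), [23, 25, 27]),
  (([12, 34, 56, 146, 189, 237, 249, 369, 579, 678], [15, 45]), [25, 35, 1387851237040,
   1577839265240]),
  (([12, 34, 56, 146, 189, 249], [7, 8, 9, 13, 15, 17, 45, 47, 48]), [59, 69, 39, 35, 57, 78, 26,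
   1663895067341, 1370532867519, 57, 27, 28, 38, 1335072863519, 39, 26, 36, 633289705246,
   29876543310, 36, 19876543310, 68, 10356718349, 79, 69, 39, 1066031857349, 67, 27, 9876543310,
   68, 37, 28, 35, 1318143752790, 79, 57, 27, 28, 38, 1512140739785, 1521408572793, 58, 37, 28,
   1423756829240]),
  (([12, 34, 56, 146, 189, 238, 247, 357, 459, 678], [7, 9, 79]), [29, 39, 1378271903745,
   1625910376528]),
  (([12, 34, 56, 146, 189, 235, 247, 368, 459, 578], [7, 17, 29]), [37, 67, 1338301975562,
   1441063254898]),
  (([12, 34, 56, 146, 189, 235, 247, 268, 459, 578], [7, 9, 13, 17, 29, 38]), [36, 37,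
   1363072945718, 37, 67, 39, 69]),
  (([12, 34, 56, 146, 189, 459], [7, 8, 9, 13, 15, 17, 48]), [24, 47, 585370298741, 25, 57, 58,
   78, 28, 37, 23, 26, 1658127357040, 1645910263578, 35, 28, 38, 23, 26, 37, 1478127536590, 37,
   67, 1472750139748, 38, 23, 36, 1539105874723, 68, 26, 29, 960462376018, 36, 37, 1358165732590,
   1441950876523, 58, 78, 79, 28, 29876543310, 57, 35, 78, 38, 37, 23, 1513914260678, 67, 36, 23,
   1470376513048, 1488590124737, 78, 38, 67, 23, 1538972105563, 1280163486027, 38, 79, 23, 36,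
   1368721095743, 1366018974623, 29, 39, 57, 58, 28, 38, 67, 1429170584363, 28, 38, 29,
   19876543310, 67, 37, 1141860342697, 29, 38, 9876543310]),
  (([12, 34, 56, 146, 189, 249, 278, 358, 457], [7, 9, 13, 17, 23, 26, 59, 68]), [36, 37, 67, 37,
   67, 39, 69]),
  (([12, 34, 56, 146, 189, 235, 249, 278, 368, 457], [7, 17]), [37, 67, 1640514263898,
   1587985602441]),
  (([12, 34, 56, 146, 189, 249, 359, 457, 679], [8, 13, 48, 58]), [68, 28, 1458715326590, 38,
   1427538127040]),
  (([12, 34, 56, 146, 189, 249, 258, 359, 457], [7, 9, 17, 79]), [27, 37, 1463796084351, 67,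
   1446108794623]),
  (([12, 34, 56, 146, 189, 249, 258, 359, 457, 679], [7, 8, 17, 48]), [26, 27, 37, 1700376125598,
   78, 38, 1301860253597, 27, 37, 1371824756490]),
  (([12, 34, 56, 146, 189, 249, 457], [7, 8, 9, 13, 15, 17, 48]), [59, 25, 58, 28, 68, 26, 27, 79,
   39, 1482095713748, 27, 37, 1430523164889, 68, 23, 26, 49876543310, 37, 67, 1528974162135,
   1459781064335, 78, 27, 67, 1700581924773, 35, 23, 27, 407630149952, 68, 78, 36, 1501930874725,
   37, 1598103976525, 38, 39, 79, 67, 1605780942731, 78, 67, 1519712534708, 27, 38, 39, 67,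
   1428579316340, 67, 1571832460697, 58, 28, 38, 39876543310, 27, 38, 67, 1431094826637, 58, 79,
   937064218459, 29876543310, 79, 19876543310, 9876543310]),
  (([12, 34, 56, 146, 189, 245, 357], [7, 8, 9, 17, 47, 48, 49, 58, 59]), [38, 39, 28, 67,
   1417925463181, 39, 29, 67, 1417965023581]),
  (([12, 34, 56, 146, 189, 245, 369, 579], [7, 8, 17, 47, 48, 58]), [37, 27, 28, 38]),
  (([12, 34, 56, 146, 189, 245, 579], [7, 8, 9, 13, 17, 35, 47, 48, 49, 58]), [29, 39, 9876543310,
   39, 23, 27, 28, 9872503714]),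
  (([12, 34, 56, 146, 189, 237, 245, 359, 578, 679], [8, 48]), [28, 38, 1482147963680,
   1498791402753]),
  (([12, 34, 56, 146, 189, 245, 359, 578], [7, 8, 17, 47, 48]), [79, 27, 9876543310, 37,
   9872503714]),
  (([12, 34, 56, 146, 189, 245], [7, 8, 9, 13, 15, 17, 47, 48, 49]), [58, 59, 35, 49876543310, 35,
   29876543310, 57, 59, 35, 28976543310, 9876543310, 57, 8976543310]),
  (([12, 34, 56, 146, 189, 245, 269, 359, 479], [7, 8, 17, 48, 57, 58]), [27, 37, 38, 28]),
  (([12, 34, 56, 146, 189, 245, 269, 359, 479, 578], [7, 8, 17, 48]), [27, 67, 68, 28,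
   1461826734690, 28, 38, 1307895243701]),
  (([12, 34, 56, 146, 189, 245, 479], [7, 8, 9, 13, 15, 17, 48]), [59, 29, 69, 26, 67, 68,
   815379802561, 27, 28, 58, 35, 1737983516502, 57, 35, 1358973156502, 67, 27, 57, 1559738154720,
   68, 28, 58, 1638390126557, 39, 23, 27, 28, 35, 57, 58, 57, 58, 36, 1618976142153, 36,
   1710531894727, 27, 35, 36, 57, 1661852640497, 67, 1743871564309, 35, 36, 57, 1638370562519, 57,
   67, 1640518974363, 69, 26, 27, 28, 507352046991, 57, 58, 68, 36, 1766054123898, 67, 36,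
   1748615942470, 27, 67, 57, 1519378514360, 28, 68, 58, 1665816240479, 69, 57, 58, 1062064718459,
   916204735919, 57, 58, 19876543310, 9876543310]),
  (([12, 34, 56, 146, 189, 249, 258, 267, 368, 478], [7, 9, 13, 15, 17, 23, 45, 69]), [35, 37, 57,
   37, 57, 39, 59]),
  (([12, 34, 56, 146, 189, 249, 478], [7, 8, 9, 13, 15, 17, 45]), [58, 28, 68, 67, 825378902561,
   59, 25, 1575032717048, 25, 57, 37, 1598170396345, 38, 25, 23, 35, 36, 1817598146303, 27, 57,
   37, 1541086924457, 68, 25, 26, 35, 357352047081, 28, 68, 25, 59, 39, 69, 157532046991, 23, 37,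
   26, 1828127535060, 1591267809445, 59, 23, 26, 1131490638825, 37, 67, 1660318976345,
   1569781602535, 25, 59, 27, 37, 1567359124960, 69, 1635734928260, 1315037489361, 23, 59,
   648792134750, 68, 38, 26, 23, 27, 666374958202, 35, 36, 57, 1836013549378, 36, 67,
   1677835049316, 23, 36, 35, 1823910574728, 27, 67, 37, 1765871346309, 26, 27, 67, 37,
   1739127534960, 35, 57, 1813657924910, 57, 67, 1340145739926, 23, 69, 9876543310])]

/-- Partial systems with instructions for a search. -/
def searchData₃ : List (PartialSystem × List ℕ) := [
  (([12, 34, 56, 146, 189, 235, 459, 478], [7, 8, 17, 57, 58]), [28, 38, 37, 27, 1539501873742,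
   27, 37, 1800316245889]),
  (([12, 34, 56, 146, 189, 239, 257, 268, 358, 459, 478], [7, 17]), [37, 67, 1360163759024,
   1441940235787]),
  (([12, 34, 56, 146, 189, 459, 478], [7, 8, 9, 13, 15, 17, 24]), [58, 57, 25, 19876543310, 25,
   38, 28, 23, 27, 36, 1591820534797, 27, 67, 1768127357040, 28, 23, 26, 1739872103745, 68,
   763754621081, 35, 28, 38, 23, 26, 37, 1620158325067, 37, 67, 1682308194775, 38, 23, 36,
   1658712356509, 68, 753754621081, 57, 25, 28, 1077534603081, 151273849705, 28, 68,
   1067534603081, 23, 29, 36, 37, 1752160758593, 37, 67, 39, 69, 9876543310, 57, 35, 38,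
   655734621081, 631374928705, 38, 68, 645734621081, 23, 39, 202196857503, 27, 67, 1491286539570,
   79, 1480145693927]),
  (([12, 34, 56, 146, 189, 249, 458], [7, 13, 15, 17, 47]), [59, 25, 35, 79, 39, 27, 23, 36,
   1601920356587, 1770351896527, 35, 79, 39, 37, 23, 1698570342719, 67, 233752046991, 57, 35, 39,
   1083124897705, 1063124897705, 69, 175732046991, 37, 27, 1351840562497, 57, 79, 37, 26,
   1680381266047, 1353057698341, 1377893265501]),
  (([12, 34, 56, 146, 189], [7, 8, 9, 13, 15, 17]), [48, 45, 49, 24, 25, 58, 59, 309876543310, 57,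
   308976543310, 299876543310, 298976543310, 28, 58, 59, 29, 68, 67, 37, 1647590482731, 29, 59,
   69, 67, 37, 1647580492731, 24, 837350298741, 47, 259876543310, 219876543310, 49, 24,
   1273570298741, 159876543310, 49, 47, 99876543310, 69876543310, 45, 49, 24, 837350289741,
   49876543310, 24, 19876543310, 49, 68976543310, 49, 218976543310, 24, 18976543310, 47,
   9876543310, 45, 49, 47, 258976543310, 48976543310, 47, 8976543310, 49, 158976543310]),
  (([12, 34, 56, 146], [7, 8, 9, 13, 15]), [17, 18, 9876543310, 18, 9786543310, 19, 8796543310]),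
  (([12, 34, 56, 148, 159, 167, 235, 247, 368, 469], [8, 9, 28, 29]), [39, 79, 1795302916587, 89,
   58, 1482051897743]),
  (([12, 34, 56, 148, 159, 167, 235, 247, 289, 368, 379, 469], [8]), [78, 1495036789512,
   1460614598832]),
  (([12, 34, 56, 148, 159, 167, 239, 247, 268, 469, 789], [13, 36]), [37, 35, 1495301769384,
   1530532862047]),
  (([12, 34, 56, 148, 159, 167, 239, 247, 268, 469], [7, 8, 13, 25, 36, 45]), [79, 89, 35, 37, 57,
   37, 57, 38, 58, 9876543310]),
  (([12, 34, 56, 148, 159, 167, 235, 247, 268, 469], [7, 8, 9, 13, 29, 36, 57, 58]), [37, 38, 78,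
   38, 78, 39, 79]),
  (([12, 34, 56, 148, 159, 167, 235, 247, 268, 469], [7, 8, 9, 13, 29, 36]), [57, 58, 9876543310,
   37, 79, 38, 1570351296947, 1543950461378]),
  (([12, 34, 56, 148, 159, 167, 247, 268, 469], [7, 8, 9, 13, 36, 45]), [25, 23, 607896543220,
   29876543310, 29, 9876543310]),
  (([12, 34, 56, 148, 159, 167, 236, 247, 469], [8, 9, 28, 68]), [58, 38, 1735792086513, 78,
   1687296841135]),
  (([12, 34, 56, 148, 159, 167, 236, 247, 289, 469], [7, 8, 13, 25, 45, 68]), [39, 79, 35, 37, 57,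
   37, 57, 38, 58, 35, 57, 1465018297563, 1608512904737]),
  (([12, 34, 56, 148, 159, 167, 236, 247, 258, 469], [7, 8, 9, 13, 29, 68]), [35, 57,
   163471928705, 38, 78, 1523058972264, 1579853076341]),
  (([12, 34, 56, 148, 159, 167, 236, 247, 469], [7, 8, 9, 13, 45, 68]), [25, 28, 29876543310,
   19876543310, 29, 9876543310]),
  (([12, 34, 56, 148, 159, 167, 247, 469], [7, 8, 9, 13, 45]), [26, 36, 68, 679781243660, 23, 25,
   28, 39, 35, 1823895704262, 35, 57, 1480365129884, 29, 35, 37, 1825972806513, 39, 79,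
   1633058627249, 25, 28, 35, 57, 1822783901745, 58, 78, 1632037459718, 37, 57, 78, 1635029138567,
   89, 1479568703341, 1570529783561, 28, 29, 109876543310, 37, 79, 57, 1593024978265, 99876543310,
   36, 49876543310, 68, 9876543310]),
  (([12, 34, 56, 148, 159, 167, 469], [7, 8, 9, 13, 45]), [47, 24, 579871265440, 9876543310]),
  (([12, 34, 56, 148, 159, 167, 246, 368], [7, 9, 45, 47, 49, 69]), [39, 89, 35, 387958162134, 27,
   57, 1637953416380, 89, 58, 347953062284, 27, 37, 1564017986623]),
  (([12, 34, 56, 148, 159, 167, 238, 246, 379, 689], [8, 35, 45]), [25, 57, 1760325786294,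
   1875703481729]),
  (([12, 34, 56, 148, 159, 167, 246, 379, 689], [7, 8, 13, 29, 36, 45, 47]), [23, 35, 25, 27,
   1853956718340, 1853981765304, 35, 9876543310, 38, 9571803364]),
  (([12, 34, 56, 148, 159, 167, 246, 689], [7, 8, 9, 13, 36, 45, 47, 49]), [29, 39, 9876543310,
   39, 23, 35, 78, 2035304262087, 37, 57, 2038340217057, 79, 27, 37, 1883958721740, 37,
   1883985726204]),
  (([12, 34, 56, 148, 159, 167, 246, 369], [7, 8, 9, 13, 45, 47, 49, 68]), [29, 79, 27, 37, 23,
   25, 1800243975718, 1755930416378, 37, 23, 35, 1972047896253, 2009380721754, 57, 25, 35,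
   2032076314698, 2068405972263, 79, 27, 37, 1920376216048, 57, 1888405792713, 89, 28, 38, 57,
   1850485372269, 58, 2023402817075]),
  (([12, 34, 56, 148, 159, 167, 246], [7, 8, 9, 13, 45, 47, 49]), [69, 36, 68, 627590318364,
   49876543310, 36, 19876543310, 68, 9876543310]),
  (([12, 34, 56, 148, 159, 167, 246, 368, 479], [7, 8, 9, 13, 45, 69]), [39, 89, 58, 78, 23, 35,
   2083820574719, 25, 35, 27, 37, 35, 23, 1755017328569, 1747984301725, 89, 35, 37, 1270684715339,
   58, 28, 1685039124868, 1679714082735]),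
  (([12, 34, 56, 148, 159, 167, 246, 479, 689], [8, 13, 36, 39]), [23, 35, 1939783201745, 35, 78,
   1903206715085, 37, 1825309741782]),
  (([12, 34, 56, 148, 159, 167, 239, 246, 278, 479, 689], [13, 36]), [37, 35, 1723502789246,
   1605302789264]),
  (([12, 34, 56, 148, 159, 167, 239, 246, 258, 479, 689], [8, 13, 36]), [35, 37, 1600325916947,
   1633790821754]),
  (([12, 34, 56, 148, 159, 167, 239, 246, 479, 689], [7, 8, 13, 36, 45]), [25, 27, 28,
   185871093562, 19876543310, 9876543310, 35, 37, 1638347619350, 1653846719350]),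
  (([12, 34, 56, 148, 159, 167, 246, 479, 689], [7, 8, 13, 36, 45]), [39, 39876543310,
   9876543310]),
  (([12, 34, 56, 148, 159, 167, 246, 289, 369, 479], [7, 8, 13, 45, 68]), [23, 25, 27,
   328976543220, 35, 37, 1810362891845, 78, 1663068792245, 25, 35, 57, 1653064792285, 78,
   1745018343067, 27, 37, 57, 1828715239740, 1687815069343]),
  (([12, 34, 56, 148, 159, 167, 246, 369, 479], [7, 8, 13, 45, 68]), [89, 28, 38, 2149587246203,
   38, 1855978206513, 58, 1705796801523, 9876543310]),
  (([12, 34, 56, 148, 159, 167, 246, 479], [7, 8, 9, 13, 45]), [69, 36, 68, 99381705346,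
   79876543310, 36, 29876543310, 68, 9876543310]),
  (([12, 34, 56, 148, 159, 167, 246], [7, 8, 9, 13, 45]), [47, 49, 99876543310, 9876543310]),
  (([12, 34, 56, 148, 159, 167, 235, 457, 469], [7, 8, 9, 13, 24, 58]), [26, 68, 829781243660,
   238794312660, 36, 238971243660]),
  (([12, 34, 56, 148, 159, 167, 457, 469], [7, 8, 9, 13, 24]), [25, 35, 58, 829784312750,
   238974312750, 35, 238791243750, 58, 9876543310]),
  (([12, 34, 56, 148, 159, 167, 246, 258, 457], [9, 13, 23, 29, 35, 49]), [36, 37, 79, 69]),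
  (([12, 34, 56, 148, 159, 167, 239, 246, 258, 457], [7, 9, 13, 27, 35, 49]), [36, 37, 79, 69,
   1693987405262, 37, 78, 1889385061527]),
  (([12, 34, 56, 148, 159, 167, 246, 258, 457], [7, 8, 9, 13, 35, 49]), [27, 23, 29, 19876543310,
   9876543310, 23, 37, 36, 1703978401626, 29, 79, 39, 1899371025568]),
  (([12, 34, 56, 148, 159, 167, 235, 246, 457], [8, 9, 28, 29, 49, 58]), [68, 38, 39, 69]),
  (([12, 34, 56, 148, 159, 167, 235, 246, 289, 457], [7, 8, 9, 27, 49, 58]), [68, 78, 79, 39,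
   1877815496330, 78, 37, 1849817364620]),
  (([12, 34, 56, 148, 159, 167, 235, 246, 457], [7, 8, 9, 49, 58]), [27, 28, 29, 19876543310,
   9876543310, 28, 78, 68, 1923845912770, 29, 79, 69, 1768976421603]),
  (([12, 34, 56, 148, 159, 167, 246, 457], [7, 8, 9, 13, 49]), [25, 35, 58, 857981243750,
   268974312750, 35, 39876543310, 58, 9876543310]),
  (([12, 34, 56, 148, 159, 167], [7, 8, 9, 13]), [45, 46, 47, 49, 415672918404, 24, 1338971265440,
   49, 416592718404, 259876543310, 99876543310, 46, 257895643310, 24, 79876543310, 49, 9876543310,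
   46, 97895643310, 47, 7895643310]),
  (([12, 34, 56, 148, 159], [7, 8, 9, 13]), [16, 17, 738975643310, 9876543310]),
  (([12, 34, 56, 146, 159, 257, 358, 369, 479, 678], [9, 13, 17, 23, 26]), [24, 28, 2064318709662,
   2188723164690]),
  (([12, 34, 56, 146, 159, 257, 358, 367, 689], [7, 17, 23, 26]), [28, 29, 79, 47, 2273806458012,
   78, 47, 2101904876632]),
  (([12, 34, 56, 146, 159, 236, 257, 358, 379, 678], [8, 9, 18, 45, 47, 69]), [24, 48,
   2259142863670, 28, 48, 29, 49]),
  (([12, 34, 56, 146, 159, 358], [7, 8, 9, 13, 17, 18, 45]), [25, 57, 1254271938705, 23, 36, 37,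
   1448975621530, 37, 67, 26, 47, 29876543310, 39, 26, 68, 69, 731295867503, 19876543310, 68, 28,
   78, 2231049876353, 69, 29, 79, 2060143785729, 37, 28, 1018972156530, 67, 47, 2117839402661, 47,
   67, 89, 2211069824637, 26, 28, 68, 48, 2322789103664, 428793456220, 24, 69, 389872134750, 37,
   39, 67, 68, 47, 28, 2308430653017, 69, 47, 29, 2168734012669, 67, 47, 49, 1742590387714, 28,
   68, 1867851029734, 47, 69, 9876543310]),
  (([12, 34, 56, 146, 159, 235, 368, 578], [7, 8, 9, 17, 18, 37, 39]), [67, 27, 28, 48,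
   2309816547402, 2308935627204, 69, 47, 29, 2144015326979]),
  (([12, 34, 56, 146, 159, 235, 368, 379, 578], [7, 8, 9, 17, 18, 45]), [67, 47, 69, 733875902561,
   28, 48, 1887840123795, 47, 69, 24, 48, 2257892103664, 28, 48, 29, 49]),
  (([12, 34, 56, 146, 159, 236, 249, 257, 458], [7, 8, 17, 18, 28, 47]), [37, 38, 67, 68]),
  (([12, 34, 56, 146, 159, 249, 257, 458], [7, 8, 13, 17, 18, 35, 47]), [23, 28, 989785643220,
   157986543220, 398794356220, 28, 9876543310]),
  (([12, 34, 56, 146, 159, 235, 458], [7, 8, 9, 17, 18, 57]), [24, 47, 347385902741, 47, 49,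
   3876459301]),
  (([12, 34, 56, 146, 159, 458], [7, 8, 9, 13, 17, 18]), [35, 25, 57, 928971243750, 24, 47, 49,
   939270358714, 317385902741, 47, 19876543310, 25, 307984312750, 57, 9876543310]),
  (([12, 34, 56, 146, 159, 245, 279, 367, 478], [8, 13, 18, 35, 58]), [23, 39, 28, 2123970124758,
   68, 2080523864819]),
  (([12, 34, 56, 146, 159, 245, 478], [7, 8, 13, 17, 18, 35, 57, 58]), [27, 37, 9876543310, 37,
   23, 36, 28, 2133980124757, 68, 2133980564317, 67, 9872143750]),
  (([12, 34, 56, 146, 159, 245], [7, 8, 13, 17, 18, 35, 57, 58]), [47, 48, 9876543310]),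
  (([12, 34, 56, 146, 159, 245, 489, 578], [7, 8, 13, 17, 18, 35, 47]), [28, 38, 37, 27,
   2327983265510, 67, 2141906254973, 38, 23, 27, 36, 67, 27, 37, 2181924758163, 37,
   2206109724683]),
  (([12, 34, 56, 146, 159, 245, 578], [7, 8, 9, 13, 17, 18, 35]), [47, 48, 49, 23876459301,
   9876543310, 48, 9786543310]),
  (([12, 34, 56, 146, 159, 245, 358, 479], [7, 8, 17, 18, 48, 57]), [37, 78, 68, 29,
   2433820146697, 2108792103646, 78, 28, 36, 2458793625501, 2127836419620]),
  (([12, 34, 56, 146, 159, 245, 358], [7, 8, 9, 17, 18, 57]), [48, 47, 9876543310, 47, 49,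
   23876459301]),
  (([12, 34, 56, 146, 159, 178, 249, 358], [7, 8, 47, 48, 57]), [28, 89, 79, 27, 2440358961374,
   89, 27, 67, 2254059381727]),
  (([12, 34, 56, 146, 159, 178, 249, 258], [7, 9, 13, 35, 45, 47, 57]), [27, 23, 37, 36, 89,
   2260495371368, 67, 179871265440]),
  (([12, 34, 56, 146, 159, 178, 249, 258, 267, 357], [7, 8, 9, 13, 23, 48, 79]), [36, 38,
   2464398521770, 38, 68, 39, 69]),
  (([12, 34, 56, 146, 159, 178, 249, 258, 357], [7, 8, 9, 13, 47, 48]), [27, 79, 23,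
   1436374958202, 68, 38, 2177851649330, 23, 79, 9876543310]),
  (([12, 34, 56, 146, 159, 178, 248], [7, 8, 9, 13, 45, 47, 49]), [58, 25, 57, 27, 67, 26, 29, 89,
   38, 2477586139142, 68, 38, 2190415936828, 67, 1374281937705, 79, 29, 69, 2364372169005, 35, 23,
   29, 1503695748202, 67, 79, 36, 2313481026697, 79, 38, 2360396125848, 198791265440, 37, 38, 67,
   2220541362898, 38, 68, 2498934021757, 57, 169872134750, 57, 89, 1599601724458, 1334271938705,
   89, 1330691735348, 26, 29, 39, 36, 2492437951960, 79, 37, 2094063978621, 67, 37,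
   2167983405361]),
  (([12, 34, 56, 146, 159, 178, 248, 479], [7, 8, 9, 13, 45]), [58, 57, 25, 169872134750, 67,
   1304281937705, 1274281937705, 35, 37, 824382719705, 804382719705, 57, 25, 89, 68,
   1597241960485, 1324271938705, 37, 67, 68, 89, 23, 36, 2487291458163, 26, 36, 29, 39, 36, 23,
   2030613729954, 2127914352780, 39, 662196758503, 607985621530]),
  (([12, 34, 56, 146, 159, 178, 236, 249, 257, 458], [7, 8, 13, 28, 35, 47]), [37, 38, 67,
   2193842756290, 38, 68, 2038791465303]),
  (([12, 34, 56, 146, 159, 178, 249, 257, 458], [7, 8, 9, 13, 35, 47]), [28, 23, 26,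
   1149785643220, 9876543310, 23, 38, 36, 2013789402616, 26, 558794356220]),
  (([12, 34, 56, 146, 159, 178, 257, 458], [7, 8, 9, 13, 35]), [47, 24, 49, 487891243750,
   9876543310, 24, 407891243750]),
  (([12, 34, 56, 146, 159, 178, 235, 367, 458, 479], [8, 9, 24, 27]), [38, 39, 1789184052773, 28,
   26, 2167891036642, 2090237946951]),
  (([12, 34, 56, 146, 159, 178, 235, 458, 479], [7, 8, 9, 13, 24, 57]), [27, 37, 9876543310, 37,
   8976512440]),
  (([12, 34, 56, 146, 159, 178, 235, 249, 267, 379, 458], [8, 9, 28]), [38, 68, 2063720654298,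
   2097869024613]),
  (([12, 34, 56, 146, 159, 178, 235, 247, 269, 458], [7, 8, 28, 57]), [67, 79, 89, 38,
   2117916052538, 68, 38, 2108957042731]),
  (([12, 34, 56, 146, 159, 178, 235, 247, 458], [7, 8, 9, 13, 49, 57]), [28, 29, 628964753112,
   9876543310, 26, 38, 68, 36, 37, 67, 37, 67, 39, 69, 37, 67, 2137920341686, 2139710652583, 29,
   89, 69, 2083950124787]),
  (([12, 34, 56, 146, 159, 178, 235, 458], [7, 8, 9, 13, 57]), [24, 47, 49, 577295803714,
   39876543310, 47, 27, 28, 37, 29876543310, 49, 9876543310]),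
  (([12, 34, 56, 146, 159, 178, 458], [7, 8, 9, 13]), [35, 57, 25, 1088971243750, 69876543310, 25,
   447984312750, 57, 9876543310]),
  (([12, 34, 56, 146, 159, 178, 245, 358, 689], [7, 47, 57]), [67, 27, 2369872045263, 37,
   2357382456209]),
  (([12, 34, 56, 146, 159, 178, 245, 358], [7, 8, 9, 47, 48, 49, 57]), [28, 68, 9876543310,
   9872503714, 89, 27, 37, 39, 29]),
  (([12, 34, 56, 146, 159, 178, 245], [7, 8, 9, 47, 48, 49]), [57, 58, 233876019345, 9876543310,
   58, 9786543310]),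
  (([12, 34, 56, 146, 159, 178, 245, 357, 489], [7, 8, 9, 13, 47, 58]), [38, 28, 23, 36, 67, 27,
   2147398621550, 27, 67, 2160354163087, 28, 23, 39, 1471924075783, 27, 67, 2267861235590,
   2258937152740, 68, 36, 39, 1425064971338, 67, 27, 2197836059521, 2287836295510]),
  (([12, 34, 56, 146, 159, 178, 245, 268, 358, 489], [7, 47, 57]), [27, 37, 2157389512560, 67,
   2170324615997]),
  (([12, 34, 56, 146, 159, 178, 245, 358, 489], [7, 47, 57]), [68, 570625318048, 9876543310]),
  (([12, 34, 56, 146, 159, 178, 245, 489], [7, 8, 9, 13, 47]), [58, 57, 35, 259872143750,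
   29876543310, 57, 9876543310]),
  (([12, 34, 56, 146, 159, 178], [7, 8, 9, 13]), [45, 47, 48, 49, 57, 25, 58, 229876543310, 35,
   219876543310, 58, 27, 28, 58, 229786543310, 199876543310, 58, 35, 219786543310, 199786543310,
   24, 839876512440, 49, 189876543310, 48, 24, 839786512440, 179876543310, 48, 49, 189786543310,
   179786543310, 79876543310, 79786543310, 47, 48, 49, 49876543310, 9876543310, 48, 9786543310]),
  (([12, 34, 56, 146, 159], [7, 8, 9, 13]), [17, 18, 45, 35, 25, 57, 2102431987705, 57,
   1084372819705, 58, 1084382719705, 379876543310, 379786543310, 57, 58, 24, 47, 48,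
   2162590387714, 47, 27, 28, 47, 27, 37, 68, 2441059874723, 48, 28, 38, 67, 2441059784723, 37,
   36, 38, 869872156530, 38, 67, 68, 39, 369876543310, 38, 869782156530, 359876543310, 38, 39,
   369786543310, 359786543310, 319876543310, 319786543310, 35, 57, 58, 289876543310, 269876543310,
   57, 249876543310, 58, 249786543310, 9876543310]),
  (([12, 34, 56, 159], [7, 8, 9, 13]), [14, 16, 17, 1759875643310, 17, 834375968301, 18,
   834385967301, 429876543310, 429786543310, 9876543310]),
  (([12, 34, 56, 145], [7, 8, 9, 13]), [16, 839875643310, 19875643310, 18975643310, 17985643310]),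
  (([12, 34, 56, 139, 146, 158, 237, 269, 368], [7, 9, 17, 67]), [25, 24, 1344586937202, 78, 47,
   2407582013749, 57, 47, 2337839516340]),
  (([12, 34, 56, 139, 146, 158, 238, 269, 367], [7, 8, 9, 17, 35, 68]), [25, 27, 1349873465220,
   528974365220, 24, 757896534220, 27, 57, 47, 2379732681550]),
  (([12, 34, 56, 139, 146, 158, 236, 245, 357], [7, 8, 9, 17, 27, 28, 29, 38, 59]), [47, 48, 49]),
  (([12, 34, 56, 139, 146, 158, 236, 245, 289, 357], [7, 8, 17, 27, 38]), [48, 68, 47,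
   2349873041626, 67, 2387985063242]),
  (([12, 34, 56, 139, 146, 158, 236, 245, 279, 357], [7, 8, 17, 28, 38]), [47, 67, 48,
   2399873041626, 68, 2279875601424]),
  (([12, 34, 56, 139, 146, 158, 236, 245, 357], [7, 8, 9, 17, 38, 59]), [27, 28, 29, 29876543310,
   19876543310, 28, 9876543310, 29, 8974365310]),
  (([12, 34, 56, 139, 146, 158, 235, 267, 368], [7, 8, 9, 17, 37, 69]), [57, 47, 218972134750, 59,
   78, 29, 2439814563307]),
  (([12, 34, 56, 139, 146, 158, 235, 368], [7, 8, 9, 17, 37]), [26, 67, 57, 59, 27, 228974312660,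
   67, 69, 9876543310]),
  (([12, 34, 56, 139, 146, 158, 235, 268, 367], [7, 8, 9, 17, 38, 69]), [24, 27, 29, 454795368202,
   228795634220, 27, 47, 57, 2347941023758, 78, 2469816052447, 29, 49, 78, 57, 2339817036345, 48,
   78, 2458916345307]),
  (([12, 34, 56, 139, 146, 158], [7, 8, 9, 17]), [35, 36, 38, 23, 996582719503, 23, 2002651987503,
   37, 956572819503, 23, 37, 1288971265530, 26, 67, 69, 797891265530, 737891265530, 67,
   89876543310, 38, 23, 1295281967503, 68, 26, 69, 758791265530, 79876543310, 26, 668791265530,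
   38, 37, 369872165530, 68, 67, 69, 189874105336, 169782165530, 67, 149872165530, 36, 38, 23,
   1406281957503, 25, 45, 59, 1494291837705, 828791256530, 45, 639782156530, 59, 569782156530, 23,
   557986512530, 38, 25, 45, 59, 1454291837705, 567894312750, 568792134750, 59, 39876543310, 36,
   38, 37, 449872156530, 219872156530, 37, 19876543310, 38, 26, 68, 69, 452984137606,
   227984312660, 68, 27981243660, 69, 9876543310]),
  (([12, 34, 56, 139, 158], [7, 8, 9]), [14, 548976534310, 16, 559874356310, 17, 9876543310])]

/-- Partial systems with instructions for a search. -/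
def searchData₄ : List (PartialSystem × List ℕ) := [
  (([12, 34, 56, 139, 145], [7, 8, 9]), [16, 139874356310, 17, 19875643310, 18, 19785643310]),
  (([12, 34, 56, 139], [7, 8, 9]), [15, 139874365310, 19876543310, 19786543310, 9876543310]),
  (([12, 34, 56, 136, 145, 239, 258, 579], [7, 8, 17, 18, 37, 38]), [27, 47, 68, 2593419752780,
   67, 48, 2593609752581]),
  (([12, 34, 56, 136, 145, 239, 258, 267, 378, 579], [8, 9, 18, 19, 24, 47]), [46, 48,
   2567936152184, 48, 68, 49, 69]),
  (([12, 34, 56, 136, 145, 239, 258, 378], [7, 8, 9, 17, 18, 19]), [57, 59, 18976345301, 27, 47,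
   48, 68, 2574137857002, 2576157934902, 24, 47, 9876543310, 26, 67, 9874563301]),
  (([12, 34, 56, 136, 145, 239], [7, 8, 9, 17, 18, 19, 35]), [37, 38, 25, 59, 57, 1168796302551,
   57, 58, 57, 29876543310, 58, 29786543310, 25, 57, 58, 1129876302551, 58, 1129786302551,
   9876543310, 9786543310]),
  (([12, 34, 56, 136, 145, 238, 359], [7, 8, 9, 17, 18, 19, 37]), [57, 269876302551, 58, 24, 26,
   1566493857202, 668796354121, 668794356220, 29, 148796543220]),
  (([12, 34, 56, 136, 145, 359], [7, 8, 9, 17, 18, 19]), [23, 37, 38, 492876159503, 269876512530,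
   37, 9876543310, 38, 9786543310]),
  (([12, 34, 56, 136, 145, 235, 269, 389, 579], [7, 8, 17, 18, 37, 58]), [27, 47, 48, 28]),
  (([12, 34, 56, 136, 145, 235, 389, 579], [7, 8, 9, 17, 18, 19, 37, 58]), [29, 49, 47, 27, 28,
   48, 9876543310, 9874563301]),
  (([12, 34, 56, 136, 145, 235, 389], [7, 8, 9, 17, 18, 19, 37]), [58, 57, 9876543310, 59,
   8976543310]),
  (([12, 34, 56, 136, 145, 189, 237, 579], [8, 9, 35, 38, 39, 58]), [78, 28, 29, 49,
   2767984516132, 2914031562997, 28, 29, 49, 2790357981742, 2507982534206]),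
  (([12, 34, 56, 136, 145, 189, 237, 259], [7, 8, 17, 35, 38, 57, 58]), [28, 48, 67,
   2947430127058, 68, 47, 2809856034317]),
  (([12, 34, 56, 136, 145, 189, 237, 259, 578], [7, 8, 9, 17, 38, 39]), [28, 48, 1926483759202,
   24, 48, 46, 47, 2908972645203, 47, 67, 49, 69, 26, 68, 657981265530]),
  (([12, 34, 56, 136, 145, 189, 237, 259], [7, 8, 9, 17, 35, 38, 39]), [57, 58, 19876543310,
   9876543310]),
  (([12, 34, 56, 136, 145, 189, 239, 258, 579], [7, 17, 37]), [69, 2236041857339, 27, 47,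
   2607854326290, 67, 2537823049256]),
  (([12, 34, 56, 136, 145, 189, 239], [7, 8, 17, 35, 37, 38]), [59, 25, 58, 79, 27, 28, 48,
   2910325781569, 2947453816390, 27, 28, 48, 2942795341708, 2939872354206, 57, 58, 39874365310,
   58, 49, 2266041857339, 1219784312750, 9876543310]),
  (([12, 34, 56, 136, 145, 189, 239, 258, 378, 469, 579], [7, 17]), [47, 27, 2677893402715,
   2698723169550]),
  (([12, 34, 56, 136, 145, 189, 239, 378], [7, 8, 9, 17, 35]), [58, 59, 25, 49874365310, 25, 49,
   2134601823859, 1229784312750, 57, 28974365310, 48, 68, 49, 69, 146402573298, 9876543310,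
   8974365310]),
  (([12, 34, 56, 136, 145, 189, 237, 258, 359, 478, 679], []), [24, 2867280435269, 2548794512406,
   2539872105464]),
  (([12, 34, 56, 136, 145, 189, 237, 258, 359], [7, 17, 57]), [78, 47, 26, 2904763510398,
   2714735821790, 2668972015464, 67, 9876543310]),
  (([12, 34, 56, 136, 145, 189, 238, 359], [7, 17, 37]), [58, 57, 9874365310, 379874312750]),
  (([12, 34, 56, 136, 145, 189, 359], [7, 8, 9, 17]), [38, 23, 37, 602876159503, 25, 57, 58,
   612874139705, 409874312750, 57, 19876543310, 23, 379876512530, 37, 9876543310]),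
  (([12, 34, 56, 136, 145, 189, 239, 258, 357], [7, 8, 9, 17, 38, 59]), [24, 26, 27,
   1716473958202, 828976534220, 829874356220, 27, 309876543220]),
  (([12, 34, 56, 136, 145, 189, 239, 357], [7, 8, 9, 17, 38, 59]), [58, 652984137705, 9876543310]),
  (([12, 34, 56, 136, 145, 189, 235, 267, 379, 578], [8, 9, 38, 59]), [28, 68, 69, 29,
   2719872014735, 29, 49, 2599872104735]),
  (([12, 34, 56, 136, 145, 189, 235, 379], [7, 8, 9, 17, 38, 59]), [57, 58, 169874321750, 27, 47,
   48, 68, 69, 29, 2689874032715, 49, 29, 2727984036351, 9876543310, 8974365310]),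
  (([12, 34, 56, 136, 145, 189], [7, 8, 9, 17]), [35, 38, 39, 23, 25, 58, 57, 159876543310, 59,
   158976543310, 129876543310, 128976543310, 23, 1309786512530, 37, 109876543310, 39, 23,
   1308796512530, 89876543310, 39, 37, 108976543310, 88976543310, 49876543310, 48976543310, 38,
   39, 23, 672986157503, 59, 29876543310, 39, 58, 28976543310, 38, 39, 37, 169876521530, 59,
   9876543310, 39, 58, 8976543310]),
  (([12, 34, 56, 136], [7, 8, 9]), [14, 399875634310, 279875634310, 278975634310, 277985634310,
   17, 18, 19, 35, 23, 37, 38, 1349876512530, 38, 1349786512530, 39, 1348796512530, 229876543310,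
   228976543310, 227986543310, 209876543310, 208976543310, 207986543310, 37, 38, 39, 57, 58, 59,
   179876543310, 38, 179786543310, 39, 178796543310, 9876543310, 18, 9786543310, 19, 8796543310]),
  (([12, 34, 56, 89, 178], [7, 13, 15]), [14, 16, 435439687301, 16, 433659487301, 19,
   855934687301]),
  (([12, 34, 56, 89, 168], [7, 13, 15]), [14, 19, 445438697301, 17, 315379486301, 19,
   869356847301]),
  (([12, 34, 56, 89, 148, 159, 167, 239, 247, 268, 469], [7, 13, 25, 36, 45, 79]), [35, 37, 57,
   37, 57, 2797564091383]),
  (([12, 34, 56, 89, 148, 159, 167, 247, 379, 469], [13, 29, 45]), [57, 78, 1010584293717, 25, 35,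
   23, 26, 36, 2705673289510, 2705802361597, 26, 1259685310572, 2723950786242]),
  (([12, 34, 56, 89, 148, 159, 167, 247, 469], [7, 13, 45]), [79, 29, 39, 573278015749, 26, 25,
   28, 1196584793112, 57, 37, 2667643928115, 68, 2803749260258, 2747468093621, 25, 36,
   19876543310, 29, 9876543310]),
  (([12, 34, 56, 89, 148, 159, 167, 246, 278, 369, 479], [13, 23]), [37, 35, 2843598720516,
   2798217309745]),
  (([12, 34, 56, 89, 148, 159, 167, 238, 246, 369, 479], [45]), [25, 9381705346, 2807512394168]),
  (([12, 34, 56, 89, 148, 159, 167, 249, 278, 379, 457], [46, 69]), [25, 26, 23, 36,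
   2835679134902, 58, 2806375049228, 2766753198520, 26, 36, 2776354927280]),
  (([12, 34, 56, 89, 148, 159, 167, 249, 379, 457], [13, 46, 69]), [27, 78, 1080829316647,
   9876543310]),
  (([12, 34, 56, 89, 148, 159, 167, 379, 457, 469], [24, 29]), [27, 558025493717, 14502893717]),
  (([12, 34, 56, 89, 148, 159, 167, 457, 469], [7, 13, 24]), [79, 29, 39, 413721580749, 25, 35,
   708326047295, 37, 27, 2907214306086, 27, 37, 2742389150567, 29, 9876543310, 39, 9875612440]),
  (([12, 34, 56, 89, 148, 159, 167, 237, 245, 268, 358, 479], []), [36, 2727916238154,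
   2807124685193]),
  (([12, 34, 56, 89, 148, 159, 167, 245, 278, 358, 479], [13, 37, 46, 68]), [23, 36,
   2926795240913, 26, 36, 2926720985513]),
  (([12, 34, 56, 89, 148, 159, 167, 245, 358, 479], [7, 13, 46, 57]), [78, 37, 28, 68,
   682679053518, 19876543310, 37, 68, 9876543310]),
  (([12, 34, 56, 89, 148, 159, 167, 245, 368, 469], [7, 13, 26, 47]), [58, 78, 57, 27,
   2943760215058, 29, 1156934587202, 79, 37, 2837152605083, 28, 35, 111938742165]),
  (([12, 34, 56, 89, 148, 159, 167, 245, 469], [7, 13, 47]), [26, 68, 36, 1053825018046,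
   9876543310, 36, 29, 23, 27, 39, 35, 57, 39, 79, 35, 57, 23, 39, 27, 79, 68, 5276903914]),
  (([12, 34, 56, 89, 148, 159, 167], [7, 13]), [45, 46, 49, 47, 776952703914, 24, 1126259703914,
   47, 605672903914, 47, 24, 1027259603914, 119876543310, 49, 47, 69, 68, 36, 1775791803364,
   697592603914, 68, 1139750318364, 69, 29, 39, 1136321547909, 120862315849, 29, 68, 23, 25, 27,
   109876543310, 35, 37, 2907398261145, 2903795240268, 28, 109750318364, 99876543310, 91780542496,
   99381705346, 46, 49, 24, 1286295703914, 69, 79, 39, 217638024619, 79876543310, 79, 79267503914,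
   24, 59876543310, 49, 116295703914, 46, 49, 47, 57, 35, 1816971803354, 78, 68, 37, 719672503914,
   35, 759672503914, 58, 1207960318354, 57, 58, 35, 548730625015, 29876543310, 35, 61279856440,
   58, 121279856440, 47, 9876543310]),
  (([12, 34, 56, 89, 148, 159], [7, 13]), [16, 17, 476378495301, 9876543310]),
  (([12, 34, 56, 89, 147, 159, 168, 249], [7, 13, 45, 46, 48]), [69, 39, 79, 1818561703394,
   748562917404, 39, 1176851703394, 79, 1176580317394]),
  (([12, 34, 56, 89, 147, 159, 168, 248], [7, 13, 45]), [46, 49, 8975643310, 88256917404]),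
  (([12, 34, 56, 89, 147, 159, 168, 357, 458, 469], [7, 24, 25]), [36, 67, 26, 553278194606,
   1410985362247, 1221985762143]),
  (([12, 34, 56, 89, 147, 159, 168], [7, 13]), [45, 48, 46, 49, 29876543310, 24, 1148256917404,
   49, 26579843310, 19876543310, 46, 49, 24, 1149265817404, 109265817404, 24, 25, 35, 57,
   557326091945, 9876543310, 35, 8976512440, 57, 8639502841, 49, 106298517404, 48, 16579843310]),
  (([12, 34, 56, 89, 159], [7, 13]), [14, 16, 18, 656439587301, 17, 234376895301, 18,
   658435967301, 49876543310, 16, 18, 1078365947301, 9876543310, 45678943310]),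
  (([12, 34, 56, 89, 157, 168], [7, 13]), [14, 19, 669436857301, 68975643310]),
  (([12, 34, 56, 89, 148, 157], [7, 13]), [16, 19, 1099634857301, 79875643310]),
  (([12, 34, 56, 89, 157], [7, 13]), [18, 246579843310, 19876543310, 9876543310]),
  (([12, 34, 56, 89, 139, 146, 158, 237, 248, 457, 679], [68]), [59, 3182398760245,
   2997346910628]),
  (([12, 34, 56, 89, 139, 146, 158, 237, 248, 678], [7, 17, 26, 35, 69]), [25, 29, 919564837202,
   57, 47, 2897643192185, 2919321850567]),
  (([12, 34, 56, 89, 139, 146, 158, 238, 367], [7, 17, 35]), [26, 69, 1278920537516,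
   181482905836]),
  (([12, 34, 56, 89, 139, 146, 158, 238, 357], [7, 17, 36]), [68, 78, 374679023618, 45, 24, 49,
   1495928716134, 1504923706285, 24, 25, 265928716134, 49, 59, 26, 67, 3079785243116, 27, 67, 29,
   69, 48, 201967504383]),
  (([12, 34, 56, 89, 139, 146, 158, 235, 378], [7, 17, 36]), [68, 28, 48, 892469037618, 26, 67,
   27, 47, 3077985013526, 27, 67, 29, 69, 175167309528, 201962504883]),
  (([12, 34, 56, 89, 139, 158], [7]), [14, 138976534310, 16, 149874356310, 17, 35, 36, 38, 23, 68,
   26, 67, 78, 28, 47, 49876543310, 28, 57, 24, 25, 3302789105734, 25, 45, 3302764015939, 67, 78,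
   79, 44678593301, 26, 69, 28, 48, 1393921487606, 39876543310, 28, 48, 34678593301, 25,
   189037615528, 78, 67, 47, 404375127008, 67, 57, 409375028516, 57, 24, 25, 45, 3082761948153,
   3064731587002, 25, 45, 3069730568512, 23, 892569187503, 37, 385672891503, 23, 37, 632578691503,
   26, 67, 69, 78, 28, 57, 869274105936, 179872165530, 67, 78, 79, 195074192486, 38, 23,
   892584068013, 29876543310, 37, 385872641013, 24678593301, 36, 38, 23, 45, 59, 25,
   2016821904853, 1486820458013, 25, 1212864058013, 59, 1488621957503, 19876543310, 23,
   158975612530, 38, 14678593301, 36, 38, 37, 45, 57, 708670426013, 57, 706871925503, 9876543310,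
   37, 26, 67, 57, 78, 194079152963, 67, 78, 57, 199174052783, 38, 4678593301]),
  (([12, 34, 56, 89, 139, 157], [7]), [14, 78976534310, 16, 109874356310, 18, 154689357301]),
  (([12, 34, 56, 89, 139], [7]), [15, 109874365310, 19876543310, 9876543310, 14378965310]),
  (([12, 34, 56, 89], [7]), [13, 15, 18, 14, 16, 1198534967301, 16, 1198356947301, 19,
   1195834697301, 339876543310, 329876543310, 329874365310, 119876543310, 118976543310,
   89876543310, 18, 326574398310, 96579843310, 166579843310, 9876543310, 8976543310, 15,
   89874365310, 19874365310, 18974365310, 18, 106574398310, 19, 175498637301, 6579843310,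
   5679843310]),
  -- After relabelling, every system of triples contains these three triples, so the last entry
  -- amounts to the whole classification.
  (([12, 34, 56], []), [7, 8, 9, 13, 15, 14, 16, 17, 2529876543310, 17, 2528976543310, 18,
   2527986543310, 1929876543310, 1928976543310, 1927986543310, 1599876543310, 769876543310,
   768976543310, 767986543310, 759876543310, 629876543310, 628976543310, 627986543310,
   359876543310, 359875643310, 9876543310, 8, 9786543310, 9, 8796543310])]

/-- Partial systems with instructions for a search, in the order of dependence. -/
def searchData : List (PartialSystem × List ℕ) :=
  searchData₁ ++ (searchData₂ ++ (searchData₃ ++ (searchData₄)))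

/-- The combinatorial classification is contained in this evaluation; the lemmas on soundness make
it a statement about all systems of triples. -/
lemma searchAll_searchData : searchAll completeSystems.reverse searchData = true := by
  decide +kernel

/-! ### The patterns of admissible arrangements -/

/-- The system of triples has exactly the triples with codes in `B`. -/
def HasTriples (C : Fin 10 → Fin 10 → Fin 10 → Prop) (B : List ℕ) : Prop :=
  ∀ a b c : Fin 10, a < b → b < c → (C a b c ↔ 100 * a.val + 10 * b.val + c.val ∈ B)

/-- The triple with code `n` contains the point `a`. -/
def codeHas (n a : ℕ) : Bool :=
  Nat.beq (n / 100) a || (Nat.beq (n / 10 % 10) a || Nat.beq (n % 10) a)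

/-- Each pair of points is in a triple or in the list of pairs. -/
def PartialSystem.complete (R : PartialSystem) : Bool :=
  (R.1.all fun n => Nat.blt n 1000 && NormalForm.isCode n) && ((R.2.all fun n => Nat.blt n 100) &&
    (List.range 10).all fun b => (List.range b).all fun a =>
      memCode (10 * a + b) R.2 || R.1.any fun n => codeHas n a && codeHas n b)

/-- There is no room for further triples: if `a`, `b`, `c` is a triple, the pair `a`, `b` is not a
pair without triple, so it lies in a listed triple, whose third point is `c` by uniqueness. -/
lemma PartialSystem.hasTriples_of_complete {R : PartialSystem} (hR : R.complete = true)
    {C : Fin 10 → Fin 10 → Fin 10 → Prop} (hC : TripleSystem C) (h : R.Holds C) :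
    HasTriples C R.1 := by
  simp only [complete, Bool.and_eq_true, List.all_eq_true, Bool.or_eq_true, memCode_eq_true,
    List.any_eq_true, List.mem_range, Nat.blt_eq] at hR
  obtain ⟨hR1, -, hR⟩ := hR
  have hfin : ∀ {a : ℕ} {b : Fin 10}, a = b.val → Fin.ofNat 10 a = b := by
    rintro _ b rfl; ext; simp
  have digits : ∀ x y z : ℕ, x < 10 → y < 10 → z < 10 →
      (100 * x + 10 * y + z) / 100 = x ∧ (100 * x + 10 * y + z) / 10 % 10 = y ∧
        (100 * x + 10 * y + z) % 10 = z := by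
    intros; omega
  intro a b c hab hbc
  constructor
  · intro habc
    rcases hR b.val b.2 a.val hab with hE | ⟨n, hn, hna, hnb⟩
    · have := h.2 _ hE c
      rw [hfin (b := a) (by omega), hfin (b := b) (by omega)] at this
      exact absurd habc this
    · have h0 := h.1 n hn
      have hn' := hR1 n hn
      simp only [codeHas, Bool.or_eq_true, Nat.beq_eq] at hna hnb
      obtain ⟨hlt, hcode⟩ := hR1 n hn
      simp only [NormalForm.isCode, Bool.and_eq_true, Nat.blt_eq] at hcode
      have hac := hC.swap (hC.rotate (hC.rotate h0))
      have hbc' := hC.rotate h0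
      have hthird : ∀ {x y z : ℕ}, z < 10 → x = a.val → y = b.val →
          C (Fin.ofNat 10 x) (Fin.ofNat 10 y) (Fin.ofNat 10 z) → z = c.val := by
        intro x y z hz hx hy h'
        rw [hfin hx, hfin hy] at h'
        rw [hC.unique habc h']
        simp [Nat.mod_eq_of_lt hz]
      have hab' : a.val < b.val := hab
      have hbc'' : b.val < c.val := hbc
      rcases hna with hna | hna | hna <;> rcases hnb with hnb | hnb | hnb
      · omega
      · have := hthird (by omega) hna hnb h0
        convert hn using 1
        omega
      · have := hthird (by omega) hna hnb hac
        omega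
      · omega
      · omega
      · have := hthird (by omega) hna hnb hbc'
        omega
      · omega
      · omega
      · omega
  · intro hn
    have := h.1 _ hn
    obtain ⟨h1, h2, h3⟩ := digits a b c a.2 b.2 c.2
    rw [h1, h2, h3] at this
    simpa using this

lemma complete_completeSystems : (completeSystems.all fun R => R.complete) = true := by
  decide +kernel

/-- The system of triples has one of the complete patterns, up to relabelling. -/
def HasCompletePattern (C : Fin 10 → Fin 10 → Fin 10 → Prop) : Prop :=
  ∃ R ∈ completeSystems, ∃ σ : Equiv.Perm (Fin 10), HasTriples (relabel C σ) R.1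

lemma hasCompletePattern_of_relabel {C : Fin 10 → Fin 10 → Fin 10 → Prop}
    {σ : Equiv.Perm (Fin 10)} (h : HasCompletePattern (relabel C σ)) : HasCompletePattern C := by
  obtain ⟨R, hR, τ, h⟩ := h
  exact ⟨R, hR, τ.trans σ, h⟩

/-- At least five points lie outside `s` and are different from 0, and at most three points are not
joined to 0. -/
lemma TripleSystem.exists_pair {C : Fin 10 → Fin 10 → Fin 10 → Prop} (hC : TripleSystem C)
    (s : Finset (Fin 10)) (hs : s.card ≤ 4) : ∃ j k, C 0 j k ∧ j ≠ 0 ∧ j ∉ s := by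
  classical
  by_contra! h
  have := hC.degree 0 (Finset.univ \ (insert 0 s)) fun j hj => by
    simp only [Finset.mem_sdiff, Finset.mem_univ, true_and, Finset.mem_insert, not_or] at hj
    exact ⟨hj.1, fun k hk => hj.2 (h j k hk hj.1)⟩
  have h1 := Finset.le_card_sdiff (insert 0 s) Finset.univ
  have h2 := Finset.card_insert_le 0 s
  rw [Finset.card_univ, Fintype.card_fin] at h1
  omega

/-- Three times a point joined to 0 is chosen outside the triples found so far. Its third point is
new as well, because two points lie in at most one triple. The seven distinct points are then
extended to a relabelling of all ten. -/
lemma TripleSystem.exists_star {C : Fin 10 → Fin 10 → Fin 10 → Prop} (hC : TripleSystem C) :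
    ∃ σ : Equiv.Perm (Fin 10), PartialSystem.Holds ([12, 34, 56], []) (LineArrangement.relabel C σ) := by
  obtain ⟨j₁, k₁, h₁, hj₁, -⟩ := hC.exists_pair ∅ (by simp)
  obtain ⟨j₂, k₂, h₂, hj₂, hs₂⟩ := hC.exists_pair {j₁, k₁} (Finset.card_le_two.trans (by norm_num))
  obtain ⟨j₃, k₃, h₃, hj₃, hs₃⟩ := hC.exists_pair {j₁, k₁, j₂, k₂} Finset.card_le_four
  simp only [Finset.mem_insert, Finset.mem_singleton, not_or] at hs₂ hs₃
  have hz : ∀ {j k}, C 0 j k → k ≠ 0 ∧ j ≠ k := fun h =>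
    ⟨hC.ne (hC.rotate (hC.rotate h)), hC.ne (hC.rotate h)⟩
  have hne : ∀ {j k j' k'}, C 0 j k → C 0 j' k' → j' ≠ j → j' ≠ k → k' ≠ j ∧ k' ≠ k :=
    fun h h' h1 h2 => by
    have hr := hC.rotate (hC.rotate h)
    have hr' := hC.rotate (hC.rotate h')
    constructor
    · rintro rfl
      exact h2 (hC.unique (hC.swap hr') h)
    · rintro rfl
      exact h1 (hC.unique hr' hr)
  obtain ⟨a1, a2⟩ := hz h₁
  obtain ⟨b1, b2⟩ := hz h₂
  obtain ⟨c1, c2⟩ := hz h₃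
  obtain ⟨d1, d2⟩ := hne h₁ h₂ hs₂.1 hs₂.2
  obtain ⟨e1, e2⟩ := hne h₁ h₃ hs₃.1 hs₃.2.1
  obtain ⟨f1, f2⟩ := hne h₂ h₃ hs₃.2.2.1 hs₃.2.2.2
  have hinj : Function.Injective ![0, j₁, k₁, j₂, k₂, j₃, k₃] := by
    rw [← List.nodup_ofFn]
    simp [List.ofFn_succ, hj₁.symm, a1.symm, hj₂.symm, b1.symm, hj₃.symm, c1.symm, a2, b2, c2,
      d1.symm, d2.symm, e1.symm, e2.symm, f1.symm, f2.symm, Ne.symm hs₂.1, Ne.symm hs₂.2,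
      Ne.symm hs₃.1, Ne.symm hs₃.2.1, Ne.symm hs₃.2.2.1, Ne.symm hs₃.2.2.2]
  obtain ⟨σ, hσ⟩ := Equiv.Perm.exists_extending_pair (Fin.castLE (show 7 ≤ 10 by norm_num)) _
    (Fin.castLE_injective _) hinj
  refine ⟨σ, fun n hn => ?_, fun n hn => absurd hn (by simp)⟩
  have e0 : σ 0 = 0 := hσ 0
  have e1 : σ 1 = j₁ := hσ 1
  have e2 : σ 2 = k₁ := hσ 2
  have e3 : σ 3 = j₂ := hσ 3
  have e4 : σ 4 = k₂ := hσ 4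
  have e5 : σ 5 = j₃ := hσ 5
  have e6 : σ 6 = k₃ := hσ 6
  simp only [List.mem_cons, List.not_mem_nil, or_false] at hn
  rcases hn with rfl | rfl | rfl
  · change C (σ 0) (σ 1) (σ 2)
    rwa [e0, e1, e2]
  · change C (σ 0) (σ 3) (σ 4)
    rwa [e0, e3, e4]
  · change C (σ 0) (σ 5) (σ 6)
    rwa [e0, e5, e6]

/-- Every system of triples has one of the complete patterns. -/
theorem TripleSystem.hasCompletePattern {C : Fin 10 → Fin 10 → Fin 10 → Prop}
    (hC : TripleSystem C) : HasCompletePattern C := by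
  have hcomplete : ∀ R ∈ completeSystems.reverse, R.Implies HasCompletePattern := by
    intro R hR
    rw [List.mem_reverse] at hR
    have h := List.all_eq_true.1 complete_completeSystems R hR
    refine ⟨?_, ?_, fun C hC h' => ⟨R, hR, Equiv.refl _,
      PartialSystem.hasTriples_of_complete h hC h'⟩⟩
    · simp only [PartialSystem.complete, Bool.and_eq_true, List.all_eq_true] at h ⊢
      exact fun n hn => (h.1 n hn).1
    · simp only [PartialSystem.complete, Bool.and_eq_true] at h
      exact h.2.1
  -- The last entry of the search data is the system that `exists_star` provides.
  obtain ⟨x, hx, hx1⟩ : ∃ x ∈ searchData, x.1 = ([12, 34, 56], []) :=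
    ⟨searchData.getLast (by simp [searchData, searchData₁]), List.getLast_mem _, rfl⟩
  have := implies_of_searchAll (fun C σ => hasCompletePattern_of_relabel) hcomplete
    searchAll_searchData x hx
  obtain ⟨σ, hσ⟩ := hC.exists_star
  exact hasCompletePattern_of_relabel (this.implies _ (hC.relabel σ) (by rwa [hx1]))

/-! ### Triple points of admissible arrangements -/

lemma eq_of_incident {p q : Pt} {L M : Line} (hLM : L ≠ M) (h1 : Incident p L) (h2 : Incident p M)
    (h3 : Incident q L) (h4 : Incident q M) : p = q :=
  ((Configuration.ofField.eq_or_eq_of_orthogonal h1 h2 h3 h4).resolve_left hLM)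

lemma Admissible.not_incident {n : ℕ} {A : Fin n → Line} (hA : Admissible A) {p : Pt}
    {i j k l : Fin n} (hij : i ≠ j) (hik : i ≠ k) (hil : i ≠ l) (hjk : j ≠ k) (hjl : j ≠ l)
    (hi : Incident p (A i)) (hj : Incident p (A j)) (hk : Incident p (A k))
    (hl : Incident p (A l)) : k = l := by
  by_contra hkl
  have h := hA.mult_le_three p
  have hsub : (({i, j, k, l} : Finset (Fin n)) : Set (Fin n)) ⊆ {i | Incident p (A i)} := by
    intro x hx
    simp only [Finset.coe_insert, Finset.coe_singleton, Set.mem_insert_iff,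
      Set.mem_singleton_iff] at hx
    rcases hx with rfl | rfl | rfl | rfl <;> assumption
  have := Set.ncard_le_ncard hsub
  rw [Set.ncard_coe_finset, Finset.card_insert_of_notMem (by simp [*]),
    Finset.card_insert_of_notMem (by simp [*]), Finset.card_pair hkl] at this
  unfold mult at h
  omega

/-- The triples of concurrent lines. -/
def concurrentTriples (A : Fin 10 → Line) (i j k : Fin 10) : Prop :=
  i ≠ j ∧ i ≠ k ∧ j ≠ k ∧ Concurrent A i j k

lemma exists_incident_of_concurrent {n : ℕ} {A : Fin n → Line} {i j k : Fin n}
    (h : Concurrent A i j k) : ∃ p, Incident p (A i) ∧ Incident p (A j) ∧ Incident p (A k) := by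
  obtain ⟨p, hp⟩ := h
  exact ⟨p, hp i (by simp), hp j (by simp), hp k (by simp)⟩

lemma concurrent_of_incident {n : ℕ} {A : Fin n → Line} {i j k : Fin n} {p : Pt}
    (hi : Incident p (A i)) (hj : Incident p (A j)) (hk : Incident p (A k)) : Concurrent A i j k := by
  refine ⟨p, ?_⟩
  rintro l (rfl | rfl | rfl) <;> assumption

lemma concurrent_swap {n : ℕ} {A : Fin n → Line} {i j k : Fin n} (h : Concurrent A i j k) :
    Concurrent A j i k := by
  obtain ⟨p, h1, h2, h3⟩ := exists_incident_of_concurrent h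
  exact concurrent_of_incident h2 h1 h3

lemma concurrent_rotate {n : ℕ} {A : Fin n → Line} {i j k : Fin n} (h : Concurrent A i j k) :
    Concurrent A j k i := by
  obtain ⟨p, h1, h2, h3⟩ := exists_incident_of_concurrent h
  exact concurrent_of_incident h2 h3 h1

/-- Two concurrent triples with two lines in common pass through the same point, which would have
multiplicity four if the third lines differed. For the degree condition, three triple points on
`L_i` carry two further lines each, and these six lines are distinct because another line meets
`L_i` only once. -/
lemma Admissible.tripleSystem {A : Fin 10 → Line} (hA : Admissible A) :
    TripleSystem (concurrentTriples A) where
  swap := fun ⟨h1, h2, h3, h⟩ => ⟨h1.symm, h3, h2, concurrent_swap h⟩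
  rotate := fun ⟨h1, h2, h3, h⟩ => ⟨h3, h1.symm, h2.symm, concurrent_rotate h⟩
  ne h := h.1
  unique := by
    rintro i j k l ⟨h1, h2, h3, h⟩ ⟨-, h5, h6, h'⟩
    obtain ⟨p, hi, hj, hk⟩ := exists_incident_of_concurrent h
    obtain ⟨q, hi', hj', hl⟩ := exists_incident_of_concurrent h'
    obtain rfl := eq_of_incident (fun h => h1 (hA.injective h)) hi hj hi' hj'
    exact hA.not_incident h1 h2 h5 h3 h6 hi hj hk hl
  degree i s hs := by
    classical
    obtain ⟨t, ht, htcard⟩ := Set.exists_subset_encard_eq (hA.three_le_triples i)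
    have htfin : t.Finite := Set.finite_of_encard_eq_coe htcard
    let T : Finset Pt := htfin.toFinset
    have hT : T.card = 3 := by
      have h3 := htcard
      rw [htfin.encard_eq_coe_toFinset_card] at h3
      exact_mod_cast h3
    let U : Pt → Finset (Fin 10) := fun p =>
      Finset.univ.filter fun j => j ≠ i ∧ Incident p (A j)
    have hU : ∀ p ∈ T, (U p).card = 2 := by
      intro p hp
      obtain ⟨hpi, hpm⟩ := ht (htfin.mem_toFinset.1 hp)
      have : insert i (U p) = Finset.univ.filter fun j => Incident p (A j) := by
        ext j
        by_cases hj : j = i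
        · subst hj; simp [hpi]
        · simp [U, hj]
      have hcard := congrArg Finset.card this
      rw [Finset.card_insert_of_notMem (by simp [U])] at hcard
      rw [mult, Set.ncard_eq_toFinset_card'] at hpm
      simp only [Set.toFinset_ofPred] at hpm
      omega
    have hdisj : ∀ p ∈ T, ∀ q ∈ T, p ≠ q → Disjoint (U p) (U q) := by
      intro p hp q hq hpq
      rw [Finset.disjoint_left]
      intro j hj hj'
      simp only [U, Finset.mem_filter, Finset.mem_univ, true_and] at hj hj'
      exact hpq (eq_of_incident (fun h => hj.1 (hA.injective h)) hj.2
        (ht (htfin.mem_toFinset.1 hp)).1 hj'.2 (ht (htfin.mem_toFinset.1 hq)).1)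
    have hunion : (T.biUnion U).card = 6 := by
      rw [Finset.card_biUnion hdisj, Finset.sum_congr rfl hU]
      simp [hT]
    have hs' : Disjoint s (T.biUnion U) := by
      rw [Finset.disjoint_left]
      intro j hj hj'
      obtain ⟨p, hp, hjp⟩ := Finset.mem_biUnion.1 hj'
      obtain ⟨k, hk, hkj⟩ := Finset.exists_mem_ne (by rw [hU p hp]; norm_num) j
      simp only [U, Finset.mem_filter, Finset.mem_univ, true_and] at hjp hk
      exact (hs j hj).2 k ⟨hjp.1.symm, hk.1.symm, hkj.symm, concurrent_of_incident
        (ht (htfin.mem_toFinset.1 hp)).1 hjp.2 hk.2⟩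
    have hi : i ∉ s ∪ T.biUnion U := by
      intro h
      rcases Finset.mem_union.1 h with h | h
      · exact (hs i h).1 rfl
      · obtain ⟨p, -, h⟩ := Finset.mem_biUnion.1 h
        simp [U] at h
    -- Among ten lines, `i` and its six partners leave room for at most three.
    have := Finset.card_le_univ (insert i (s ∪ T.biUnion U))
    rw [Finset.card_insert_of_notMem hi, Finset.card_union_of_disjoint hs', hunion,
      Fintype.card_fin] at this
    omega

/-- If all lines passed through the intersection of the lines `i` and `j`, two further lines would
give two different triples containing the pair. -/
lemma Admissible.spread {A : Fin 10 → Line} (hA : Admissible A) : Spread A := by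
  intro i j hij
  by_contra! h
  obtain ⟨k, hk⟩ := Finset.exists_mem_notMem_of_card_lt_card
    (s := {i, j}) (t := Finset.univ) (Finset.card_le_two.trans_lt (by simp))
  obtain ⟨l, hl⟩ := Finset.exists_mem_notMem_of_card_lt_card
    (s := {i, j, k}) (t := Finset.univ) (Finset.card_le_three.trans_lt (by simp))
  simp only [Finset.mem_univ, true_and, Finset.mem_insert, Finset.mem_singleton, not_or] at hk hl
  have hT := hA.tripleSystem
  exact hl.2.2 (hT.unique (i := i) (j := j) ⟨hij, Ne.symm hl.1, Ne.symm hl.2.1, h l⟩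
    ⟨hij, Ne.symm hk.1, Ne.symm hk.2, h k⟩)

/-- Up to a permutation of the labels, an admissible arrangement has one of the complete
patterns. -/
theorem Admissible.exists_hasPattern {A : Fin 10 → Line} (hA : Admissible A) :
    ∃ R ∈ completeSystems, ∃ σ : Equiv.Perm (Fin 10), HasPattern (A ∘ σ) R.1 := by
  obtain ⟨R, hR, σ, h⟩ := hA.tripleSystem.hasCompletePattern
  refine ⟨R, hR, σ, hA.injective.comp σ.injective, fun a b c hab hbc => ?_⟩
  rw [← h a b c hab hbc, concurrent_comp]
  have h1 : σ a ≠ σ b := fun h => hab.ne (σ.injective h)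
  have h2 : σ a ≠ σ c := fun h => (hab.trans hbc).ne (σ.injective h)
  have h3 : σ b ≠ σ c := fun h => hbc.ne (σ.injective h)
  exact ⟨fun h => ⟨h1, h2, h3, h⟩, fun h => h.2.2.2⟩

/-! ### Computations with ten labels -/

/-- A sum over ten labels. -/
def sumFin (f : Fin 10 → ℕ) : ℕ :=
  f ⟨0, by decide⟩ + (f ⟨1, by decide⟩ + (f ⟨2, by decide⟩ + (f ⟨3, by decide⟩ + (f ⟨4, by decide⟩ +
    (f ⟨5, by decide⟩ + (f ⟨6, by decide⟩ + (f ⟨7, by decide⟩ + (f ⟨8, by decide⟩ +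
      f ⟨9, by decide⟩))))))))

lemma sumFin_eq (f : Fin 10 → ℕ) : sumFin f = ∑ i, f i := by
  simp only [Fin.sum_univ_succ, Finset.univ_eq_empty, Finset.sum_empty, add_zero]
  rfl

/-- A condition on all ten labels. -/
def allFin (f : Fin 10 → Bool) : Bool :=
  f ⟨0, by decide⟩ && (f ⟨1, by decide⟩ && (f ⟨2, by decide⟩ && (f ⟨3, by decide⟩ &&
    (f ⟨4, by decide⟩ && (f ⟨5, by decide⟩ && (f ⟨6, by decide⟩ && (f ⟨7, by decide⟩ &&
      (f ⟨8, by decide⟩ && f ⟨9, by decide⟩))))))))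

lemma allFin_eq_true {f : Fin 10 → Bool} : allFin f = true ↔ ∀ i, f i = true := by
  simp only [allFin, Bool.and_eq_true]
  constructor
  · rintro ⟨h0, h1, h2, h3, h4, h5, h6, h7, h8, h9⟩ i
    fin_cases i <;> assumption
  · exact fun h => ⟨h _, h _, h _, h _, h _, h _, h _, h _, h _, h _⟩

/-! ### Admissibility of arrangements with a given pattern -/

/-- Conditions on a list of codes of concurrent triples: no four lines are concurrent, each line is
in at least three triples, and triples are determined by their digits. -/
structure AdmissiblePattern (B : List ℕ) : Prop where
  eq_of_mem : ∀ i j k l : Fin 10, i ≠ j → i ≠ k → i ≠ l → j ≠ k → j ≠ l →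
    tripleCode i j k ∈ B → tripleCode i j l ∈ B → k = l
  isCode : ∀ n ∈ B, NormalForm.isCode n = true
  lt : ∀ n ∈ B, n < 1000
  ext : ∀ n ∈ B, ∀ m ∈ B, (∀ l : Fin 10, codeHas n l = codeHas m l) → n = m
  three_le : ∀ i : Fin 10, 3 ≤ (B.toFinset.filter fun n => codeHas n i = true).card
  ne : ∀ i j k : Fin 10, tripleCode i j k ∈ B → i ≠ j ∧ i ≠ k ∧ j ≠ k

/-- The computation of `AdmissiblePattern`. -/
def checkPattern (B : List ℕ) : Bool :=
  (allFin fun i => allFin fun j => allFin fun k => !memCode (tripleCode i j k) B ||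
    !(Nat.beq i j || (Nat.beq i k || Nat.beq j k)) &&
      allFin fun l => !memCode (tripleCode i j l) B || Nat.beq k l) &&
  ((B.all fun n => NormalForm.isCode n && Nat.blt n 1000) &&
  ((B.all fun n => B.all fun m => Nat.beq n m ||
    !allFin fun l => bif codeHas n l then codeHas m l else !codeHas m l) &&
  decide (∀ i : Fin 10, 3 ≤ (B.toFinset.filter fun n => codeHas n i = true).card)))

lemma admissiblePattern_of_check {B : List ℕ} (h : checkPattern B = true) : AdmissiblePattern B := by
  simp only [checkPattern, Bool.and_eq_true, decide_eq_true_eq, List.all_eq_true, Nat.blt_eq,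
    allFin_eq_true, Bool.or_eq_true, Bool.not_eq_true', ← Bool.not_eq_true, memCode_eq_true,
    Nat.beq_eq, Fin.val_inj, ← imp_iff_not_or] at h
  obtain ⟨h1, h2, h3, h4⟩ := h
  refine ⟨fun i j k l _ _ _ _ _ h h' => (h1 i j k h).2 l h', fun n hn => (h2 n hn).1,
    fun n hn => (h2 n hn).2, fun n hn m hm h => (h3 n hn m hm).resolve_right fun h' => h' fun l => ?_,
    h4, fun i j k h => ?_⟩
  · rw [h l]
    cases codeHas m l <;> rfl
  · have := (h1 i j k h).1
    tauto

/-! ### Arrangements with an admissible pattern are admissible. -/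

section
variable {A : Fin 10 → Line} {B : List ℕ}

lemma HasPattern.not_incident (h : HasPattern A B) (hB : AdmissiblePattern B) {p : Pt}
    {i j k l : Fin 10} (hij : i ≠ j) (hik : i ≠ k) (hil : i ≠ l) (hjk : j ≠ k) (hjl : j ≠ l)
    (hi : Incident p (A i)) (hj : Incident p (A j)) (hk : Incident p (A k))
    (hl : Incident p (A l)) : k = l := by
  have h1 := (h.concurrent_iff i j k).1 (concurrent_of_incident hi hj hk)
  have h2 := (h.concurrent_iff i j l).1 (concurrent_of_incident hi hj hl)
  simp only [hij, hik, hil, hjk, hjl, false_or] at h1 h2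
  exact hB.eq_of_mem i j k l hij hik hil hjk hjl h1 h2

lemma HasPattern.mult_le (h : HasPattern A B) (hB : AdmissiblePattern B) (p : Pt) :
    mult A p ≤ 3 := by
  classical
  by_contra! h4
  rw [mult, Set.ncard_eq_toFinset_card'] at h4
  obtain ⟨t, ht, htc⟩ := Finset.exists_subset_card_eq (Nat.succ_le_of_lt h4)
  obtain ⟨i, j, k, l, hij, hik, hil, hjk, hjl, hkl, rfl⟩ := Finset.card_eq_four.1 htc
  have key : ∀ x ∈ ({i, j, k, l} : Finset (Fin 10)), Incident p (A x) := fun x hx => by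
    simpa using ht hx
  exact hkl (h.not_incident hB hij hik hil hjk hjl (key i (by simp)) (key j (by simp))
    (key k (by simp)) (key l (by simp)))

/-- The lines through the triple point with code `n`. -/
lemma HasPattern.exists_point (h : HasPattern A B) (hB : AdmissiblePattern B) {n : ℕ} (hn : n ∈ B) :
    ∃ p : Pt, mult A p = 3 ∧ ∀ l, Incident p (A l) ↔ codeHas n l = true := by
  classical
  have hc := hB.isCode n hn
  have hlt := hB.lt n hn
  simp only [NormalForm.isCode, Bool.and_eq_true, Nat.blt_eq] at hc
  obtain ⟨i, hi⟩ : ∃ i : Fin 10, i.val = n / 100 := ⟨⟨n / 100, by omega⟩, rfl⟩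
  obtain ⟨j, hj⟩ : ∃ i : Fin 10, i.val = n / 10 % 10 := ⟨⟨n / 10 % 10, by omega⟩, rfl⟩
  obtain ⟨k, hk⟩ : ∃ i : Fin 10, i.val = n % 10 := ⟨⟨n % 10, by omega⟩, rfl⟩
  have hij : i < j := by rw [Fin.lt_def]; omega
  have hjk : j < k := by rw [Fin.lt_def]; omega
  have hcon : Concurrent A i j k := (h.2 i j k hij hjk).2 (by convert hn using 1; omega)
  obtain ⟨p, h1, h2, h3⟩ := exists_incident_of_concurrent hcon
  have hinc : ∀ l, Incident p (A l) ↔ codeHas n l = true := by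
    intro l
    simp only [codeHas, Bool.or_eq_true, Nat.beq_eq, ← hi, ← hj, ← hk]
    constructor
    · intro hl
      by_contra! hne
      obtain ⟨e1, e2, e3⟩ := hne
      have e3' : k ≠ l := fun h => e3 (by rw [h])
      exact e3' (h.not_incident hB hij.ne (hij.trans hjk).ne (fun h => e1 (by rw [h])) hjk.ne
        (fun h => e2 (by rw [h])) h1 h2 h3 hl)
    · rintro (hl | hl | hl)
      · rwa [← Fin.ext hl]
      · rwa [← Fin.ext hl]
      · rwa [← Fin.ext hl]
  refine ⟨p, le_antisymm (h.mult_le hB p) ?_, hinc⟩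
  have hsub : (({i, j, k} : Finset (Fin 10)) : Set (Fin 10)) ⊆ {l | Incident p (A l)} := by
    intro x hx
    simp only [Finset.coe_insert, Finset.coe_singleton, Set.mem_insert_iff,
      Set.mem_singleton_iff] at hx
    rcases hx with rfl | rfl | rfl <;> assumption
  have := Set.ncard_le_ncard hsub
  rwa [Set.ncard_coe_finset, Finset.card_eq_three.2
    ⟨i, j, k, hij.ne, (hij.trans hjk).ne, hjk.ne, rfl⟩] at this

/-- The codes that contain `i` give triple points on the line `i`. They are distinct points because
a code is determined by the set of lines through its point. -/
lemma HasPattern.admissible (h : HasPattern A B) (hB : AdmissiblePattern B) : Admissible A where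
  injective := h.1
  mult_le_three := h.mult_le hB
  three_le_triples i := by
    classical
    choose! p hp hinc using fun n (hn : n ∈ B) => h.exists_point hB hn
    let S := B.toFinset.filter fun n => codeHas n i = true
    have hmem : ∀ n ∈ S, n ∈ B ∧ codeHas n i = true := fun n hn => by
      simpa [S] using hn
    have hinj : Set.InjOn p S := by
      intro n hn m hm hnm
      refine hB.ext n (hmem n hn).1 m (hmem m hm).1 fun l => ?_
      rw [Bool.eq_iff_iff, ← hinc n (hmem n hn).1, ← hinc m (hmem m hm).1, hnm]
    calc (3 : ℕ∞) ≤ (S.card : ℕ∞) := by exact_mod_cast hB.three_le i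
      _ = ((S.image p : Finset Pt) : Set Pt).encard := by
          rw [Set.encard_coe_eq_coe_finsetCard, Finset.card_image_of_injOn hinj]
      _ ≤ _ := by
          refine Set.encard_le_encard fun q hq => ?_
          obtain ⟨n, hn, rfl⟩ := Finset.mem_image.1 (Finset.mem_coe.1 hq)
          exact ⟨(hinc n (hmem n hn).1 i).2 (hmem n hn).2, hp n (hmem n hn).1⟩

lemma mult_comp {n : ℕ} (A : Fin n → Line) (σ : Equiv.Perm (Fin n)) (p : Pt) :
    mult (A ∘ σ) p = mult A p := by
  have : {i | Incident p ((A ∘ σ) i)} = σ ⁻¹' {i | Incident p (A i)} := rfl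
  rw [mult, this, mult, Set.ncard_preimage_of_injective_subset_range σ.injective (by simp)]

lemma admissible_of_comp {n : ℕ} {A : Fin n → Line} {σ : Equiv.Perm (Fin n)}
    (h : Admissible (A ∘ σ)) : Admissible A where
  injective := by
    have := h.injective.comp σ.symm.injective
    rwa [Function.comp_assoc, Equiv.self_comp_symm, Function.comp_id] at this
  mult_le_three p := by rw [← mult_comp A σ]; exact h.mult_le_three p
  three_le_triples i := by
    have := h.three_le_triples (σ.symm i)
    simpa [mult_comp] using this

end

/-! ### Intersection lattices and concurrent triples -/

section
variable {n : ℕ} {A B : Fin n → Line}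

lemma exists_incident (P Q : Line) : ∃ p : Pt, Incident p P ∧ Incident p Q := by
  have h : Concurrent ![P, Q] 0 0 1 := by
    rw [(represents_rep _).concurrent_iff]
    simp only [vdet]; ring
  obtain ⟨p, h1, -, h2⟩ := exists_incident_of_concurrent h
  exact ⟨p, h1, h2⟩

/-- If `S` contains two different labels `i` and `j`, its flat is at most the intersection point of
these lines, and lying on the line `t` means concurrency of `i`, `j`, `t`. If `S` has at most one
element, its flat is a line or the plane, which is contained in no line with a label outside `S`. -/
lemma flat_subset_flat (hA : Spread A) (hBi : Function.Injective B)
    (h : ∀ i j k, Concurrent A i j k ↔ Concurrent B i j k) {S T : Set (Fin n)}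
    (hST : flat A S ⊆ flat A T) : flat B S ⊆ flat B T := by
  intro p hp t ht
  by_cases hS : ∃ i ∈ S, ∃ j ∈ S, i ≠ j
  · obtain ⟨i, hi, j, hj, hij⟩ := hS
    obtain ⟨q, hqi, hqj⟩ := exists_incident (A i) (A j)
    have hAi : A i ≠ A j := fun h' => by
      obtain ⟨k, hk⟩ := hA i j hij
      exact hk (concurrent_of_eq h' k)
    have hq : q ∈ flat A S := by
      intro k hk
      obtain ⟨r, h1, h2, h3⟩ := exists_incident_of_concurrent
        ((h i j k).2 (concurrent_of_incident (hp i hi) (hp j hj) (hp k hk)))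
      rwa [eq_of_incident hAi hqi hqj h1 h2]
    obtain ⟨r, h1, h2, h3⟩ := exists_incident_of_concurrent
      ((h i j t).1 (concurrent_of_incident hqi hqj (hST hq t ht)))
    rwa [eq_of_incident (fun h' => hij (hBi h')) (hp i hi) (hp j hj) h1 h2]
  · push Not at hS
    by_cases htS : t ∈ S
    · exact hp t htS
    · exfalso
      have key : ∀ i, i ≠ t → (∀ j ∈ S, j = i) → False := by
        intro i hit hi
        obtain ⟨k, hk⟩ := hA i t hit
        obtain ⟨q, hqi, hqk⟩ := exists_incident (A i) (A k)
        refine hk (concurrent_of_incident hqi (hST (fun j hj => ?_) t ht) hqk)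
        rwa [hi j hj]
      rcases S.eq_empty_or_nonempty with rfl | ⟨i, hi⟩
      · by_cases hi : ∃ i, i ≠ t
        · obtain ⟨i, hi⟩ := hi
          exact key i hi (by simp)
        · push Not at hi
          obtain ⟨L, hL⟩ : ∃ q : Pt, ¬ Incident q (A t) := by
            by_contra! hall
            induction h' : A t using Projectivization.ind with | h v hv =>
            apply hv
            ext j
            have := hall (Projectivization.mk ℂ (Pi.single j 1) (by simp))
            rw [h', incident_mk] at this
            simpa using this
          exact hL (hST (by intro i hi; simp at hi) t ht)
      · exact key i (fun h => htS (h ▸ hi)) fun j hj => (hS i hi j hj).symm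

lemma latticeIso_of_concurrent_iff (hA : Spread A) (hB : Spread B) (hAi : Function.Injective A)
    (hBi : Function.Injective B) (σ : Equiv.Perm (Fin n))
    (h : ∀ i j k, Concurrent A i j k ↔ Concurrent B (σ i) (σ j) (σ k)) : LatticeIso A B := by
  have hB' : Spread (B ∘ σ) := fun i j hij => by
    obtain ⟨k, hk⟩ := hB (σ i) (σ j) (fun h => hij (σ.injective h))
    exact ⟨σ.symm k, by rwa [concurrent_comp, Equiv.apply_symm_apply]⟩
  have h' : ∀ i j k, Concurrent A i j k ↔ Concurrent (B ∘ σ) i j k := fun i j k => by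
    rw [concurrent_comp, h]
  exact ⟨σ, fun S T => ⟨flat_subset_flat hA (hBi.comp σ.injective) h',
    flat_subset_flat hB' hAi fun i j k => (h' i j k).symm⟩⟩

/-- The flat of all lines is empty. Three lines fail to be concurrent exactly when their flat is
contained in it, so concurrency is visible in the order of the lattice. -/
lemma LatticeIso.exists_concurrent_iff (hA : flat A Set.univ = ∅) (hB : flat B Set.univ = ∅)
    (h : LatticeIso A B) : ∃ σ : Equiv.Perm (Fin n),
      ∀ i j k, Concurrent A i j k ↔ Concurrent B (σ i) (σ j) (σ k) := by
  obtain ⟨σ, h⟩ := h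
  refine ⟨σ, fun i j k => ?_⟩
  have hB' : flat (B ∘ σ) Set.univ = ∅ := by
    rw [← hB]
    ext p
    exact ⟨fun h i _ => by simpa using h (σ.symm i) trivial, fun h i _ => h (σ i) trivial⟩
  have := h {i, j, k} Set.univ
  rw [hA, hB', Set.subset_empty_iff, Set.subset_empty_iff] at this
  rw [← concurrent_comp, Concurrent, Concurrent, Set.nonempty_iff_ne_empty,
    Set.nonempty_iff_ne_empty, ne_eq, ne_eq, this]

lemma Admissible.flat_univ {A : Fin 10 → Line} (hA : Admissible A) : flat A Set.univ = ∅ := by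
  by_contra! h
  obtain ⟨p, hp⟩ := h
  have := hA.mult_le_three p
  rw [mult, show {i | Incident p (A i)} = Set.univ from
    Set.eq_univ_of_forall fun i => hp i trivial, Set.ncard_univ] at this
  simp at this

end

/-! ### Numerical invariants of patterns -/

/-- The points `i` and `j` are in no common triple. -/
def unjoined (C : Fin 10 → Fin 10 → Fin 10 → Bool) (i j : Fin 10) : Bool :=
  !Nat.beq i j && allFin fun k => !C i j k

/-- The sum over all points of the square of the number of paths of length two in the graph of
unjoined points. -/
def pathInvariant (C : Fin 10 → Fin 10 → Fin 10 → Bool) : ℕ :=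
  sumFin fun i => (sumFin fun j => bif unjoined C i j then
    sumFin fun k => bif unjoined C j k then 1 else 0 else 0) ^ 2

/-- The number of labelled quadruples of triples `abc`, `ade`, `fbd`, `fce`. -/
def quadrangleInvariant (C : Fin 10 → Fin 10 → Fin 10 → Bool) : ℕ :=
  sumFin fun a => sumFin fun b => sumFin fun c => bif C a b c then
    sumFin fun d => sumFin fun e => bif C a d e then
      sumFin fun f => bif C f b d && C f c e then 1 else 0 else 0
  else 0

lemma unjoined_comp (C : Fin 10 → Fin 10 → Fin 10 → Bool) (σ : Equiv.Perm (Fin 10)) (i j : Fin 10) :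
    unjoined (fun i j k => C (σ i) (σ j) (σ k)) i j = unjoined C (σ i) (σ j) := by
  rw [Bool.eq_iff_iff]
  simp only [unjoined, beq_eq_decide, Fin.val_inj, EmbeddingLike.apply_eq_iff_eq,
    Bool.and_eq_true, allFin_eq_true]
  rw [σ.forall_congr_right (q := fun k => (!C (σ i) (σ j) k) = true)]

lemma pathInvariant_comp (C : Fin 10 → Fin 10 → Fin 10 → Bool) (σ : Equiv.Perm (Fin 10)) :
    pathInvariant (fun i j k => C (σ i) (σ j) (σ k)) = pathInvariant C := by
  simp only [pathInvariant, unjoined_comp, sumFin_eq]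
  refine Fintype.sum_equiv σ _ _ fun i => ?_
  refine congrArg (· ^ 2) (Fintype.sum_equiv σ _ _ fun j => ?_)
  refine congrArg (fun n => bif _ then n else 0) ?_
  exact Fintype.sum_equiv σ _ _ fun k => rfl

lemma quadrangleInvariant_comp (C : Fin 10 → Fin 10 → Fin 10 → Bool) (σ : Equiv.Perm (Fin 10)) :
    quadrangleInvariant (fun i j k => C (σ i) (σ j) (σ k)) = quadrangleInvariant C := by
  simp only [quadrangleInvariant, sumFin_eq]
  refine Fintype.sum_equiv σ _ _ fun a => Fintype.sum_equiv σ _ _ fun b =>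
    Fintype.sum_equiv σ _ _ fun c => ?_
  refine congrArg (fun n => bif _ then n else 0) ?_
  refine Fintype.sum_equiv σ _ _ fun d => Fintype.sum_equiv σ _ _ fun e => ?_
  refine congrArg (fun n => bif _ then n else 0) ?_
  exact Fintype.sum_equiv σ _ _ fun f => rfl

/-! ### The nine special patterns -/

section
open PolyExpr

/-- Normal forms of the arrangements with the nine configuration tables. -/
def specialForm : Fin 9 → NormalForm := ![
  ⟨[24, 35, 69, 78, 126, 137, 145, 189, 238, 257, 346, 479],
    [(1, 0, x), (1, x, x), (0, 1, -x + 1), (1, x, 1), (-x, -x, -1), (-x, -x*x - x, -1)],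
    [.line 0 2, .meet 0 3 1 4 (1), .meet 1 2 3 4 (1), .meet 1 3 2 5 (1), .meet 0 7 2 3 (1),
      .meet 1 8 4 7 (x - 1)]⟩,
  ⟨[16, 24, 35, 78, 125, 134, 179, 239, 267, 368, 456, 589],
    [(1, 0, 1), (0, 1, 1), (1, -1, 0), (x, -x, 1), (x + 2, -x, 1), (x, x, 1)],
    [.meet 0 2 1 3 (1), .meet 0 3 1 2 (1), .meet 0 1 4 5 (1), .line 2 6, .meet 0 7 3 6 (1),
      .meet 1 7 2 3 (1)]⟩,
  ⟨[16, 24, 57, 89, 125, 134, 179, 239, 268, 358, 367, 478],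
    [(1, 0, 1), (0, 1, x), (1, y, 0), (-x*y + x - 1, -y, -x*y), (-1, -y, -x), (y, y, x)],
    [.meet 0 2 1 3 (1), .line 1 2, .line 0 1, .meet 0 5 3 6 (1), .meet 2 6 4 7 (y),
      .meet 0 8 2 3 (1)]⟩,
  ⟨[16, 24, 79, 125, 134, 189, 239, 267, 357, 368, 456, 478],
    [(1, 0, 1), (0, 1, x), (x, -1, 0), (x, -1, -x*x), (x*x + 2*x, -1, x), (1, 1, x*x)],
    [.meet 0 2 1 3 (1), .line 1 2, .meet 0 1 4 5 (1), .meet 2 6 3 5 (1), .meet 3 6 4 7 (x),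
      .meet 0 7 2 3 (1)]⟩,
  ⟨[15, 26, 34, 89, 124, 139, 178, 238, 257, 367, 456, 479],
    [(0, 1, 1), (1, x, 0), (1, 0, -x), (-1, -x, -x*x), (-1, -1, -x*x), (-x*x, -1, -x*x)],
    [.meet 0 3 1 2 (1), .line 0 1, .meet 0 2 4 5 (1), .meet 2 5 3 6 (1), .meet 1 7 2 3 (1),
      .meet 0 8 1 3 (1)]⟩,
  ⟨[15, 24, 37, 89, 126, 134, 178, 238, 257, 356, 459, 679],
    [(1, 0, 1), (1, x, 0), (0, -x + 1, 1), (-1, -x, -x), (-1, -1, -x), (x*x + 1, x, x*x)],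
    [.meet 0 2 1 3 (1), .line 0 1, .meet 1 2 3 5 (1), .meet 0 3 2 5 (1), .meet 1 7 2 3 (1),
      .meet 0 8 4 5 (1)]⟩,
  ⟨[15, 28, 34, 124, 137, 189, 235, 267, 369, 456, 479, 578],
    [(0, 1, 1), (-1, -1, 0), (-x, -x + 1, 1), (-x, -x + 1, -x), (1, 0, x), (-x, -x*x + 1, -x*x)],
    [.meet 0 3 1 2 (1), .meet 0 1 2 3 (1), .line 4 5, .meet 1 3 2 6 (1), .meet 0 2 5 7 (1),
      .meet 1 8 4 7 (1)]⟩,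
  ⟨[15, 24, 78, 126, 134, 238, 257, 359, 367, 456, 479, 689],
    [(1, 0, 1), (x, 1, 0), (0, -1, x), (-x, -1, -x*x), (1, 1, x*x), (x*x - 2*x, -1, -x)],
    [.meet 0 2 1 3 (1), .line 1 0, .meet 1 2 4 5 (1), .meet 2 5 3 6 (1), .meet 0 7 2 3 (1),
      .meet 3 5 4 7 (x)]⟩,
  ⟨[15, 24, 67, 126, 134, 235, 278, 368, 379, 469, 589],
    [(1, 0, 1), (-1, -1, 0), (0, 1, x), (1, y, x*y), (1, y, x*y - x + 1),
      (-x + 1, -x*y + 1, -x*x*y + 1)],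
    [.meet 0 2 1 3 (1), .meet 0 1 2 3 (1), .line 1 2, .line 0 6, .meet 2 7 3 6 (1),
      .meet 3 7 4 6 (1)]⟩]

end

lemma valid_specialForm : ∀ t, (specialForm t).valid = true := by decide +kernel

/-- The line of the configuration table that corresponds to a line of the normal form. -/
def specialLabel : Fin 9 → Fin 10 → Fin 10 := ![
  ![5, 1, 3, 2, 4, 9, 6, 0, 7, 8], ![3, 7, 0, 4, 9, 5, 2, 1, 6, 8], ![5, 2, 8, 1, 0, 4, 7, 3, 6, 9],
  ![1, 2, 6, 8, 4, 9, 0, 3, 5, 7], ![5, 8, 7, 6, 3, 1, 0, 4, 9, 2], ![4, 6, 7, 8, 1, 3, 9, 5, 2, 0],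
  ![9, 3, 5, 4, 7, 8, 2, 6, 1, 0], ![0, 2, 6, 7, 8, 4, 5, 3, 1, 9], ![7, 4, 0, 1, 8, 3, 2, 6, 5, 9]]

/-- The labels of the configuration table, as a permutation. -/
noncomputable def specialPerm (t : Fin 9) : Equiv.Perm (Fin 10) :=
  Equiv.ofBijective (specialLabel t) (Finite.injective_iff_bijective.1 (by
    revert t; decide +kernel))

/-- The dictionary between the columns of the tables and the codes of the normal forms. Repeated
labels are excluded because a single column always meets itself. -/
lemma mem_specialForm_blocks : ∀ (t : Fin 9) (i j k : Fin 10), i ≠ j → i ≠ k → j ≠ k →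
    (memCode (tripleCode i j k) (specialForm t).blocks = true ↔
      (table t (specialLabel t i) ∩ table t (specialLabel t j) ∩
        table t (specialLabel t k)).Nonempty) := by
  have h : ∀ t, (allFin fun i => allFin fun j => Nat.beq i j || allFin fun k =>
      Nat.beq i k || (Nat.beq j k || decide (memCode (tripleCode i j k) (specialForm t).blocks =
        decide (table t (specialLabel t i) ∩ table t (specialLabel t j) ∩
        table t (specialLabel t k)).Nonempty))) = true := by decide +kernel
  intro t i j k hij hik hjk
  have := h t
  simp only [allFin_eq_true, Bool.or_eq_true, decide_eq_true_eq, Nat.beq_eq, Fin.val_inj] at this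
  rw [(((this i j).resolve_left hij k).resolve_left hik).resolve_left hjk, decide_eq_true_eq]

lemma admissiblePattern_specialForm (t : Fin 9) : AdmissiblePattern (specialForm t).blocks :=
  admissiblePattern_of_check (by revert t; decide +kernel)

/-! ### Special patterns, configuration tables and their lattices. -/

section
variable {A B : Fin 10 → Line} {s t : Fin 9}

lemma realizes_iff_hasPattern :
    Realizes A (table t) ↔ HasPattern (A ∘ specialPerm t) (specialForm t).blocks := by
  have hS : ∀ i, specialPerm t i = specialLabel t i := fun i => rfl
  constructor
  · rintro ⟨h1, h2⟩
    refine ⟨h1.comp (specialPerm t).injective, fun a b c hab hbc => ?_⟩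
    have hac := hab.trans hbc
    have hne : ∀ {a b}, a < b → specialPerm t a ≠ specialPerm t b := fun h h' =>
      h.ne ((specialPerm t).injective h')
    rw [concurrent_comp, h2 _ _ _ (hne hab) (hne hac) (hne hbc), hS, hS, hS,
      ← mem_specialForm_blocks t a b c hab.ne hac.ne hbc.ne, memCode_eq_true]
    simp [tripleCode, blt_eq_decide, hab, hbc]
  · intro h
    refine ⟨?_, fun i j k hij hik hjk => ?_⟩
    · have := h.1.comp (specialPerm t).symm.injective
      rwa [Function.comp_assoc, Equiv.self_comp_symm, Function.comp_id] at this
    · obtain ⟨i, rfl⟩ := (specialPerm t).surjective i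
      obtain ⟨j, rfl⟩ := (specialPerm t).surjective j
      obtain ⟨k, rfl⟩ := (specialPerm t).surjective k
      have hij' : i ≠ j := fun h => hij (by rw [h])
      have hik' : i ≠ k := fun h => hik (by rw [h])
      have hjk' : j ≠ k := fun h => hjk (by rw [h])
      rw [← concurrent_comp, h.concurrent_iff, hS, hS, hS,
        ← mem_specialForm_blocks t i j k hij' hik' hjk', memCode_eq_true]
      simp [hij', hik', hjk']

lemma Realizes.hasPattern (h : Realizes A (table t)) :
    HasPattern (A ∘ specialPerm t) (specialForm t).blocks := realizes_iff_hasPattern.1 h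

lemma Realizes.admissible (h : Realizes A (table t)) : Admissible A :=
  admissible_of_comp (h.hasPattern.admissible (admissiblePattern_specialForm t))

lemma latticeIso_of_hasPattern {C : List ℕ} {σ τ : Equiv.Perm (Fin 10)} (hA : Admissible A)
    (hB : Admissible B) (h : HasPattern (A ∘ σ) C) (h' : HasPattern (B ∘ τ) C) :
    LatticeIso A B := by
  refine latticeIso_of_concurrent_iff hA.spread hB.spread hA.injective hB.injective
    (σ.symm.trans τ) fun i j k => ?_
  have e1 := h.concurrent_iff (σ.symm i) (σ.symm j) (σ.symm k)
  have e2 := h'.concurrent_iff (σ.symm i) (σ.symm j) (σ.symm k)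
  rw [← e2, concurrent_comp, concurrent_comp] at e1
  simpa using e1

lemma LatticeIso.exists_hasPattern {C : List ℕ} {τ : Equiv.Perm (Fin 10)} (hA : Admissible A)
    (hB : Admissible B) (h : LatticeIso A B) (h' : HasPattern (B ∘ τ) C) :
    ∃ σ : Equiv.Perm (Fin 10), HasPattern (A ∘ σ) C := by
  obtain ⟨ρ, hρ⟩ := h.exists_concurrent_iff hA.flat_univ hB.flat_univ
  refine ⟨τ.trans ρ.symm, h'.of_concurrent_iff (hA.injective.comp (Equiv.injective _))
    fun i j k => ?_⟩
  rw [concurrent_comp, concurrent_comp, hρ]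
  simp

/-- The triples of a special pattern. -/
def specialTriple (t : Fin 9) (i j k : Fin 10) : Bool :=
  memCode (tripleCode i j k) (specialForm t).blocks

/-- This invariant alone does not separate the patterns, since 242, 210 and 202 each occur twice.
Together with the number of quadrangles it does. -/
lemma pathInvariant_specialTriple : ∀ t, pathInvariant (specialTriple t) =
    ![242, 210, 330, 242, 234, 210, 202, 202, 498] t := by
  decide +kernel

lemma quadrangleInvariant_specialTriple : ∀ t, quadrangleInvariant (specialTriple t) =
    ![96, 144, 72, 120, 96, 72, 96, 120, 114] t := by
  decide +kernel

/-- A lattice isomorphism is a relabelling that carries one system of triples to the other, so both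
invariants agree. -/
lemma eq_of_latticeIso (hA : Realizes A (table s)) (hB : Realizes B (table t))
    (h : LatticeIso A B) : s = t := by
  obtain ⟨ρ, hρ⟩ := h.exists_concurrent_iff hA.admissible.flat_univ hB.admissible.flat_univ
  let σ : Equiv.Perm (Fin 10) := (specialPerm s).trans (ρ.trans (specialPerm t).symm)
  have key : specialTriple s = fun i j k => specialTriple t (σ i) (σ j) (σ k) := by
    funext i j k
    rw [Bool.eq_iff_iff, specialTriple, specialTriple, memCode_eq_true, memCode_eq_true]
    have e1 := hA.hasPattern.concurrent_iff i j k
    have e2 := hB.hasPattern.concurrent_iff (σ i) (σ j) (σ k)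
    rw [concurrent_comp, hρ] at e1
    rw [concurrent_comp] at e2
    simp only [σ, Equiv.trans_apply, Equiv.apply_symm_apply] at e2 ⊢
    rw [e1] at e2
    simp only [EmbeddingLike.apply_eq_iff_eq] at e2
    -- Triples with repeated labels are concurrent for trivial reasons, but their codes do not
    -- belong to the patterns; so these alternatives can be discarded.
    have n1 := (admissiblePattern_specialForm s).ne i j k
    have n2 := (admissiblePattern_specialForm t).ne (σ i) (σ j) (σ k)
    simp only [σ, Equiv.trans_apply, ne_eq, EmbeddingLike.apply_eq_iff_eq] at n2
    simp only [ne_eq] at n1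
    constructor
    · exact fun h => (e2.1 (Or.inr (Or.inr (Or.inr h)))).elim (fun h' => absurd h' (n1 h).1)
        fun h' => h'.elim (fun h' => absurd h' (n1 h).2.1)
          fun h' => h'.elim (fun h' => absurd h' (n1 h).2.2) id
    · exact fun h => (e2.2 (Or.inr (Or.inr (Or.inr h)))).elim (fun h' => absurd h' (n2 h).1)
        fun h' => h'.elim (fun h' => absurd h' (n2 h).2.1)
          fun h' => h'.elim (fun h' => absurd h' (n2 h).2.2) id
  have h1 := congrArg pathInvariant key
  have h2 := congrArg quadrangleInvariant key
  rw [pathInvariant_comp, pathInvariant_specialTriple, pathInvariant_specialTriple] at h1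
  rw [quadrangleInvariant_comp, quadrangleInvariant_specialTriple,
    quadrangleInvariant_specialTriple] at h2
  have : ∀ s t : Fin 9, ![242, 210, 330, 242, 234, 210, 202, 202, 498] s =
      ![242, 210, 330, 242, 234, 210, 202, 202, 498] t →
      ![96, 144, 72, 120, 96, 72, 96, 120, 114] s = ![96, 144, 72, 120, 96, 72, 96, 120, 114] t →
      s = t := by decide
  exact this s t h1 h2

end

/-! ### Coordinates of a line with respect to a frame -/

lemma vdet_map (g : (Fin 3 → ℂ) →ₗ[ℂ] (Fin 3 → ℂ)) (u v w : Fin 3 → ℂ) :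
    vdet (g u) (g v) (g w) = LinearMap.det g * vdet u v w := by
  have h := (Pi.basisFun ℂ (Fin 3)).det_comp g ![u, v, w]
  rw [Pi.basisFun_det_apply, Pi.basisFun_det_apply] at h
  rw [vdet_eq_det, vdet_eq_det, ← h]
  congr 1
  ext i j
  fin_cases i <;> rfl

/-- The determinant of the frame formed by the first three vectors, with the vector of index `a`
replaced by the vector `v l`. -/
def frameDet (v : Fin 10 → Fin 3 → ℂ) (l : Fin 10) : Fin 3 → ℂ :=
  ![vdet (v l) (v 1) (v 2), vdet (v 0) (v l) (v 2), vdet (v 0) (v 1) (v l)]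

/-- The numerator of the ratio of the coordinates of index `b` and `a` of the vector `v l`, when the
fourth vector is the unit vector. -/
def ratioNum (v : Fin 10 → Fin 3 → ℂ) (l : Fin 10) (a b : Fin 3) : ℂ :=
  frameDet v l b * frameDet v 3 a

/-- Scaling the vectors and applying `g` multiplies each determinant by the determinant of `g` and
three of the scalars. The factor of the product is symmetric in `a` and `b`, so the quotient of the
two products is a projective invariant. -/
lemma exists_ratioNum_eq {v w : Fin 10 → Fin 3 → ℂ} (g : (Fin 3 → ℂ) ≃ₗ[ℂ] (Fin 3 → ℂ))
    (h : ∀ i, ∃ μ : ℂ, μ ≠ 0 ∧ w i = μ • g (v i)) (l : Fin 10) (a b : Fin 3) :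
    ∃ κ : ℂ, κ ≠ 0 ∧ ratioNum w l a b = κ * ratioNum v l a b ∧
      ratioNum w l b a = κ * ratioNum v l b a := by
  choose μ hμ hw using h
  have hD : LinearMap.det (g : (Fin 3 → ℂ) →ₗ[ℂ] (Fin 3 → ℂ)) ≠ 0 :=
    (LinearEquiv.isUnit_det' g).ne_zero
  set D := LinearMap.det (g : (Fin 3 → ℂ) →ₗ[ℂ] (Fin 3 → ℂ))
  -- The scalars of the two frame vectors that remain when the vector of index `a` is replaced.
  let f : Fin 3 → ℂ := ![μ 1 * μ 2, μ 0 * μ 2, μ 0 * μ 1]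
  have hf : ∀ a, f a ≠ 0 := by
    intro a
    fin_cases a <;> simp [f, hμ]
  have hdet : ∀ u v w, vdet (g u) (g v) (g w) = D * vdet u v w := fun u v w => vdet_map g u v w
  have key : ∀ l a, frameDet w l a = D * f a * μ l * frameDet v l a := by
    intro l a
    fin_cases a <;> simp [frameDet, hw, vdet_smul, hdet, f] <;> ring
  refine ⟨D ^ 2 * f a * f b * μ l * μ 3, ?_, ?_, ?_⟩
  · simp [hD, hf, hμ]
  · simp only [ratioNum, key]; ring
  · simp only [ratioNum, key]; ring

lemma exists_ratioNum_rep {A : Fin 10 → Line} {P Q : TotalSpace A} {v : Fin 10 → Fin 3 → ℂ}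
    (hv : Represents v Q.lines) (hPQ : ModuliSpace.mk Q = ModuliSpace.mk P)
    (σ : Equiv.Perm (Fin 10)) (l : Fin 10) (a b : Fin 3) :
    ∃ κ : ℂ, κ ≠ 0 ∧
      ratioNum (fun i => (P.lines (σ i)).rep) l a b = κ * ratioNum (v ∘ σ) l a b ∧
      ratioNum (fun i => (P.lines (σ i)).rep) l b a = κ * ratioNum (v ∘ σ) l b a := by
  obtain ⟨g, hg⟩ := ModuliSpace.mk_eq_mk.1 hPQ
  refine exists_ratioNum_eq g.toLinearEquiv (fun i => ?_) l a b
  refine (represents_rep P.lines).exists_scale (w := fun i => g.toLinearEquiv (v i)) ?_ (σ i)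
  have := hv.smul g.toLinearEquiv
  rwa [show P.lines = fun i => LinearMap.GeneralLinearGroup.ofLinearEquiv g.toLinearEquiv • Q.lines i
    from funext hg]

/-- The ratio of two coordinates of a line, as a function on the moduli space. -/
noncomputable def coordRatio {A : Fin 10 → Line} (σ : Equiv.Perm (Fin 10)) (l : Fin 10)
    (a b : Fin 3) : ModuliSpace A → ℂ :=
  Quotient.lift (fun P : TotalSpace A => ratioNum (fun i => (P.lines (σ i)).rep) l a b /
    ratioNum (fun i => (P.lines (σ i)).rep) l b a) (by
      intro Q P h
      obtain ⟨κ, hκ, h1, h2⟩ := exists_ratioNum_rep (represents_rep Q.lines)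
        (Quotient.sound (s := projSetoid A) h) σ l a b
      rw [h1, h2, mul_div_mul_left _ _ hκ]
      rfl)

lemma coordRatio_mk {A : Fin 10 → Line} (σ : Equiv.Perm (Fin 10)) (l : Fin 10) (a b : Fin 3)
    {Q : TotalSpace A} {v : Fin 10 → Fin 3 → ℂ} (hv : Represents v Q.lines) :
    coordRatio σ l a b (ModuliSpace.mk Q) = ratioNum (v ∘ σ) l a b / ratioNum (v ∘ σ) l b a := by
  obtain ⟨κ, hκ, h1, h2⟩ := exists_ratioNum_rep hv rfl σ l a b
  change ratioNum _ l a b / ratioNum _ l b a = _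
  rw [h1, h2, mul_div_mul_left _ _ hκ]

/-! ### Coordinates as polynomials -/

/-- The determinant of three vectors, as a polynomial in their entries. -/
noncomputable def detPoly {n : ℕ} (i j k : Fin n) : MvPolynomial (Fin n × Fin 3) ℂ :=
  vdet (fun m => .X (i, m)) (fun m => .X (j, m)) (fun m => .X (k, m))

@[simp] lemma evalVecs_detPoly {n : ℕ} (i j k : Fin n) (v : Fin n → Fin 3 → ℂ) :
    evalVecs (detPoly i j k) v = vdet (v i) (v j) (v k) := by
  simp [evalVecs, detPoly, vdet]

/-- The polynomial with values `ratioNum`. -/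
noncomputable def ratioPoly (σ : Equiv.Perm (Fin 10)) (l : Fin 10) (a b : Fin 3) :
    MvPolynomial (Fin 10 × Fin 3) ℂ :=
  let f := fun l => ![detPoly (σ l) (σ 1) (σ 2), detPoly (σ 0) (σ l) (σ 2), detPoly (σ 0) (σ 1) (σ l)]
  f l b * f 3 a

lemma evalVecs_ratioPoly (σ : Equiv.Perm (Fin 10)) (l : Fin 10) (a b : Fin 3)
    (v : Fin 10 → Fin 3 → ℂ) : evalVecs (ratioPoly σ l a b) v = ratioNum (v ∘ σ) l a b := by
  have hmul : ∀ p q, evalVecs (n := 10) (p * q) v = evalVecs p v * evalVecs q v :=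
    fun p q => map_mul _ p q
  rw [ratioPoly, hmul, ratioNum]
  congr 1
  · fin_cases b <;> simp [frameDet]
  · fin_cases a <;> simp [frameDet]

/-- As the denominator never vanishes, the level set is given by the vanishing of numerator minus
`c` times denominator, which is a polynomial in the coordinates. -/
lemma isClosed_coordRatio_eq {A : Fin 10 → Line} (σ : Equiv.Perm (Fin 10)) (l : Fin 10)
    (a b : Fin 3) (hden : ∀ P : TotalSpace A,
      ratioNum (fun i => (P.lines (σ i)).rep) l b a ≠ 0) (c : ℂ) :
    IsClosed {x : ModuliSpace A | coordRatio σ l a b x = c} := by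
  let Z : Set (Fin 10 → Line) := {P | ratioNum (fun i => (P (σ i)).rep) l a b -
    c * ratioNum (fun i => (P (σ i)).rep) l b a = 0}
  have hZ : IsClosed[zariskiLines 10] Z := by
    refine isClosed_zariskiLines (ratioPoly σ l a b - .C c * ratioPoly σ l b a) fun v P hv => ?_
    obtain ⟨κ, hκ, h1, h2⟩ := exists_ratioNum_eq (v := v ∘ σ) (w := fun i => (P (σ i)).rep)
      (LinearEquiv.refl ℂ _) (fun i => (represents_rep P).exists_scale hv (σ i)) l a b
    have e : evalVecs (ratioPoly σ l a b - .C c * ratioPoly σ l b a) v =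
        ratioNum (v ∘ σ) l a b - c * ratioNum (v ∘ σ) l b a := by
      rw [← evalVecs_ratioPoly, ← evalVecs_ratioPoly]
      simp [evalVecs]
    change ratioNum _ l a b - c * ratioNum _ l b a = 0 ↔ _
    rw [e, h1, h2]
    constructor
    · intro h
      refine (mul_eq_zero.1 (?_ : κ * _ = 0)).resolve_left hκ
      linear_combination h
    · intro h
      linear_combination κ * h
  rw [← @isOpen_compl_iff _ _ (zariskiLines 10)] at hZ
  rw [← isOpen_compl_iff]
  refine isOpen_coinduced.2 ((@isOpen_induced_iff _ _ (zariskiLines 10) _ _).2 ⟨Zᶜ, hZ, ?_⟩)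
  ext P
  simp only [Set.mem_preimage, Set.mem_compl_iff, not_iff_not]
  change ratioNum _ l a b - c * ratioNum _ l b a = 0 ↔
    ratioNum _ l a b / ratioNum _ l b a = c
  rw [div_eq_iff (hden P), sub_eq_zero]

/-! ### The Galois action on moduli spaces -/

/-- The field automorphism acts only semilinearly on vectors, but conjugating a linear automorphism
by it gives a linear automorphism again. -/
lemma TotalSpace.mk_gal_eq {n : ℕ} {A : Fin n → Line} (τ : ℂ ≃+* ℂ) {P Q : TotalSpace A}
    (h : ModuliSpace.mk P = ModuliSpace.mk Q) :
    ModuliSpace.mk (P.gal τ) = ModuliSpace.mk (Q.gal τ) := by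
  obtain ⟨g, hg⟩ := ModuliSpace.mk_eq_mk.1 h
  have hinv : ∀ v, galVec τ (galVec τ.symm v) = v := fun v => by ext i; simp [galVec]
  have hinv' : ∀ v, galVec τ.symm (galVec τ v) = v := fun v => by ext i; simp [galVec]
  -- The conjugate of `g` by the action of `τ` on coordinates.
  let e : (Fin 3 → ℂ) ≃ₗ[ℂ] (Fin 3 → ℂ) :=
    { toFun := fun v => galVec τ (g.toLinearEquiv (galVec τ.symm v))
      invFun := fun v => galVec τ (g.toLinearEquiv.symm (galVec τ.symm v))
      map_add' := fun v w => by simp only [map_add]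
      map_smul' := fun c v => by
        rw [map_smulₛₗ, LinearEquiv.map_smul, map_smulₛₗ]
        simp
      left_inv := fun v => by
        beta_reduce
        rw [hinv', LinearEquiv.symm_apply_apply, hinv]
      right_inv := fun v => by
        beta_reduce
        rw [hinv', LinearEquiv.apply_symm_apply, hinv] }
  refine ModuliSpace.mk_eq_mk.2 ⟨LinearMap.GeneralLinearGroup.ofLinearEquiv e, fun i => ?_⟩
  have h1 : Represents (fun i => galVec τ (g.toLinearEquiv (P.lines i).rep))
      (Q.gal τ).lines := by
    have := ((represents_rep P.lines).smul g.toLinearEquiv).gal τ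
    change Represents _ (fun i => galLine τ (Q.lines i))
    rwa [show Q.lines = fun i => LinearMap.GeneralLinearGroup.ofLinearEquiv g.toLinearEquiv •
      P.lines i from funext hg]
  have h2 := ((represents_rep P.lines).gal τ).smul e
  have h3 : (fun i => e (galVec τ (P.lines i).rep)) =
      fun i => galVec τ (g.toLinearEquiv (P.lines i).rep) := by
    funext i
    change galVec τ (g.toLinearEquiv (galVec τ.symm (galVec τ _))) = _
    rw [hinv']
  have h4 : Represents (fun i => galVec τ (g.toLinearEquiv (P.lines i).rep))
      (fun i => LinearMap.GeneralLinearGroup.ofLinearEquiv e • galLine τ (P.lines i)) := by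
    rw [← h3]; exact h2
  exact congrFun (h1.eq h4) i

lemma galConj_conjAut_of_mem_realPoints {n : ℕ} {A : Fin n → Line} {x : ModuliSpace A}
    (hx : x ∈ realPoints A) : GalConj conjAut x x := by
  obtain ⟨P, rfl, hP⟩ := hx
  refine galConj_iff.2 ⟨P, rfl, ?_⟩
  congr 1
  refine TotalSpace.ext (funext fun i => ?_)
  change galLine conjAut (P.lines i) = P.lines i
  obtain ⟨v, hv, h⟩ := hP i
  rw [h, galLine_mk]
  congr 1
  ext j
  exact Complex.conj_ofReal (v j)

/-! ### Points of the moduli space in normal form -/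

namespace NormalForm

/-- The parameter of index `i` of a normal form is the coordinate of index `b` of the vector of
index `l`, whose coordinate of index `a` is one. -/
structure Coordinate (N : NormalForm) (i : ℕ) (l : Fin 10) (a b : Fin 3) : Prop where
  den : ∀ s : ℕ → ℂ, (N.vec l).ev s a = 1
  num : ∀ s : ℕ → ℂ, (N.vec l).ev s b = s i

/-- The point of the moduli space is given by the normal form with the given parameters. -/
def IsPoint (N : NormalForm) {A : Fin 10 → Line} (σ : Equiv.Perm (Fin 10)) (s : ℕ → ℂ)
    (x : ModuliSpace A) : Prop :=
  ∃ Q : TotalSpace A, Represents ((N.family σ).ev s) Q.lines ∧ ModuliSpace.mk Q = x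

variable {N : NormalForm} {A : Fin 10 → Line} {σ : Equiv.Perm (Fin 10)}

lemma exists_isPoint (hN : N.valid = true) (hA : HasPattern (A ∘ σ) N.blocks)
    (x : ModuliSpace A) : ∃ s, N.Good s ∧ N.IsPoint σ s x := by
  obtain ⟨P, rfl⟩ := ModuliSpace.mk_surjective x
  exact N.exists_represents hN hA P

lemma Good.exists_isPoint {s : ℕ → ℂ} (hs : N.Good s) (hA : HasPattern (A ∘ σ) N.blocks) :
    ∃ x : ModuliSpace A, N.IsPoint σ s x := by
  obtain ⟨Q, hQ⟩ := hs.exists_totalSpace hA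
  exact ⟨_, Q, hQ, rfl⟩

lemma IsPoint.eq {s t : ℕ → ℂ} {x y : ModuliSpace A} (hx : N.IsPoint σ s x)
    (hy : N.IsPoint σ t y) (h : ∀ i < 10, (N.vec i).ev s = (N.vec i).ev t) : x = y := by
  obtain ⟨P, hP, rfl⟩ := hx
  obtain ⟨Q, hQ, rfl⟩ := hy
  congr 1
  refine TotalSpace.ext (hP.eq ?_)
  rwa [show (N.family σ).ev s = (N.family σ).ev t from funext fun i => h _ (σ.symm i).2]

/-- In a normal form the frame is the standard one, so the determinants in Cramer's rule are just
the coordinates of the vector. -/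
lemma ratioNum_family (s : ℕ → ℂ) (l : Fin 10) (a b : Fin 3) :
    ratioNum ((N.family σ).ev s ∘ σ) l a b = (N.vec l).ev s b := by
  have hv : ∀ l, ((N.family σ).ev s ∘ σ) l = (N.vec l).ev s := fun l => by
    simp [Family.ev, family]
  have h0 : (N.vec 0).ev s = ![1, 0, 0] := by simp [vec, PolyVec.ev]
  have h1 : (N.vec 1).ev s = ![0, 1, 0] := by simp [vec, PolyVec.ev]
  have h2 : (N.vec 2).ev s = ![0, 0, 1] := by simp [vec, PolyVec.ev]
  have h3 : (N.vec 3).ev s = ![1, 1, 1] := by simp [vec, PolyVec.ev]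
  have key : ∀ l a, frameDet ((N.family σ).ev s ∘ σ) l a = (N.vec l).ev s a := by
    intro l a
    have e0 := hv 0
    have e1 := hv 1
    have e2 := hv 2
    simp only [Fin.isValue, Fin.coe_ofNat_eq_mod, Nat.zero_mod, Nat.one_mod, Nat.reduceMod,
      h0, h1, h2] at e0 e1 e2
    fin_cases a <;> simp [frameDet, vdet, e0, e1, e2, hv l, -Function.comp_apply]
  rw [ratioNum, key, key]
  have h3' : (N.vec (3 : Fin 10)).ev s = ![1, 1, 1] := h3
  rw [h3']
  fin_cases a <;> simp

section
variable {i : ℕ} {l : Fin 10} {a b : Fin 3}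

lemma IsPoint.coordRatio_eq (hc : N.Coordinate i l a b) {s : ℕ → ℂ} {x : ModuliSpace A}
    (hx : N.IsPoint σ s x) : coordRatio σ l a b x = s i := by
  obtain ⟨Q, hQ, rfl⟩ := hx
  rw [coordRatio_mk σ l a b hQ, ratioNum_family, ratioNum_family, hc.num, hc.den, div_one]

lemma Coordinate.isClosed (hc : N.Coordinate i l a b) (hN : N.valid = true)
    (hA : HasPattern (A ∘ σ) N.blocks) (c : ℂ) :
    IsClosed {x : ModuliSpace A | coordRatio σ l a b x = c} := by
  refine isClosed_coordRatio_eq σ l a b (fun P => ?_) c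
  obtain ⟨s, -, Q, hQ, hQP⟩ := N.exists_represents hN hA P
  obtain ⟨κ, hκ, -, h2⟩ := exists_ratioNum_rep hQ hQP σ l a b
  rwa [h2, ratioNum_family, hc.den, mul_one]

end

lemma IsPoint.gal {s : ℕ → ℂ} {Q : TotalSpace A} (hx : Represents ((N.family σ).ev s) Q.lines)
    (τ : ℂ ≃+* ℂ) : Represents ((N.family σ).ev fun i => τ (s i)) (Q.gal τ).lines := by
  have := hx.gal τ
  rwa [show (N.family σ).ev (fun i => τ (s i)) = fun i j => τ ((N.family σ).ev s i j) from
    funext fun i => funext fun j => (PolyVec.map_ev s (τ : ℂ →+* ℂ) (N.family σ i) j).symm]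

lemma IsPoint.of_galConj {s : ℕ → ℂ} {x y : ModuliSpace A} {τ : ℂ ≃+* ℂ} (hx : N.IsPoint σ s x)
    (h : GalConj τ x y) : N.IsPoint σ (fun i => τ (s i)) y := by
  obtain ⟨Q, hQ, hQx⟩ := hx
  obtain ⟨P, rfl, rfl⟩ := galConj_iff.1 h
  exact ⟨Q.gal τ, IsPoint.gal hQ τ, TotalSpace.mk_gal_eq τ hQx⟩

lemma IsPoint.exists_galConj {s : ℕ → ℂ} {x : ModuliSpace A} (hx : N.IsPoint σ s x) (τ : ℂ ≃+* ℂ) :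
    ∃ y, GalConj τ x y ∧ N.IsPoint σ (fun i => τ (s i)) y := by
  obtain ⟨Q, hQ, rfl⟩ := hx
  exact ⟨_, galConj_mk_gal τ Q, Q.gal τ, IsPoint.gal hQ τ, rfl⟩

lemma IsPoint.mem_realPoints {s : ℕ → ℝ} {x : ModuliSpace A}
    (hx : N.IsPoint σ (fun i => (s i : ℂ)) x) : x ∈ realPoints A := by
  obtain ⟨Q, hQ, rfl⟩ := hx
  refine ⟨Q, rfl, fun i => ?_⟩
  have e : (fun j => (((N.family σ i).ev s j : ℝ) : ℂ)) = (N.family σ).ev (fun i => (s i : ℂ)) i :=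
    funext fun j => PolyVec.map_ev s Complex.ofRealHom (N.family σ i) j
  obtain ⟨h0, h⟩ := hQ i
  refine ⟨(N.family σ i).ev s, by rwa [e], ?_⟩
  rw [h]
  congr 1
  exact e.symm

end NormalForm

/-! ### Automorphisms of the complex numbers -/

-- Steinitz's argument. Over a countable field, a transcendence basis of an uncountable
-- algebraically closed field has the cardinality of that field. A bijection of the two bases gives
-- an isomorphism of the generated subalgebras over `K`, which extends to the algebraic closures.
open Cardinal in
lemma exists_ringEquiv_of_algebra {K L M : Type} [Field K] [Field L] [Field M] [Algebra K L]
    [Algebra K M] [IsAlgClosed L] [IsAlgClosed M] (hK : #K ≤ ℵ₀) (hL : ℵ₀ < #L) (h : #L = #M) :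
    ∃ τ : L ≃+* M, ∀ x : K, τ (algebraMap K L x) = algebraMap K M x := by
  obtain ⟨s, hs⟩ := exists_isTranscendenceBasis K L
  obtain ⟨t, ht⟩ := exists_isTranscendenceBasis K M
  have hst : #s = #t := by
    rw [← IsAlgClosed.cardinal_eq_cardinal_transcendence_basis_of_aleph0_lt' _ hs hK hL,
      ← IsAlgClosed.cardinal_eq_cardinal_transcendence_basis_of_aleph0_lt' _ ht hK (h ▸ hL), h]
  obtain ⟨e⟩ := Cardinal.eq.1 hst
  let := IsAlgClosed.isAlgClosure_of_transcendence_basis _ hs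
  let := IsAlgClosed.isAlgClosure_of_transcendence_basis _ ht
  let f := hs.1.aevalEquiv.symm.trans ((MvPolynomial.renameEquiv K e).trans ht.1.aevalEquiv)
  refine ⟨IsAlgClosure.equivOfEquiv L M f.toRingEquiv, fun x => ?_⟩
  rw [IsScalarTower.algebraMap_apply K (Algebra.adjoin K (Set.range ((↑) : s → L))) L,
    IsAlgClosure.equivOfEquiv_algebraMap]
  change algebraMap _ M (f _) = _
  rw [AlgEquiv.commutes, ← IsScalarTower.algebraMap_apply]

open Polynomial Cardinal in
/-- Two roots of an irreducible rational polynomial are conjugate under an automorphism of the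
complex numbers. -/
lemma exists_ringEquiv_of_aeval_eq_zero {p : ℚ[X]} (hp : Irreducible p) {c d : ℂ}
    (hc : aeval c p = 0) (hd : aeval d p = 0) : ∃ τ : ℂ ≃+* ℂ, τ c = d := by
  have : Fact (Irreducible p) := ⟨hp⟩
  -- The two roots define two embeddings of the same countable number field, and `ℂ` is regarded as
  -- an extension of it in two ways.
  let φ : AdjoinRoot p →+* ℂ := AdjoinRoot.lift (algebraMap ℚ ℂ) c hc
  let ψ : AdjoinRoot p →+* ℂ := AdjoinRoot.lift (algebraMap ℚ ℂ) d hd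
  have hK : #(AdjoinRoot p) ≤ ℵ₀ := by
    have : Countable (AdjoinRoot p) := by
      have : Countable ℚ[X] := by
        rw [← Cardinal.mk_le_aleph0_iff]
        exact Polynomial.cardinalMk_le_max.trans (by simp)
      exact (AdjoinRoot.mk_surjective (g := p)).countable
    exact Cardinal.mk_le_aleph0
  have hL : ℵ₀ < #ℂ := by
    rw [Cardinal.mk_complex]
    exact Cardinal.aleph0_lt_continuum
  obtain ⟨τ, hτ⟩ := @exists_ringEquiv_of_algebra (AdjoinRoot p) ℂ ℂ _ _ _ φ.toAlgebra ψ.toAlgebra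
    _ _ hK hL rfl
  refine ⟨τ, ?_⟩
  have := hτ (AdjoinRoot.root p)
  have h1 : φ (AdjoinRoot.root p) = c := AdjoinRoot.lift_root hc
  have h2 : ψ (AdjoinRoot.root p) = d := AdjoinRoot.lift_root hd
  change τ (φ _) = ψ _ at this
  rwa [h1, h2] at this

open Polynomial in
lemma aeval_ne_zero_of_irreducible {p q : ℚ[X]} (hp : Irreducible p) {c : ℂ} (hc : aeval c p = 0)
    (hq : q ≠ 0) (hdeg : q.natDegree < p.natDegree) : aeval c q ≠ 0 := by
  intro h
  obtain ⟨a, b, hab⟩ := (hp.coprime_iff_not_dvd).2 fun h' =>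
    not_le_of_gt hdeg (natDegree_le_of_dvd h' hq)
  have := congrArg (aeval c) hab
  simp [hc, h] at this

/-! ### Roots of cubic and quadratic polynomials -/

open Polynomial in
/-- The polynomial `x³ - k₂ x² - k₁ x - k₀`. -/
noncomputable def cubicPoly (k : ℤ × ℤ × ℤ) : ℚ[X] :=
  X ^ 3 - C (k.2.2 : ℚ) * X ^ 2 - C (k.2.1 : ℚ) * X - C (k.1 : ℚ)

open Polynomial in
/-- The polynomial `x² - k₁ x - k₀`. -/
noncomputable def quadPoly (k : ℤ × ℤ) : ℚ[X] :=
  X ^ 2 - C (k.2 : ℚ) * X - C (k.1 : ℚ)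

open Polynomial in
lemma natDegree_cubicPoly (k : ℤ × ℤ × ℤ) : (cubicPoly k).natDegree = 3 := by
  rw [cubicPoly]; compute_degree!

open Polynomial in
lemma natDegree_quadPoly (k : ℤ × ℤ) : (quadPoly k).natDegree = 2 := by
  rw [quadPoly]; compute_degree!

lemma aeval_cubicPoly (k : ℤ × ℤ × ℤ) (c : ℂ) :
    Polynomial.aeval c (cubicPoly k) = c ^ 3 - k.2.2 * c ^ 2 - k.2.1 * c - k.1 := by
  simp [cubicPoly]

lemma aeval_quadPoly (k : ℤ × ℤ) (c : ℂ) :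
    Polynomial.aeval c (quadPoly k) = c ^ 2 - k.2 * c - k.1 := by
  simp [quadPoly]

open Polynomial in
/-- A monic integral cubic polynomial without integral roots is irreducible. -/
lemma irreducible_cubicPoly {k : ℤ × ℤ × ℤ}
    (h : ∀ n : ℤ, n ∣ k.1 → n ^ 3 - k.2.2 * n ^ 2 - k.2.1 * n - k.1 ≠ 0) :
    Irreducible (cubicPoly k) := by
  refine irreducible_of_degree_le_three_of_not_isRoot (by simp [natDegree_cubicPoly]) fun x hx => ?_
  let p : ℤ[X] := X ^ 3 - C k.2.2 * X ^ 2 - C k.2.1 * X - C k.1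
  have hp : p.Monic := by simp only [p]; monicity!
  have hx' : x ^ 3 - k.2.2 * x ^ 2 - k.2.1 * x - k.1 = 0 := by simpa [cubicPoly] using hx
  -- A rational root of a monic integral polynomial is an integer that divides the constant term.
  obtain ⟨n, rfl, hn⟩ := exists_integer_of_is_root_of_monic hp (r := x) (by simpa [p] using hx')
  refine h n ?_ ?_
  · simpa [p] using hn
  · simp only [eq_intCast] at hx'
    exact_mod_cast hx'

open Polynomial in
/-- A monic integral quadratic polynomial without integral roots is irreducible. -/
lemma irreducible_quadPoly {k : ℤ × ℤ}
    (h : ∀ n : ℤ, n ∣ k.1 → n ^ 2 - k.2 * n - k.1 ≠ 0) : Irreducible (quadPoly k) := by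
  refine irreducible_of_degree_le_three_of_not_isRoot (by simp [natDegree_quadPoly]) fun x hx => ?_
  let p : ℤ[X] := X ^ 2 - C k.2 * X - C k.1
  have hp : p.Monic := by simp only [p]; monicity!
  have hx' : x ^ 2 - k.2 * x - k.1 = 0 := by simpa [quadPoly] using hx
  obtain ⟨n, rfl, hn⟩ := exists_integer_of_is_root_of_monic hp (r := x) (by simpa [p] using hx')
  refine h n ?_ ?_
  · simpa [p] using hn
  · simp only [eq_intCast] at hx'
    exact_mod_cast hx'

/-- The value of a quadratic expression. -/
def quadValue (c : ℂ) (a : ℤ × ℤ × ℤ) : ℂ := a.1 + a.2.1 * c + a.2.2 * c ^ 2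

-- A root of an irreducible cubic satisfies no rational equation of degree at most two.
open Polynomial in
lemma quadValue_eq_zero_of_cubic {k : ℤ × ℤ × ℤ} (hk : Irreducible (cubicPoly k)) {c : ℂ}
    (hc : aeval c (cubicPoly k) = 0) {a : ℤ × ℤ × ℤ} (h : quadValue c a = 0) : a = 0 := by
  by_contra ha
  let q : ℚ[X] := C (a.2.2 : ℚ) * X ^ 2 + C (a.2.1 : ℚ) * X + C (a.1 : ℚ)
  refine aeval_ne_zero_of_irreducible hk hc (q := q) (fun hq => ha ?_) ?_ ?_
  · have h0 := congrArg (coeff · 0) hq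
    have h1 := congrArg (coeff · 1) hq
    have h2 := congrArg (coeff · 2) hq
    simp only [q, coeff_add, coeff_C_mul, coeff_X, coeff_X_pow, coeff_C, coeff_zero] at h0 h1 h2
    norm_num at h0 h1 h2
    exact Prod.ext h0 (Prod.ext h1 h2)
  · rw [natDegree_cubicPoly]
    have : q.natDegree ≤ 2 := by simp only [q]; compute_degree
    omega
  · simp only [quadValue] at h
    simp only [q, map_add, map_mul, aeval_C, aeval_X, map_pow, eq_ratCast, Rat.cast_intCast]
    linear_combination h

-- After reduction of the square, only a linear expression in `c` remains, and `c` is not rational.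
open Polynomial in
lemma quadValue_eq_zero_of_quad {k : ℤ × ℤ} (hk : Irreducible (quadPoly k)) {c : ℂ}
    (hc : aeval c (quadPoly k) = 0) {a : ℤ × ℤ × ℤ} (h : quadValue c a = 0) :
    a.1 + a.2.2 * k.1 = 0 ∧ a.2.1 + a.2.2 * k.2 = 0 := by
  by_contra ha
  let q : ℚ[X] := C ((a.2.1 + a.2.2 * k.2 : ℤ) : ℚ) * X + C ((a.1 + a.2.2 * k.1 : ℤ) : ℚ)
  refine aeval_ne_zero_of_irreducible hk hc (q := q) (fun hq => ha ?_) ?_ ?_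
  · have h0 := congrArg (coeff · 0) hq
    have h1 := congrArg (coeff · 1) hq
    simp only [q, coeff_add, coeff_C_mul, coeff_X, coeff_C, coeff_zero] at h0 h1
    norm_num at h0 h1
    exact ⟨by exact_mod_cast h0, by exact_mod_cast h1⟩
  · rw [natDegree_quadPoly]
    have : q.natDegree ≤ 1 := by simp only [q]; compute_degree
    omega
  · rw [aeval_quadPoly] at hc
    simp only [quadValue] at h
    simp only [q, map_add, map_mul, aeval_C, aeval_X, eq_ratCast, Rat.cast_intCast, Int.cast_add,
      Int.cast_mul]
    linear_combination h - a.2.2 * hc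

lemma exists_roots_quadratic {b c : ℝ} (h : b ^ 2 < 4 * c) :
    ∃ w : ℂ, conjAut w ≠ w ∧ ∀ x : ℂ, x ^ 2 + b * x + c = (x - w) * (x - conjAut w) := by
  let w : ℂ := ⟨-b / 2, Real.sqrt (4 * c - b ^ 2) / 2⟩
  have hs : Real.sqrt (4 * c - b ^ 2) ^ 2 = 4 * c - b ^ 2 := Real.sq_sqrt (by linarith)
  have hs0 : 0 < Real.sqrt (4 * c - b ^ 2) := Real.sqrt_pos.2 (by linarith)
  have hconj : conjAut w = ⟨-b / 2, -(Real.sqrt (4 * c - b ^ 2) / 2)⟩ := rfl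
  have h1 : w + conjAut w = -b := by
    rw [hconj]; apply Complex.ext <;> simp [w]
  have h2 : w * conjAut w = c := by
    rw [hconj]
    apply Complex.ext
    · simp [w]; linear_combination hs / 4
    · simp [w]; ring
  refine ⟨w, fun hw => ?_, fun x => ?_⟩
  · have := congrArg Complex.im hw
    rw [hconj] at this
    simp only [w] at this
    linarith
  · linear_combination -h2 + x * h1

/-- A real cubic polynomial with exactly one real root. -/
lemma exists_roots_cubicPoly (k : ℤ × ℤ × ℤ) (lo hi : ℝ) (hlh : lo ≤ hi)
    (hlo : lo ^ 3 - k.2.2 * lo ^ 2 - k.2.1 * lo - k.1 ≤ 0)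
    (hhi : 0 ≤ hi ^ 3 - k.2.2 * hi ^ 2 - k.2.1 * hi - k.1)
    (hd : ∀ r : ℝ, lo ≤ r → r ≤ hi → (r - k.2.2) ^ 2 < 4 * (r ^ 2 - k.2.2 * r - k.2.1)) :
    ∃ (r : ℝ) (w : ℂ), conjAut w ≠ w ∧
      {x : ℂ | Polynomial.aeval x (cubicPoly k) = 0} = {(r : ℂ), w, conjAut w} := by
  -- A real root `r` by the intermediate value theorem. The other roots are those of `x² + (r - k₂)
  -- x + (r² - k₂ r - k₁)`; its discriminant is assumed to be negative on the whole interval, so the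
  -- exact value of `r` is not needed.
  obtain ⟨r, ⟨h1, h2⟩, hr⟩ := intermediate_value_Icc hlh
    (f := fun r : ℝ => r ^ 3 - k.2.2 * r ^ 2 - k.2.1 * r - k.1) (by fun_prop) ⟨hlo, hhi⟩
  obtain ⟨w, hw, hfac⟩ := exists_roots_quadratic (hd r h1 h2)
  have hr' : (r : ℂ) ^ 3 - k.2.2 * r ^ 2 - k.2.1 * r - k.1 = 0 := by
    exact_mod_cast congrArg Complex.ofReal hr
  refine ⟨r, w, hw, ?_⟩
  ext x
  have : Polynomial.aeval x (cubicPoly k) = (x - r) * ((x - w) * (x - conjAut w)) := by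
    rw [← hfac, aeval_cubicPoly]
    push_cast
    linear_combination hr'
  rw [Set.mem_ofPred_eq, this, mul_eq_zero, mul_eq_zero, sub_eq_zero, sub_eq_zero, sub_eq_zero]
  simp

/-- A real quadratic polynomial with two real roots. -/
lemma exists_roots_quadPoly (k : ℤ × ℤ) (h : 0 < k.2 ^ 2 + 4 * k.1) :
    ∃ r w : ℝ, w ≠ r ∧ {x : ℂ | Polynomial.aeval x (quadPoly k) = 0} = {(r : ℂ), (w : ℂ)} := by
  have h' : (0 : ℝ) < k.2 ^ 2 + 4 * k.1 := by exact_mod_cast h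
  have hs := Real.sq_sqrt h'.le
  have hs0 := Real.sqrt_pos.2 h'
  set d := Real.sqrt (k.2 ^ 2 + 4 * k.1)
  have hsC : (d : ℂ) ^ 2 = k.2 ^ 2 + 4 * k.1 := by exact_mod_cast congrArg Complex.ofReal hs
  refine ⟨(k.2 + d) / 2, (k.2 - d) / 2, by linarith, ?_⟩
  ext x
  have : Polynomial.aeval x (quadPoly k) =
      (x - ((k.2 + d) / 2 : ℝ)) * (x - ((k.2 - d) / 2 : ℝ)) := by
    rw [aeval_quadPoly]
    push_cast
    linear_combination hsC / 4
  rw [Set.mem_ofPred_eq, this, mul_eq_zero, sub_eq_zero, sub_eq_zero]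
  simp

/-! ### Arithmetic modulo a cubic polynomial -/

namespace PolyExpr

/-- The product of two quadratic expressions modulo `x³ = k₀ + k₁ x + k₂ x²`. -/
def mulMod (k a b : ℤ × ℤ × ℤ) : ℤ × ℤ × ℤ :=
  -- The coefficients of `x³` and `x⁴` in the product. The latter power is `k₂ k₀ + (k₀ + k₂ k₁) x +
  -- (k₁ + k₂²) x²`.
  let p₃ := a.2.1 * b.2.2 + a.2.2 * b.2.1
  let p₄ := a.2.2 * b.2.2
  (a.1 * b.1 + k.1 * p₃ + k.2.2 * k.1 * p₄,
    a.1 * b.2.1 + a.2.1 * b.1 + k.2.1 * p₃ + (k.1 + k.2.2 * k.2.1) * p₄,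
    a.1 * b.2.2 + a.2.1 * b.2.1 + a.2.2 * b.1 + k.2.2 * p₃ + (k.2.1 + k.2.2 * k.2.2) * p₄)

/-- The value of an expression modulo `x³ = k₀ + k₁ x + k₂ x²`. -/
def evMod (k : ℤ × ℤ × ℤ) (s : ℕ → ℤ × ℤ × ℤ) : PolyExpr → ℤ × ℤ × ℤ
  | var i => s i
  | nat n => (n, 0, 0)
  | add a b => ((a.evMod k s).1 + (b.evMod k s).1, (a.evMod k s).2.1 + (b.evMod k s).2.1,
      (a.evMod k s).2.2 + (b.evMod k s).2.2)
  | mul a b => mulMod k (a.evMod k s) (b.evMod k s)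
  | neg a => (-(a.evMod k s).1, -(a.evMod k s).2.1, -(a.evMod k s).2.2)

lemma ev_eq_quadValue {k : ℤ × ℤ × ℤ} {c : ℂ} (hc : c ^ 3 - k.2.2 * c ^ 2 - k.2.1 * c - k.1 = 0)
    (s : ℕ → ℤ × ℤ × ℤ) (a : PolyExpr) :
    a.ev (fun i => quadValue c (s i)) = quadValue c (a.evMod k s) := by
  induction a with
  | var i => rfl
  | nat n => simp [evMod, quadValue]
  | add a b ha hb => rw [ev, ha, hb]; simp only [evMod, quadValue]; push_cast; ring
  | mul a b ha hb =>
    rw [ev, ha, hb]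
    simp only [evMod, mulMod, quadValue]
    generalize a.evMod k s = u
    generalize b.evMod k s = v
    push_cast
    linear_combination (u.2.1 * v.2.2 + u.2.2 * v.2.1 + u.2.2 * v.2.2 * (c + k.2.2)) * hc
  | neg a ha => rw [ev, ha]; simp only [evMod, quadValue]; push_cast; ring

end PolyExpr

/-! ### Finding good parameters -/

/-- Proportional vectors `v i` and `v j` would make every third line concurrent with them, so four
lines would be concurrent, which the pattern forbids. A zero vector is proportional to all others.
-/
lemma VecPattern.of_vdet {v : ℕ → Fin 3 → ℂ} {B : List ℕ} (hB : AdmissiblePattern B)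
    (h : ∀ a b c, a < b → b < c → c < 10 →
      (vdet (v a) (v b) (v c) = 0 ↔ 100 * a + 10 * b + c ∈ B)) : VecPattern v B := by
  have hcross : ∀ i < 10, ∀ j < 10, i ≠ j → vcross (v i) (v j) ≠ 0 := by
    intro i hi j hj hij hc
    have hdet : ∀ k, vdet (v i) (v j) (v k) = 0 := fun k => by
      have e0 := congrFun hc 0
      have e1 := congrFun hc 1
      have e2 := congrFun hc 2
      simp only [vcross, Matrix.cons_val, Pi.zero_apply] at e0 e1 e2
      simp only [vdet]
      linear_combination v k 0 * e0 + v k 1 * e1 + v k 2 * e2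
    let i' : Fin 10 := ⟨i, hi⟩
    let j' : Fin 10 := ⟨j, hj⟩
    have hij' : i' ≠ j' := fun h => hij (congrArg Fin.val h)
    obtain ⟨k, hk⟩ := Finset.exists_mem_notMem_of_card_lt_card
      (s := {i', j'}) (t := Finset.univ) (Finset.card_le_two.trans_lt (by simp))
    obtain ⟨l, hl⟩ := Finset.exists_mem_notMem_of_card_lt_card
      (s := {i', j', k}) (t := Finset.univ) (Finset.card_le_three.trans_lt (by simp))
    simp only [Finset.mem_univ, true_and, Finset.mem_insert, Finset.mem_singleton, not_or] at hk hl
    have key : ∀ m : Fin 10, m ≠ i' → m ≠ j' → tripleCode i' j' m ∈ B := fun m h1 h2 =>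
      (vdet_eq_zero_iff_tripleCode h hi hj m.2 hij (fun h => h1 (Fin.ext h.symm))
        (fun h => h2 (Fin.ext h.symm))).1 (hdet m)
    exact hl.2.2 (hB.eq_of_mem i' j' k l hij' (Ne.symm hk.1) (Ne.symm hl.1) (Ne.symm hk.2)
      (Ne.symm hl.2.1) (key k hk.1 hk.2) (key l hl.1 hl.2.1)).symm
  refine ⟨fun i hi h0 => ?_, hcross, h⟩
  obtain ⟨j, hj, hij⟩ : ∃ j < 10, i ≠ j := by
    by_cases hi0 : i = 0
    · exact ⟨1, by norm_num, by omega⟩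
    · exact ⟨0, by norm_num, hi0⟩
  refine hcross i hi j hj hij ?_
  ext m
  fin_cases m <;> simp [vcross, h0]

/-- A test of vanishing for quadratic expressions in a number with `x³ = k₀ + k₁ x + k₂ x²`. -/
structure ZeroTest (c : ℂ) (k : ℤ × ℤ × ℤ) (f : ℤ × ℤ × ℤ → Bool) : Prop where
  rel : c ^ 3 - k.2.2 * c ^ 2 - k.2.1 * c - k.1 = 0
  iff : ∀ a, quadValue c a = 0 ↔ f a = true

/-- The test for a cubic number. -/
def isZeroCubic (a : ℤ × ℤ × ℤ) : Bool :=
  decide (a.1 = 0) && (decide (a.2.1 = 0) && decide (a.2.2 = 0))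

/-- The test for a quadratic number. -/
def isZeroQuad (k : ℤ × ℤ) (a : ℤ × ℤ × ℤ) : Bool :=
  decide (a.1 + a.2.2 * k.1 = 0) && decide (a.2.1 + a.2.2 * k.2 = 0)

lemma zeroTest_cubic {k : ℤ × ℤ × ℤ} (hk : Irreducible (cubicPoly k)) {c : ℂ}
    (hc : Polynomial.aeval c (cubicPoly k) = 0) : ZeroTest c k isZeroCubic where
  rel := by rwa [aeval_cubicPoly] at hc
  iff a := by
    simp only [isZeroCubic, Bool.and_eq_true, decide_eq_true_eq]
    constructor
    · intro h
      simp [quadValue_eq_zero_of_cubic hk hc h]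
    · rintro ⟨h1, h2, h3⟩
      simp [quadValue, h1, h2, h3]

/-- The quadratic relation is multiplied by `x`, so that the arithmetic modulo a cubic polynomial
serves here too; only the test of vanishing changes. -/
lemma zeroTest_quad {k : ℤ × ℤ} (hk : Irreducible (quadPoly k)) {c : ℂ}
    (hc : Polynomial.aeval c (quadPoly k) = 0) :
    ZeroTest c (0, k.1, k.2) (isZeroQuad k) where
  rel := by
    rw [aeval_quadPoly] at hc
    push_cast
    linear_combination c * hc
  iff a := by
    simp only [isZeroQuad, Bool.and_eq_true, decide_eq_true_eq]
    refine ⟨quadValue_eq_zero_of_quad hk hc, ?_⟩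
    rintro ⟨h1, h2⟩
    rw [aeval_quadPoly] at hc
    have h1' : (a.1 + a.2.2 * k.1 : ℂ) = 0 := by exact_mod_cast h1
    have h2' : (a.2.1 + a.2.2 * k.2 : ℂ) = 0 := by exact_mod_cast h2
    rw [quadValue]
    linear_combination a.2.2 * hc + h1' + c * h2'

namespace NormalForm

/-- The determinants vanish exactly for the concurrent triples. -/
def checkAt (N : NormalForm) (k : ℤ × ℤ × ℤ) (f : ℤ × ℤ × ℤ → Bool) (s : ℕ → ℤ × ℤ × ℤ) : Bool :=
  allFin fun a => allFin fun b => !Nat.blt a b || allFin fun c => !Nat.blt b c ||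
    bif memCode (100 * a + 10 * b + c) N.blocks then
      f ((PolyVec.det (N.vec a) (N.vec b) (N.vec c)).evMod k s)
    else !f ((PolyVec.det (N.vec a) (N.vec b) (N.vec c)).evMod k s)

lemma good_of_checkAt {N : NormalForm} (hB : AdmissiblePattern N.blocks) {c : ℂ} {k : ℤ × ℤ × ℤ}
    {f : ℤ × ℤ × ℤ → Bool} (hf : ZeroTest c k f) {s : ℕ → ℤ × ℤ × ℤ}
    (h : N.checkAt k f s = true) : N.Good fun i => quadValue c (s i) := by
  refine VecPattern.of_vdet hB fun x y z hxy hyz hz => ?_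
  rw [← PolyVec.ev_det, PolyExpr.ev_eq_quadValue hf.rel, hf.iff, ← memCode_eq_true]
  simp only [checkAt, allFin_eq_true] at h
  have hy : y < 10 := by omega
  have := h ⟨x, by omega⟩ ⟨y, hy⟩
  simp only [blt_eq_decide, hxy, decide_true, Bool.not_true, Bool.false_or, allFin_eq_true] at this
  have := this ⟨z, hz⟩
  simp only [hyz, decide_true, Bool.not_true, Bool.false_or] at this
  cases hm : memCode (100 * x + 10 * y + z) N.blocks <;> simpa [hm] using this

/-! ### Rigid normal forms -/

/-- The parameters `c, c - 1, …`. -/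
def params (c : ℂ) : ℕ → ℂ := fun i => c - i

/-- The good parameters of the normal form are given by the roots of an irreducible polynomial. -/
structure Rigid (N : NormalForm) (p : Polynomial ℚ) (l : Fin 10) (a b : Fin 3) : Prop where
  valid : N.valid = true
  irreducible : Irreducible p
  coord : N.Coordinate 0 l a b
  root : ∀ s, N.Good s → Polynomial.aeval (s 0) p = 0
  good : ∀ c : ℂ, Polynomial.aeval c p = 0 → N.Good (params c)
  vec_eq : ∀ s, N.Good s → ∀ i < 10, (N.vec i).ev s = (N.vec i).ev (params (s 0))

namespace Rigid
variable {N : NormalForm} {p : Polynomial ℚ} {l : Fin 10} {a b : Fin 3} {A : Fin 10 → Line}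
  {σ : Equiv.Perm (Fin 10)}

lemma isPoint (h : N.Rigid p l a b) (hA : HasPattern (A ∘ σ) N.blocks) (x : ModuliSpace A) :
    N.IsPoint σ (params (coordRatio σ l a b x)) x := by
  obtain ⟨s, hs, Q, hQ, hQx⟩ := N.exists_isPoint h.valid hA x
  rw [IsPoint.coordRatio_eq h.coord ⟨Q, hQ, hQx⟩]
  refine ⟨Q, ?_, hQx⟩
  rwa [show (N.family σ).ev (params (s 0)) = (N.family σ).ev s from
    funext fun i => (h.vec_eq s hs _ (σ.symm i).2).symm]

lemma aeval_coordRatio (h : N.Rigid p l a b) (hA : HasPattern (A ∘ σ) N.blocks)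
    (x : ModuliSpace A) : Polynomial.aeval (coordRatio σ l a b x) p = 0 := by
  obtain ⟨s, hs, hx⟩ := N.exists_isPoint h.valid hA x
  rw [hx.coordRatio_eq h.coord]
  exact h.root s hs

lemma exists_coordRatio_eq (h : N.Rigid p l a b) (hA : HasPattern (A ∘ σ) N.blocks) {c : ℂ}
    (hc : Polynomial.aeval c p = 0) : ∃ x : ModuliSpace A, coordRatio σ l a b x = c := by
  obtain ⟨x, hx⟩ := (h.good c hc).exists_isPoint hA
  exact ⟨x, by rw [hx.coordRatio_eq h.coord]; simp [params]⟩

lemma coordRatio_injective (h : N.Rigid p l a b) (hA : HasPattern (A ∘ σ) N.blocks) :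
    Function.Injective (coordRatio (A := A) σ l a b) := fun x y hxy =>
  (h.isPoint hA x).eq (h.isPoint hA y) fun i _ => by rw [hxy]

/-- The coordinate of a conjugate point is the conjugate of the coordinate, and a point is
determined by its coordinate. -/
lemma galConj_iff (h : N.Rigid p l a b) (hA : HasPattern (A ∘ σ) N.blocks) {τ : ℂ ≃+* ℂ}
    {x y : ModuliSpace A} :
    GalConj τ x y ↔ coordRatio σ l a b y = τ (coordRatio σ l a b x) := by
  obtain ⟨z, hz, hz'⟩ := (h.isPoint hA x).exists_galConj τ
  have ez : coordRatio σ l a b z = τ (coordRatio σ l a b x) := by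
    rw [hz'.coordRatio_eq h.coord]; simp [params]
  constructor
  · intro hxy
    rw [((h.isPoint hA x).of_galConj hxy).coordRatio_eq h.coord]
    simp [params]
  · intro hxy
    rwa [h.coordRatio_injective hA (hxy.trans ez.symm)]

/-- A coordinate fixed by conjugation is real, and the normal form has integral coefficients, so
with real parameters it consists of real lines. -/
lemma mem_realPoints_iff (h : N.Rigid p l a b) (hA : HasPattern (A ∘ σ) N.blocks)
    {x : ModuliSpace A} :
    x ∈ realPoints A ↔ conjAut (coordRatio σ l a b x) = coordRatio σ l a b x := by
  constructor
  · intro hx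
    exact ((h.galConj_iff hA).1 (galConj_conjAut_of_mem_realPoints hx)).symm
  · intro hx
    obtain ⟨r, hr⟩ := Complex.conj_eq_iff_real.1 hx
    refine IsPoint.mem_realPoints (N := N) (σ := σ) (s := fun i => r - i) ?_
    have := h.isPoint hA x
    rw [hr] at this
    convert this using 1
    funext i
    simp [params]

end Rigid

end NormalForm

/-- The function has finitely many values, so the level set of the real value `r` is both open and
closed. It is stable under conjugation, and therefore it and its complement descend to disjoint
nonempty open subsets. The values `w` and its conjugate may coincide. -/
lemma not_irreducibleSpace {A : Fin 10 → Line} (X : ModuliSpace A → ℂ)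
    (hcl : ∀ c, IsClosed {x | X x = c})
    (hconj : ∀ x y, GalConj conjAut x y → X y = conjAut (X x)) {r w : ℂ} (hr : conjAut r = r)
    (hX : ∀ x, X x = r ∨ X x = w ∨ X x = conjAut w) (hrw : w ≠ r) (h1 : ∃ x, X x = r)
    (h2 : ∃ x, X x = w) : ¬ IrreducibleSpace (ModuliSpaceConj A) := by
  intro hirr
  have hrw' : conjAut w ≠ r := fun h => hrw (conjAut.injective (h.trans hr.symm))
  let Y : ModuliSpaceConj A → Prop := Quot.lift (fun x => X x = r) fun x y h => by
    rw [hconj x y h, eq_iff_iff, ← conjAut.injective.eq_iff (a := X x), hr]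
  have ho : IsOpen {y | Y y} := by
    refine isOpen_coinduced.2 ?_
    have : {x | X x = r} = ({x | X x = w} ∪ {x | X x = conjAut w})ᶜ := by
      ext x
      simp only [Set.mem_ofPred_eq, Set.mem_compl_iff, Set.mem_union, not_or]
      constructor
      · rintro h
        exact ⟨fun h' => hrw (h'.symm.trans h), fun h' => hrw' (h'.symm.trans h)⟩
      · exact fun h => (hX x).resolve_right fun h' => h'.elim h.1 h.2
    change IsOpen {x | X x = r}
    rw [this]
    exact ((hcl w).union (hcl (conjAut w))).isOpen_compl
  have hc : IsOpen {y | ¬ Y y} := by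
    refine isOpen_coinduced.2 ?_
    exact (hcl r).isOpen_compl
  obtain ⟨x, hx⟩ := h1
  obtain ⟨x', hx'⟩ := h2
  obtain ⟨y, hy, hy'⟩ := nonempty_preirreducible_inter ho hc ⟨Quot.mk _ x, hx⟩
    ⟨Quot.mk _ x', fun h => hrw (hx'.symm.trans h)⟩
  exact hy' hy

/-! ### Points, real points and Galois conjugacy for rigid normal forms. -/

namespace NormalForm.Rigid
variable {N : NormalForm} {p : Polynomial ℚ} {l : Fin 10} {a b : Fin 3} {A : Fin 10 → Line}
  {σ : Equiv.Perm (Fin 10)}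

section
variable {r w : ℂ}

lemma coordRatio_cases (h : N.Rigid p l a b) (hA : HasPattern (A ∘ σ) N.blocks)
    (hroots : {x : ℂ | Polynomial.aeval x p = 0} = {r, w, conjAut w}) (x : ModuliSpace A) :
    coordRatio σ l a b x = r ∨ coordRatio σ l a b x = w ∨ coordRatio σ l a b x = conjAut w := by
  have : coordRatio σ l a b x ∈ {x : ℂ | Polynomial.aeval x p = 0} := h.aeval_coordRatio hA x
  rw [hroots] at this
  simpa using this

lemma exists_of_mem_roots (h : N.Rigid p l a b) (hA : HasPattern (A ∘ σ) N.blocks)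
    (hroots : {x : ℂ | Polynomial.aeval x p = 0} = {r, w, conjAut w}) {c : ℂ}
    (hc : c = r ∨ c = w ∨ c = conjAut w) : ∃ x : ModuliSpace A, coordRatio σ l a b x = c := by
  refine h.exists_coordRatio_eq hA ?_
  change c ∈ {x : ℂ | Polynomial.aeval x p = 0}
  rw [hroots]
  simpa using hc

theorem not_irreducible (h : N.Rigid p l a b) (hA : HasPattern (A ∘ σ) N.blocks)
    (hroots : {x : ℂ | Polynomial.aeval x p = 0} = {r, w, conjAut w}) (hr : conjAut r = r)
    (hrw : w ≠ r) : ¬ IrreducibleSpace (ModuliSpaceConj A) :=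
  not_irreducibleSpace (coordRatio σ l a b) (h.coord.isClosed h.valid hA)
    (fun _ _ hxy => (h.galConj_iff hA).1 hxy) hr (h.coordRatio_cases hA hroots) hrw
    (h.exists_of_mem_roots hA hroots (by simp)) (h.exists_of_mem_roots hA hroots (by simp))

/-- The coordinates of any two points are roots of the same irreducible polynomial. -/
theorem exists_galConj (h : N.Rigid p l a b) (hA : HasPattern (A ∘ σ) N.blocks)
    (x y : ModuliSpace A) : ∃ τ : ℂ ≃+* ℂ, GalConj τ x y := by
  obtain ⟨τ, hτ⟩ := exists_ringEquiv_of_aeval_eq_zero h.irreducible (h.aeval_coordRatio hA x)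
    (h.aeval_coordRatio hA y)
  exact ⟨τ, (h.galConj_iff hA).2 hτ.symm⟩

lemma card_eq (h : N.Rigid p l a b) (hA : HasPattern (A ∘ σ) N.blocks) :
    Nat.card (ModuliSpace A) = {x : ℂ | Polynomial.aeval x p = 0}.ncard := by
  refine Nat.card_congr (Equiv.ofBijective
    (fun x => ⟨coordRatio σ l a b x, h.aeval_coordRatio hA x⟩) ⟨fun x y hxy => ?_, fun c => ?_⟩)
  · exact h.coordRatio_injective hA (congrArg Subtype.val hxy)
  · obtain ⟨x, hx⟩ := h.exists_coordRatio_eq hA c.2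
    exact ⟨x, Subtype.ext hx⟩

lemma ncard_realPoints (h : N.Rigid p l a b) (hA : HasPattern (A ∘ σ) N.blocks) :
    (realPoints A).ncard = {x : ℂ | Polynomial.aeval x p = 0 ∧ conjAut x = x}.ncard := by
  rw [← Set.ncard_image_of_injective _ (h.coordRatio_injective hA)]
  congr 1
  ext c
  constructor
  · rintro ⟨x, hx, rfl⟩
    exact ⟨h.aeval_coordRatio hA x, (h.mem_realPoints_iff hA).1 hx⟩
  · rintro ⟨hc, hc'⟩
    obtain ⟨x, rfl⟩ := h.exists_coordRatio_eq hA hc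
    exact ⟨x, (h.mem_realPoints_iff hA).2 hc', rfl⟩

/-- The real root is a class of its own, since having coordinate `r` is stable under conjugation;
the other roots form the second class. -/
lemma card_conj (h : N.Rigid p l a b) (hA : HasPattern (A ∘ σ) N.blocks)
    (hroots : {x : ℂ | Polynomial.aeval x p = 0} = {r, w, conjAut w}) (hr : conjAut r = r)
    (hrw : w ≠ r) : Nat.card (ModuliSpaceConj A) = 2 := by
  have hww : conjAut (conjAut w) = w := Complex.conj_conj w
  have hrw' : conjAut w ≠ r := fun h => hrw (conjAut.injective (h.trans hr.symm))
  obtain ⟨x, hx⟩ := h.exists_of_mem_roots hA hroots (c := r) (by simp)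
  obtain ⟨y, hy⟩ := h.exists_of_mem_roots hA hroots (c := w) (by simp)
  refine Nat.card_eq_two_iff.2 ⟨Quot.mk _ x, Quot.mk _ y, fun hxy => ?_, ?_⟩
  · let Y : ModuliSpaceConj A → Prop := Quot.lift (fun x => coordRatio σ l a b x = r)
      fun x y hxy => by
        rw [(h.galConj_iff hA).1 hxy, eq_iff_iff,
          ← conjAut.injective.eq_iff (a := coordRatio σ l a b x), hr]
    have hY : Y (Quot.mk _ y) := hxy ▸ (show Y (Quot.mk _ x) from hx)
    exact hrw (hy.symm.trans hY)
  · rw [Set.eq_univ_iff_forall]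
    rintro ⟨z⟩
    rcases h.coordRatio_cases hA hroots z with hz | hz | hz
    · left
      rw [h.coordRatio_injective hA (hz.trans hx.symm)]
    · right
      rw [h.coordRatio_injective hA (hz.trans hy.symm)]
      rfl
    · right
      exact (Quot.sound ((h.galConj_iff hA).2 (by rw [hy, hz]))).symm

end

/-- The conclusion for a polynomial with one real root and two other complex roots. -/
theorem conclusion_of_complex (h : N.Rigid p l a b) (hA : HasPattern (A ∘ σ) N.blocks) {r : ℝ} {w : ℂ}
    (hw : conjAut w ≠ w) (hroots : {x : ℂ | Polynomial.aeval x p = 0} = {(r : ℂ), w, conjAut w}) :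
    (Nat.card (ModuliSpace A) = 3 ∧ (realPoints A).ncard = 1 ∧ Nat.card (ModuliSpaceConj A) = 2 ∧
      ∀ x y : ModuliSpace A, ∃ τ : ℂ ≃+* ℂ, GalConj τ x y) ∧
    ¬ IrreducibleSpace (ModuliSpaceConj A) := by
  have hr : conjAut (r : ℂ) = r := Complex.conj_ofReal r
  have hww : conjAut (conjAut w) = w := Complex.conj_conj w
  have hrw : w ≠ r := fun h => hw (by rw [h, hr])
  have hrw' : conjAut w ≠ r := fun h => hrw (conjAut.injective (h.trans hr.symm))
  refine ⟨⟨?_, ?_, h.card_conj hA hroots hr hrw, h.exists_galConj hA⟩,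
    h.not_irreducible hA hroots hr hrw⟩
  · rw [h.card_eq hA, hroots]
    exact Set.ncard_eq_three.2 ⟨_, _, _, hrw.symm, hrw'.symm, hw.symm, rfl⟩
  · rw [h.ncard_realPoints hA, Set.ncard_eq_one]
    refine ⟨r, Set.ext fun x => ?_⟩
    change x ∈ {x : ℂ | Polynomial.aeval x p = 0} ∧ _ ↔ _
    rw [hroots]
    simp only [Set.mem_insert_iff, Set.mem_singleton_iff]
    constructor
    · rintro ⟨rfl | rfl | rfl, hx⟩
      · rfl
      · exact absurd hx hw
      · exact absurd (hx.symm.trans hww) hw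
    · rintro rfl
      exact ⟨Or.inl rfl, hr⟩

/-- The conclusion for a polynomial with two real roots. -/
theorem conclusion_of_real (h : N.Rigid p l a b) (hA : HasPattern (A ∘ σ) N.blocks) {r w : ℝ}
    (hw : w ≠ r) (hroots : {x : ℂ | Polynomial.aeval x p = 0} = {(r : ℂ), (w : ℂ)}) :
    (Nat.card (ModuliSpace A) = 2 ∧ (realPoints A).ncard = 2 ∧ Nat.card (ModuliSpaceConj A) = 2 ∧
      ∀ x y : ModuliSpace A, ∃ τ : ℂ ≃+* ℂ, GalConj τ x y) ∧
    ¬ IrreducibleSpace (ModuliSpaceConj A) := by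
  have hr : ∀ r : ℝ, conjAut (r : ℂ) = r := fun r => Complex.conj_ofReal r
  have hrw : (w : ℂ) ≠ r := by exact_mod_cast hw
  -- A real root `w` is its own conjugate, so the statements on `r`, `w` and the conjugate of `w`
  -- also cover two real roots.
  have hroots' : {x : ℂ | Polynomial.aeval x p = 0} = {(r : ℂ), (w : ℂ), conjAut w} := by
    rw [hr, Set.pair_eq_singleton, hroots]
  have hcard : ({(r : ℂ), (w : ℂ)} : Set ℂ).ncard = 2 := Set.ncard_pair hrw.symm
  refine ⟨⟨?_, ?_, h.card_conj hA hroots' (hr r) hrw, h.exists_galConj hA⟩,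
    h.not_irreducible hA hroots' (hr r) hrw⟩
  · rw [h.card_eq hA, hroots, hcard]
  · rw [h.ncard_realPoints hA, ← hcard]
    congr 1
    ext x
    change x ∈ {x : ℂ | Polynomial.aeval x p = 0} ∧ _ ↔ _
    rw [hroots]
    refine and_iff_left_of_imp ?_
    rintro (rfl | rfl) <;> exact hr _

end NormalForm.Rigid

/-! ### The eight rigid special patterns -/

namespace NormalForm

/-- All coordinates are expressions in the first parameter. -/
def usesOneParam (N : NormalForm) : Bool := allFin fun i => (N.vec i).usesBelow 1

lemma vec_eq_of_usesOneParam {N : NormalForm} (h : N.usesOneParam = true) (s : ℕ → ℂ) :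
    ∀ i < 10, (N.vec i).ev s = (N.vec i).ev (params (s 0)) := by
  intro i hi
  simp only [usesOneParam, allFin_eq_true] at h
  refine PolyVec.ev_congr_of_usesBelow (fun j hj => ?_) (h ⟨i, hi⟩)
  obtain rfl : j = 0 := by omega
  simp [params]

/-- The parameters `x, x - 1, …` as quadratic expressions. -/
def paramsMod : ℕ → ℤ × ℤ × ℤ := fun i => (-i, 1, 0)

lemma quadValue_paramsMod (c : ℂ) : (fun i => quadValue c (paramsMod i)) = params c := by
  funext i
  simp [quadValue, paramsMod, params]
  ring

/-- A cubic polynomial as an expression in the first parameter. -/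
def cubicExpr (k : ℤ × ℤ × ℤ) : PolyExpr :=
  let coeff : ℤ → PolyExpr := fun n => .nat n.toNat + -.nat (-n).toNat
  .var 0 * (.var 0 * .var 0) - coeff k.2.2 * (.var 0 * .var 0) - coeff k.2.1 * .var 0 - coeff k.1

lemma ev_cubicExpr (k : ℤ × ℤ × ℤ) (s : ℕ → ℂ) :
    (cubicExpr k).ev s = Polynomial.aeval (s 0) (cubicPoly k) := by
  have h : ∀ n : ℤ, (n.toNat : ℂ) + -((-n).toNat : ℂ) = n := fun n => by
    have := n.toNat_sub_toNat_neg
    rw [← sub_eq_add_neg]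
    exact_mod_cast congrArg (Int.cast : ℤ → ℂ) this
  rw [aeval_cubicPoly]
  simp only [cubicExpr, PolyExpr.ev_sub, PolyExpr.ev_add, PolyExpr.ev_mul, PolyExpr.ev_var,
    PolyExpr.ev_neg, PolyExpr.ev_nat, h]
  ring

/-- A quadratic polynomial as an expression in the first parameter. -/
def quadExpr (k : ℤ × ℤ) : PolyExpr :=
  let coeff : ℤ → PolyExpr := fun n => .nat n.toNat + -.nat (-n).toNat
  .var 0 * .var 0 - coeff k.2 * .var 0 - coeff k.1

lemma ev_quadExpr (k : ℤ × ℤ) (s : ℕ → ℂ) :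
    (quadExpr k).ev s = Polynomial.aeval (s 0) (quadPoly k) := by
  have h : ∀ n : ℤ, (n.toNat : ℂ) + -((-n).toNat : ℂ) = n := fun n => by
    have := n.toNat_sub_toNat_neg
    rw [← sub_eq_add_neg]
    exact_mod_cast congrArg (Int.cast : ℤ → ℂ) this
  rw [aeval_quadPoly]
  simp only [quadExpr, PolyExpr.ev_sub, PolyExpr.ev_add, PolyExpr.ev_mul, PolyExpr.ev_var,
    PolyExpr.ev_neg, PolyExpr.ev_nat, h]
  ring

/-- The residual identity shows that a good parameter is a root of the cubic. Conversely, all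
determinants are computed modulo the cubic; as it is irreducible, a single computation decides their
vanishing at all roots at once. -/
lemma rigid_cubic {N : NormalForm} {k : ℤ × ℤ × ℤ} {l : Fin 10} {a b : Fin 3}
    (hB : AdmissiblePattern N.blocks)
    (hk : ∀ n : ℤ, n ∣ k.1 → n ^ 3 - k.2.2 * n ^ 2 - k.2.1 * n - k.1 ≠ 0)
    (hc : N.Coordinate 0 l a b) (n : ℕ) (q : PolyExpr) (w : ℕ × PolyExpr × List ℕ)
    (h : (N.valid && (N.usesOneParam && (N.residual (cubicExpr k) n q w &&
      N.checkAt k isZeroCubic paramsMod))) = true) : N.Rigid (cubicPoly k) l a b := by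
  simp only [Bool.and_eq_true] at h
  obtain ⟨h1, h2, h3, h4⟩ := h
  have hirr := irreducible_cubicPoly hk
  refine ⟨h1, hirr, hc, fun s hs => ?_, fun c hc => ?_, fun s _ => vec_eq_of_usesOneParam h2 s⟩
  · rw [← ev_cubicExpr]
    exact hs.ev_eq_zero h3
  · rw [← quadValue_paramsMod]
    exact good_of_checkAt hB (zeroTest_cubic hirr hc) h4

lemma rigid_quad {N : NormalForm} {k : ℤ × ℤ} {l : Fin 10} {a b : Fin 3}
    (hB : AdmissiblePattern N.blocks) (hk : ∀ n : ℤ, n ∣ k.1 → n ^ 2 - k.2 * n - k.1 ≠ 0)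
    (hc : N.Coordinate 0 l a b) (n : ℕ) (q : PolyExpr) (w : ℕ × PolyExpr × List ℕ)
    (h : (N.valid && (N.usesOneParam && (N.residual (quadExpr k) n q w &&
      N.checkAt (0, k.1, k.2) (isZeroQuad k) paramsMod))) = true) :
    N.Rigid (quadPoly k) l a b := by
  simp only [Bool.and_eq_true] at h
  obtain ⟨h1, h2, h3, h4⟩ := h
  have hirr := irreducible_quadPoly hk
  refine ⟨h1, hirr, hc, fun s hs => ?_, fun c hc => ?_, fun s _ => vec_eq_of_usesOneParam h2 s⟩
  · rw [← ev_quadExpr]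
    exact hs.ev_eq_zero h3
  · rw [← quadValue_paramsMod]
    exact good_of_checkAt hB (zeroTest_quad hirr hc) h4

end NormalForm

section
open PolyExpr NormalForm

/-- The polynomial is `x³ - x + 1`. For the indices 1, 3, 4, 5, 6, 7 below it is `x² + x - 1`, `x² +
x - 1`, `x³ - x - 1`, `x³ - x² + 2x - 1`, `x³ - x² - x - 1` and `x² - 2`. In each case the numbers
after the coordinate give a concurrent triple, the cofactor in its determinant, and the certificate
that this cofactor does not vanish. -/
lemma rigid_specialForm_0 : (specialForm 0).Rigid (cubicPoly (-1, 1, 0)) 4 0 2 :=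
  rigid_cubic (admissiblePattern_specialForm 0)
    (fun n hn => by
      have h1 := Int.le_of_dvd one_pos (dvd_neg.1 hn)
      have h2 := Int.le_of_dvd one_pos (neg_dvd.2 (dvd_neg.1 hn))
      have : -1 ≤ n := by linarith
      interval_cases n <;> norm_num)
    ⟨fun s => PolyExpr.ev_one s, fun s => rfl⟩ 69 (-1) (0, -1, []) (by decide +kernel)

lemma rigid_specialForm_1 : (specialForm 1).Rigid (quadPoly (1, -1)) 7 2 0 :=
  rigid_quad (admissiblePattern_specialForm 1)
    (fun n hn => by
      have h1 := Int.le_of_dvd one_pos hn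
      have h2 := Int.le_of_dvd one_pos (neg_dvd.2 hn)
      have : -1 ≤ n := by linarith
      interval_cases n <;> norm_num)
    ⟨fun s => PolyExpr.ev_one s, fun s => rfl⟩ 589 2 (1, 1, []) (by decide +kernel)

lemma rigid_specialForm_3 : (specialForm 3).Rigid (quadPoly (1, -1)) 5 1 2 :=
  rigid_quad (admissiblePattern_specialForm 3)
    (fun n hn => by
      have h1 := Int.le_of_dvd one_pos hn
      have h2 := Int.le_of_dvd one_pos (neg_dvd.2 hn)
      have : -1 ≤ n := by linarith
      interval_cases n <;> norm_num)
    ⟨fun s => PolyExpr.ev_one s, fun s => rfl⟩ 189 (-x*x - x) (0, -1, [38, 15]) (by decide +kernel)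

lemma rigid_specialForm_4 : (specialForm 4).Rigid (cubicPoly (1, 1, 0)) 5 0 1 :=
  rigid_cubic (admissiblePattern_specialForm 4)
    (fun n hn => by
      have h1 := Int.le_of_dvd one_pos hn
      have h2 := Int.le_of_dvd one_pos (neg_dvd.2 hn)
      have : -1 ≤ n := by linarith
      interval_cases n <;> norm_num)
    ⟨fun s => PolyExpr.ev_one s, fun s => rfl⟩ 479 (x - 1) (0, -x, [37]) (by decide +kernel)

lemma rigid_specialForm_5 : (specialForm 5).Rigid (cubicPoly (1, -2, 1)) 5 0 1 :=
  rigid_cubic (admissiblePattern_specialForm 5)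
    (fun n hn => by
      have h1 := Int.le_of_dvd one_pos hn
      have h2 := Int.le_of_dvd one_pos (neg_dvd.2 hn)
      have : -1 ≤ n := by linarith
      interval_cases n <;> norm_num)
    ⟨fun s => PolyExpr.ev_one s, fun s => rfl⟩ 679 x (0, -1, [17]) (by decide +kernel)

lemma rigid_specialForm_6 : (specialForm 6).Rigid (cubicPoly (1, 1, 1)) 8 0 2 :=
  rigid_cubic (admissiblePattern_specialForm 6)
    (fun n hn => by
      have h1 := Int.le_of_dvd one_pos hn
      have h2 := Int.le_of_dvd one_pos (neg_dvd.2 hn)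
      have : -1 ≤ n := by linarith
      interval_cases n <;> norm_num)
    ⟨fun s => PolyExpr.ev_one s, fun s => rfl⟩ 369 1 (0, 1, []) (by decide +kernel)

lemma rigid_specialForm_7 : (specialForm 7).Rigid (quadPoly (2, 0)) 5 1 0 :=
  rigid_quad (admissiblePattern_specialForm 7)
    (fun n hn => by
      have h1 := Int.le_of_dvd two_pos hn
      have h2 := Int.le_of_dvd two_pos (neg_dvd.2 hn)
      have : -2 ≤ n := by linarith
      interval_cases n <;> norm_num)
    ⟨fun s => PolyExpr.ev_one s, fun s => rfl⟩ 689 (-x*x + x) (0, 1, [39, 16]) (by decide +kernel)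

/-- This normal form has two parameters. The triple 179 gives `y = x - 1`, since its other factor
does not vanish, and the triple 358 then gives `x² - 3x + 1 = 0`. This explains the choice `c`, `c -
1` in `params`. -/
lemma rigid_specialForm_2 : (specialForm 2).Rigid (quadPoly (-1, 3)) 5 1 2 := by
  have hirr : Irreducible (quadPoly (-1, 3)) := irreducible_quadPoly fun n hn => by
    have h1 := Int.le_of_dvd one_pos (dvd_neg.1 hn)
    have h2 := Int.le_of_dvd one_pos (neg_dvd.2 (dvd_neg.1 hn))
    have : -1 ≤ n := by linarith
    interval_cases n <;> norm_num
  have h1 : ∀ s, (specialForm 2).Good s → s 1 = s 0 - 1 := fun s hs => by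
    have : (specialForm 2).residual (x - y - 1) 179 (x*y - x) (0, 1, [58]) = true := by
      decide +kernel
    have := hs.ev_eq_zero this
    simp only [ev_sub, ev_var, ev_one, x, y] at this
    linear_combination -this
  refine ⟨valid_specialForm 2, hirr, ⟨fun s => PolyExpr.ev_one s, fun s => rfl⟩, fun s hs => ?_,
    fun c hc => ?_, fun s hs i hi => ?_⟩
  · have : (specialForm 2).residual (x*y - 2*x + 1) 358 1 (0, 1, []) = true := by
      decide +kernel
    have := hs.ev_eq_zero this
    simp only [ev_add, ev_sub, ev_mul, ev_var, ev_one, ev_ofNat, x, y, h1 s hs] at this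
    rw [aeval_quadPoly]
    push_cast
    linear_combination this
  · rw [← quadValue_paramsMod]
    exact good_of_checkAt (admissiblePattern_specialForm 2) (zeroTest_quad hirr hc)
      (by decide +kernel)
  · have h : (allFin fun i => ((specialForm 2).vec i).usesBelow 2) = true := by decide +kernel
    rw [allFin_eq_true] at h
    refine PolyVec.ev_congr_of_usesBelow (fun j hj => ?_) (h ⟨i, hi⟩)
    interval_cases j
    · simp [params]
    · simp [params, h1 s hs]

end

/-- The moduli spaces of the first eight special patterns. -/
theorem conclusion_specialForm {A : Fin 10 → Line} {σ : Equiv.Perm (Fin 10)} {t : Fin 9}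
    (ht : t ≠ 8) (hP : HasPattern (A ∘ σ) (specialForm t).blocks) :
    (Nat.card (ModuliSpace A) = ![3, 2, 2, 2, 3, 3, 3, 2, 0] t ∧
      (realPoints A).ncard = ![1, 2, 2, 2, 1, 1, 1, 2, 0] t ∧ Nat.card (ModuliSpaceConj A) = 2 ∧
      ∀ x y : ModuliSpace A, ∃ σ : ℂ ≃+* ℂ, GalConj σ x y) ∧
    ¬ IrreducibleSpace (ModuliSpaceConj A) := by
  have quad : ∀ {k : ℤ × ℤ} {t l a b}, (specialForm t).Rigid (quadPoly k) l a b →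
      HasPattern (A ∘ σ) (specialForm t).blocks → 0 < k.2 ^ 2 + 4 * k.1 →
      (Nat.card (ModuliSpace A) = 2 ∧ (realPoints A).ncard = 2 ∧
        Nat.card (ModuliSpaceConj A) = 2 ∧ ∀ x y : ModuliSpace A, ∃ τ : ℂ ≃+* ℂ, GalConj τ x y) ∧
      ¬ IrreducibleSpace (ModuliSpaceConj A) := fun h hP hk => by
    obtain ⟨r, w, hw, hroots⟩ := exists_roots_quadPoly _ hk
    exact h.conclusion_of_real hP hw hroots
  have cubic : ∀ {k : ℤ × ℤ × ℤ} {t l a b}, (specialForm t).Rigid (cubicPoly k) l a b →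
      HasPattern (A ∘ σ) (specialForm t).blocks → ∀ lo hi : ℝ, lo ≤ hi →
      lo ^ 3 - k.2.2 * lo ^ 2 - k.2.1 * lo - k.1 ≤ 0 →
      0 ≤ hi ^ 3 - k.2.2 * hi ^ 2 - k.2.1 * hi - k.1 →
      (∀ r : ℝ, lo ≤ r → r ≤ hi → (r - k.2.2) ^ 2 < 4 * (r ^ 2 - k.2.2 * r - k.2.1)) →
      (Nat.card (ModuliSpace A) = 3 ∧ (realPoints A).ncard = 1 ∧
        Nat.card (ModuliSpaceConj A) = 2 ∧ ∀ x y : ModuliSpace A, ∃ τ : ℂ ≃+* ℂ, GalConj τ x y) ∧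
      ¬ IrreducibleSpace (ModuliSpaceConj A) := fun h hP lo hi h1 h2 h3 h4 => by
    obtain ⟨r, w, hw, hroots⟩ := exists_roots_cubicPoly _ lo hi h1 h2 h3 h4
    exact h.conclusion_of_complex hP hw hroots
  fin_cases t
  -- The other two roots are not real as soon as `3 r² > 4`, and `1.2` is larger than `2/√3`.
  · refine cubic rigid_specialForm_0 hP (-2) (-1.2) (by norm_num) (by norm_num) (by norm_num)
      fun r h1 h2 => ?_
    norm_num at h1 h2 ⊢
    nlinarith
  · exact quad rigid_specialForm_1 hP (by norm_num)
  · exact quad rigid_specialForm_2 hP (by norm_num)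
  · exact quad rigid_specialForm_3 hP (by norm_num)
  -- Again the condition is `3 r² > 4`.
  · refine cubic rigid_specialForm_4 hP 1.2 2 (by norm_num) (by norm_num) (by norm_num)
      fun r h1 h2 => ?_
    norm_num at h1 h2 ⊢
    nlinarith
  -- Here the condition is `3 r² - 2 r + 7 > 0`, which always holds.
  · refine cubic rigid_specialForm_5 hP 0 1 (by norm_num) (by norm_num) (by norm_num)
      fun r h1 h2 => ?_
    norm_num at h1 h2 ⊢
    nlinarith [sq_nonneg r]
  -- Here the condition is `(3 r - 5) (r + 1) > 0`, and `1.7` is larger than `5/3`.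
  · refine cubic rigid_specialForm_6 hP 1.7 2 (by norm_num) (by norm_num) (by norm_num)
      fun r h1 h2 => ?_
    norm_num at h1 h2 ⊢
    nlinarith
  · exact quad rigid_specialForm_7 hP (by norm_num)
  · exact absurd rfl ht

/-! ### Spaces that consist of two disjoint irreducible curves -/

/-- The function `X` takes the two values `r` and `w`, and the function `Y` is a coordinate on the
fibres of `X`, which are cofinite in the affine line with its cofinite topology. -/
structure TwoCurves {M : Type*} [TopologicalSpace M] (X Y : M → ℂ) (r w : ℂ) : Prop where
  isClosed_left : ∀ c, IsClosed {x | X x = c}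
  isClosed_right : ∀ c, IsClosed {x | Y x = c}
  eq_or_eq : ∀ x, X x = r ∨ X x = w
  injective : ∀ x y, X x = X y → Y x = Y y → x = y
  finite : ∀ U : Set M, IsOpen U → ∀ x ∈ U, {y | ¬ ∃ z ∈ U, X z = X x ∧ Y z = y}.Finite
  left : ∃ x, X x = r
  right : ∃ x, X x = w
  ne : w ≠ r

namespace TwoCurves
variable {M : Type*} [TopologicalSpace M] {X Y : M → ℂ} {r w : ℂ}

/-- Each of two nonempty open subsets of a fibre misses only finitely many values of `Y`. As `ℂ` is
infinite, they share a value and hence a point. -/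
lemma isIrreducible_fibre (h : TwoCurves X Y r w) (x : M) : IsIrreducible {y | X y = X x} := by
  refine ⟨⟨x, rfl⟩, fun U V hU hV ⟨u, hu, hu'⟩ ⟨v, hv, hv'⟩ => ?_⟩
  obtain ⟨y, hy⟩ := ((h.finite U hU u hu').union (h.finite V hV v hv')).infinite_compl.nonempty
  simp only [Set.mem_compl_iff, Set.mem_union, not_or, Set.mem_ofPred_eq, not_not] at hy hu hv
  obtain ⟨⟨z, hz, hz1, hz2⟩, z', hz', hz1', hz2'⟩ := hy
  obtain rfl := h.injective z z' (by rw [hz1, hz1', hu, hv]) (by rw [hz2, hz2'])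
  exact ⟨z, hz1.trans hu, hz, hz'⟩

lemma subset_of_isIrreducible (h : TwoCurves X Y r w) {C : Set M} (hC : IsIrreducible C) {x : M}
    (hx : x ∈ C) : C ⊆ {y | X y = X x} := by
  have := isPreirreducible_iff_isClosed_union_isClosed.1 hC.2 _ _ (h.isClosed_left r)
    (h.isClosed_left w) fun y _ => h.eq_or_eq y
  rcases this with h' | h' <;> exact fun y hy => (h' hy).trans (h' hx).symm

lemma t1Space (h : TwoCurves X Y r w) : T1Space M where
  t1 x := by
    have : {x} = {y | X y = X x} ∩ {y | Y y = Y x} := by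
      ext y
      exact ⟨by rintro rfl; exact ⟨rfl, rfl⟩, fun hy => h.injective _ _ hy.1 hy.2⟩
    rw [this]
    exact (h.isClosed_left _).inter (h.isClosed_right _)

/-- A closed subset that misses a point of its fibre takes only finitely many values of `Y`, so it
is finite; a finite irreducible subset of a T1 space is a point. -/
lemma eq_singleton (h : TwoCurves X Y r w) {C : Set M} (hC : IsIrreducible C) (hC' : IsClosed C)
    {x y : M} (hx : x ∈ C) (hy : X y = X x) (hyC : y ∉ C) : C = {x} := by
  have := h.t1Space
  have hsub := h.subset_of_isIrreducible hC hx
  have hfin : C.Finite := by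
    refine Set.Finite.of_finite_image ((h.finite Cᶜ hC'.isOpen_compl y hyC).subset ?_)
      (f := Y) fun u hu v hv => h.injective u v ((hsub hu).trans (hsub hv).symm)
    rintro _ ⟨u, hu, rfl⟩ ⟨z, hz, hz1, hz2⟩
    exact hz (h.injective z u (by rw [hz1, hy, hsub hu]) hz2 ▸ hu)
  have := isPreirreducible_iff_isClosed_union_isClosed.1 hC.2 {x} (C \ {x}) isClosed_singleton
    (hfin.sdiff).isClosed fun z hz => (em (z = x)).imp_right fun hzx => ⟨hz, hzx⟩
  rcases this with h' | h'
  · exact h'.antisymm (Set.singleton_subset_iff.2 hx)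
  · exact absurd rfl (h' hx).2

lemma irreducibleComponents_eq (h : TwoCurves X Y r w) :
    irreducibleComponents M = {{x | X x = r}, {x | X x = w}} := by
  have key : ∀ x, {y | X y = X x} ∈ irreducibleComponents M := fun x =>
    ⟨h.isIrreducible_fibre x, fun C hC hle => h.subset_of_isIrreducible hC (hle rfl)⟩
  ext C
  constructor
  · intro hC
    obtain ⟨x, hx⟩ := hC.1.1
    have hsub := h.subset_of_isIrreducible hC.1 hx
    have : C = {y | X y = X x} := hsub.antisymm (hC.2 (h.isIrreducible_fibre x) hsub)
    rcases h.eq_or_eq x with hx' | hx' <;> rw [this, hx'] <;> simp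
  · obtain ⟨x, hx⟩ := h.left
    obtain ⟨y, hy⟩ := h.right
    rintro (rfl | rfl)
    · exact hx ▸ key x
    · exact hy ▸ key y

/-- A closed irreducible set is either a whole fibre, hence maximal, or a point, hence minimal, so
there is no chain of length two. A fibre has more than one point, which gives a chain of length one.
-/
lemma topologicalKrullDim_eq (h : TwoCurves X Y r w) : topologicalKrullDim M = 1 := by
  have := h.t1Space
  refine le_antisymm (Order.krullDim_le_one_iff.2 fun C => ?_) (Order.one_le_krullDim_iff.2 ?_)
  · obtain ⟨x, hx⟩ := C.isIrreducible.1
    by_cases hC : ∀ y, X y = X x → y ∈ (C : Set M)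
    · exact Or.inr fun D hD y hy => hC y (h.subset_of_isIrreducible D.isIrreducible (hD hx) hy)
    · push Not at hC
      obtain ⟨y, hy, hyC⟩ := hC
      have hCx := h.eq_singleton C.isIrreducible C.isClosed hx hy hyC
      refine Or.inl fun D hD => ?_
      obtain ⟨z, hz⟩ := D.isIrreducible.1
      have hzx : z ∈ (C : Set M) := hD hz
      rw [hCx] at hzx
      obtain rfl := hzx
      intro u hu
      have hu' : u ∈ (C : Set M) := hu
      rw [hCx] at hu'
      obtain rfl := hu'
      exact hz
  · obtain ⟨x, -⟩ := h.left
    obtain ⟨y, hy⟩ :=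
      ((h.finite Set.univ isOpen_univ x trivial).union (Set.finite_singleton (Y x))).infinite_compl.nonempty
    simp only [Set.mem_compl_iff, Set.mem_union, not_or, Set.mem_ofPred_eq, not_not,
      Set.mem_singleton_iff] at hy
    obtain ⟨⟨z, -, hz, hzy⟩, hy⟩ := hy
    refine ⟨⟨{x}, isIrreducible_singleton, isClosed_singleton⟩,
      ⟨{y | X y = X x}, h.isIrreducible_fibre x, h.isClosed_left _⟩, ?_, fun hle => ?_⟩
    · rintro u rfl
      exact rfl
    · have : z = x := hle (show X z = X x from hz)
      exact hy (by rw [← hzy, this])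

end TwoCurves

/-! ### The special pattern with a curve as its moduli space -/

/-- The parameters `c, y, y, …`. -/
def curveParams (c y : ℂ) : ℕ → ℂ := fun i => if i = 0 then c else y

namespace NormalForm
open PolyExpr

variable {A : Fin 10 → Line} {σ : Equiv.Perm (Fin 10)}

lemma coordinate_zero_specialForm_eight : (specialForm 8).Coordinate 0 6 1 2 :=
  ⟨fun s => PolyExpr.ev_one s, fun _ => rfl⟩

lemma coordinate_one_specialForm_eight : (specialForm 8).Coordinate 1 7 0 1 :=
  ⟨fun s => PolyExpr.ev_one s, fun _ => rfl⟩

lemma irreducible_quadPoly_golden : Irreducible (quadPoly (1, 1)) :=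
  irreducible_quadPoly fun n hn => by
    have h1 := Int.le_of_dvd one_pos hn
    have h2 := Int.le_of_dvd one_pos (neg_dvd.2 hn)
    have : -1 ≤ n := by linarith
    interval_cases n <;> norm_num

/-- The determinant of the triple 589 is `(y - 1) (x² - x - 1)`, and its first factor does not
vanish at good parameters. The other concurrent triples impose no condition, so `y` remains free. -/
lemma Good.aeval_quadPoly_eq_zero {s : ℕ → ℂ} (hs : (specialForm 8).Good s) :
    Polynomial.aeval (s 0) (quadPoly (1, 1)) = 0 := by
  rw [← ev_quadExpr]
  have : (specialForm 8).residual (quadExpr (1, 1)) 589 (y - 1) (0, -x, [138]) = true := by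
    decide +kernel
  exact hs.ev_eq_zero this

lemma ev_specialForm_eight_congr {s t : ℕ → ℂ} (h0 : s 0 = t 0) (h1 : s 1 = t 1) :
    ∀ i < 10, ((specialForm 8).vec i).ev s = ((specialForm 8).vec i).ev t := by
  intro i hi
  have h : (allFin fun i => ((specialForm 8).vec i).usesBelow 2) = true := by decide +kernel
  rw [allFin_eq_true] at h
  refine PolyVec.ev_congr_of_usesBelow (fun j hj => ?_) (h ⟨i, hi⟩)
  interval_cases j <;> assumption

/-- Any value of the free parameter at which no further triple becomes concurrent would do; for 5
this is checked modulo `x² - x - 1`, thus for both roots at once. -/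
lemma good_curveParams {c : ℂ} (hc : Polynomial.aeval c (quadPoly (1, 1)) = 0) :
    (specialForm 8).Good (curveParams c 5) := by
  have : (fun i => quadValue c (if i = 0 then (0, 1, 0) else (5, 0, 0))) = curveParams c 5 := by
    funext i
    by_cases hi : i = 0 <;> simp [quadValue, curveParams, hi]
  rw [← this]
  exact good_of_checkAt (admissiblePattern_specialForm 8)
    (zeroTest_quad irreducible_quadPoly_golden hc) (by decide +kernel)

/-! ### The two curves over the roots of the quadratic polynomial. -/

section
variable (hA : HasPattern (A ∘ σ) (specialForm 8).blocks)
include hA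

lemma isPoint_curveParams (x : ModuliSpace A) : (specialForm 8).IsPoint σ
    (curveParams (coordRatio σ 6 1 2 x) (coordRatio σ 7 0 1 x)) x := by
  obtain ⟨s, hs, Q, hQ, hQx⟩ := exists_isPoint (valid_specialForm 8) hA x
  have hx : (specialForm 8).IsPoint σ s x := ⟨Q, hQ, hQx⟩
  rw [hx.coordRatio_eq coordinate_zero_specialForm_eight,
    hx.coordRatio_eq coordinate_one_specialForm_eight]
  refine ⟨Q, ?_, hQx⟩
  have : ((specialForm 8).family σ).ev (curveParams (s 0) (s 1)) =
      ((specialForm 8).family σ).ev s := by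
    funext i
    exact ev_specialForm_eight_congr (by simp [curveParams]) (by simp [curveParams]) _ (σ.symm i).2
  rwa [this]

lemma aeval_coordRatio_specialForm_eight (x : ModuliSpace A) :
    Polynomial.aeval (coordRatio σ 6 1 2 x) (quadPoly (1, 1)) = 0 := by
  obtain ⟨s, hs, hx⟩ := exists_isPoint (valid_specialForm 8) hA x
  rw [hx.coordRatio_eq coordinate_zero_specialForm_eight]
  exact hs.aeval_quadPoly_eq_zero

lemma coordRatio_of_galConj {τ : ℂ ≃+* ℂ} {x y : ModuliSpace A} (h : GalConj τ x y) :
    coordRatio σ 6 1 2 y = τ (coordRatio σ 6 1 2 x) := by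
  rw [((isPoint_curveParams hA x).of_galConj h).coordRatio_eq coordinate_zero_specialForm_eight]
  simp [curveParams]

/-- Along the curve with first parameter `c`, all equations of the pattern hold. A parameter `y`
gives a point of `U` whenever a certain polynomial in `y` does not vanish, and this polynomial is
not zero because of the given point of `U`; the exceptions are among its roots. -/
lemma finite_curveParams {U : Set (ModuliSpace A)} (hU : IsOpen U) {x : ModuliSpace A}
    (hx : x ∈ U) : {y | ¬ ∃ z ∈ U, (specialForm 8).IsPoint σ
      (curveParams (coordRatio σ 6 1 2 x) y) z}.Finite := by
  set c := coordRatio σ 6 1 2 x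
  let S : Set (ℕ → ℂ) := {s | ∃ y, curveParams c y = s}
  have hS : ∀ s ∈ S, ∀ n ∈ (specialForm 8).blocks, ((specialForm 8).det n).ev s = 0 := by
    rintro s ⟨y, rfl⟩ n hn
    have h : (specialForm 8).blocksVanish (quadExpr (1, 1)) 589 (PolyExpr.y - 1) = true := by
      decide +kernel
    refine NormalForm.ev_det_eq_zero_of_blocksVanish h _ ?_ hn
    rw [ev_quadExpr]
    exact aeval_coordRatio_specialForm_eight hA x
  have hspread := (admissible_of_comp (hA.admissible (admissiblePattern_specialForm 8))).spread
  obtain ⟨p, hp, hpS⟩ := exists_poly_totalSpace hspread ((specialForm 8).family σ)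
    fun s hs i j k hc => NormalForm.vdet_family_eq_zero hA (hS s hs) hc
  obtain ⟨V, hV, hVU⟩ := (@isOpen_induced_iff _ _ (zariskiLines 10) _ _).1 (isOpen_coinduced.1 hU)
  obtain ⟨Q, hQ, hQx⟩ := isPoint_curveParams hA x
  have hQV : Q.lines ∈ V := by
    have : Q ∈ ModuliSpace.mk ⁻¹' U := by rwa [Set.mem_preimage, hQx]
    rwa [← hVU] at this
  obtain ⟨q, hq, hqV⟩ := exists_poly_of_isOpen_zariskiLines hV hQ hQV
  obtain ⟨q', hq'⟩ := Family.exists_eval_eq ((specialForm 8).family σ) q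
  let f : Polynomial ℂ := MvPolynomial.aeval
    (fun i : ℕ => if i = 0 then Polynomial.C c else Polynomial.X) (p * q')
  have hf : ∀ y, f.eval y = MvPolynomial.eval (curveParams c y) (p * q') := by
    intro y
    rw [← Polynomial.coe_evalRingHom, MvPolynomial.map_aeval]
    have : (fun i : ℕ => Polynomial.evalRingHom y (if i = 0 then Polynomial.C c else Polynomial.X))
        = curveParams c y := by
      funext i
      by_cases hi : i = 0 <;> simp [curveParams, hi]
    have h' : (Polynomial.evalRingHom y).comp (algebraMap ℂ (Polynomial ℂ)) = RingHom.id ℂ := by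
      ext
      simp
    rw [this, h']
    rfl
  -- It does not vanish at the second coordinate of `x`.
  have hf0 : f ≠ 0 := by
    intro h0
    have := hf (coordRatio σ 7 0 1 x)
    rw [h0, Polynomial.eval_zero, map_mul, hq'] at this
    exact mul_ne_zero (hp _ Q hQ) hq this.symm
  refine (Polynomial.finite_setOfPred_isRoot hf0).subset fun y hy => ?_
  by_contra hne
  change f.eval y ≠ 0 at hne
  rw [hf, map_mul, hq'] at hne
  obtain ⟨R, hR⟩ := hpS _ ⟨y, rfl⟩ (left_ne_zero_of_mul hne)
  refine hy ⟨ModuliSpace.mk R, ?_, R, hR, rfl⟩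
  have : R ∈ TotalSpace.lines ⁻¹' V := hqV _ _ hR (right_ne_zero_of_mul hne)
  rwa [hVU] at this

lemma exists_realPoints_coordRatio_eq {c : ℝ}
    (hc : Polynomial.aeval (c : ℂ) (quadPoly (1, 1)) = 0) :
    ∃ x ∈ realPoints A, coordRatio σ 6 1 2 x = c := by
  obtain ⟨x, hx⟩ := (good_curveParams hc).exists_isPoint hA
  refine ⟨x, IsPoint.mem_realPoints (N := specialForm 8) (σ := σ)
    (s := fun i => if i = 0 then c else 5) ?_, ?_⟩
  · convert hx using 1
    funext i
    by_cases hi : i = 0 <;> simp [curveParams, hi]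
  · rw [hx.coordRatio_eq coordinate_zero_specialForm_eight]
    simp [curveParams]

lemma twoCurves {r w : ℝ} (hrw : w ≠ r)
    (hroots : {x : ℂ | Polynomial.aeval x (quadPoly (1, 1)) = 0} = {(r : ℂ), (w : ℂ)}) :
    TwoCurves (M := ModuliSpace A) (coordRatio σ 6 1 2) (coordRatio σ 7 0 1) r w where
  isClosed_left := coordinate_zero_specialForm_eight.isClosed (valid_specialForm 8) hA
  isClosed_right := coordinate_one_specialForm_eight.isClosed (valid_specialForm 8) hA
  eq_or_eq x := by
    have : coordRatio σ 6 1 2 x ∈ {x : ℂ | Polynomial.aeval x (quadPoly (1, 1)) = 0} :=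
      aeval_coordRatio_specialForm_eight hA x
    rw [hroots] at this
    simpa using this
  injective x y h1 h2 := (isPoint_curveParams hA x).eq (isPoint_curveParams hA y) fun i _ => by
    rw [h1, h2]
  finite U hU x hx := (finite_curveParams hA hU hx).subset fun y hy ⟨z, hz, h⟩ => hy ⟨z, hz, by
    constructor
    · rw [h.coordRatio_eq coordinate_zero_specialForm_eight]; simp [curveParams]
    · rw [h.coordRatio_eq coordinate_one_specialForm_eight]; simp [curveParams]⟩
  left := by
    obtain ⟨x, -, hx⟩ := exists_realPoints_coordRatio_eq hA (c := r)
      (show (r : ℂ) ∈ {x : ℂ | Polynomial.aeval x (quadPoly (1, 1)) = 0} by simp [hroots])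
    exact ⟨x, hx⟩
  right := by
    obtain ⟨x, -, hx⟩ := exists_realPoints_coordRatio_eq hA (c := w)
      (show (w : ℂ) ∈ {x : ℂ | Polynomial.aeval x (quadPoly (1, 1)) = 0} by simp [hroots])
    exact ⟨x, hx⟩
  ne := by exact_mod_cast hrw

/-- The moduli space of the last special pattern. -/
theorem conclusion_specialForm_eight :
    (topologicalKrullDim (ModuliSpace A) = 1 ∧
      ∃ Z₁ Z₂ : Set (ModuliSpace A), irreducibleComponents (ModuliSpace A) = {Z₁, Z₂} ∧
        Disjoint Z₁ Z₂ ∧ (Z₁ ∩ realPoints A).Nonempty ∧ (Z₂ ∩ realPoints A).Nonempty ∧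
        (∀ x y, GalConj conjAut x y → (x ∈ Z₁ ↔ y ∈ Z₁)) ∧
        (∀ x y, GalConj conjAut x y → (x ∈ Z₂ ↔ y ∈ Z₂)) ∧
        ∃ σ : ℂ ≃+* ℂ, ∀ x y, GalConj σ x y → (x ∈ Z₁ ↔ y ∈ Z₂)) ∧
    ¬ IrreducibleSpace (ModuliSpaceConj A) := by
  obtain ⟨r, w, hrw, hroots⟩ := exists_roots_quadPoly (1, 1) (by norm_num)
  have h := twoCurves hA hrw hroots
  have hr : Polynomial.aeval (r : ℂ) (quadPoly (1, 1)) = 0 :=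
    show (r : ℂ) ∈ {x : ℂ | Polynomial.aeval x (quadPoly (1, 1)) = 0} by simp [hroots]
  have hw : Polynomial.aeval (w : ℂ) (quadPoly (1, 1)) = 0 :=
    show (w : ℂ) ∈ {x : ℂ | Polynomial.aeval x (quadPoly (1, 1)) = 0} by simp [hroots]
  have hconj : ∀ r : ℝ, conjAut (r : ℂ) = r := fun r => Complex.conj_ofReal r
  have hgal : ∀ r w τ, τ r = w → ∀ x y : ModuliSpace A, GalConj τ x y →
      (x ∈ {x | coordRatio σ 6 1 2 x = r} ↔ y ∈ {x | coordRatio σ 6 1 2 x = w}) := by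
    intro r w τ hτ x y hxy
    rw [Set.mem_ofPred_eq, Set.mem_ofPred_eq, coordRatio_of_galConj hA hxy, ← hτ,
      τ.injective.eq_iff]
  -- An automorphism of `ℂ` that takes one root to the other takes the level set of the first
  -- coordinate over `r` to the one over `w`.
  obtain ⟨τ, hτ⟩ := exists_ringEquiv_of_aeval_eq_zero irreducible_quadPoly_golden hr hw
  obtain ⟨x, hx, hxr⟩ := exists_realPoints_coordRatio_eq hA hr
  obtain ⟨y, hy, hyw⟩ := exists_realPoints_coordRatio_eq hA hw
  refine ⟨⟨h.topologicalKrullDim_eq, _, _, h.irreducibleComponents_eq, ?_, ⟨x, hxr, hx⟩,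
    ⟨y, hyw, hy⟩, hgal _ _ _ (hconj r), hgal _ _ _ (hconj w), τ, hgal _ _ _ hτ⟩, ?_⟩
  · exact Set.disjoint_left.2 fun z h1 h2 => h.ne (h2.symm.trans h1)
  · exact not_irreducibleSpace (coordRatio σ 6 1 2) h.isClosed_left
      (fun _ _ hxy => coordRatio_of_galConj hA hxy) (hconj r)
      (fun x => (h.eq_or_eq x).imp_right Or.inl) h.ne h.left h.right

end

end NormalForm

end LineArrangement

/-! ### Realizability of the tables and the final classification. -/

namespace LineArrangement

lemma exists_realizes_of_good {t : Fin 9} {s : ℕ → ℂ} (hs : (specialForm t).Good s) :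
    ∃ A : Fin 10 → Line, Realizes A (table t) := by
  obtain ⟨A, -, hA⟩ := VecPattern.exists_hasPattern hs
  refine ⟨A ∘ (specialPerm t).symm, realizes_iff_hasPattern.2 ?_⟩
  rwa [Function.comp_assoc, Equiv.symm_comp_self, Function.comp_id]

lemma NormalForm.Rigid.exists_good {N : NormalForm} {p : Polynomial ℚ} {l : Fin 10} {a b : Fin 3}
    (h : N.Rigid p l a b) : ∃ s, N.Good s := by
  obtain ⟨c, hc⟩ := IsAlgClosed.exists_aeval_eq_zero ℂ p h.irreducible.degree_pos.ne'
  exact ⟨_, h.good c hc⟩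

/-- Each of the configuration tables is realized. -/
theorem exists_realizes (t : Fin 9) : ∃ A : Fin 10 → Line, Realizes A (table t) := by
  suffices ∃ s, (specialForm t).Good s from this.elim fun s hs => exists_realizes_of_good hs
  fin_cases t
  · exact rigid_specialForm_0.exists_good
  · exact rigid_specialForm_1.exists_good
  · exact rigid_specialForm_2.exists_good
  · exact rigid_specialForm_3.exists_good
  · exact rigid_specialForm_4.exists_good
  · exact rigid_specialForm_5.exists_good
  · exact rigid_specialForm_6.exists_good
  · exact rigid_specialForm_7.exists_good
  · obtain ⟨c, hc⟩ := IsAlgClosed.exists_aeval_eq_zero ℂ (quadPoly (1, 1))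
      NormalForm.irreducible_quadPoly_golden.degree_pos.ne'
    exact ⟨_, NormalForm.good_curveParams hc⟩

/-- The link between the combinatorial and the geometric half: each of the 65 systems has either a
certificate of irreducibility or one of the special normal forms. The order of the special ones is
that of the list of systems. -/
lemma completeSystems_map_fst : completeSystems.map Prod.fst =
    irreducibleCases.map (fun c => c.1.blocks) ++
      [8, 4, 3, 0, 7, 1, 6, 5, 2].map fun t => (specialForm t).blocks := by
  decide +kernel

lemma isPotentialZariskiPair_of_hasPattern {A : Fin 10 → Line} {σ : Equiv.Perm (Fin 10)} {t : Fin 9}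
    (hA : HasPattern (A ∘ σ) (specialForm t).blocks) : IsPotentialZariskiPair A := by
  by_cases ht : t = 8
  · subst ht
    exact (NormalForm.conclusion_specialForm_eight hA).2
  · exact (conclusion_specialForm ht hA).2

/-- The classification of the potential Zariski pairs. -/
theorem isPotentialZariskiPair_iff {A : Fin 10 → Line} (hA : Admissible A) :
    IsPotentialZariskiPair A ↔
      ∃ (t : Fin 9) (B : Fin 10 → Line), Realizes B (table t) ∧ LatticeIso A B := by
  constructor
  · intro h
    obtain ⟨R, hR, σ, hσ⟩ := hA.exists_hasPattern
    have hR' := List.mem_map_of_mem (f := Prod.fst) hR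
    rw [completeSystems_map_fst, List.mem_append] at hR'
    rcases hR' with hR' | hR'
    -- For a system with a certificate the moduli space modulo conjugation is irreducible, against
    -- the assumption.
    · obtain ⟨c, hc, hcR⟩ := List.mem_map.1 hR'
      rw [← hcR] at hσ
      exact absurd (irreducibleSpace_of_mem_irreducibleCases hc hσ hA.spread hA.injective) h
    · obtain ⟨t, -, htR⟩ := List.mem_map.1 hR'
      rw [← htR] at hσ
      obtain ⟨B, hB⟩ := exists_realizes t
      exact ⟨t, B, hB, latticeIso_of_hasPattern hA hB.admissible hσ hB.hasPattern⟩
  -- The pattern passes along the lattice isomorphism from `B` to `A`, and reducibility depends on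
  -- the pattern only.
  · rintro ⟨t, B, hB, h⟩
    obtain ⟨σ, hσ⟩ := h.exists_hasPattern hA hB.admissible hB.hasPattern
    exact isPotentialZariskiPair_of_hasPattern hσ

end LineArrangement

theorem theorem5p2 :
    -- an arrangement gives a potential Zariski pair iff its lattice is one of the nine listed
    (∀ A : Fin 10 → LineArrangement.Line, LineArrangement.Admissible A →
      (LineArrangement.IsPotentialZariskiPair A ↔
        ∃ (t : Fin 9) (B : Fin 10 → LineArrangement.Line),
          LineArrangement.Realizes B (LineArrangement.table t) ∧
            LineArrangement.LatticeIso A B)) ∧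
    -- each of the nine tables is realized, by arrangements of the type considered
    (∀ t : Fin 9, ∃ A : Fin 10 → LineArrangement.Line,
      LineArrangement.Realizes A (LineArrangement.table t)) ∧
    (∀ (t : Fin 9) (A : Fin 10 → LineArrangement.Line),
      LineArrangement.Realizes A (LineArrangement.table t) → LineArrangement.Admissible A) ∧
    -- the nine tables have pairwise different lattices
    (∀ (s t : Fin 9) (A B : Fin 10 → LineArrangement.Line),
      LineArrangement.Realizes A (LineArrangement.table s) →
      LineArrangement.Realizes B (LineArrangement.table t) →
      (LineArrangement.LatticeIso A B ↔ s = t)) ∧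
    -- the first eight moduli spaces: two or three points, Galois conjugate, in exactly two classes
    -- under complex conjugation
    (∀ (t : Fin 9) (A : Fin 10 → LineArrangement.Line), t ≠ 8 →
      LineArrangement.Realizes A (LineArrangement.table t) →
        Nat.card (LineArrangement.ModuliSpace A) = ![3, 2, 2, 2, 3, 3, 3, 2, 0] t ∧
        (LineArrangement.realPoints A).ncard = ![1, 2, 2, 2, 1, 1, 1, 2, 0] t ∧
        Nat.card (LineArrangement.ModuliSpaceConj A) = 2 ∧
        ∀ x y : LineArrangement.ModuliSpace A, ∃ σ : ℂ ≃+* ℂ,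
          LineArrangement.GalConj σ x y) ∧
    -- the last one: two disjoint irreducible curves, each with real points and mapped to itself by
    -- complex conjugation, Galois conjugate to each other
    (∀ A : Fin 10 → LineArrangement.Line,
      LineArrangement.Realizes A (LineArrangement.table 8) →
        topologicalKrullDim (LineArrangement.ModuliSpace A) = 1 ∧
        ∃ Z₁ Z₂ : Set (LineArrangement.ModuliSpace A),
          irreducibleComponents (LineArrangement.ModuliSpace A) = {Z₁, Z₂} ∧
          Disjoint Z₁ Z₂ ∧
          (Z₁ ∩ LineArrangement.realPoints A).Nonempty ∧
          (Z₂ ∩ LineArrangement.realPoints A).Nonempty ∧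
          (∀ x y, LineArrangement.GalConj LineArrangement.conjAut x y → (x ∈ Z₁ ↔ y ∈ Z₁)) ∧
          (∀ x y, LineArrangement.GalConj LineArrangement.conjAut x y → (x ∈ Z₂ ↔ y ∈ Z₂)) ∧
          ∃ σ : ℂ ≃+* ℂ, ∀ x y, LineArrangement.GalConj σ x y → (x ∈ Z₁ ↔ y ∈ Z₂)) := by
  open LineArrangement in
  exact ⟨fun A hA => isPotentialZariskiPair_iff hA, exists_realizes, fun t A h => h.admissible,
    fun s t A B hA hB => ⟨eq_of_latticeIso hA hB, fun hst => by
      subst hst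
      exact latticeIso_of_hasPattern hA.admissible hB.admissible hA.hasPattern hB.hasPattern⟩,
    fun t A ht hA => (conclusion_specialForm ht hA.hasPattern).1,
    fun A hA => (NormalForm.conclusion_specialForm_eight hA.hasPattern).1⟩
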